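/- Let $M$ be a supermanifold of dimension $p|q$, in one of the following categories: real smooth, complex analytic, or algebraic over a field $k$ of characteristic zero (that is, $M$ is a space with a sheaf $\mathcal O_M$ of supercommutative algebras that is locally isomorphic to $\mathcal O_Y\otimes\Lambda(\theta_1,\dots,\theta_q)$, where $\mathcal O_Y$ is the sheaf of smooth functions on open subsets of $\mathbb R^p$, or of holomorphic functions on open subsets of $\mathbb C^p$, or the structure sheaf of a smooth $k$-scheme of dimension $p$). Let $\mathcal T_M$ be the tangent sheaf, $\mathcal D_M\subset \mathcal End_k(\mathcal O_M)$ the sheaf of differential operators, generated by $\mathcal O_M$ and $\mathcal T_M$, $\Omega^1_{M,odd}=(\Pi\mathcal T_M)^*$ (with odd $d:\mathcal O_M\to\Omega^1_{M,odd}$, written as a right $\mathcal O_M$-module), $\Omega^k_{M,odd}=S^k\Omega^1_{M,odd}$ and $(\Omega^k_{M,odd})^*=S^k\Pi\mathcal T_M$ (supersymmetric powers over $\mathcal O_M$). Signs $(-1)^{|\cdot|}$ refer to the total $\mathbb Z_2$-parity, for which $|dx_a|=|x_a|+1$ and $|\pi X|=|X|+1$. Let $\langle\,,\rangle$ be the contraction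 of polyfields with forms: functions act by multiplication, a $1$-form $\alpha$ acts as the superderivation that vanishes on functions and satisfies $\langle df,\pi X\rangle=(-1)^{(|f|+1)(|X|+1)}X(f)$, and products of forms act by composition. Let $\mathcal L_X$ be the Lie derivative of forms, and let $\mathfrak L_X$ be the Lie derivative of polyfields, i.e. the degree preserving operator with $\mathfrak L_X f=X(f)$ and $\mathfrak L_X\langle\omega,\tau\rangle=\langle\mathcal L_X\omega,\tau\rangle+(-1)^{|\omega||X|}\langle\omega,\mathfrak L_X\tau\rangle$ for all forms $\omega$ of positive degree. Let $\mathcal V_M=\Omega^\bullet_{M,odd}\otimes_{\mathcal O_M}\mathcal D_M\otimes_{\mathcal O_M}(\Omega^\bullet_{M,odd})^*$ (tensor product of sheaves) and $\mathcal V_M^{i,j}=\Omega^i_{M,odd}\otimes_{\mathcal O_M}\mathcal D_M\otimes_{\mathcal O_M}(\Omega^j_{M,odd})^*$. In local coordinates $x_a=z_1,\dots,z_p|\theta_1,\dots,\theta_q$ with coordinate vector fields $\partial_a$ put, for homogeneous $\omega,F,\tau$, $$\hat d(\omega\otimes F\otimes\tau)=(D\otimes1)(\omega\otimes F\otimes\tau)=d\omega\otimes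 F\otimes\tau+\sum_a(-1)^{|\omega||x_a|}dx_a\,\omega\otimes\partial_aF\otimes\tau,$$ $$\hat\delta(\omega\otimes F\otimes\tau)=(-1)^{|\omega|+|F|+|\tau|}(1\otimes\delta)(\omega\otimes F\otimes\tau),$$ $$(1\otimes\delta)(\omega\otimes F\otimes\tau)=(-1)^{|\tau|}\sum_a\omega\otimes F\partial_a\otimes\langle dx_a,\tau\rangle-(-1)^{|\tau|}\,\omega\otimes F\otimes\sum_a\langle dx_a,\mathfrak L_{\partial_a}\tau\rangle .$$ Theorem. On each coordinate open set the operators $d$, $\langle\,,\rangle$, $\mathcal L_{\partial_a}$ and $\mathfrak L_{\partial_a}$ exist and are uniquely determined. There are unique endomorphisms $\hat d$ and $\hat\delta$ of the sheaf of $k$-modules $\mathcal V_M$ that are given by the above formulas in all local coordinates, and $(\mathcal V_M,\hat d,\hat\delta)$ is a double complex: $\mathcal V_M=\bigoplus_{i,j\ge0}\mathcal V_M^{i,j}$, $\hat d$ maps $\mathcal V_M^{i,j}$ to $\mathcal V_M^{i+1,j}$, $\hat\delta$ maps $\mathcal V_M^{i,j+1}$ to $\mathcal V_M^{i,j}$ and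 vanishes on $\mathcal V_M^{i,0}$, and $$\hat d^2=0,\qquad\hat\delta^2=0,\qquad\hat d\hat\delta+\hat\delta\hat d=0 .$$ Consequently the total differential $\mathfrak D=\hat d+\hat\delta$ satisfies $\mathfrak D^2=0$. -/

import Mathlib

open CategoryTheory Opposite TopologicalSpace TensorProduct
open scoped Manifold

universe u

noncomputable section

namespace SuperGeom

/-- The sign `(-1)^ε` of a parity `ε`. -/
def sgn (ε : ZMod 2) : ℤ := if ε = 0 then 1 else -1

/-! ### Supersymmetric algebras -/

section SuperSym

variable (k : Type u) [Field k] {A E : Type u} [Ring A] [Algebra k A] [AddCommGroup E] [Module k E]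

/-- The defining relations of the supersymmetric algebra `S^• E` of an `A`-module `E` over a
supercommutative algebra `A`; here `pA`, `pE` are the subspaces of given parity, and `act f e e'`
says that the product of `f` and `e` in the left module `E` is `e'`. -/
inductive SymRel (pA : ZMod 2 → Submodule k A) (pE : ZMod 2 → Submodule k E)
    (act : A → E → E → Prop) : TensorAlgebra k (A × E) → TensorAlgebra k (A × E) → Prop
  | one : SymRel pA pE act (TensorAlgebra.ι k ((1 : A), (0 : E))) 1
  | mul (f g : A) : SymRel pA pE act
      (TensorAlgebra.ι k (f, (0 : E)) * TensorAlgebra.ι k (g, (0 : E)))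
      (TensorAlgebra.ι k (f * g, (0 : E)))
  | smul (f : A) (e e' : E) (h : act f e e') : SymRel pA pE act
      (TensorAlgebra.ι k (f, (0 : E)) * TensorAlgebra.ι k ((0 : A), e))
      (TensorAlgebra.ι k ((0 : A), e'))
  | comm_fun (ε η : ZMod 2) (f : A) (e : E) (hf : f ∈ pA ε) (he : e ∈ pE η) : SymRel pA pE act
      (TensorAlgebra.ι k ((0 : A), e) * TensorAlgebra.ι k (f, (0 : E)))
      (sgn (ε * η) • (TensorAlgebra.ι k (f, (0 : E)) * TensorAlgebra.ι k ((0 : A), e)))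
  | comm (ε η : ZMod 2) (e e' : E) (he : e ∈ pE ε) (he' : e' ∈ pE η) : SymRel pA pE act
      (TensorAlgebra.ι k ((0 : A), e) * TensorAlgebra.ι k ((0 : A), e'))
      (sgn (ε * η) • (TensorAlgebra.ι k ((0 : A), e') * TensorAlgebra.ι k ((0 : A), e)))

/-- The supersymmetric algebra `S^• E` of `E` over `A`. -/
def SuperSym (pA : ZMod 2 → Submodule k A) (pE : ZMod 2 → Submodule k E)
    (act : A → E → E → Prop) : Type u := RingQuot (SymRel k pA pE act)

namespace SuperSym

variable {k} (pA : ZMod 2 → Submodule k A) (pE : ZMod 2 → Submodule k E) (act : A → E → E → Prop)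

instance : Ring (SuperSym k pA pE act) := inferInstanceAs (Ring (RingQuot (SymRel k pA pE act)))
instance : Algebra k (SuperSym k pA pE act) :=
  inferInstanceAs (Algebra k (RingQuot (SymRel k pA pE act)))

/-- The quotient map from the tensor algebra. -/
def mk : TensorAlgebra k (A × E) →ₐ[k] SuperSym k pA pE act :=
  RingQuot.mkAlgHom k (SymRel k pA pE act)

variable {pA pE act} in
theorem mk_rel {x y : TensorAlgebra k (A × E)} (h : SymRel k pA pE act x y) :
    mk pA pE act x = mk pA pE act y := RingQuot.mkAlgHom_rel k h

/-- The inclusion `A → S^• E` (elements of degree `0`). -/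
def ofFun : A →ₗ[k] SuperSym k pA pE act :=
  (mk pA pE act).toLinearMap ∘ₗ TensorAlgebra.ι k ∘ₗ
    LinearMap.inl k A E

/-- The inclusion `E → S^• E` (elements of degree `1`). -/
def ofGen : E →ₗ[k] SuperSym k pA pE act :=
  (mk pA pE act).toLinearMap ∘ₗ TensorAlgebra.ι k ∘ₗ
    LinearMap.inr k A E

/-- The homogeneous component `S^n E`: sums of products `f e₁ ⋯ eₙ`. -/
def deg (n : ℕ) : Submodule k (SuperSym k pA pE act) :=
  LinearMap.range (ofFun pA pE act) * LinearMap.range (ofGen pA pE act) ^ n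

/-- `HasParity ε s`: the element `s` of `S^• E` is homogeneous of parity `ε`. -/
inductive HasParity : ZMod 2 → SuperSym k pA pE act → Prop
  | ofFun (ε : ZMod 2) (f : A) (hf : f ∈ pA ε) : HasParity ε (ofFun pA pE act f)
  | ofGen (ε : ZMod 2) (e : E) (he : e ∈ pE ε) : HasParity ε (ofGen pA pE act e)
  | mul (ε η : ZMod 2) (s t : SuperSym k pA pE act) (hs : HasParity ε s) (ht : HasParity η t) :
      HasParity (ε + η) (s * t)
  | add (ε : ZMod 2) (s t : SuperSym k pA pE act) (hs : HasParity ε s) (ht : HasParity ε t) :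
      HasParity ε (s + t)

section map

variable {pA pE act} {A' E' : Type u} [Ring A'] [Algebra k A'] [AddCommGroup E'] [Module k E']
  {pA' : ZMod 2 → Submodule k A'} {pE' : ZMod 2 → Submodule k E'} {act' : A' → E' → E' → Prop}

/-- Functoriality of the supersymmetric algebra. -/
def map (a : A →ₐ[k] A') (e : E →ₗ[k] E') (ha : ∀ ε, ∀ f ∈ pA ε, a f ∈ pA' ε)
    (he : ∀ ε, ∀ x ∈ pE ε, e x ∈ pE' ε) (hact : ∀ f x y, act f x y → act' (a f) (e x) (e y)) :
    SuperSym k pA pE act →ₐ[k] SuperSym k pA' pE' act' :=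
  RingQuot.liftAlgHom k ⟨TensorAlgebra.lift k
    ((mk pA' pE' act').toLinearMap ∘ₗ TensorAlgebra.ι k ∘ₗ
      LinearMap.prodMap a.toLinearMap e), by
    intro x y h
    cases h with
    | one => simpa using mk_rel (SymRel.one (pA := pA') (pE := pE') (act := act'))
    | mul f g =>
      simpa using mk_rel
        (SymRel.mul (pA := pA') (pE := pE') (act := act') (a f) (a g))
    | smul f x y h =>
      simpa using mk_rel
        (SymRel.smul (pA := pA') (pE := pE') (act := act') _ _ _ (hact f x y h))
    | comm_fun ε η f x hf hx =>
      simpa using mk_rel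
        (SymRel.comm_fun (act := act') ε η _ _ (ha ε f hf) (he η x hx))
    | comm ε η x y hx hy =>
      simpa using mk_rel
        (SymRel.comm (pA := pA') (act := act') ε η _ _ (he ε x hx) (he η y hy))⟩

variable (a : A →ₐ[k] A') (e : E →ₗ[k] E') (ha : ∀ ε, ∀ f ∈ pA ε, a f ∈ pA' ε)
    (he : ∀ ε, ∀ x ∈ pE ε, e x ∈ pE' ε) (hact : ∀ f x y, act f x y → act' (a f) (e x) (e y))

theorem map_mk_ι (x : A × E) :
    map a e ha he hact (mk pA pE act (TensorAlgebra.ι k x)) =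
      mk pA' pE' act' (TensorAlgebra.ι k (a x.1, e x.2)) := by
  refine (RingQuot.liftAlgHom_mkAlgHom_apply (B := SuperSym k pA' pE' act') k
    (s := SymRel k pA pE act) _ _ _).trans ?_
  simp

theorem map_ofFun (f : A) :
    map a e ha he hact (ofFun pA pE act f) = ofFun pA' pE' act' (a f) := by
  simp [ofFun, map_mk_ι]

theorem map_ofGen (x : E) :
    map a e ha he hact (ofGen pA pE act x) = ofGen pA' pE' act' (e x) := by
  simp [ofGen, map_mk_ι]

theorem map_deg (n : ℕ) (s : SuperSym k pA pE act) (hs : s ∈ deg pA pE act n) :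
    map a e ha he hact s ∈ deg pA' pE' act' n := by
  have h : (deg pA pE act n).map (map a e ha he hact).toLinearMap ≤ deg pA' pE' act' n := by
    rw [deg, deg, Submodule.map_mul, Submodule.map_pow]
    refine mul_le_mul' ?_ (pow_le_pow_left' ?_ n)
    · rintro _ ⟨_, ⟨f, rfl⟩, rfl⟩
      exact ⟨a f, (map_ofFun a e ha he hact f).symm⟩
    · rintro _ ⟨_, ⟨x, rfl⟩, rfl⟩
      exact ⟨e x, (map_ofGen a e ha he hact x).symm⟩
  exact h ⟨s, hs, rfl⟩

end map

/-- Two algebra maps out of `S^• E` agree if they agree on `A` and on `E`. -/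
theorem hom_ext {pA : ZMod 2 → Submodule k A} {pE : ZMod 2 → Submodule k E}
    {act : A → E → E → Prop} {B : Type u} [Ring B] [Algebra k B]
    {φ ψ : SuperSym k pA pE act →ₐ[k] B}
    (h₀ : ∀ f, φ (ofFun pA pE act f) = ψ (ofFun pA pE act f))
    (h₁ : ∀ x, φ (ofGen pA pE act x) = ψ (ofGen pA pE act x)) : φ = ψ := by
  apply RingQuot.ringQuot_ext'
  apply TensorAlgebra.hom_ext
  apply LinearMap.prod_ext
  · ext f; exact h₀ f
  · ext x; exact h₁ x

end SuperSym

end SuperSym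

/-! ### Ringed superspaces -/

/-- A ringed superspace over `k`: a topological space with a sheaf of supercommutative
`k`-superalgebras; `par U ε` is the space of sections over `U` of parity `ε`. -/
structure Superspace (k : Type u) [Field k] where
  X : TopCat.{u}
  O : X.Presheaf (AlgCat.{u} k)
  isSheaf : O.IsSheaf
  par : ∀ U : Opens X, ZMod 2 → Submodule k (O.obj (op U))
  isCompl : ∀ U, IsCompl (par U 0) (par U 1)
  one_mem : ∀ U, (1 : O.obj (op U)) ∈ par U 0
  mul_mem : ∀ U ε η (f g : O.obj (op U)), f ∈ par U ε → g ∈ par U η → f * g ∈ par U (ε + η)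
  map_mem : ∀ {U V : Opens X} (h : V ≤ U) (ε : ZMod 2) (f : O.obj (op U)), f ∈ par U ε →
    (O.map (homOfLE h).op).hom f ∈ par V ε
  comm : ∀ U ε η (f g : O.obj (op U)), f ∈ par U ε → g ∈ par U η →
    f * g = sgn (ε * η) • (g * f)

namespace Superspace

variable {k : Type u} [Field k] (M : Superspace k)

/-- The superalgebra of sections `O_M(U)`. -/
abbrev Sec (U : Opens M.X) : Type u := M.O.obj (op U)

/-- Restriction of functions. -/
def res {U V : Opens M.X} (h : V ≤ U) : M.Sec U →ₐ[k] M.Sec V := (M.O.map (homOfLE h).op).hom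

theorem res_mem {U V : Opens M.X} (h : V ≤ U) (ε : ZMod 2) (f : M.Sec U) (hf : f ∈ M.par U ε) :
    M.res h f ∈ M.par V ε := M.map_mem h ε f hf

theorem res_id {U : Opens M.X} (f : M.Sec U) : M.res le_rfl f = f := by
  have : (homOfLE (le_refl U)).op = 𝟙 (op U) := rfl
  rw [res, this, M.O.map_id]; rfl

theorem res_res {U V W : Opens M.X} (h : V ≤ U) (h' : W ≤ V) (f : M.Sec U) :
    M.res h' (M.res h f) = M.res (h'.trans h) f := by
  have : (homOfLE (h'.trans h)).op = (homOfLE h).op ≫ (homOfLE h').op := rfl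
  rw [res, res, res, this, M.O.map_comp]; rfl

/-- Sections over `U` of the sheaf `End_k(O_M)`: families of `k`-linear maps
`O_M(V) → O_M(V)`, `V ⊆ U`, compatible with restrictions. -/
def endSub (U : Opens M.X) :
    Subalgebra k (∀ V : {V : Opens M.X // V ≤ U}, Module.End k (M.Sec V)) where
  carrier := {φ | ∀ (V W : {V : Opens M.X // V ≤ U}) (h : W.1 ≤ V.1) (f : M.Sec V),
    M.res h (φ V f) = φ W (M.res h f)}
  mul_mem' := by
    intro φ ψ hφ hψ V W h f
    simp only [Pi.mul_apply, Module.End.mul_apply]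
    rw [hφ V W h, hψ V W h]
  add_mem' := by
    intro φ ψ hφ hψ V W h f
    simp only [Pi.add_apply, LinearMap.add_apply, map_add]
    rw [hφ V W h, hψ V W h]
  algebraMap_mem' := by
    intro c V W h f
    simp [Pi.algebraMap_apply, Module.algebraMap_end_apply]

/-- The algebra of sections over `U` of the sheaf `End_k(O_M)`. -/
def EndO (U : Opens M.X) : Type u := M.endSub U

instance (U : Opens M.X) : Ring (M.EndO U) := inferInstanceAs (Ring (M.endSub U))
instance (U : Opens M.X) : Algebra k (M.EndO U) := inferInstanceAs (Algebra k (M.endSub U))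

variable {M} in
/-- The action of an endomorphism of `O_M|_U` on the functions over `V ⊆ U`. -/
def EndO.app {U : Opens M.X} (φ : M.EndO U) (V : {V : Opens M.X // V ≤ U}) :
    Module.End k (M.Sec V) := φ.1 V

section

variable {M} {U : Opens M.X}

theorem EndO.ext {φ ψ : M.EndO U} (h : ∀ V f, φ.app V f = ψ.app V f) : φ = ψ :=
  Subtype.ext (funext fun V => LinearMap.ext (h V))

theorem EndO.res_app (φ : M.EndO U) (V W : {V : Opens M.X // V ≤ U}) (h : W.1 ≤ V.1)
    (f : M.Sec V) : M.res h (φ.app V f) = φ.app W (M.res h f) := φ.2 V W h f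

@[simp] theorem EndO.add_app (φ ψ : M.EndO U) (V) : (φ + ψ).app V = φ.app V + ψ.app V := rfl
@[simp] theorem EndO.mul_app (φ ψ : M.EndO U) (V) : (φ * ψ).app V = φ.app V * ψ.app V := rfl
@[simp] theorem EndO.zero_app (V) : (0 : M.EndO U).app V = 0 := rfl
@[simp] theorem EndO.one_app (V) : (1 : M.EndO U).app V = 1 := rfl
@[simp] theorem EndO.smul_app (c : k) (φ : M.EndO U) (V) : (c • φ).app V = c • φ.app V := rfl
@[simp] theorem EndO.algebraMap_app (c : k) (V) :
    (algebraMap k (M.EndO U) c).app V = algebraMap k _ c := rfl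

end

/-- The action of an endomorphism of `O_M|_U` on the functions over `U`. -/
def ev {U : Opens M.X} (φ : M.EndO U) (f : M.Sec U) : M.Sec U := φ.app ⟨U, le_rfl⟩ f

/-- Restriction of endomorphisms. -/
def resEnd {U V : Opens M.X} (h : V ≤ U) : M.EndO U →ₐ[k] M.EndO V where
  toFun φ := ⟨fun W => φ.app ⟨W.1, W.2.trans h⟩,
    fun W W' hW f => φ.res_app ⟨W.1, W.2.trans h⟩ ⟨W'.1, W'.2.trans h⟩ hW f⟩
  map_one' := rfl
  map_mul' _ _ := rfl
  map_zero' := rfl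
  map_add' _ _ := rfl
  commutes' _ := rfl

@[simp] theorem resEnd_app {U V : Opens M.X} (h : V ≤ U) (φ : M.EndO U) (W) :
    (M.resEnd h φ).app W = φ.app ⟨W.1, W.2.trans h⟩ := rfl

/-- Multiplication by a function, as an endomorphism of `O_M|_U`. -/
def mulEnd (U : Opens M.X) : M.Sec U →ₐ[k] M.EndO U :=
  AlgHom.ofLinearMap
    { toFun := fun f => ⟨fun V => LinearMap.mulLeft k (M.res V.2 f), fun V W h g => by
        simp [LinearMap.mulLeft_apply, res_res]⟩
      map_add' := fun f g => EndO.ext fun V x => by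
        change M.res V.2 (f + g) * x = M.res V.2 f * x + M.res V.2 g * x
        rw [map_add, add_mul]
      map_smul' := fun c f => EndO.ext fun V x => by
        change M.res V.2 (c • f) * x = c • (M.res V.2 f * x)
        rw [map_smul, smul_mul_assoc] }
    (EndO.ext fun V x => by
      change M.res V.2 1 * x = x
      rw [map_one, one_mul])
    (fun f g => EndO.ext fun V x => by
      change M.res V.2 (f * g) * x = M.res V.2 f * (M.res V.2 g * x)
      rw [map_mul, mul_assoc])

@[simp] theorem mulEnd_app (U : Opens M.X) (f : M.Sec U) (V) (g : M.Sec V.1) :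
    (M.mulEnd U f).app V g = M.res V.2 f * g := rfl

/-- `EndPar U φ F`: the endomorphism `F` of `O_M|_U` is homogeneous of parity `φ`. -/
def EndPar (U : Opens M.X) (φ : ZMod 2) (F : M.EndO U) : Prop :=
  ∀ (V : {V : Opens M.X // V ≤ U}) (η : ZMod 2), ∀ f ∈ M.par V η, F.app V f ∈ M.par V (η + φ)

/-- Homogeneous vector fields of parity `ε` over `U`: the superderivations `X` of `O_M|_U`,
`X (f g) = X f · g + (-1)^{|X||f|} f · X g`. -/
def Der (U : Opens M.X) (ε : ZMod 2) : Submodule k (M.EndO U) where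
  carrier := {X | M.EndPar U ε X ∧
    ∀ (V : {V : Opens M.X // V ≤ U}) (η : ZMod 2), ∀ f ∈ M.par V η, ∀ g : M.Sec V,
      X.app V (f * g) = X.app V f * g + sgn (ε * η) • (f * X.app V g)}
  add_mem' := by
    rintro X Y ⟨hX, hX'⟩ ⟨hY, hY'⟩
    refine ⟨fun V η f hf => add_mem (hX V η f hf) (hY V η f hf), fun V η f hf g => ?_⟩
    have h1 := hX' V η f hf g
    have h2 := hY' V η f hf g
    simp only [EndO.add_app, LinearMap.add_apply] at *
    rw [h1, h2, add_mul, mul_add, smul_add]; abel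
  zero_mem' := ⟨fun V η f _ => zero_mem _, fun V η f _ g => by simp⟩
  smul_mem' := by
    rintro c X ⟨hX, hX'⟩
    refine ⟨fun V η f hf => Submodule.smul_mem _ c (hX V η f hf), fun V η f hf g => ?_⟩
    have h1 := hX' V η f hf g
    simp only [EndO.smul_app, LinearMap.smul_apply] at *
    rw [h1, smul_add, smul_mul_assoc, mul_smul_comm, smul_comm c]

/-- The tangent sheaf `T_M(U) = T_M(U)_0 ⊕ T_M(U)_1`. -/
def T (U : Opens M.X) : Submodule k (M.EndO U) := M.Der U 0 ⊔ M.Der U 1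

theorem Der_le_T (U : Opens M.X) (ε : ZMod 2) : M.Der U ε ≤ M.T U := by
  fin_cases ε
  · exact le_sup_left
  · exact le_sup_right

theorem resEnd_mem_Der {U V : Opens M.X} (h : V ≤ U) (ε : ZMod 2) (X : M.EndO U)
    (hX : X ∈ M.Der U ε) : M.resEnd h X ∈ M.Der V ε :=
  ⟨fun W => hX.1 ⟨W.1, W.2.trans h⟩, fun W => hX.2 ⟨W.1, W.2.trans h⟩⟩

theorem resEnd_mem_T {U V : Opens M.X} (h : V ≤ U) (X : M.EndO U) (hX : X ∈ M.T U) :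
    M.resEnd h X ∈ M.T V := by
  obtain ⟨Y, hY, Z, hZ, rfl⟩ := Submodule.mem_sup.1 hX
  rw [map_add]
  exact add_mem (M.Der_le_T V 0 (M.resEnd_mem_Der h 0 Y hY))
    (M.Der_le_T V 1 (M.resEnd_mem_Der h 1 Z hZ))

/-- Restriction of vector fields. -/
def resT {U V : Opens M.X} (h : V ≤ U) : M.T U →ₗ[k] M.T V :=
  (M.resEnd h).toLinearMap.restrict (M.resEnd_mem_T h)

/-- Differential operators over `U`: the subalgebra of `End_k(O_M|_U)` generated by functions and
vector fields. (The sheaf `D_M` is the sheaf generated by this presheaf.) -/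
def D (U : Opens M.X) : Subalgebra k (M.EndO U) :=
  Algebra.adjoin k (Set.range (M.mulEnd U) ∪ (M.T U : Set (M.EndO U)))

theorem resEnd_mulEnd {U V : Opens M.X} (h : V ≤ U) (f : M.Sec U) :
    M.resEnd h (M.mulEnd U f) = M.mulEnd V (M.res h f) := by
  apply EndO.ext; intro W g
  rw [resEnd_app, mulEnd_app, mulEnd_app, res_res]

theorem resEnd_mem_D {U V : Opens M.X} (h : V ≤ U) (F : M.EndO U) (hF : F ∈ M.D U) :
    M.resEnd h F ∈ M.D V := by
  have : M.D U ≤ (M.D V).comap (M.resEnd h) := by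
    refine Algebra.adjoin_le ?_
    rintro _ (⟨f, rfl⟩ | hX)
    · exact Algebra.subset_adjoin (Or.inl ⟨M.res h f, (M.resEnd_mulEnd h f).symm⟩)
    · exact Algebra.subset_adjoin (Or.inr (M.resEnd_mem_T h _ hX))
  exact this hF

/-- Restriction of differential operators. -/
def resD {U V : Opens M.X} (h : V ≤ U) : M.D U →ₐ[k] M.D V :=
  ((M.resEnd h).comp (M.D U).val).codRestrict (M.D V) fun F => M.resEnd_mem_D h F.1 F.2

/-- A function, as a differential operator. -/
def funD {U : Opens M.X} (f : M.Sec U) : M.D U :=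
  ⟨M.mulEnd U f, Algebra.subset_adjoin (Or.inl ⟨f, rfl⟩)⟩

/-- A vector field, as a differential operator. -/
def vecD {U : Opens M.X} (X : M.T U) : M.D U := ⟨X.1, Algebra.subset_adjoin (Or.inr X.2)⟩

/-- The module structure of `T_M`: `VecAct U f X Y` says that `Y = f X`. -/
def VecAct (U : Opens M.X) (f : M.Sec U) (X Y : M.T U) : Prop :=
  (Y : M.EndO U) = M.mulEnd U f * X

/-- `Ω¹_{M,odd}(U)`, the dual of `Π T_M`: families of left `O_M`-linear maps `T_M(V) → O_M(V)`,
`V ⊆ U`, compatible with restrictions. -/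
def formSub (U : Opens M.X) :
    Submodule k (∀ V : {V : Opens M.X // V ≤ U}, M.T V.1 →ₗ[k] M.Sec V) where
  carrier := {α | (∀ (V W : {V : Opens M.X // V ≤ U}) (h : W.1 ≤ V.1) (X : M.T V.1),
      M.res h (α V X) = α W (M.resT h X)) ∧
    ∀ (V : {V : Opens M.X // V ≤ U}) (f : M.Sec V) (X Y : M.T V.1), M.VecAct V f X Y →
      α V Y = f * α V X}
  add_mem' := by
    rintro α β ⟨h1, h2⟩ ⟨h3, h4⟩
    refine ⟨fun V W h X => ?_, fun V f X Y hXY => ?_⟩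
    · simp only [Pi.add_apply, LinearMap.add_apply, map_add]; rw [h1 V W h, h3 V W h]
    · simp only [Pi.add_apply, LinearMap.add_apply, mul_add]
      rw [h2 V f X Y hXY, h4 V f X Y hXY]
  zero_mem' := ⟨fun V W h X => by simp, fun V f X Y _ => by simp⟩
  smul_mem' := by
    rintro c α ⟨h1, h2⟩
    refine ⟨fun V W h X => ?_, fun V f X Y hXY => ?_⟩
    · simp only [Pi.smul_apply, LinearMap.smul_apply, map_smul]; rw [h1 V W h]
    · simp only [Pi.smul_apply, LinearMap.smul_apply, mul_smul_comm]; rw [h2 V f X Y hXY]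

/-- The sections of `Ω¹_{M,odd}` over `U`. -/
def Form1 (U : Opens M.X) : Type u := M.formSub U

instance (U : Opens M.X) : AddCommGroup (M.Form1 U) :=
  inferInstanceAs (AddCommGroup (M.formSub U))
instance (U : Opens M.X) : Module k (M.Form1 U) := inferInstanceAs (Module k (M.formSub U))

variable {M} in
/-- The values of a `1`-form on vector fields over `V ⊆ U`. -/
def Form1.app {U : Opens M.X} (α : M.Form1 U) (V : {V : Opens M.X // V ≤ U}) :
    M.T V.1 →ₗ[k] M.Sec V := α.1 V

/-- The value `α(X)` of a `1`-form on a vector field over `U`. -/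
def Form1.ev {M : Superspace k} {U : Opens M.X} (α : M.Form1 U) (X : M.T U) : M.Sec U :=
  α.app ⟨U, le_rfl⟩ X

/-- The `1`-forms of parity `ε`; because of the parity shift, such a form takes vector fields of
parity `η` to functions of parity `η + ε + 1`. -/
def formPar (U : Opens M.X) (ε : ZMod 2) : Submodule k (M.Form1 U) where
  carrier := {α | ∀ (V : {V : Opens M.X // V ≤ U}) (η : ZMod 2) (X : M.T V.1),
    (X : M.EndO V) ∈ M.Der V η → α.app V X ∈ M.par V (η + ε + 1)}
  add_mem' h1 h2 V η X hX := add_mem (h1 V η X hX) (h2 V η X hX)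
  zero_mem' _ _ _ _ := zero_mem _
  smul_mem' c _ h V η X hX := Submodule.smul_mem _ c (h V η X hX)

/-- The left module structure of `Ω¹_{M,odd}`, coming from its right module structure
`(α f)(X) = α(X) f` by the sign rule `f α = (-1)^{|f||α|} α f`. -/
def FormAct (U : Opens M.X) (f : M.Sec U) (α β : M.Form1 U) : Prop :=
  ∃ ε η, f ∈ M.par U ε ∧ α ∈ M.formPar U η ∧
    ∀ (V : {V : Opens M.X // V ≤ U}) (X : M.T V.1),
      β.app V X = sgn (ε * η) • (α.app V X * M.res V.2 f)

/-- The differential `df` of a function: `(df)(X) = X f`. -/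
def dFun {U : Opens M.X} (f : M.Sec U) : M.Form1 U :=
  ⟨fun V =>
    { toFun := fun X => M.ev X.1 (M.res V.2 f)
      map_add' := fun _ _ => rfl
      map_smul' := fun _ _ => rfl }, by
    refine ⟨fun V W h X => ?_, fun V g X Y hXY => ?_⟩
    · have := X.1.res_app ⟨V.1, le_rfl⟩ ⟨W.1, h⟩ h (M.res V.2 f)
      rw [res_res] at this
      exact this
    · change M.ev (Y : M.EndO V.1) _ = g * M.ev (X : M.EndO V.1) _
      rw [hXY, ev, EndO.mul_app, Module.End.mul_apply, mulEnd_app, res_id]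
      rfl⟩

/-- Restriction of `1`-forms. -/
def resForm {U V : Opens M.X} (h : V ≤ U) : M.Form1 U →ₗ[k] M.Form1 V where
  toFun α := ⟨fun W => α.app ⟨W.1, W.2.trans h⟩,
    fun W W' hW X => α.2.1 ⟨W.1, W.2.trans h⟩ ⟨W'.1, W'.2.trans h⟩ hW X,
    fun W => α.2.2 ⟨W.1, W.2.trans h⟩⟩
  map_add' _ _ := rfl
  map_smul' _ _ := rfl

/-- The elements of parity `ε` of `Π T_M(U)`: the vector fields of parity `ε + 1`. -/
def piPar (U : Opens M.X) (ε : ZMod 2) : Submodule k (M.T U) :=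
  (M.Der U (ε + 1)).comap (M.T U).subtype

/-- The superalgebra of differential forms `Ω^•_{M,odd}(U) = S^• Ω¹_{M,odd}(U)`. -/
abbrev Forms (U : Opens M.X) : Type u := SuperSym k (M.par U) (M.formPar U) (M.FormAct U)

/-- The superalgebra of polyfields `(Ω^•_{M,odd})^*(U) = S^• Π T_M(U)`. -/
abbrev Poly (U : Opens M.X) : Type u := SuperSym k (M.par U) (M.piPar U) (M.VecAct U)

variable {M} in
/-- A function as a form of degree `0`. -/
abbrev Forms.ofFun {U : Opens M.X} (f : M.Sec U) : M.Forms U := SuperSym.ofFun _ _ _ f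

variable {M} in
/-- A `1`-form as an element of `Ω^•_{M,odd}`. -/
abbrev Forms.ofForm1 {U : Opens M.X} (α : M.Form1 U) : M.Forms U := SuperSym.ofGen _ _ _ α

variable {M} in
/-- A function as a polyfield of degree `0`. -/
abbrev Poly.ofFun {U : Opens M.X} (f : M.Sec U) : M.Poly U := SuperSym.ofFun _ _ _ f

variable {M} in
/-- The polyfield `π X` of degree `1`. -/
abbrev Poly.pi {U : Opens M.X} (X : M.T U) : M.Poly U := SuperSym.ofGen _ _ _ X

/-- `k`-forms. -/
abbrev formsDeg (U : Opens M.X) (n : ℕ) : Submodule k (M.Forms U) := SuperSym.deg _ _ _ n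

/-- Polyfields of degree `n`. -/
abbrev polyDeg (U : Opens M.X) (n : ℕ) : Submodule k (M.Poly U) := SuperSym.deg _ _ _ n

/-- The form `ω` is homogeneous of parity `ε`. -/
abbrev FormsPar (U : Opens M.X) (ε : ZMod 2) (ω : M.Forms U) : Prop := SuperSym.HasParity _ _ _ ε ω

/-- The polyfield `τ` is homogeneous of parity `ε`. -/
abbrev PolyPar (U : Opens M.X) (ε : ZMod 2) (τ : M.Poly U) : Prop := SuperSym.HasParity _ _ _ ε τ

/-- Restriction of forms. -/
def resForms {U V : Opens M.X} (h : V ≤ U) : M.Forms U →ₐ[k] M.Forms V :=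
  SuperSym.map (M.res h) (M.resForm h) (M.res_mem h)
    (fun _ _ hα W η X hX => hα ⟨W.1, W.2.trans h⟩ η X hX) (by
      rintro f α β ⟨ε, η, hf, hα, hβ⟩
      refine ⟨ε, η, M.res_mem h ε f hf, fun W η X hX => hα ⟨W.1, W.2.trans h⟩ η X hX,
        fun W X => ?_⟩
      have := hβ ⟨W.1, W.2.trans h⟩ X
      rw [res_res]
      exact this)

/-- Restriction of polyfields. -/
def resPoly {U V : Opens M.X} (h : V ≤ U) : M.Poly U →ₐ[k] M.Poly V :=
  SuperSym.map (M.res h) (M.resT h) (M.res_mem h)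
    (fun ε X hX => M.resEnd_mem_Der h (ε + 1) X.1 hX) (by
      intro f X Y hXY
      change M.resEnd h Y.1 = M.mulEnd V (M.res h f) * M.resEnd h X.1
      rw [hXY, map_mul, resEnd_mulEnd])

/-! ### Virtual superforms -/

/-- The relations `ω f ⊗ F ⊗ τ = ω ⊗ f F ⊗ τ` and `ω ⊗ F f ⊗ τ = ω ⊗ F ⊗ f τ`. -/
def tensorRel (U : Opens M.X) : Submodule k (M.Forms U ⊗[k] (M.D U ⊗[k] M.Poly U)) :=
  Submodule.span k
    ({t | ∃ (ω : M.Forms U) (f : M.Sec U) (F : M.D U) (τ : M.Poly U),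
        t = (ω * Forms.ofFun f) ⊗ₜ[k] (F ⊗ₜ[k] τ) - ω ⊗ₜ[k] ((M.funD f * F) ⊗ₜ[k] τ)} ∪
     {t | ∃ (ω : M.Forms U) (f : M.Sec U) (F : M.D U) (τ : M.Poly U),
        t = ω ⊗ₜ[k] ((F * M.funD f) ⊗ₜ[k] τ) - ω ⊗ₜ[k] (F ⊗ₜ[k] (Poly.ofFun f * τ))})

/-- The tensor product `Ω^•_{M,odd}(U) ⊗ D_M(U) ⊗ (Ω^•_{M,odd})^*(U)` over `O_M(U)`. -/
def PreVirt (U : Opens M.X) : Type u :=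
  (M.Forms U ⊗[k] (M.D U ⊗[k] M.Poly U)) ⧸ M.tensorRel U

instance (U : Opens M.X) : AddCommGroup (M.PreVirt U) :=
  inferInstanceAs (AddCommGroup ((M.Forms U ⊗[k] (M.D U ⊗[k] M.Poly U)) ⧸ M.tensorRel U))
instance (U : Opens M.X) : Module k (M.PreVirt U) :=
  inferInstanceAs (Module k ((M.Forms U ⊗[k] (M.D U ⊗[k] M.Poly U)) ⧸ M.tensorRel U))

variable {M} in
/-- The element `ω ⊗ F ⊗ τ`. -/
def tmul {U : Opens M.X} (ω : M.Forms U) (F : M.D U) (τ : M.Poly U) : M.PreVirt U :=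
  (M.tensorRel U).mkQ (ω ⊗ₜ[k] (F ⊗ₜ[k] τ))

theorem preVirt_ext {U : Opens M.X} {N : Type u} [AddCommGroup N] [Module k N]
    {φ ψ : M.PreVirt U →ₗ[k] N} (h : ∀ ω F τ, φ (tmul ω F τ) = ψ (tmul ω F τ)) : φ = ψ := by
  apply Submodule.linearMap_qext
  apply TensorProduct.ext'
  intro ω y
  induction y with
  | zero => simp
  | tmul F τ => exact h ω F τ
  | add x y hx hy => rw [TensorProduct.tmul_add, map_add, map_add, hx, hy]

theorem resForms_ofFun {U V : Opens M.X} (h : V ≤ U) (f : M.Sec U) :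
    M.resForms h (Forms.ofFun f) = Forms.ofFun (M.res h f) := SuperSym.map_ofFun ..

theorem resPoly_ofFun {U V : Opens M.X} (h : V ≤ U) (f : M.Sec U) :
    M.resPoly h (Poly.ofFun f) = Poly.ofFun (M.res h f) := SuperSym.map_ofFun ..

theorem resForms_ofForm1 {U V : Opens M.X} (h : V ≤ U) (α : M.Form1 U) :
    M.resForms h (Forms.ofForm1 α) = Forms.ofForm1 (M.resForm h α) := SuperSym.map_ofGen ..

theorem resPoly_pi {U V : Opens M.X} (h : V ≤ U) (X : M.T U) :
    M.resPoly h (Poly.pi X) = Poly.pi (M.resT h X) := SuperSym.map_ofGen ..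

theorem resD_funD {U V : Opens M.X} (h : V ≤ U) (f : M.Sec U) :
    M.resD h (M.funD f) = M.funD (M.res h f) := Subtype.ext (M.resEnd_mulEnd h f)

/-- Restriction of tensors. -/
def resVirt {U V : Opens M.X} (h : V ≤ U) : M.PreVirt U →ₗ[k] M.PreVirt V :=
  Submodule.mapQ _ _ (TensorProduct.map (M.resForms h).toLinearMap
    (TensorProduct.map (M.resD h).toLinearMap (M.resPoly h).toLinearMap)) (by
    rw [tensorRel, Submodule.span_le]
    rintro _ (⟨ω, f, F, τ, rfl⟩ | ⟨ω, f, F, τ, rfl⟩)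
    · refine Submodule.subset_span (Or.inl ⟨M.resForms h ω, M.res h f, M.resD h F,
        M.resPoly h τ, ?_⟩)
      simp [map_sub, TensorProduct.map_tmul, resForms_ofFun, resD_funD]
    · refine Submodule.subset_span (Or.inr ⟨M.resForms h ω, M.res h f, M.resD h F,
        M.resPoly h τ, ?_⟩)
      simp [map_sub, TensorProduct.map_tmul, resPoly_ofFun, resD_funD])

theorem resVirt_tmul {U V : Opens M.X} (h : V ≤ U) (ω : M.Forms U) (F : M.D U) (τ : M.Poly U) :
    M.resVirt h (tmul ω F τ) = tmul (M.resForms h ω) (M.resD h F) (M.resPoly h τ) := rfl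

theorem resVirt_id (U : Opens M.X) : M.resVirt (le_refl U) = LinearMap.id := by
  apply M.preVirt_ext
  intro ω F τ
  have h1 : M.resForms (le_refl U) = AlgHom.id k _ := SuperSym.hom_ext
    (fun f => by rw [resForms_ofFun, res_id]; rfl) (fun α => SuperSym.map_ofGen ..)
  have h2 : M.resPoly (le_refl U) = AlgHom.id k _ := SuperSym.hom_ext
    (fun f => by rw [resPoly_ofFun, res_id]; rfl) (fun α => SuperSym.map_ofGen ..)
  rw [resVirt_tmul, h1, h2]; rfl

theorem resVirt_comp {U V W : Opens M.X} (h : V ≤ U) (h' : W ≤ V) :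
    M.resVirt (h'.trans h) = M.resVirt h' ∘ₗ M.resVirt h := by
  apply M.preVirt_ext
  intro ω F τ
  have h1 : M.resForms (h'.trans h) = (M.resForms h').comp (M.resForms h) := SuperSym.hom_ext
    (fun f => by
      rw [AlgHom.comp_apply, resForms_ofFun, resForms_ofFun, resForms_ofFun, res_res])
    (fun α => by
      rw [AlgHom.comp_apply, resForms_ofForm1, resForms_ofForm1, resForms_ofForm1]; rfl)
  have h2 : M.resPoly (h'.trans h) = (M.resPoly h').comp (M.resPoly h) := SuperSym.hom_ext
    (fun f => by
      rw [AlgHom.comp_apply, resPoly_ofFun, resPoly_ofFun, resPoly_ofFun, res_res])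
    (fun α => by
      rw [AlgHom.comp_apply, resPoly_pi, resPoly_pi, resPoly_pi]; rfl)
  rw [LinearMap.comp_apply, resVirt_tmul, resVirt_tmul, resVirt_tmul, h1, h2]; rfl

/-- The presheaf tensor product `U ↦ Ω^•_{M,odd}(U) ⊗ D_M(U) ⊗ (Ω^•_{M,odd})^*(U)`. -/
def preVirt : M.X.Presheaf (ModuleCat.{u} k) where
  obj U := ModuleCat.of k (M.PreVirt U.unop)
  map i := ModuleCat.ofHom (M.resVirt i.unop.le)
  map_id U := by rw [← ModuleCat.ofHom_id, ← M.resVirt_id]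
  map_comp i j := by rw [← ModuleCat.ofHom_comp, ← M.resVirt_comp]

/-- The part of bidegree `(i, j)`, spanned by the `ω ⊗ F ⊗ τ` with `ω` an `i`-form and `τ` a
polyfield of degree `j`. -/
def virtDeg (U : Opens M.X) (i j : ℕ) : Submodule k (M.PreVirt U) :=
  Submodule.span k {t | ∃ ω ∈ M.formsDeg U i, ∃ F, ∃ τ ∈ M.polyDeg U j, t = tmul ω F τ}

theorem resVirt_mem_virtDeg {U V : Opens M.X} (h : V ≤ U) (i j : ℕ) (t : M.PreVirt U)
    (ht : t ∈ M.virtDeg U i j) : M.resVirt h t ∈ M.virtDeg V i j := by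
  have : M.virtDeg U i j ≤ (M.virtDeg V i j).comap (M.resVirt h) := by
    refine Submodule.span_le.2 ?_
    rintro _ ⟨ω, hω, F, τ, hτ, rfl⟩
    exact Submodule.subset_span ⟨_, SuperSym.map_deg _ _ _ _ _ i ω hω, _, _,
      SuperSym.map_deg _ _ _ _ _ j τ hτ, rfl⟩
  exact this ht

/-- The presheaf `Ω^i_{M,odd} ⊗ D_M ⊗ (Ω^j_{M,odd})^*`. -/
def preVirtDeg (i j : ℕ) : M.X.Presheaf (ModuleCat.{u} k) where
  obj U := ModuleCat.of k (M.virtDeg U.unop i j)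
  map f := ModuleCat.ofHom ((M.resVirt f.unop.le).restrict (M.resVirt_mem_virtDeg f.unop.le i j))
  map_id U := ModuleCat.hom_ext (LinearMap.ext fun t =>
    Subtype.ext (LinearMap.congr_fun (M.resVirt_id U.unop) t.1))
  map_comp f g := ModuleCat.hom_ext (LinearMap.ext fun t =>
    Subtype.ext (LinearMap.congr_fun (M.resVirt_comp f.unop.le g.unop.le) t.1))

/-- The inclusion of the part of bidegree `(i, j)`. -/
def preVirtDegι (i j : ℕ) : M.preVirtDeg i j ⟶ M.preVirt where
  app U := ModuleCat.ofHom (M.virtDeg U.unop i j).subtype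
  naturality _ _ _ := rfl

/-- The sheaf of virtual superforms `Ω^•_{M,odd} ⊗ D_M ⊗ (Ω^•_{M,odd})^*`. -/
def Virt : Sheaf (Opens.grothendieckTopology M.X) (ModuleCat.{u} k) :=
  (presheafToSheaf _ _).obj M.preVirt

/-- The sheaf `Ω^i_{M,odd} ⊗ D_M ⊗ (Ω^j_{M,odd})^*`. -/
def VirtDeg (i j : ℕ) : Sheaf (Opens.grothendieckTopology M.X) (ModuleCat.{u} k) :=
  (presheafToSheaf _ _).obj (M.preVirtDeg i j)

/-- The inclusion of the sheaf of virtual superforms of bidegree `(i, j)`. -/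
def VirtDegι (i j : ℕ) : M.VirtDeg i j ⟶ M.Virt := (presheafToSheaf _ _).map (M.preVirtDegι i j)

/-- The section of the sheaf of virtual superforms defined by a tensor. -/
def toVirt (U : Opens M.X) : M.PreVirt U →ₗ[k] M.Virt.obj.obj (op U) :=
  ((toSheafify (Opens.grothendieckTopology M.X) M.preVirt).app (op U)).hom

variable {M} in
/-- The action of an endomorphism of the sheaf of virtual superforms on sections. -/
def onSec (φ : M.Virt ⟶ M.Virt) (U : Opens M.X) :
    M.Virt.obj.obj (op U) →ₗ[k] M.Virt.obj.obj (op U) :=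
  (φ.hom.app (op U)).hom

/-! ### Local coordinates and the operators -/

/-- The parity of the coordinates `x_a = z_1, …, z_p | θ_1, …, θ_q`. -/
def idxPar {p q : ℕ} : Fin p ⊕ Fin q → ZMod 2
  | Sum.inl _ => 0
  | Sum.inr _ => 1

/-- Local coordinates `x_a = z_i | θ_α` over `U`, with the coordinate vector fields `∂_a`: these
satisfy `∂_a x_b = δ_{ab}` and freely generate the tangent sheaf over `U`. -/
structure Coords (p q : ℕ) (U : Opens M.X) where
  x : Fin p ⊕ Fin q → M.Sec U
  x_par : ∀ a, x a ∈ M.par U (idxPar a)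
  ptl : Fin p ⊕ Fin q → M.T U
  ptl_par : ∀ a, (ptl a : M.EndO U) ∈ M.Der U (idxPar a)
  ptl_x : ∀ a b, M.ev (ptl a).1 (x b) = if a = b then 1 else 0
  eq_sum : ∀ (V : Opens M.X) (h : V ≤ U) (X : M.T V),
    (X : M.EndO V) = ∑ a, M.mulEnd V (M.ev X.1 (M.res h (x a))) * M.resEnd h (ptl a).1

/-- `d` is the exterior derivative of forms over `U`. -/
structure IsExteriorDerivative {U : Opens M.X} (d : M.Forms U →ₗ[k] M.Forms U) : Prop where
  d_fun : ∀ f : M.Sec U, d (Forms.ofFun f) = Forms.ofForm1 (M.dFun f)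
  d_mul : ∀ (ε : ZMod 2) (ω η : M.Forms U), M.FormsPar U ε ω →
    d (ω * η) = d ω * η + sgn ε • (ω * d η)
  d_d : ∀ ω, d (d ω) = 0

/-- `c ω τ = ⟨ω, τ⟩` is the pairing of forms with polyfields by contraction: a function acts by
multiplication, a `1`-form `α` acts as a superderivation that kills functions, with
`⟨α, π X⟩ = (-1)^{|α||π X|} α(X)`, and a product of forms acts by composition. -/
structure IsPairing {U : Opens M.X} (c : M.Forms U →ₐ[k] Module.End k (M.Poly U)) : Prop where
  fun_apply : ∀ (f : M.Sec U) (τ : M.Poly U), c (Forms.ofFun f) τ = Poly.ofFun f * τ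
  form_fun : ∀ (α : M.Form1 U) (f : M.Sec U), c (Forms.ofForm1 α) (Poly.ofFun f) = 0
  form_pi : ∀ (ε η : ZMod 2) (α : M.Form1 U) (X : M.T U), α ∈ M.formPar U ε → X ∈ M.piPar U η →
    c (Forms.ofForm1 α) (Poly.pi X) = sgn (ε * η) • Poly.ofFun (α.ev X)
  form_mul : ∀ (ε η : ZMod 2) (α : M.Form1 U) (σ τ : M.Poly U), α ∈ M.formPar U ε →
    M.PolyPar U η σ → c (Forms.ofForm1 α) (σ * τ) =
      c (Forms.ofForm1 α) σ * τ + sgn (ε * η) • (σ * c (Forms.ofForm1 α) τ)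

/-- `L` is the Lie derivative of forms along the vector field `X` of parity `ξ`. -/
structure IsLieForms {U : Opens M.X} (d : M.Forms U →ₗ[k] M.Forms U) (X : M.T U) (ξ : ZMod 2)
    (L : Module.End k (M.Forms U)) : Prop where
  lie_fun : ∀ f : M.Sec U, L (Forms.ofFun f) = Forms.ofFun (M.ev X.1 f)
  lie_mul : ∀ (ε : ZMod 2) (ω η : M.Forms U), M.FormsPar U ε ω →
    L (ω * η) = L ω * η + sgn (ξ * ε) • (ω * L η)
  lie_d : ∀ ω, L (d ω) = sgn ξ • d (L ω)

/-- `L` is the Lie derivative of polyfields along the vector field `X` of parity `ξ`: it preserves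
the degree, is `X` on functions, and satisfies
`L ⟨ω, τ⟩ = ⟨L_X ω, τ⟩ + (-1)^{|ω||X|} ⟨ω, L τ⟩` for forms `ω` of positive degree. -/
structure IsLiePoly {U : Opens M.X} (c : M.Forms U →ₐ[k] Module.End k (M.Poly U))
    (X : M.T U) (ξ : ZMod 2) (LΩ : Module.End k (M.Forms U)) (L : Module.End k (M.Poly U)) :
    Prop where
  lie_fun : ∀ f : M.Sec U, L (Poly.ofFun f) = Poly.ofFun (M.ev X.1 f)
  lie_deg : ∀ n, ∀ τ ∈ M.polyDeg U n, L τ ∈ M.polyDeg U n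
  lie_pair : ∀ (n : ℕ) (ε : ZMod 2) (ω : M.Forms U) (τ : M.Poly U), 0 < n → ω ∈ M.formsDeg U n →
    M.FormsPar U ε ω → L (c ω τ) = c (LΩ ω) τ + sgn (ε * ξ) • c ω (L τ)

/-- The exterior derivative, the pairing, and the Lie derivatives of forms and of polyfields along
the coordinate vector fields, over a coordinate open set. -/
@[ext]
structure Calculus {p q : ℕ} {U : Opens M.X} (x : M.Coords p q U) where
  d : M.Forms U →ₗ[k] M.Forms U
  pair : M.Forms U →ₐ[k] Module.End k (M.Poly U)
  lieΩ : Fin p ⊕ Fin q → Module.End k (M.Forms U)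
  lie : Fin p ⊕ Fin q → Module.End k (M.Poly U)
  is_d : M.IsExteriorDerivative d
  is_pair : M.IsPairing pair
  is_lieΩ : ∀ a, M.IsLieForms d (x.ptl a) (idxPar a) (lieΩ a)
  is_lie : ∀ a, M.IsLiePoly pair (x.ptl a) (idxPar a) (lieΩ a) (lie a)

section local_formulas

variable {M} {p q : ℕ} {U : Opens M.X} (x : M.Coords p q U)

/-- The coordinate differential `dx_a`. -/
def Coords.dx (a : Fin p ⊕ Fin q) : M.Forms U := Forms.ofForm1 (M.dFun (x.x a))

variable {x}

/-- `(D ⊗ 1)(ω ⊗ F ⊗ τ) = dω ⊗ F ⊗ τ + ∑_a (-1)^{|ω||x_a|} dx_a ω ⊗ ∂_a F ⊗ τ`, for `ω` of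
parity `ε`. -/
def Calculus.D₁ (C : M.Calculus x) (ε : ZMod 2) (ω : M.Forms U) (F : M.D U) (τ : M.Poly U) :
    M.PreVirt U :=
  tmul (C.d ω) F τ +
    ∑ a, sgn (ε * idxPar a) • tmul (x.dx a * ω) (M.vecD (x.ptl a) * F) τ

/-- The local operator `𝔢_x(τ) = ∑_a ⟨dx_a, L_{∂_a} τ⟩` on polyfields. -/
def Calculus.e (C : M.Calculus x) (τ : M.Poly U) : M.Poly U :=
  ∑ a, C.pair (x.dx a) (C.lie a τ)

/-- `(1 ⊗ δ)(ω ⊗ F ⊗ τ) = (-1)^{|τ|} ∑_a ω ⊗ F ∂_a ⊗ ⟨dx_a, τ⟩ - (-1)^{|τ|} ω ⊗ F ⊗ 𝔢_x(τ)`,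
for `τ` of parity `t`. -/
def Calculus.δ₁ (C : M.Calculus x) (t : ZMod 2) (ω : M.Forms U) (F : M.D U) (τ : M.Poly U) :
    M.PreVirt U :=
  sgn t • (∑ a, tmul ω (F * M.vecD (x.ptl a)) (C.pair (x.dx a) τ)) -
    sgn t • tmul ω F (C.e τ)

end local_formulas

/-- `d'` is the operator `\hat d = D ⊗ 1`: in all local coordinates it is given by the formula for
`D ⊗ 1`. -/
def IsHatD (p q : ℕ) (d' : M.Virt ⟶ M.Virt) : Prop :=
  ∀ (U : Opens M.X) (x : M.Coords p q U) (C : M.Calculus x) (ε : ZMod 2) (ω : M.Forms U)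
    (F : M.D U) (τ : M.Poly U), M.FormsPar U ε ω →
    onSec d' U (M.toVirt U (tmul ω F τ)) = M.toVirt U (C.D₁ ε ω F τ)

/-- `δ'` is the operator `\hat δ`: in all local coordinates,
`\hat δ (ω ⊗ F ⊗ τ) = (-1)^{|ω| + |F| + |τ|} (1 ⊗ δ)(ω ⊗ F ⊗ τ)`. -/
def IsHatDelta (p q : ℕ) (δ' : M.Virt ⟶ M.Virt) : Prop :=
  ∀ (U : Opens M.X) (x : M.Coords p q U) (C : M.Calculus x) (ε φ t : ZMod 2) (ω : M.Forms U)
    (F : M.D U) (τ : M.Poly U), M.FormsPar U ε ω → M.EndPar U φ F.1 → M.PolyPar U t τ →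
    onSec δ' U (M.toVirt U (tmul ω F τ)) = sgn (ε + φ + t) • M.toVirt U (C.δ₁ t ω F τ)

/-- `(\mathcal V, d', δ')` is a double complex: the sheaf of virtual superforms is the direct sum of
its parts of bidegree `(i, j)`, `d'` raises the degree `i` of forms by one and `δ'` lowers the degree
`j` of polyfields by one, and `d'` and `δ'` square to zero and anticommute. -/
structure IsDoubleComplex (d' δ' : M.Virt ⟶ M.Virt) : Prop where
  directSum : Nonempty (Limits.IsColimit
    (Limits.Cofan.mk M.Virt fun ij : ℕ × ℕ => M.VirtDegι ij.1 ij.2))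
  d_deg : ∀ i j, ∃ φ : M.VirtDeg i j ⟶ M.VirtDeg (i + 1) j,
    M.VirtDegι i j ≫ d' = φ ≫ M.VirtDegι (i + 1) j
  δ_deg : ∀ i j, ∃ φ : M.VirtDeg i (j + 1) ⟶ M.VirtDeg i j,
    M.VirtDegι i (j + 1) ≫ δ' = φ ≫ M.VirtDegι i j
  δ_deg_zero : ∀ i, M.VirtDegι i 0 ≫ δ' = 0
  d_comp_d : d' ≫ d' = 0
  δ_comp_δ : δ' ≫ δ' = 0
  anticomm : δ' ≫ d' + d' ≫ δ' = 0

end Superspace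

/-! ### Supermanifolds -/

/-- A space with a sheaf of commutative `k`-algebras: the ordinary manifolds and varieties that
serve as local models. -/
structure LocalModel (k : Type u) [Field k] where
  Y : TopCat.{u}
  B : Y.Presheaf CommRingCat.{u}
  scalars : k →+* B.obj (op ⊤)

/-- Affine space `𝕜^p` with its sheaf of smooth functions; for `𝕜 = ℂ` these are the holomorphic
functions. -/
def smoothModel (𝕜 : Type u) [RCLike 𝕜] (p : ℕ) : LocalModel 𝕜 where
  Y := TopCat.of (EuclideanSpace 𝕜 (Fin p))
  B := (smoothSheafCommRing 𝓘(𝕜, EuclideanSpace 𝕜 (Fin p)) 𝓘(𝕜, 𝕜)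
    (EuclideanSpace 𝕜 (Fin p)) 𝕜).presheaf
  scalars :=
    { toFun := fun c => (⟨fun _ => c, contMDiff_const⟩ :
        ContMDiffMap 𝓘(𝕜, EuclideanSpace 𝕜 (Fin p)) 𝓘(𝕜, 𝕜)
          (⊤ : Opens (EuclideanSpace 𝕜 (Fin p))) 𝕜 ((⊤ : ℕ∞) : WithTop ℕ∞))
      map_one' := rfl
      map_mul' := fun _ _ => rfl
      map_zero' := rfl
      map_add' := fun _ _ => rfl }

/-- A scheme over `k` with its structure sheaf. -/
def schemeModel {k : Type u} [Field k] {S : AlgebraicGeometry.Scheme.{u}}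
    (f : S ⟶ AlgebraicGeometry.Spec (.of k)) : LocalModel k where
  Y := TopCat.of S
  B := S.presheaf
  scalars := ((AlgebraicGeometry.Scheme.ΓSpecIso (.of k)).inv ≫ f.appTop).hom

/-- The geometric categories: real smooth (`𝕜 = ℝ`) and complex analytic (`𝕜 = ℂ`) geometry, and
algebraic geometry over a field of characteristic zero. -/
inductive Geometry : Type (u + 1)
  | analytic (𝕜 : Type u) (inst : RCLike 𝕜) : Geometry
  | algebraic (k : Type u) (inst : Field k) (char : CharZero k) : Geometry

/-- The ground field. -/
def Geometry.K : Geometry.{u} → Type u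
  | .analytic 𝕜 _ => 𝕜
  | .algebraic k _ _ => k

instance Geometry.instField : (G : Geometry.{u}) → Field G.K
  | .analytic 𝕜 _ => inferInstanceAs (Field 𝕜)
  | .algebraic k _ _ => inferInstanceAs (Field k)

/-- The local models of dimension `p`: affine space `𝕜^p` in the smooth or analytic case, smooth
schemes of dimension `p` in the algebraic case. -/
def Geometry.IsModel : (G : Geometry.{u}) → ℕ → LocalModel G.K → Prop
  | .analytic 𝕜 _, p, Y => Y = smoothModel 𝕜 p
  | .algebraic k _ _, p, Y => ∃ (S : AlgebraicGeometry.Scheme.{u})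
      (f : S ⟶ AlgebraicGeometry.Spec (.of k)),
      AlgebraicGeometry.SmoothOfRelativeDimension p f ∧ Y = schemeModel f

/-- The open subset of `X` that corresponds to `W ⊆ Y` under a chart `φ : U → Y`. -/
def preOpen {X Y : TopCat.{u}} (U : Opens X) (φ : C(U, Y)) (W : Opens Y) : Opens X :=
  ⟨Subtype.val '' (φ ⁻¹' W),
    U.isOpen.isOpenEmbedding_subtypeVal.isOpenMap _ (W.isOpen.preimage φ.continuous)⟩

theorem preOpen_le {X Y : TopCat.{u}} (U : Opens X) (φ : C(U, Y)) (W : Opens Y) :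
    preOpen U φ W ≤ U := by
  rintro _ ⟨x, _, rfl⟩
  exact x.2

theorem preOpen_mono {X Y : TopCat.{u}} (U : Opens X) (φ : C(U, Y)) {W W' : Opens Y}
    (h : W' ≤ W) : preOpen U φ W' ≤ preOpen U φ W :=
  Set.image_mono (Set.preimage_mono h)

/-- A chart of `M` over the open set `U`, identifying `U` with an open subset of the model `Y` and
`O_M|_U` with `O_Y ⊗ Λ(θ_1, …, θ_q)`: over each open subset, every section of `O_M` is, for unique
sections `f_I` of `O_Y`, the sum `∑_I f_I θ^I` over `I ⊆ {1, …, q}`. -/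
structure Superspace.Chart {k : Type u} [Field k] (M : Superspace k) (Y : LocalModel k) (q : ℕ)
    (U : Opens M.X) where
  φ : C(U, Y.Y)
  isOpenEmbedding : Topology.IsOpenEmbedding φ
  θ : Fin q → M.Sec U
  θ_odd : ∀ i, θ i ∈ M.par U 1
  s : ∀ W : Opens Y.Y, Y.B.obj (op W) →+* M.Sec (preOpen U φ W)
  s_even : ∀ W g, s W g ∈ M.par _ 0
  s_scalars : ∀ (W : Opens Y.Y) (c : k),
    s W ((Y.B.map (homOfLE (le_top : W ≤ ⊤)).op).hom (Y.scalars c)) = algebraMap k _ c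
  s_res : ∀ (W W' : Opens Y.Y) (h : W' ≤ W) (g : Y.B.obj (op W)),
    M.res (preOpen_mono U φ h) (s W g) = s W' ((Y.B.map (homOfLE h).op).hom g)
  bijective : ∀ W : Opens Y.Y, (W : Set Y.Y) ⊆ Set.range φ → Function.Bijective
    fun f : Finset (Fin q) → Y.B.obj (op W) =>
      ∑ I, s W (f I) * ((I.sort (· ≤ ·)).map fun i => M.res (preOpen_le U φ W) (θ i)).prod

/-- `M` is a supermanifold of dimension `p|q`: it is covered by charts. -/
def Superspace.IsSupermanifold (G : Geometry.{u}) (p q : ℕ) (M : Superspace G.K) : Prop :=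
  ∀ m : M.X, ∃ (Y : LocalModel G.K) (U : Opens M.X), G.IsModel p Y ∧ m ∈ U ∧
    Nonempty (M.Chart Y q U)

end SuperGeom

end

noncomputable section
namespace SuperGeom

/-! ### Signs and superalgebras -/

/-! Everything is local. Where there are coordinates `x_a` with dual vector fields `∂_a`, the
tangent sheaf is free on the `∂_a`, so forms and polyfields are free supersymmetric algebras on the
`dx_a` and the `π ∂_a`. A superderivation of such an algebra is determined by its values on
functions and on the basis (`Frame.isDer_ext`), and these values can be prescribed as soon as the
parities and the Leibniz rule on functions are right (`Frame.exists_isDer`): it is the corner entry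
of an algebra map into upper triangular matrices. This produces `d`, the contractions and the Lie
derivatives along the `∂_a`, and reduces identities between them to generators. The axioms for the
Lie derivative of polyfields do not say that it is a derivation. Its uniqueness uses that a
polyfield of positive degree whose contractions with all `dx_a` vanish is zero, by Euler's identity
in characteristic zero.

Signs like `(-1)^{|ω|}` are turned into linear operators, so that `\hat d` and `\hat δ` become
linear maps on tensors. They are balanced over functions because the commutator of `∂_a` with `f` is
`∂_a f`, and `df = ∑ dx_a ∂_a f`. That `\hat d` is independent of the coordinates is the chain rule.
In `\hat δ` the operator `𝔢_x` does depend on them: a change of coordinates adds contractions whose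
coefficients are derivatives of the Jacobian (`Calculus.e_change`). The sum of the `F ∂_a ⊗ ⟨dx_a,
τ⟩` changes by the same amount, since the Jacobian has to be carried across a `∂` before it can pass
to the polyfield (`Calculus.hatDelta_change`).

The squares vanish because the `∂_a` supercommute with parity `|x_a|`, while the `dx_a` and the
contractions with them supercommute with parity `|x_a| + 1`: the double sums are antisymmetric. The
two differentials act on opposite sides of `F`, so that their anticommutation is a matter of signs.
Coordinate open sets form a basis of the topology, and compatible linear maps over a basis extend to
the associated sheaf (`exists_hom_of_basis`); the bigrading passes to the sheaf in the same way
(`directSum_of_basis`).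

It remains to find coordinates. In a chart, `O_M` is `B ⊗ Λ(θ)`, which is itself a free
supersymmetric algebra over `B` on odd generators. Hence the derivations of `B` extend and the
`∂/∂θ` exist, and it is enough that `B` has coordinates with dual derivations such that a derivation
killing the coordinates vanishes. On affine space the last point is Hadamard's lemma. On a smooth
scheme, a standard smooth algebra has a basis of Kähler differentials, and derivations extend from
an affine open set to smaller open sets by the quotient rule. -/

theorem zmod2_cases (a : ZMod 2) : a = 0 ∨ a = 1 := by revert a; decide

@[simp] theorem sgn_zero : sgn 0 = 1 := rfl
@[simp] theorem sgn_one : sgn 1 = -1 := rfl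
theorem sgn_add (a b : ZMod 2) : sgn (a + b) = sgn a * sgn b := by revert a b; decide
theorem sgn_mul_sgn (a : ZMod 2) : sgn a * sgn a = 1 := by revert a; decide

section

variable {G : Type*} [AddCommGroup G]

theorem sgn_smul_smul (a b : ZMod 2) (x : G) : sgn a • sgn b • x = sgn (a + b) • x := by
  rw [smul_smul, sgn_add]

theorem sgn_smul_self (a : ZMod 2) (x : G) : sgn a • sgn a • x = x := by
  rw [smul_smul, sgn_mul_sgn, one_smul]

theorem sgn_smul_mem {k : Type*} [Ring k] [Module k G] (p : Submodule k G) (a : ZMod 2) {x : G}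
    (hx : x ∈ p) : sgn a • x ∈ p := zsmul_mem hx _

/-- Reduces a comparison of signs to an identity of exponents. Once the parities are generalized to
variables and the context is cleared, the identity is a finite check in `ZMod 2`. -/
theorem sgn_smul_congr {a b : ZMod 2} (h : a = b) (x : G) : sgn a • x = sgn b • x := by rw [h]

theorem sgn_smul_add_sgn_smul {a b : ZMod 2} (h : a = b + 1) (x : G) :
    sgn a • x + sgn b • x = 0 := by
  rw [h, sgn_add]; simp

end

/-- A sum over pairs of indices vanishes if it is antisymmetric. -/
theorem sum_sum_eq_zero_of_antisymm {k : Type*} [Field k] [CharZero k] {G : Type*} [AddCommGroup G]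
    [Module k G] {I : Type*} [Fintype I] (u : I → I → G) (h : ∀ a b, u a b + u b a = 0) :
    ∑ a, ∑ b, u a b = 0 := by
  have h1 : (∑ a, ∑ b, u a b) + ∑ a, ∑ b, u a b = 0 := by
    conv_lhs => arg 2; rw [Finset.sum_comm]
    rw [← Finset.sum_add_distrib]
    refine Finset.sum_eq_zero fun a _ => ?_
    rw [← Finset.sum_add_distrib]
    exact Finset.sum_eq_zero fun b _ => h a b
  rw [← two_smul k] at h1
  exact (smul_eq_zero.1 h1).resolve_left two_ne_zero

/-- The axioms of a supercommutative superalgebra with parity subspaces `pA`. -/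
structure IsSuperAlg {k A : Type*} [Field k] [Ring A] [Algebra k A]
    (pA : ZMod 2 → Submodule k A) : Prop where
  isCompl : IsCompl (pA 0) (pA 1)
  one_mem : (1 : A) ∈ pA 0
  mul_mem : ∀ {ε η : ZMod 2} {f g : A}, f ∈ pA ε → g ∈ pA η → f * g ∈ pA (ε + η)
  comm : ∀ {ε η : ZMod 2} {f g : A}, f ∈ pA ε → g ∈ pA η → f * g = sgn (ε * η) • (g * f)

namespace IsSuperAlg

variable {k A : Type*} [Field k] [Ring A] [Algebra k A] {pA : ZMod 2 → Submodule k A}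
  (hA : IsSuperAlg pA)


/-- The sign operator `f ↦ (-1)^{ε|f|} f`. -/
def tw (ε : ZMod 2) : A →ₗ[k] A :=
  (pA 0).projection (pA 1) hA.isCompl + sgn ε • (pA 1).projection (pA 0) hA.isCompl.symm

theorem tw_apply {ε η : ZMod 2} {f : A} (hf : f ∈ pA η) : hA.tw ε f = sgn (ε * η) • f := by
  rcases zmod2_cases η with rfl | rfl
  · simp [tw, Submodule.projection_apply_left hA.isCompl ⟨f, hf⟩,
      Submodule.projection_apply_right hA.isCompl.symm ⟨f, hf⟩]
  · simp [tw, Submodule.projection_apply_left hA.isCompl.symm ⟨f, hf⟩,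
      Submodule.projection_apply_right hA.isCompl ⟨f, hf⟩]

theorem induction (hA : IsSuperAlg pA) {C : A → Prop} (mem : ∀ η, ∀ f ∈ pA η, C f) (add : ∀ f g, C f → C g → C (f + g))
    (f : A) : C f := by
  have : f ∈ pA 0 ⊔ pA 1 := by rw [hA.isCompl.sup_eq_top]; trivial
  obtain ⟨g, hg, h, hh, rfl⟩ := Submodule.mem_sup.1 this
  exact add _ _ (mem 0 g hg) (mem 1 h hh)

theorem tw_zero (f : A) : hA.tw 0 f = f :=
  hA.induction (C := fun f => hA.tw 0 f = f) (fun η f hf => by rw [hA.tw_apply hf]; simp)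
    (fun f g hf hg => by rw [map_add, hf, hg]) f

theorem tw_one (ε : ZMod 2) : hA.tw ε 1 = 1 := by rw [hA.tw_apply hA.one_mem]; simp

theorem tw_mem {ε η : ZMod 2} {f : A} (hf : f ∈ pA η) : hA.tw ε f ∈ pA η := by
  rw [hA.tw_apply hf]; exact sgn_smul_mem _ _ hf

theorem tw_mul (ε : ZMod 2) (f g : A) : hA.tw ε (f * g) = hA.tw ε f * hA.tw ε g := by
  revert g
  refine hA.induction (C := fun f => ∀ g, hA.tw ε (f * g) = hA.tw ε f * hA.tw ε g) ?_
    (fun f f' h h' g => by rw [add_mul, map_add, map_add, h, h', add_mul]) f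
  intro η f hf g
  refine hA.induction (C := fun g => hA.tw ε (f * g) = hA.tw ε f * hA.tw ε g) ?_
    (fun f f' h h' => by rw [mul_add, map_add, map_add, h, h', mul_add]) g
  intro η' g hg
  rw [hA.tw_apply hf, hA.tw_apply hg, hA.tw_apply (hA.mul_mem hf hg), smul_mul_smul_comm,
    ← sgn_add, mul_add]

theorem tw_tw (ε η : ZMod 2) (f : A) : hA.tw ε (hA.tw η f) = hA.tw (ε + η) f :=
  hA.induction (C := fun f => hA.tw ε (hA.tw η f) = hA.tw (ε + η) f)
    (fun φ f hf => by
      rw [hA.tw_apply hf, map_zsmul, hA.tw_apply hf, hA.tw_apply hf, sgn_smul_smul]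
      exact sgn_smul_congr (by ring) f)
    (fun f g hf hg => by rw [map_add, map_add, map_add, hf, hg]) f

theorem tw_self (ε : ZMod 2) (f : A) : hA.tw ε (hA.tw ε f) = f := by
  rw [tw_tw, CharTwo.add_self_eq_zero, tw_zero]

/-- The Koszul sign is carried by the operator `tw`, so only one of the two factors has to be
homogeneous. -/
theorem mul_eq_tw_mul (hA : IsSuperAlg pA) {ε : ZMod 2} {f : A} (hf : f ∈ pA ε) (g : A) : f * g = hA.tw ε g * f := by
  refine hA.induction (C := fun g => f * g = hA.tw ε g * f) (fun η g hg => ?_)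
    (fun g h hg hh => by rw [mul_add, map_add, add_mul, hg, hh]) g
  rw [hA.tw_apply hg, smul_mul_assoc, hA.comm hf hg]

/-- A homogeneous element of parity `ε + 1` that is invariant under the sign `(-1)^ε` vanishes. -/
theorem eq_zero_of_mem_mem (hA : IsSuperAlg pA) {f : A} {ε : ZMod 2} (h : f ∈ pA ε) (h' : f ∈ pA (ε + 1)) : f = 0 := by
  rcases zmod2_cases ε with rfl | rfl
  · exact Submodule.disjoint_def.1 hA.isCompl.disjoint f h h'
  · exact Submodule.disjoint_def.1 hA.isCompl.disjoint f h' h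

theorem odd_mul_self [CharZero k] (hA : IsSuperAlg pA) {f : A} (hf : f ∈ pA 1) : f * f = 0 := by
  have h := hA.comm hf hf
  rw [mul_one, sgn_one, neg_smul, one_smul, eq_neg_iff_add_eq_zero, ← two_smul k] at h
  exact (smul_eq_zero.1 h).resolve_left two_ne_zero

end IsSuperAlg

/-! ### Superderivations -/

section IsDer

variable {k A : Type*} [Field k] [Ring A] [Algebra k A] {pA : ZMod 2 → Submodule k A}

/-- Homogeneous operators of parity `ε`. -/
def IsHomog (pA : ZMod 2 → Submodule k A) (ε : ZMod 2) (D : Module.End k A) : Prop :=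
  ∀ η, ∀ s ∈ pA η, D s ∈ pA (η + ε)

/-- Superderivations of parity `ε`. -/
def IsDer (pA : ZMod 2 → Submodule k A) (ε : ZMod 2) (D : Module.End k A) : Prop :=
  ∀ η, ∀ s ∈ pA η, ∀ t, D (s * t) = D s * t + sgn (ε * η) • (s * D t)

/-- With the sign written as `tw`, the Leibniz rule holds for inhomogeneous `s` as well, and can be
used in inductions over generators that do not track parity. -/
theorem IsDer.apply_mul {ε : ZMod 2} {D : Module.End k A} (hD : IsDer pA ε D) (hA : IsSuperAlg pA)
    (s t : A) : D (s * t) = D s * t + hA.tw ε s * D t := by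
  refine hA.induction (C := fun s => D (s * t) = D s * t + hA.tw ε s * D t) (fun η s hs => ?_)
    (fun s s' hs hs' => by simp only [add_mul, map_add, hs, hs']; abel) s
  rw [hD η s hs, hA.tw_apply hs, smul_mul_assoc]

theorem IsDer.apply_one {ε : ZMod 2} {D : Module.End k A} (hD : IsDer pA ε D)
    (hA : IsSuperAlg pA) : D 1 = 0 := by
  have := hD 0 1 hA.one_mem 1
  simpa using this

theorem IsDer.add {ε : ZMod 2} {D D' : Module.End k A} (hD : IsDer pA ε D) (hD' : IsDer pA ε D') :
    IsDer pA ε (D + D') := fun η s hs t => by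
  simp only [LinearMap.add_apply, hD η s hs, hD' η s hs, add_mul, mul_add, smul_add]; abel

theorem isDer_zero (ε : ZMod 2) : IsDer pA ε (0 : Module.End k A) := fun η s hs t => by simp

theorem IsDer.sum {ι : Type*} (F : Finset ι) {ε : ZMod 2} {D : ι → Module.End k A}
    (hD : ∀ i, IsDer pA ε (D i)) : IsDer pA ε (∑ i ∈ F, D i) := by
  classical
  induction F using Finset.induction_on with
  | empty => exact isDer_zero ε
  | insert i F hi ih => rw [Finset.sum_insert hi]; exact (hD i).add ih

theorem IsHomog.mul {ε ε' : ZMod 2} {D D' : Module.End k A} (h : IsHomog pA ε D)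
    (h' : IsHomog pA ε' D') : IsHomog pA (ε' + ε) (D * D') := fun η s hs => by
  rw [← add_assoc]; exact h _ _ (h' _ _ hs)

/-- The supercommutator of superderivations is a superderivation. -/
theorem IsDer.supercomm {ε ε' : ZMod 2} {D D' : Module.End k A} (hD : IsDer pA ε D)
    (hD' : IsDer pA ε' D') (h : IsHomog pA ε D) (h' : IsHomog pA ε' D') :
    IsDer pA (ε + ε') (D * D' - sgn (ε * ε') • (D' * D)) := fun η s hs t => by
  simp only [LinearMap.sub_apply, LinearMap.smul_apply, Module.End.mul_apply, hD η s hs,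
    hD' η s hs, map_add, map_zsmul, hD _ _ (h' η s hs), hD' _ _ (h η s hs), smul_add, sub_mul,
    smul_mul_assoc, mul_sub, smul_sub, mul_smul_comm, sgn_smul_smul]
  -- The first two identities make the cross terms `D s * D' t` and `D' s * D t` cancel; the other
  -- two give the second-order terms in `t` the sign of the supercommutator.
  have e1 : ε * ε' + ε' * (η + ε) = ε' * η := by clear * -; decide +revert
  have e2 : ε * ε' + ε * η = ε * (η + ε') := by clear * -; decide +revert
  have e3 : ε * ε' + (ε * η + ε' * η) = (ε + ε') * η + ε * ε' := by clear * -; decide +revert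
  have e4 : ε' * η + ε * η = (ε + ε') * η := by clear * -; decide +revert
  rw [e1, e2, e3, e4]
  abel

end IsDer
end SuperGeom
end

noncomputable section
namespace SuperGeom

/-! ### The supersymmetric algebra -/

namespace SuperSym

variable {k : Type u} [Field k] {A E : Type u} [Ring A] [Algebra k A] [AddCommGroup E] [Module k E]
  {pA : ZMod 2 → Submodule k A} {pE : ZMod 2 → Submodule k E} {act : A → E → E → Prop}

local notation "S" => SuperSym k pA pE act

theorem mk_ι (f : A) (x : E) : mk pA pE act (TensorAlgebra.ι k (f, x)) =
    ofFun pA pE act f + ofGen pA pE act x := by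
  change _ = mk pA pE act (TensorAlgebra.ι k (f, (0 : E))) +
    mk pA pE act (TensorAlgebra.ι k ((0 : A), x))
  rw [← map_add, ← map_add, Prod.mk_add_mk, zero_add, add_zero]

@[simp] theorem ofFun_one : ofFun pA pE act 1 = 1 := (mk_rel .one).trans (map_one _)

theorem ofFun_mul (f g : A) : ofFun pA pE act (f * g) = ofFun pA pE act f * ofFun pA pE act g :=
  ((map_mul (mk pA pE act) _ _).symm.trans (mk_rel (.mul f g))).symm

theorem ofFun_mul_ofGen {f : A} {x y : E} (h : act f x y) :
    ofFun pA pE act f * ofGen pA pE act x = ofGen pA pE act y :=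
  (map_mul (mk pA pE act) _ _).symm.trans (mk_rel (.smul f x y h))

theorem ofGen_mul_ofFun {ε η : ZMod 2} {f : A} {x : E} (hf : f ∈ pA ε) (hx : x ∈ pE η) :
    ofGen pA pE act x * ofFun pA pE act f =
      sgn (ε * η) • (ofFun pA pE act f * ofGen pA pE act x) := by
  have := mk_rel (act := act) (.comm_fun ε η f x hf hx)
  rwa [map_zsmul, map_mul, map_mul] at this

theorem ofGen_mul_ofGen {ε η : ZMod 2} {x y : E} (hx : x ∈ pE ε) (hy : y ∈ pE η) :
    ofGen pA pE act x * ofGen pA pE act y =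
      sgn (ε * η) • (ofGen pA pE act y * ofGen pA pE act x) := by
  have := mk_rel (pA := pA) (act := act) (.comm ε η x y hx hy)
  rwa [map_zsmul, map_mul, map_mul] at this

theorem mk_surjective : Function.Surjective (mk pA pE act) := RingQuot.mkAlgHom_surjective k _

theorem induction {C : S → Prop} (fun_mem : ∀ f, C (ofFun pA pE act f))
    (gen_mem : ∀ x, C (ofGen pA pE act x)) (mul : ∀ s t, C s → C t → C (s * t))
    (add : ∀ s t, C s → C t → C (s + t)) (s : S) : C s := by
  obtain ⟨t, rfl⟩ := mk_surjective s
  induction t using TensorAlgebra.induction with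
  | algebraMap c =>
    have : algebraMap k (TensorAlgebra k (A × E)) c = c • 1 := Algebra.algebraMap_eq_smul_one c
    rw [this, map_smul, map_one, ← ofFun_one, ← map_smul]
    exact fun_mem _
  | ι x => rw [show x = (x.1, x.2) from rfl, mk_ι]; exact add _ _ (fun_mem _) (gen_mem _)
  | mul a b ha hb => rw [map_mul]; exact mul _ _ ha hb
  | add a b ha hb => rw [map_add]; exact add _ _ ha hb

/-- The universal property of the supersymmetric algebra. -/
def lift {B : Type u} [Ring B] [Algebra k B] (a : A →ₗ[k] B) (e : E →ₗ[k] B) (one : a 1 = 1)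
    (mul : ∀ f g, a f * a g = a (f * g)) (smul : ∀ f x y, act f x y → a f * e x = e y)
    (comm_fun : ∀ ε η, ∀ f ∈ pA ε, ∀ x ∈ pE η, e x * a f = sgn (ε * η) • (a f * e x))
    (comm : ∀ ε η, ∀ x ∈ pE ε, ∀ y ∈ pE η, e x * e y = sgn (ε * η) • (e y * e x)) : S →ₐ[k] B :=
  RingQuot.liftAlgHom k ⟨TensorAlgebra.lift k (a.coprod e), by
    intro x y h
    cases h with
    | one => simpa using one
    | mul f g => simpa using mul f g
    | smul f x y h => simpa using smul f x y h
    | comm_fun ε η f x hf hx => simpa using comm_fun ε η f hf x hx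
    | comm ε η x y hx hy => simpa using comm ε η x hx y hy⟩

section lift

variable {B : Type u} [Ring B] [Algebra k B] {a : A →ₗ[k] B} {e : E →ₗ[k] B} {one : a 1 = 1}
    {mul : ∀ f g, a f * a g = a (f * g)} {smul : ∀ f x y, act f x y → a f * e x = e y}
    {comm_fun : ∀ ε η, ∀ f ∈ pA ε, ∀ x ∈ pE η, e x * a f = sgn (ε * η) • (a f * e x)}
    {comm : ∀ ε η, ∀ x ∈ pE ε, ∀ y ∈ pE η, e x * e y = sgn (ε * η) • (e y * e x)}

theorem lift_mk_ι (x : A × E) : lift a e one mul smul comm_fun comm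
    (mk pA pE act (TensorAlgebra.ι k x)) = a x.1 + e x.2 :=
  (RingQuot.liftAlgHom_mkAlgHom_apply (B := B) k (s := SymRel k pA pE act) _ _ _).trans
    (by simp)

@[simp] theorem lift_ofFun (f : A) :
    lift a e one mul smul comm_fun comm (ofFun pA pE act f) = a f := by
  simp [ofFun, lift_mk_ι]

@[simp] theorem lift_ofGen (x : E) :
    lift a e one mul smul comm_fun comm (ofGen pA pE act x) = e x := by
  simp [ofGen, lift_mk_ι]

end lift

theorem HasParity.smul (c : k) {ε : ZMod 2} {s : S} (h : HasParity pA pE act ε s) :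
    HasParity pA pE act ε (c • s) := by
  induction h with
  | ofFun ε f hf => rw [← map_smul]; exact .ofFun _ _ (Submodule.smul_mem _ c hf)
  | ofGen ε x hx => rw [← map_smul]; exact .ofGen _ _ (Submodule.smul_mem _ c hx)
  | mul ε η s t hs ht ihs => rw [← smul_mul_assoc]; exact .mul _ _ _ _ ihs ht
  | add ε s t hs ht ihs iht => rw [smul_add]; exact .add _ _ _ ihs iht

variable (pA pE act) in
/-- The subspace of elements of parity `ε` of the supersymmetric algebra. -/
def par (ε : ZMod 2) : Submodule k S where
  carrier := {s | HasParity pA pE act ε s}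
  add_mem' hs ht := .add _ _ _ hs ht
  zero_mem' := by
    have := HasParity.ofFun (pE := pE) (act := act) ε _ (zero_mem (pA ε))
    rwa [map_zero] at this
  smul_mem' c _ h := h.smul c

theorem ofFun_mem {ε : ZMod 2} {f : A} (hf : f ∈ pA ε) : ofFun pA pE act f ∈ par pA pE act ε :=
  .ofFun _ _ hf

theorem ofGen_mem {ε : ZMod 2} {x : E} (hx : x ∈ pE ε) : ofGen pA pE act x ∈ par pA pE act ε :=
  .ofGen _ _ hx

theorem mul_mem {ε η : ZMod 2} {s t : S} (hs : s ∈ par pA pE act ε) (ht : t ∈ par pA pE act η) :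
    s * t ∈ par pA pE act (ε + η) := .mul _ _ _ _ hs ht

theorem commute_mul {B : Type*} [Ring B] {s t b : B} {ε ε' η : ZMod 2}
    (h : s * b = sgn (ε * η) • (b * s)) (h' : t * b = sgn (ε' * η) • (b * t)) :
    s * t * b = sgn ((ε + ε') * η) • (b * (s * t)) := by
  rw [mul_assoc, h', mul_smul_comm, ← mul_assoc, h, smul_mul_assoc, sgn_smul_smul, mul_assoc]
  exact sgn_smul_congr (by ring) _

theorem sgn_comm {B : Type*} [Ring B] {s t : B} {ε η : ZMod 2}
    (h : s * t = sgn (ε * η) • (t * s)) : t * s = sgn (η * ε) • (s * t) := by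
  rw [h, mul_comm η, sgn_smul_self]

/-- The defining relations only concern generators. The elements that supercommute with a given one
are closed under products by `commute_mul`; this is used first for the right factor, with a
generator on the left, and then for the left factor. -/
theorem comm (hA : IsSuperAlg pA) {ε η : ZMod 2} {s t : S} (hs : s ∈ par pA pE act ε)
    (ht : t ∈ par pA pE act η) : s * t = sgn (ε * η) • (t * s) := by
  have h1 : ∀ η, ∀ t ∈ par pA pE act η, ∀ ε, ∀ f ∈ pA ε,
      ofFun pA pE act f * t = sgn (ε * η) • (t * ofFun _ _ _ f) := by
    intro η t ht ε f hf
    induction ht with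
    | ofFun η g hg => rw [← ofFun_mul, ← ofFun_mul, ← map_zsmul, hA.comm hf hg]
    | ofGen η x hx => exact sgn_comm (by rw [ofGen_mul_ofFun hf hx, mul_comm])
    | mul η η' s t hs ht ihs iht => exact sgn_comm (commute_mul (sgn_comm ihs) (sgn_comm iht))
    | add η s t hs ht ihs iht => rw [mul_add, ihs, iht, add_mul, smul_add]
  have h2 : ∀ η, ∀ t ∈ par pA pE act η, ∀ ε, ∀ x ∈ pE ε,
      ofGen pA pE act x * t = sgn (ε * η) • (t * ofGen _ _ _ x) := by
    intro η t ht ε x hx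
    induction ht with
    | ofFun η g hg => rw [ofGen_mul_ofFun hg hx, mul_comm]
    | ofGen η y hy => exact ofGen_mul_ofGen hx hy
    | mul η η' s t hs ht ihs iht => exact sgn_comm (commute_mul (sgn_comm ihs) (sgn_comm iht))
    | add η s t hs ht ihs iht => rw [mul_add, ihs, iht, add_mul, smul_add]
  induction hs with
  | ofFun ε f hf => exact h1 η t ht ε f hf
  | ofGen ε x hx => exact h2 η t ht ε x hx
  | mul ε ε' s t hs ht ihs iht => exact commute_mul ihs iht
  | add ε s t hs ht ihs iht => rw [add_mul, ihs, iht, mul_add, smul_add]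

/-- The commutation relation with its sign moved onto the function, valid for inhomogeneous `f`. It
carries coefficients between the left and the right of a basis element. -/
theorem ofGen_mul_tw (hA : IsSuperAlg pA) {η : ZMod 2} {x : E} (hx : x ∈ pE η) (f : A) :
    ofGen pA pE act x * ofFun pA pE act (hA.tw η f) = ofFun pA pE act f * ofGen pA pE act x := by
  refine hA.induction (C := fun f => ofGen pA pE act x * ofFun pA pE act (hA.tw η f) =
    ofFun pA pE act f * ofGen pA pE act x) (fun φ f hf => ?_)
    (fun f g hf hg => by rw [map_add, map_add, mul_add, hf, hg, map_add, add_mul]) f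
  rw [hA.tw_apply hf, map_zsmul, mul_smul_comm, ofGen_mul_ofFun hf hx, mul_comm η, sgn_smul_self]

/-! ### Free supersymmetric algebras -/

variable (pA pE act) in
/-- A finite homogeneous basis `e_a` of the `A`-module `E`, with `e_a` of parity `p a`; the
coordinates of `x = ∑ e_a x_a` are `x_a = coef a x`. -/
structure Frame {I : Type} [Fintype I] [DecidableEq I] (p : I → ZMod 2) where
  alg : IsSuperAlg pA
  e : I → E
  e_mem : ∀ a, e a ∈ pE (p a)
  coef : I → E →ₗ[k] A
  coef_mem : ∀ a η, ∀ x ∈ pE η, coef a x ∈ pA (η + p a)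
  -- Coefficients stand to the right of `e a`, so a function acting from the left crosses `e a`
  -- first.
  coef_act : ∀ f x y, act f x y → ∀ a, coef a y = alg.tw (p a) f * coef a x
  coef_e : ∀ a b, coef a (e b) = if a = b then 1 else 0
  -- An identity in the supersymmetric algebra, because `E` has no scalar multiplication by `A`,
  -- only the relation `act`.
  ofGen_eq : ∀ x, ofGen pA pE act x = ∑ a, ofGen pA pE act (e a) * ofFun pA pE act (coef a x)

namespace Frame

variable {I : Type} [Fintype I] [DecidableEq I] {p : I → ZMod 2} (F : Frame pA pE act p)

/-- The generator `e_a` of the supersymmetric algebra. -/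
abbrev gen (a : I) : S := ofGen pA pE act (F.e a)

theorem gen_mem (a : I) : F.gen a ∈ par pA pE act (p a) := ofGen_mem (F.e_mem a)

theorem gen_mul_tw (a : I) (f : A) :
    F.gen a * ofFun pA pE act (F.alg.tw (p a) f) = ofFun pA pE act f * F.gen a :=
  ofGen_mul_tw F.alg (F.e_mem a) f

theorem induction (F : Frame pA pE act p) {C : S → Prop}
    (fun_mem : ∀ f, C (ofFun pA pE act f)) (gen : ∀ a, C (F.gen a))
    (mul : ∀ s t, C s → C t → C (s * t)) (add : ∀ s t, C s → C t → C (s + t)) (s : S) : C s := by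
  refine SuperSym.induction fun_mem (fun x => ?_) mul add s
  rw [F.ofGen_eq]
  exact Finset.sum_induction _ C add (by simpa using fun_mem 0)
    fun a _ => mul _ _ (gen a) (fun_mem _)

theorem sup_par (F : Frame pA pE act p) : par pA pE act 0 ⊔ par pA pE act 1 = ⊤ := by
  rw [eq_top_iff]
  rintro s -
  have hle : ∀ ε, par pA pE act ε ≤ par pA pE act 0 ⊔ par pA pE act 1 := fun ε => by
    rcases zmod2_cases ε with rfl | rfl
    exacts [le_sup_left, le_sup_right]
  refine F.induction (C := fun s => s ∈ par pA pE act 0 ⊔ par pA pE act 1) (fun f => ?_)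
    (fun a => hle _ (F.gen_mem a)) (fun s t hs ht => ?_) (fun s t hs ht => add_mem hs ht) s
  · exact F.alg.induction (C := fun f => ofFun pA pE act f ∈ _) 
      (fun η f hf => hle η (ofFun_mem hf)) (fun f g hf hg => by rw [map_add]; exact add_mem hf hg) f
  · obtain ⟨s0, h0, s1, h1, rfl⟩ := Submodule.mem_sup.1 hs
    obtain ⟨t0, h0', t1, h1', rfl⟩ := Submodule.mem_sup.1 ht
    rw [add_mul, mul_add, mul_add]
    exact add_mem (add_mem (hle _ (mul_mem h0 h0')) (hle _ (mul_mem h0 h1')))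
      (add_mem (hle _ (mul_mem h1 h0')) (hle _ (mul_mem h1 h1')))

/-- The sign operator on generators. -/
def twGen (ε : ZMod 2) : E →ₗ[k] S :=
  ∑ a, sgn (ε * p a) • (LinearMap.mulLeft k (F.gen a) ∘ₗ ofFun pA pE act ∘ₗ F.alg.tw ε ∘ₗ F.coef a)

theorem twGen_apply (ε : ZMod 2) (x : E) : F.twGen ε x =
    ∑ a, sgn (ε * p a) • (F.gen a * ofFun pA pE act (F.alg.tw ε (F.coef a x))) := by
  simp [twGen]

theorem twGen_of_mem {ε η : ZMod 2} {x : E} (hx : x ∈ pE η) :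
    F.twGen ε x = sgn (ε * η) • ofGen pA pE act x := by
  rw [F.ofGen_eq x, twGen_apply, Finset.smul_sum]
  refine Finset.sum_congr rfl fun a _ => ?_
  rw [F.alg.tw_apply (F.coef_mem a η x hx), map_zsmul, mul_smul_comm, sgn_smul_smul]
  exact sgn_smul_congr (by generalize p a = x; clear * -; decide +revert) _

/-- The sign automorphism `s ↦ (-1)^{ε|s|} s` of the supersymmetric algebra. -/
def twHom (ε : ZMod 2) : S →ₐ[k] S :=
  lift (ofFun pA pE act ∘ₗ F.alg.tw ε) (F.twGen ε) (by simp [F.alg.tw_one])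
    (fun f g => by simp [F.alg.tw_mul, ofFun_mul])
    (fun f x y h => by
      rw [twGen_apply, twGen_apply, Finset.mul_sum]
      refine Finset.sum_congr rfl fun a _ => ?_
      rw [F.coef_act f x y h, F.alg.tw_mul, ofFun_mul, ← mul_assoc, F.alg.tw_tw, add_comm,
        ← F.alg.tw_tw, gen_mul_tw, mul_smul_comm, mul_assoc]
      rfl)
    (fun ε' η f hf x hx => by
      rw [F.twGen_of_mem hx, LinearMap.comp_apply, F.alg.tw_apply hf, map_zsmul, smul_mul_smul_comm,
        ofGen_mul_ofFun hf hx, smul_mul_smul_comm, smul_comm, mul_comm (sgn (ε * η))])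
    (fun ε' η x hx y hy => by
      rw [F.twGen_of_mem hx, F.twGen_of_mem hy, smul_mul_smul_comm, ofGen_mul_ofGen hx hy,
        smul_mul_smul_comm, smul_comm, mul_comm (sgn (ε * η))])

theorem twHom_ofFun (ε : ZMod 2) (f : A) :
    F.twHom ε (ofFun pA pE act f) = ofFun pA pE act (F.alg.tw ε f) := lift_ofFun _

theorem twHom_ofGen (ε : ZMod 2) (x : E) : F.twHom ε (ofGen pA pE act x) = F.twGen ε x :=
  lift_ofGen _

theorem twHom_apply {ε η : ZMod 2} {s : S} (hs : s ∈ par pA pE act η) :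
    F.twHom ε s = sgn (ε * η) • s := by
  induction hs with
  | ofFun η f hf => rw [twHom_ofFun, F.alg.tw_apply hf, map_zsmul]
  | ofGen η x hx => rw [twHom_ofGen, F.twGen_of_mem hx]
  | mul η η' s t hs ht ihs iht => 
    rw [map_mul, ihs, iht, smul_mul_smul_comm, ← sgn_add, mul_add]
  | add η s t hs ht ihs iht => rw [map_add, ihs, iht, smul_add]

/-- `HasParity` is an inductive predicate, so that nothing prevents an element from being both even
and odd a priori. The automorphism `twHom 1` is `1` on even and `-1` on odd elements, which
separates them since `2` is invertible. -/
theorem isSuperAlg [CharZero k] (F : Frame pA pE act p) : IsSuperAlg (par pA pE act) where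
  isCompl := by
    refine ⟨Submodule.disjoint_def.2 fun s h0 h1 => ?_, codisjoint_iff.2 F.sup_par⟩
    have h := F.twHom_apply (ε := 1) h0
    rw [F.twHom_apply h1] at h
    simp only [mul_one, sgn_one, mul_zero, sgn_zero, neg_smul, one_smul, neg_eq_iff_add_eq_zero,
      ← two_smul k] at h
    exact (smul_eq_zero.1 h).resolve_left two_ne_zero
  one_mem := by rw [← ofFun_one]; exact ofFun_mem F.alg.one_mem
  mul_mem := mul_mem
  comm := comm F.alg

end Frame
end SuperSym
end SuperGeom
end

/-! ### Superderivations of free supersymmetric algebras -/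

noncomputable section
namespace SuperGeom
namespace SuperSym

variable {k : Type u} [Field k] {A E : Type u} [Ring A] [Algebra k A] [AddCommGroup E] [Module k E]
  {pA : ZMod 2 → Submodule k A} {pE : ZMod 2 → Submodule k E} {act : A → E → E → Prop}

local notation "S" => SuperSym k pA pE act

/-- Upper triangular `2 × 2` matrices. -/
def upper {B : Type u} [Ring B] [Algebra k B] : B × B × B →ₗ[k] Matrix (Fin 2) (Fin 2) B where
  toFun x := !![x.1, x.2.1; 0, x.2.2]
  map_add' x y := by ext i j; fin_cases i <;> fin_cases j <;> simp
  map_smul' c x := by ext i j; fin_cases i <;> fin_cases j <;> simp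

/-- The corner entry obeys a Leibniz rule. When the upper diagonal entry is the sign twist of the
lower one, it is the Leibniz rule of a superderivation, so superderivations can be built by the
universal property of algebra maps. -/
theorem upper_mul {B : Type u} [Ring B] [Algebra k B] (s d t s' d' t' : B) :
    upper (k := k) (s, d, t) * upper (k := k) (s', d', t') =
      upper (k := k) (s * s', s * d' + d * t', t * t') := by
  simp [upper]

theorem upper_congr {B : Type u} [Ring B] [Algebra k B] {s d t s' d' t' : B} (h : s = s')
    (h' : d = d') (h'' : t = t') : upper (k := k) (s, d, t) = upper (k := k) (s', d', t') := by
  rw [h, h', h'']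

/-- The two corner terms on one side match those on the other crosswise, each by supercommutativity
of an element with a derivative. This covers both commutation relations of the universal property.
-/
theorem upper_comm (hA : IsSuperAlg pA) {ε η φ : ZMod 2} {s ds t dt : S}
    (hs : s ∈ par pA pE act η) (hds : ds ∈ par pA pE act (η + ε)) (ht : t ∈ par pA pE act φ)
    (hdt : dt ∈ par pA pE act (φ + ε)) :
    upper (k := k) (sgn (ε * η) • s, ds, s) * upper (k := k) (sgn (ε * φ) • t, dt, t) =
      sgn (η * φ) • (upper (k := k) (sgn (ε * φ) • t, dt, t) *
        upper (k := k) (sgn (ε * η) • s, ds, s)) := by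
  rw [upper_mul, upper_mul, ← map_zsmul]
  simp only [Prod.smul_mk]
  refine upper_congr ?_ ?_ (comm hA hs ht)
  · rw [smul_mul_smul_comm, smul_mul_smul_comm, comm hA hs ht, smul_comm, mul_comm (sgn (ε * η))]
  · rw [smul_mul_assoc, smul_mul_assoc, comm hA hs hdt, comm hA hds ht, smul_add, sgn_smul_smul,
      sgn_smul_smul, add_comm]
    congr 1
    · exact sgn_smul_congr (by clear * -; decide +revert) _
    · exact sgn_smul_congr (by clear * -; decide +revert) _

namespace Frame

variable {I : Type} [Fintype I] [DecidableEq I] {p : I → ZMod 2} (F : Frame pA pE act p)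

/-- The superderivation with given values on functions and on the basis, on `E`. -/
def derGen (ε : ZMod 2) (D₀ : A →ₗ[k] S) (v : I → S) : E →ₗ[k] S :=
  ∑ a, (LinearMap.mulLeft k (v a) ∘ₗ ofFun pA pE act ∘ₗ F.coef a +
    sgn (ε * p a) • (LinearMap.mulLeft k (F.gen a) ∘ₗ D₀ ∘ₗ F.coef a))

theorem derGen_apply (ε : ZMod 2) (D₀ : A →ₗ[k] S) (v : I → S) (x : E) : F.derGen ε D₀ v x = ∑ a, (v a * ofFun pA pE act (F.coef a x) +
    sgn (ε * p a) • (F.gen a * D₀ (F.coef a x))) := by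
  simp [derGen]

theorem derGen_mem {ε : ZMod 2} {D₀ : A →ₗ[k] S} {v : I → S}
    (hD : ∀ η, ∀ f ∈ pA η, D₀ f ∈ par pA pE act (η + ε))
    (hv : ∀ a, v a ∈ par pA pE act (p a + ε)) {η : ZMod 2} {x : E} (hx : x ∈ pE η) :
    F.derGen ε D₀ v x ∈ par pA pE act (η + ε) := by
  rw [derGen_apply]
  refine sum_mem fun a _ => add_mem ?_ (sgn_smul_mem _ _ ?_)
  · have := mul_mem (hv a) (ofFun_mem (F.coef_mem a η x hx))
    rwa [show p a + ε + (η + p a) = η + ε by generalize p a = y; clear * -; decide +revert] at this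
  · have := mul_mem (F.gen_mem a) (hD _ _ (F.coef_mem a η x hx))
    rwa [show p a + (η + p a + ε) = η + ε by generalize p a = y; clear * -; decide +revert] at this

/-- The corner entry of the relation `smul`. The function `f` reaches the coefficient of `e a` as
`tw (p a) f`; `h1` moves it back to the left across `v a`, and `h2` moves its derivative back across
`e a`. -/
theorem derGen_act {ε : ZMod 2} {D₀ : A →ₗ[k] S} {v : I → S}
    (hD : ∀ η, ∀ f ∈ pA η, D₀ f ∈ par pA pE act (η + ε))
    (hDm : ∀ f g, D₀ (f * g) = D₀ f * ofFun pA pE act g + ofFun pA pE act (F.alg.tw ε f) * D₀ g)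
    (hv : ∀ a, v a ∈ par pA pE act (p a + ε)) {f : A} {x y : E} (h : act f x y) :
    F.derGen ε D₀ v y =
      ofFun pA pE act (F.alg.tw ε f) * F.derGen ε D₀ v x + D₀ f * ofGen pA pE act x := by
  have h1 : ∀ a f, v a * ofFun pA pE act (F.alg.tw (p a) f) =
      ofFun pA pE act (F.alg.tw ε f) * v a := fun a f => by
    refine F.alg.induction (C := fun f => v a * ofFun pA pE act (F.alg.tw (p a) f) =
      ofFun pA pE act (F.alg.tw ε f) * v a) (fun φ f hf => ?_)
      (fun f g hf hg => by simp only [map_add, mul_add, add_mul, hf, hg]) f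
    rw [F.alg.tw_apply hf, F.alg.tw_apply hf, map_zsmul, map_zsmul, mul_smul_comm, smul_mul_assoc,
      comm F.alg (hv a) (ofFun_mem hf), sgn_smul_smul]
    exact sgn_smul_congr (by generalize p a = y; clear * -; decide +revert) _
  have h2 : ∀ a f, F.gen a * D₀ (F.alg.tw (p a) f) = sgn (ε * p a) • (D₀ f * F.gen a) :=
      fun a f => by
    refine F.alg.induction (C := fun f => F.gen a * D₀ (F.alg.tw (p a) f) =
      sgn (ε * p a) • (D₀ f * F.gen a)) (fun φ f hf => ?_)
      (fun f g hf hg => by simp only [map_add, mul_add, add_mul, hf, hg, smul_add]) f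
    rw [F.alg.tw_apply hf, map_zsmul, mul_smul_comm, comm F.alg (F.gen_mem a) (hD _ _ hf),
      sgn_smul_smul]
    exact sgn_smul_congr (by generalize p a = y; clear * -; decide +revert) _
  rw [derGen_apply, derGen_apply, F.ofGen_eq x, Finset.mul_sum, Finset.mul_sum,
    ← Finset.sum_add_distrib]
  refine Finset.sum_congr rfl fun a _ => ?_
  rw [F.coef_act f x y h, hDm, ofFun_mul, ← mul_assoc, h1, mul_add, ← mul_assoc, h2, F.alg.tw_tw,
    add_comm ε, ← F.alg.tw_tw, ← mul_assoc, gen_mul_tw, mul_add, smul_add, mul_smul_comm,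
    smul_mul_assoc, sgn_smul_self]
  simp only [mul_assoc]
  abel

/-- Superderivations of a free supersymmetric algebra with given values on functions and on the
basis. -/
theorem exists_isDer [CharZero k] {ε : ZMod 2} {D₀ : A →ₗ[k] S} {v : I → S}
    (hD : ∀ η, ∀ f ∈ pA η, D₀ f ∈ par pA pE act (η + ε))
    (hDm : ∀ f g, D₀ (f * g) = D₀ f * ofFun pA pE act g + ofFun pA pE act (F.alg.tw ε f) * D₀ g)
    (hv : ∀ a, v a ∈ par pA pE act (p a + ε)) :
    ∃ D : Module.End k S, IsDer (par pA pE act) ε D ∧ (∀ f, D (ofFun _ _ _ f) = D₀ f) ∧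
      (∀ a, D (F.gen a) = v a) ∧ ∀ x, D (ofGen _ _ _ x) = F.derGen ε D₀ v x := by
  have hg : ∀ {η x}, x ∈ pE η → F.derGen ε D₀ v x ∈ par pA pE act (η + ε) :=
    fun hx => F.derGen_mem hD hv hx
  -- The algebra map `s ↦ !![twHom ε s, D s; 0, s]`, given by its values on functions and on `E`.
  let φ : S →ₐ[k] Matrix (Fin 2) (Fin 2) S := lift
    (upper ∘ₗ (ofFun pA pE act ∘ₗ F.alg.tw ε).prod (D₀.prod (ofFun pA pE act)))
    (upper ∘ₗ (F.twGen ε).prod ((F.derGen ε D₀ v).prod (ofGen pA pE act)))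
    (by
      have h1 : D₀ 1 = 0 := by simpa [F.alg.tw_one] using hDm 1 1
      have h2 : (1 : Matrix (Fin 2) (Fin 2) S) = upper (k := k) (1, 0, 1) := by
        simp [upper, Matrix.one_fin_two]
      rw [h2]
      exact upper_congr (by simp [F.alg.tw_one]) h1 ofFun_one)
    (fun f g => by
      refine (upper_mul (k := k) ..).trans (upper_congr (k := k) ?_ ?_ (ofFun_mul f g).symm)
      · exact ((congrArg _ (F.alg.tw_mul ..)).trans (ofFun_mul ..)).symm
      · exact (add_comm _ _).trans (hDm f g).symm)
    (fun f x y h => by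
      refine (upper_mul (k := k) ..).trans (upper_congr (k := k) ?_
        (F.derGen_act hD hDm hv h).symm (ofFun_mul_ofGen h))
      have := congrArg (F.twHom ε) (ofFun_mul_ofGen (pA := pA) (pE := pE) h)
      rwa [map_mul, twHom_ofFun, twHom_ofGen, twHom_ofGen] at this)
    (fun φ η f hf x hx => by
      have := upper_comm (act := act) (ε := ε) F.alg (ofGen_mem hx) (hg hx) (ofFun_mem hf) (hD φ f hf)
      rw [← map_zsmul (ofFun pA pE act), ← F.alg.tw_apply hf, ← F.twGen_of_mem hx, mul_comm η] at this
      exact this)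
    (fun φ η x hx y hy => by
      have := upper_comm (act := act) (ε := ε) F.alg (ofGen_mem hx) (hg hx) (ofGen_mem hy) (hg hy)
      rw [← F.twGen_of_mem hx, ← F.twGen_of_mem hy] at this
      exact this)
  have hφ0 : ∀ f, φ (ofFun _ _ _ f) = upper (k := k) (ofFun _ _ _ (F.alg.tw ε f), D₀ f, ofFun _ _ _ f) :=
    fun f => lift_ofFun f
  have hφ1 : ∀ x, φ (ofGen _ _ _ x) =
    upper (k := k) (F.twGen ε x, F.derGen ε D₀ v x, ofGen _ _ _ x) := fun x => lift_ofGen x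
  -- Identifies the diagonal entries for every `s`, not just for generators, so that the corner of
  -- `φ (s * t)` is the Leibniz rule for the corner entries.
  have key : ∀ s, φ s = upper (k := k) (F.twHom ε s, φ s 0 1, s) := by
    refine fun s => SuperSym.induction (C := fun s => φ s = upper (k := k) (F.twHom ε s, φ s 0 1, s))
      ?_ ?_ ?_ ?_ s
    · intro f; rw [hφ0, F.twHom_ofFun]; rfl
    · intro x; rw [hφ1, F.twHom_ofGen]; rfl
    · intro s t hs ht; rw [map_mul, hs, ht, upper_mul, map_mul]; rfl
    · intro s t hs ht
      refine (map_add φ s t).trans ((congrArg₂ (· + ·) hs ht).trans ((map_add upper _ _).symm.trans ?_))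
      exact upper_congr (map_add _ _ _).symm (by rw [map_add]; rfl) rfl
  let D : Module.End k S :=
    { toFun := fun s => φ s 0 1
      map_add' := fun s t => by rw [map_add]; rfl
      map_smul' := fun c s => by rw [map_smul]; rfl }
  have hDg : ∀ x, D (ofGen _ _ _ x) = F.derGen ε D₀ v x := fun x => by
    change φ _ 0 1 = _; rw [hφ1]; rfl
  refine ⟨D, fun η s hs t => ?_, fun f => ?_, fun a => ?_, hDg⟩
  · change φ (s * t) 0 1 = φ s 0 1 * t + _ • (s * φ t 0 1)
    have := congrFun (congrFun (upper_mul (k := k) (F.twHom ε s) (φ s 0 1) s (F.twHom ε t)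
      (φ t 0 1) t) 0) 1
    rw [← key, ← key, ← map_mul, F.twHom_apply hs, smul_mul_assoc _ s (φ t 0 1)] at this
    exact this.trans (add_comm _ _)
  · change φ _ 0 1 = _; rw [hφ0]; rfl
  · have h1 : D₀ 1 = 0 := by simpa [F.alg.tw_one] using hDm 1 1
    rw [hDg, derGen_apply, Finset.sum_eq_single a]
    · simp [F.coef_e, h1]
    · intro b _ hb; simp [F.coef_e, hb]
    · simp

/-- Agreement spreads from generators by the Leibniz rule. Operator identities such as `d² = 0`
follow by comparing a supercommutator with the zero derivation. -/
theorem isDer_ext [CharZero k] {ε : ZMod 2} {D D' : Module.End k S}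
    (hD : IsDer (par pA pE act) ε D) (hD' : IsDer (par pA pE act) ε D')
    (h₀ : ∀ f, D (ofFun _ _ _ f) = D' (ofFun _ _ _ f)) (h₁ : ∀ a, D (F.gen a) = D' (F.gen a)) :
    D = D' := by
  refine LinearMap.ext (F.induction h₀ h₁ (fun s t hs ht => ?_) fun s t hs ht => ?_)
  · rw [hD.apply_mul F.isSuperAlg, hD'.apply_mul F.isSuperAlg, hs, ht]
  · rw [map_add, map_add, hs, ht]

theorem isHomog_of_isDer [CharZero k] {ε : ZMod 2} {D : Module.End k S}
    (hD : IsDer (par pA pE act) ε D)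
    (h₀ : ∀ η, ∀ f ∈ pA η, D (ofFun _ _ _ f) ∈ par pA pE act (η + ε))
    (h₁ : ∀ a, D (F.gen a) ∈ par pA pE act (p a + ε)) : IsHomog (par pA pE act) ε D := by
  intro η s hs
  have hmul : ∀ {η φ : ZMod 2} {s t : S}, s ∈ par pA pE act η → t ∈ par pA pE act φ →
      D s ∈ par pA pE act (η + ε) → D t ∈ par pA pE act (φ + ε) →
      D (s * t) ∈ par pA pE act (η + φ + ε) := by
    intro η φ s t hs ht ihs iht
    rw [hD η s hs]
    refine add_mem ?_ (sgn_smul_mem _ _ ?_)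
    · rw [show η + φ + ε = η + ε + φ by ring]; exact mul_mem ihs ht
    · rw [add_assoc]; exact mul_mem hs iht
  induction hs with
  | ofFun η f hf => exact h₀ η f hf
  | ofGen η x hx =>
    rw [F.ofGen_eq, map_sum]
    refine sum_mem fun a _ => ?_
    have := hmul (F.gen_mem a) (ofFun_mem (F.coef_mem a η x hx)) (h₁ a) (h₀ _ _ (F.coef_mem a η x hx))
    rwa [show p a + (η + p a) + ε = η + ε by generalize p a = y; clear * -; decide +revert] at this
  | mul η φ s t hs ht ihs iht => exact hmul hs ht ihs iht
  | add η s t hs ht ihs iht => rw [map_add]; exact add_mem ihs iht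

/-! #### The grading by degree -/

theorem ofFun_mem_deg (f : A) : ofFun pA pE act f ∈ deg pA pE act 0 := by
  rw [deg, pow_zero, mul_one]; exact ⟨f, rfl⟩

include F in
-- The commutation relation needs a homogeneous element of `E`; the basis provides one. A
-- coefficient is then written as a `tw` of a `tw` and carried to the left of `e a`.
theorem gen_fun_le : LinearMap.range (ofGen pA pE act) * LinearMap.range (ofFun pA pE act) ≤
    LinearMap.range (ofFun pA pE act) * LinearMap.range (ofGen pA pE act) := by
  rw [Submodule.mul_le]
  rintro _ ⟨x, rfl⟩ _ ⟨f, rfl⟩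
  rw [F.ofGen_eq, Finset.sum_mul]
  refine sum_mem fun a _ => ?_
  rw [mul_assoc, ← ofFun_mul, ← F.alg.tw_self (p a) (F.coef a x * f), gen_mul_tw]
  exact Submodule.mul_mem_mul ⟨_, rfl⟩ ⟨_, rfl⟩

theorem fun_mul_fun_le : LinearMap.range (ofFun pA pE act) * LinearMap.range (ofFun pA pE act) ≤
    LinearMap.range (ofFun pA pE act) := by
  rw [Submodule.mul_le]
  rintro _ ⟨x, rfl⟩ _ ⟨f, rfl⟩
  exact ⟨x * f, ofFun_mul ..⟩

include F in
theorem gen_pow_fun_le (n : ℕ) :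
    LinearMap.range (ofGen pA pE act) ^ n * LinearMap.range (ofFun pA pE act) ≤
      LinearMap.range (ofFun pA pE act) * LinearMap.range (ofGen pA pE act) ^ n := by
  induction n with
  | zero => simp
  | succ n ih =>
    calc _ = LinearMap.range (ofGen pA pE act) ^ n *
          (LinearMap.range (ofGen pA pE act) * LinearMap.range (ofFun pA pE act)) := by
          rw [pow_succ, mul_assoc]
      _ ≤ LinearMap.range (ofGen pA pE act) ^ n *
          (LinearMap.range (ofFun pA pE act) * LinearMap.range (ofGen pA pE act)) :=
          mul_le_mul_right F.gen_fun_le _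
      _ ≤ _ := by
          rw [← mul_assoc, pow_succ, ← mul_assoc]
          exact mul_le_mul_left ih _

include F in
theorem mul_mem_deg {m n : ℕ} {s t : S} (hs : s ∈ deg pA pE act m) (ht : t ∈ deg pA pE act n) :
    s * t ∈ deg pA pE act (m + n) := by
  have h := Submodule.mul_mem_mul hs ht
  have hle : deg pA pE act m * deg pA pE act n ≤ deg pA pE act (m + n) := by
    rw [deg, deg, deg, mul_assoc, ← mul_assoc (_ ^ m)]
    refine (mul_le_mul_right (mul_le_mul_left (F.gen_pow_fun_le m) _) _).trans ?_
    rw [pow_add, mul_assoc, ← mul_assoc]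
    exact mul_le_mul_left fun_mul_fun_le _
  exact hle h

theorem ofGen_mem_deg (x : E) : ofGen pA pE act x ∈ deg pA pE act 1 := by
  rw [deg, pow_one]
  have : ofGen pA pE act x = ofFun pA pE act 1 * ofGen pA pE act x := by simp
  rw [this]
  exact Submodule.mul_mem_mul ⟨1, rfl⟩ ⟨x, rfl⟩

include F in
theorem iSup_deg : ⨆ n, deg pA pE act n = ⊤ := by
  rw [eq_top_iff]
  rintro s -
  refine F.induction (C := fun s => s ∈ ⨆ n, deg pA pE act n)
    (fun f => Submodule.mem_iSup_of_mem 0 (ofFun_mem_deg f))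
    (fun a => Submodule.mem_iSup_of_mem 1 (ofGen_mem_deg _)) (fun s t hs ht => ?_)
    (fun s t hs ht => add_mem hs ht) s
  have hle : (⨆ n, deg pA pE act n) * (⨆ n, deg pA pE act n) ≤ ⨆ n, deg pA pE act n := by
    rw [Submodule.iSup_mul]
    refine iSup_le fun m => ?_
    rw [Submodule.mul_iSup]
    refine iSup_le fun n => ?_
    rw [Submodule.mul_le]
    exact fun s hs t ht => Submodule.mem_iSup_of_mem (m + n) (F.mul_mem_deg hs ht)
  exact hle (Submodule.mul_mem_mul hs ht)

include F in
/-- Properties of the elements of degree `n` can be checked on products of `n` generators. -/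
theorem deg_induction {C : ℕ → S → Prop} (fun_mem : ∀ f, C 0 (ofFun _ _ _ f))
    (zero : ∀ n, C n 0)
    (mul : ∀ n s a, s ∈ deg pA pE act n → C n s → C (n + 1) (F.gen a * s))
    (add : ∀ n s t, C n s → C n t → C n (s + t)) (n : ℕ) (s : S) (hs : s ∈ deg pA pE act n) :
    C n s := by
  induction n generalizing s with
  | zero =>
    rw [deg, pow_zero, mul_one] at hs
    obtain ⟨f, rfl⟩ := hs
    exact fun_mem f
  | succ n ih =>
    rw [deg, pow_succ', ← mul_assoc] at hs
    refine Submodule.mul_induction_on hs ?_ (add (n + 1))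
    intro s hs t ht
    refine Submodule.mul_induction_on hs ?_ (fun x y hx hy => by rw [add_mul]; exact add _ _ _ hx hy)
    rintro _ ⟨f, rfl⟩ _ ⟨x, rfl⟩
    rw [F.ofGen_eq, Finset.mul_sum, Finset.sum_mul]
    refine Finset.sum_induction _ (C (n + 1)) (add (n + 1)) (zero _) fun a _ => ?_
    rw [← mul_assoc, ← gen_mul_tw, mul_assoc, mul_assoc]
    have : ofFun pA pE act (F.alg.tw (p a) f) * (ofFun pA pE act (F.coef a x) * t) ∈
        deg pA pE act n := by
      rw [← mul_assoc, ← ofFun_mul]; exact Submodule.mul_mem_mul ⟨_, rfl⟩ ht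
    exact mul n _ a this (ih _ this)

include F in
/-- An element of positive degree that is killed by all partial derivatives vanishes. -/
theorem eq_zero_of_forall_eq_zero [CharZero k] {ι : I → Module.End k S} {c : I → ℤ}
    (hι : ∀ a, IsDer (par pA pE act) (p a) (ι a)) (h₀ : ∀ a f, ι a (ofFun _ _ _ f) = 0)
    (h₁ : ∀ a b, ι a (F.gen b) = if a = b then c a • 1 else 0) (hc : ∀ a, c a * c a = 1)
    {n : ℕ} (hn : n ≠ 0) {s : S} (hs : s ∈ deg pA pE act n) (h : ∀ a, ι a s = 0) : s = 0 := by
  -- Euler's identity: `∑ e_a ∂_a` multiplies elements of degree `n` by `n`. The signs `c a`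
  -- compensate for `ι a (e_a) = c a`.
  have key : ∀ s ∈ deg pA pE act n, ∑ a, c a • (F.gen a * ι a s) = n • s := by
    refine F.deg_induction (C := fun n s => ∑ a, c a • (F.gen a * ι a s) = n • s) ?_ ?_ ?_ ?_ n
    · intro f; simp [h₀]
    · intro n; simp
    · intro n s b hs ih
      have h2 : ∀ a, c a • (F.gen a * ι a (F.gen b * s)) =
          (if a = b then F.gen b * s else 0) + F.gen b * (c a • (F.gen a * ι a s)) := fun a => by
        rw [hι a _ _ (F.gen_mem b), h₁, mul_add, smul_add, mul_smul_comm, ← mul_assoc (F.gen a) (F.gen b),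
          comm F.alg (F.gen_mem a) (F.gen_mem b), smul_mul_assoc, sgn_smul_self, mul_assoc,
          mul_smul_comm]
        congr 1
        split_ifs with hab
        · subst hab
          rw [smul_mul_assoc, mul_smul_comm, smul_smul, hc, one_smul, one_mul]
        · simp
      rw [Finset.sum_congr rfl fun a _ => h2 a, Finset.sum_add_distrib, ← Finset.mul_sum, ih]
      rw [Finset.sum_ite_eq' Finset.univ b, if_pos (Finset.mem_univ b), mul_smul_comm, succ_nsmul']
    · intro n s t hs ht
      simp only [map_add, mul_add, smul_add, Finset.sum_add_distrib, hs, ht]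
  have := key s hs
  simp only [h, mul_zero, smul_zero, Finset.sum_const_zero] at this
  rw [← Nat.cast_smul_eq_nsmul k] at this
  exact (smul_eq_zero.1 this.symm).resolve_left (Nat.cast_ne_zero.2 hn)

end Frame
end SuperSym
end SuperGeom
end

/-! ### Superderivations under multiplication operators and algebra maps, and their degrees -/

noncomputable section
namespace SuperGeom

section

variable {k A : Type*} [Field k] [Ring A] [Algebra k A] {pA : ZMod 2 → Submodule k A}

/-- As `D g = 0`, the coefficient `g` merely rides along and shifts the parity. Contraction with `∑
dx_a α_a` is a sum of operators of this kind. -/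
theorem IsDer.mul_mulLeft {ε η : ZMod 2} {D : Module.End k A} (hD : IsDer pA ε D)
    (hA : IsSuperAlg pA) {g : A} (hg : g ∈ pA η) (h : D g = 0) :
    IsDer pA (ε + η) (D * LinearMap.mulLeft k g) := fun φ s hs t => by
  simp only [Module.End.mul_apply, LinearMap.mulLeft_apply]
  rw [← mul_assoc, hD _ _ (hA.mul_mem hg hs), hD _ _ hg t, h, zero_mul, zero_add, mul_smul_comm,
    ← mul_assoc s, hA.comm hs hg, smul_mul_assoc, sgn_smul_smul, sgn_smul_smul]
  congr 1
  exact sgn_smul_congr (by clear * -; decide +revert) _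

theorem isHomog_mulLeft {η : ZMod 2} (hA : IsSuperAlg pA) {g : A} (hg : g ∈ pA η) :
    IsHomog pA η (LinearMap.mulLeft k g) := fun φ s hs => by
  rw [add_comm]; exact hA.mul_mem hg hs

theorem IsHomog.sum {ι : Type*} (F : Finset ι) {ε : ZMod 2} {D : ι → Module.End k A}
    (hD : ∀ i ∈ F, IsHomog pA ε (D i)) : IsHomog pA ε (∑ i ∈ F, D i) := fun η s hs => by
  rw [LinearMap.sum_apply]; exact sum_mem fun i hi => hD i hi η s hs

theorem IsSuperAlg.map_tw {B : Type*} [Ring B] [Algebra k B] {pB : ZMod 2 → Submodule k B}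
    (hA : IsSuperAlg pA) (hB : IsSuperAlg pB) (φ : A →ₗ[k] B) (h : ∀ ε, ∀ f ∈ pA ε, φ f ∈ pB ε)
    (ε : ZMod 2) (f : A) : φ (hA.tw ε f) = hB.tw ε (φ f) := by
  refine hA.induction (C := fun f => φ (hA.tw ε f) = hB.tw ε (φ f)) (fun η f hf => ?_)
    (fun f g hf hg => by simp only [map_add, hf, hg]) f
  rw [hA.tw_apply hf, hB.tw_apply (h _ _ hf), map_zsmul]

end

namespace SuperSym

variable {k : Type u} [Field k] {A E : Type u} [Ring A] [Algebra k A] [AddCommGroup E] [Module k E]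
  {pA : ZMod 2 → Submodule k A} {pE : ZMod 2 → Submodule k E} {act : A → E → E → Prop}
  {I : Type} [Fintype I] [DecidableEq I] {p : I → ZMod 2} (F : Frame pA pE act p)

theorem Frame.tw_ofFun [CharZero k] (ε : ZMod 2) (f : A) :
    F.isSuperAlg.tw ε (ofFun pA pE act f) = ofFun pA pE act (F.alg.tw ε f) :=
  (F.alg.map_tw F.isSuperAlg (ofFun pA pE act) (fun _ _ hf => ofFun_mem hf) ε f).symm

/-- Superderivations are intertwined by an algebra map if they are so on generators. -/
theorem Frame.intertwine [CharZero k] {B : Type u} [Ring B] [Algebra k B]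
    {pB : ZMod 2 → Submodule k B} (hB : IsSuperAlg pB) (φ : SuperSym k pA pE act →ₐ[k] B)
    (hφ : ∀ ε, ∀ s ∈ par pA pE act ε, φ s ∈ pB ε) {ε : ZMod 2}
    {D : Module.End k (SuperSym k pA pE act)} {D' : Module.End k B}
    (hD : IsDer (par pA pE act) ε D) (hD' : IsDer pB ε D')
    (h₀ : ∀ f, φ (D (ofFun _ _ _ f)) = D' (φ (ofFun _ _ _ f)))
    (h₁ : ∀ a, φ (D (F.gen a)) = D' (φ (F.gen a))) (s : SuperSym k pA pE act) :
    φ (D s) = D' (φ s) := by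
  refine F.induction (C := fun s => φ (D s) = D' (φ s)) h₀ h₁ (fun s t hs ht => ?_)
    (fun s t hs ht => by simp only [map_add, hs, ht]) s
  rw [hD.apply_mul F.isSuperAlg, map_add, map_mul, map_mul, map_mul, hD'.apply_mul hB, hs, ht]
  congr 2
  exact F.isSuperAlg.map_tw hB φ.toLinearMap hφ ε s

theorem map_mem_par {A' E' : Type u} [Ring A'] [Algebra k A'] [AddCommGroup E'] [Module k E']
    {pA' : ZMod 2 → Submodule k A'} {pE' : ZMod 2 → Submodule k E'} {act' : A' → E' → E' → Prop}
    (a : A →ₐ[k] A') (e : E →ₗ[k] E') (ha : ∀ ε, ∀ f ∈ pA ε, a f ∈ pA' ε)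
    (he : ∀ ε, ∀ x ∈ pE ε, e x ∈ pE' ε) (hact : ∀ f x y, act f x y → act' (a f) (e x) (e y))
    (ε : ZMod 2) (s : SuperSym k pA pE act) (hs : s ∈ par pA pE act ε) :
    map a e ha he hact s ∈ par pA' pE' act' ε := by
  induction hs with
  | ofFun ε f hf => rw [map_ofFun]; exact ofFun_mem (ha _ _ hf)
  | ofGen ε x hx => rw [map_ofGen]; exact ofGen_mem (he _ _ hx)
  | mul ε η s t hs ht ihs iht => rw [map_mul]; exact mul_mem ihs iht
  | add ε s t hs ht ihs iht => rw [map_add]; exact add_mem ihs iht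

/-- A superderivation preserves the degree if it does so on generators. -/
theorem Frame.deg_of_isDer {ε : ZMod 2}
    {D : Module.End k (SuperSym k pA pE act)} (hD : IsDer (par pA pE act) ε D)
    (h₀ : ∀ f, D (ofFun _ _ _ f) ∈ deg pA pE act 0) (h₁ : ∀ a, D (F.gen a) ∈ deg pA pE act 1)
    (n : ℕ) (s : SuperSym k pA pE act) (hs : s ∈ deg pA pE act n) : D s ∈ deg pA pE act n := by
  refine F.deg_induction (C := fun n s => D s ∈ deg pA pE act n) h₀ (fun n => by simp)
    (fun n s a hs ih => ?_) (fun n s t hs ht => by rw [map_add]; exact add_mem hs ht) n s hs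
  rw [hD _ _ (F.gen_mem a), add_comm n]
  exact add_mem (F.mul_mem_deg (h₁ a) hs)
    (sgn_smul_mem _ _ (F.mul_mem_deg (ofGen_mem_deg _) ih))

/-- A superderivation raises the degree by one if it does so on generators. -/
theorem Frame.deg_succ_of_isDer {ε : ZMod 2}
    {D : Module.End k (SuperSym k pA pE act)} (hD : IsDer (par pA pE act) ε D)
    (h₀ : ∀ f, D (ofFun _ _ _ f) ∈ deg pA pE act 1) (h₁ : ∀ a, D (F.gen a) ∈ deg pA pE act 2)
    (n : ℕ) (s : SuperSym k pA pE act) (hs : s ∈ deg pA pE act n) : D s ∈ deg pA pE act (n + 1) := by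
  refine F.deg_induction (C := fun n s => D s ∈ deg pA pE act (n + 1)) h₀ (fun n => by simp)
    (fun n s a hs ih => ?_) (fun n s t hs ht => by rw [map_add]; exact add_mem hs ht) n s hs
  rw [hD _ _ (F.gen_mem a)]
  refine add_mem ?_ (sgn_smul_mem _ _ ?_)
  · rw [show n + 1 + 1 = 2 + n by ring]; exact F.mul_mem_deg (h₁ a) hs
  · rw [show n + 1 + 1 = 1 + (n + 1) by ring]; exact F.mul_mem_deg (ofGen_mem_deg _) ih

/-- A superderivation that kills functions and maps generators to functions lowers the degree by
one. -/
theorem Frame.deg_pred_of_isDer {ε : ZMod 2}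
    {D : Module.End k (SuperSym k pA pE act)} (hD : IsDer (par pA pE act) ε D)
    (h₀ : ∀ f, D (ofFun _ _ _ f) = 0) (h₁ : ∀ a, D (F.gen a) ∈ deg pA pE act 0)
    (n : ℕ) (s : SuperSym k pA pE act) (hs : s ∈ deg pA pE act (n + 1)) :
    D s ∈ deg pA pE act n := by
  -- In degree `0` the truncated `n - 1` is again `0`, so the vanishing of `D s` there is carried as
  -- a separate clause. The passage from degree `0` to degree `1` needs it.
  refine (F.deg_induction (C := fun n s => (n = 0 → D s = 0) ∧ D s ∈ deg pA pE act (n - 1))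
    (fun f => ?_) (fun n => by simp)
    (fun n s a hs ih => ?_) (fun n s t hs ht => ?_) (n + 1) s hs).2
  · rw [h₀]; simp
  · refine ⟨by simp, ?_⟩
    rw [hD _ _ (F.gen_mem a), Nat.add_sub_cancel]
    have := F.mul_mem_deg (h₁ a) hs
    rw [zero_add] at this
    refine add_mem this (sgn_smul_mem _ _ ?_)
    rcases Nat.eq_zero_or_pos n with rfl | hn
    · rw [ih.1 rfl, mul_zero]; exact zero_mem _
    · have := F.mul_mem_deg (ofGen_mem_deg (F.e a)) ih.2
      rwa [Nat.add_sub_cancel' hn] at this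
  · rw [map_add]
    exact ⟨fun h => by rw [hs.1 h, ht.1 h, add_zero], add_mem hs.2 ht.2⟩

end SuperSym

/-! ### Functions and vector fields on a superspace -/

namespace Superspace

variable {k : Type u} [Field k] (M : Superspace k)

theorem isSuperAlg (U : Opens M.X) : IsSuperAlg (M.par U) where
  isCompl := M.isCompl U
  one_mem := M.one_mem U
  mul_mem hf hg := M.mul_mem U _ _ _ _ hf hg
  comm hf hg := M.comm U _ _ _ _ hf hg

theorem res_tw {U V : Opens M.X} (h : V ≤ U) (ε : ZMod 2) (f : M.Sec U) :
    M.res h ((M.isSuperAlg U).tw ε f) = (M.isSuperAlg V).tw ε (M.res h f) :=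
  (M.isSuperAlg U).map_tw (M.isSuperAlg V) (M.res h).toLinearMap (M.res_mem h) ε f

variable {M} {U : Opens M.X}

theorem T_induction {C : M.EndO U → Prop} (mem : ∀ ε, ∀ X ∈ M.Der U ε, C X)
    (add : ∀ X Y, C X → C Y → C (X + Y)) {X : M.EndO U} (hX : X ∈ M.T U) : C X := by
  obtain ⟨Y, hY, Z, hZ, rfl⟩ := Submodule.mem_sup.1 hX
  exact add _ _ (mem 0 Y hY) (mem 1 Z hZ)

theorem EndPar.mul {φ ψ : ZMod 2} {F G : M.EndO U} (hF : M.EndPar U φ F) (hG : M.EndPar U ψ G) :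
    M.EndPar U (φ + ψ) (F * G) := fun V => by
  rw [add_comm]; exact IsHomog.mul (hF V) (hG V)

theorem endPar_mulEnd {φ : ZMod 2} {f : M.Sec U} (hf : f ∈ M.par U φ) :
    M.EndPar U φ (M.mulEnd U f) := fun V =>
  isHomog_mulLeft (M.isSuperAlg V.1) (M.res_mem V.2 φ f hf)

theorem mulEnd_mul_mem_Der {φ ξ : ZMod 2} {f : M.Sec U} (hf : f ∈ M.par U φ) {X : M.EndO U}
    (hX : X ∈ M.Der U ξ) : M.mulEnd U f * X ∈ M.Der U (φ + ξ) := by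
  refine ⟨(endPar_mulEnd hf).mul hX.1, fun V η g hg h => ?_⟩
  rw [EndO.mul_app, Module.End.mul_apply, Module.End.mul_apply, Module.End.mul_apply, mulEnd_app,
    mulEnd_app, mulEnd_app, hX.2 V η g hg, mul_add, mul_smul_comm, ← mul_assoc, ← mul_assoc,
    ← mul_assoc, (M.isSuperAlg V.1).comm hg (M.res_mem V.2 φ f hf), smul_mul_assoc, sgn_smul_smul]
  congr 1
  exact sgn_smul_congr (by clear * -; decide +revert) _

theorem mulEnd_mul_mem_T (f : M.Sec U) {X : M.EndO U} (hX : X ∈ M.T U) :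
    M.mulEnd U f * X ∈ M.T U := by
  refine (M.isSuperAlg U).induction (C := fun f => M.mulEnd U f * X ∈ M.T U) (fun φ f hf => ?_)
    (fun f g hf hg => by rw [map_add, add_mul]; exact add_mem hf hg) f
  exact T_induction (C := fun X => M.mulEnd U f * X ∈ M.T U)
    (fun ε X hX => M.Der_le_T U _ (mulEnd_mul_mem_Der hf hX))
    (fun X Y hX hY => by rw [mul_add]; exact add_mem hX hY) hX

/-- The product `f X` of a function and a vector field. -/
def smulT (f : M.Sec U) (X : M.T U) : M.T U := ⟨M.mulEnd U f * X, mulEnd_mul_mem_T f X.2⟩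

theorem vecAct_smulT (f : M.Sec U) (X : M.T U) : M.VecAct U f X (smulT f X) := rfl

theorem supercomm_mem_Der {ε η : ZMod 2} {X Y : M.EndO U} (hX : X ∈ M.Der U ε)
    (hY : Y ∈ M.Der U η) : X * Y - sgn (ε * η) • (Y * X) ∈ M.Der U (ε + η) := by
  have e : ∀ V, (X * Y - sgn (ε * η) • (Y * X)).app V =
      X.app V * Y.app V - sgn (ε * η) • (Y.app V * X.app V) := fun V => by
    let L : M.EndO U →+ Module.End k (M.Sec V.1) :=
      { toFun := fun F => F.app V, map_zero' := rfl, map_add' := fun _ _ => rfl }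
    exact (map_sub L _ _).trans (congrArg _ (map_zsmul L _ _))
  refine ⟨fun V η' f hf => ?_, fun V => ?_⟩
  · rw [e]
    refine sub_mem ?_ (sgn_smul_mem _ _ ?_)
    · rw [add_comm ε]; exact IsHomog.mul (hX.1 V) (hY.1 V) η' f hf
    · exact IsHomog.mul (hY.1 V) (hX.1 V) η' f hf
  · have := IsDer.supercomm (hX.2 V) (hY.2 V) (hX.1 V) (hY.1 V)
    rw [← e] at this
    exact this

theorem ev_mul (F G : M.EndO U) (f : M.Sec U) : M.ev (F * G) f = M.ev F (M.ev G f) := rfl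

theorem ev_mulEnd (f g : M.Sec U) : M.ev (M.mulEnd U f) g = f * g := by
  rw [ev, mulEnd_app, res_id]

theorem ev_add (F G : M.EndO U) (f : M.Sec U) : M.ev (F + G) f = M.ev F f + M.ev G f := rfl

theorem res_ev {V : Opens M.X} (h : V ≤ U) (F : M.EndO U) (f : M.Sec U) :
    M.res h (M.ev F f) = M.ev (M.resEnd h F) (M.res h f) := F.res_app ⟨U, le_rfl⟩ ⟨V, h⟩ h f

/-- Evaluation of endomorphisms at a function is linear. -/
def evL (f : M.Sec U) : M.EndO U →ₗ[k] M.Sec U where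
  toFun F := M.ev F f
  map_add' _ _ := rfl
  map_smul' _ _ := rfl

@[simp] theorem evL_apply (f : M.Sec U) (F : M.EndO U) : evL f F = M.ev F f := rfl

end Superspace
end SuperGeom
end

noncomputable section
namespace SuperGeom
namespace Superspace

variable {k : Type u} [Field k] {M : Superspace k} {U : Opens M.X}

/-! ### Coordinates -/

theorem resEnd_self (F : M.EndO U) : M.resEnd le_rfl F = F := rfl

theorem ev_one {X : M.EndO U} (hX : X ∈ M.T U) : M.ev X 1 = 0 :=
  T_induction (C := fun X => M.ev X 1 = 0)
    (fun _ X hX => IsDer.apply_one (hX.2 ⟨U, le_rfl⟩) (M.isSuperAlg U))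
    (fun X Y hX hY => by rw [ev_add, hX, hY, add_zero]) hX

theorem ev_mem {ε η : ZMod 2} {F : M.EndO U} (hF : M.EndPar U ε F) {f : M.Sec U}
    (hf : f ∈ M.par U η) : M.ev F f ∈ M.par U (η + ε) := hF ⟨U, le_rfl⟩ η f hf

theorem ev_apply_mul {ε : ZMod 2} {X : M.EndO U} (hX : X ∈ M.Der U ε) (f g : M.Sec U) :
    M.ev X (f * g) = M.ev X f * g + (M.isSuperAlg U).tw ε f * M.ev X g :=
  IsDer.apply_mul (hX.2 ⟨U, le_rfl⟩) (M.isSuperAlg U) f g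

variable {p q : ℕ}

namespace Coords

variable (x : M.Coords p q U)

/-- Restriction of coordinates. -/
def restrict {V : Opens M.X} (h : V ≤ U) : M.Coords p q V where
  x a := M.res h (x.x a)
  x_par a := M.res_mem h _ _ (x.x_par a)
  ptl a := M.resT h (x.ptl a)
  ptl_par a := M.resEnd_mem_Der h _ _ (x.ptl_par a)
  ptl_x a b := by
    change M.ev (M.resEnd h (x.ptl a).1) _ = _
    rw [← res_ev, x.ptl_x]
    split_ifs <;> simp
  eq_sum W hW X := by
    simp only [res_res]
    exact x.eq_sum W (hW.trans h) X

theorem eq_sum_self {X : M.EndO U} (hX : X ∈ M.T U) :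
    X = ∑ a, M.mulEnd U (M.ev X (x.x a)) * (x.ptl a).1 := by
  have := x.eq_sum U le_rfl ⟨X, hX⟩
  simpa only [res_id, resEnd_self] using this

theorem eq_sum_T (X : M.T U) : X = ∑ a, smulT (M.ev X.1 (x.x a)) (x.ptl a) := by
  apply Subtype.ext
  rw [AddSubmonoidClass.coe_finsetSum]
  exact x.eq_sum_self X.2

theorem eq_zero {X : M.EndO U} (hX : X ∈ M.T U) (h : ∀ a, M.ev X (x.x a) = 0) : X = 0 := by
  rw [x.eq_sum_self hX]
  simp [h]

/-- The supercommutator is a vector field, hence determined by its values on the coordinates, and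
these vanish because the functions `∂_b x_c` are constant. -/
theorem ptl_mul_ptl (a b : Fin p ⊕ Fin q) : (x.ptl a).1 * (x.ptl b).1 =
    sgn (idxPar a * idxPar b) • ((x.ptl b).1 * (x.ptl a).1) := by
  rw [← sub_eq_zero]
  refine x.eq_zero (M.Der_le_T _ _ (supercomm_mem_Der (x.ptl_par a) (x.ptl_par b))) fun c => ?_
  rw [← evL_apply, map_sub, map_zsmul, evL_apply, evL_apply, ev_mul, ev_mul, x.ptl_x, x.ptl_x]
  have h0 : ∀ (X : M.T U) (P : Prop) [Decidable P], M.ev X.1 (if P then 1 else 0) = 0 := by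
    intro X P _
    split_ifs
    · exact ev_one X.2
    · exact map_zero _
  rw [h0, h0, smul_zero, sub_zero]

theorem ptl_ptl (a b : Fin p ⊕ Fin q) (f : M.Sec U) : M.ev (x.ptl a).1 (M.ev (x.ptl b).1 f) =
    sgn (idxPar a * idxPar b) • M.ev (x.ptl b).1 (M.ev (x.ptl a).1 f) := by
  have := congrArg (evL f) (x.ptl_mul_ptl a b)
  rwa [map_zsmul] at this

theorem ptl_mem (a : Fin p ⊕ Fin q) {η : ZMod 2} {f : M.Sec U} (hf : f ∈ M.par U η) :
    M.ev (x.ptl a).1 f ∈ M.par U (η + idxPar a) := ev_mem (x.ptl_par a).1 hf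

end Coords

/-! ### Forms in coordinates -/

theorem Form1.ext {α β : M.Form1 U} (h : ∀ V X, α.app V X = β.app V X) : α = β :=
  Subtype.ext (funext fun V => LinearMap.ext (h V))

theorem Form1.app_smulT (α : M.Form1 U) (V : {V : Opens M.X // V ≤ U}) (f : M.Sec V.1)
    (X : M.T V.1) : α.app V (smulT f X) = f * α.app V X := α.2.2 V f X _ (vecAct_smulT f X)

theorem Form1.res_app (α : M.Form1 U) (V W : {V : Opens M.X // V ≤ U}) (h : W.1 ≤ V.1)
    (X : M.T V.1) : M.res h (α.app V X) = α.app W (M.resT h X) := α.2.1 V W h X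

/-- Evaluation of `1`-forms at a vector field is linear. -/
def Form1.evL (X : M.T U) : M.Form1 U →ₗ[k] M.Sec U where
  toFun α := α.ev X
  map_add' _ _ := rfl
  map_smul' _ _ := rfl

/-- The differential of functions is linear. -/
def dFunL (U : Opens M.X) : M.Sec U →ₗ[k] M.Form1 U where
  toFun := M.dFun
  map_add' f g := Form1.ext fun V X =>
    (congrArg (M.ev X.1) (map_add (M.res V.2) f g)).trans (map_add _ _ _)
  map_smul' c f := Form1.ext fun V X =>
    (congrArg (M.ev X.1) (map_smul (M.res V.2) c f)).trans (map_smul _ _ _)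

theorem dFun_app (f : M.Sec U) (V : {V : Opens M.X // V ≤ U}) (X : M.T V.1) :
    (M.dFun f).app V X = M.ev X.1 (M.res V.2 f) := rfl

theorem dFun_ev (f : M.Sec U) (X : M.T U) : (M.dFun f).ev X = M.ev X.1 f := by
  rw [Form1.ev, dFun_app, res_id]

theorem dFun_mem {η : ZMod 2} {f : M.Sec U} (hf : f ∈ M.par U η) :
    M.dFun f ∈ M.formPar U (η + 1) := fun V ξ X hX => by
  have := ev_mem hX.1 (M.res_mem V.2 _ _ hf)
  rw [dFun_app]
  rwa [show ξ + (η + 1) + 1 = η + ξ by clear * -; decide +revert]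

/-- The right module structure of `1`-forms, `(α f)(X) = α(X) f`. -/
def formMul (α : M.Form1 U) (f : M.Sec U) : M.Form1 U :=
  ⟨fun V => LinearMap.mulRight k (M.res V.2 f) ∘ₗ α.app V, fun V W h X => by
    change M.res h (α.app V X * M.res V.2 f) = α.app W (M.resT h X) * M.res W.2 f
    rw [map_mul, α.res_app, res_res], fun V g X Y h => by
    change α.app V Y * M.res V.2 f = g * (α.app V X * M.res V.2 f)
    rw [← mul_assoc]
    exact congrArg (· * _) (α.2.2 V g X Y h)⟩

theorem formMul_app (α : M.Form1 U) (f : M.Sec U) (V : {V : Opens M.X // V ≤ U}) (X : M.T V.1) :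
    (formMul α f).app V X = α.app V X * M.res V.2 f := rfl

theorem Form1.sum_app {ι : Type*} (s : Finset ι) (α : ι → M.Form1 U)
    (V : {V : Opens M.X // V ≤ U}) (X : M.T V.1) :
    (∑ i ∈ s, α i).app V X = ∑ i ∈ s, (α i).app V X := by
  let L : M.Form1 U →+ M.Sec V.1 :=
    { toFun := fun α => α.app V X, map_zero' := rfl, map_add' := fun _ _ => rfl }
  exact map_sum L α s

theorem Form1.zsmul_app (n : ℤ) (α : M.Form1 U) (V : {V : Opens M.X // V ≤ U}) (X : M.T V.1) :
    (n • α).app V X = n • α.app V X := by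
  let L : M.Form1 U →+ M.Sec V.1 :=
    { toFun := fun α => α.app V X, map_zero' := rfl, map_add' := fun _ _ => rfl }
  exact map_zsmul L n α

theorem Forms.ofForm1_add (α β : M.Form1 U) :
    Forms.ofForm1 (α + β) = Forms.ofForm1 α + Forms.ofForm1 β := map_add _ _ _

theorem Forms.ofForm1_zsmul (n : ℤ) (α : M.Form1 U) :
    Forms.ofForm1 (n • α) = n • Forms.ofForm1 α := map_zsmul _ _ _

theorem Forms.ofFun_add (f g : M.Sec U) :
    Forms.ofFun (f + g) = Forms.ofFun f + Forms.ofFun g := map_add _ _ _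

theorem Forms.ofFun_zsmul (n : ℤ) (f : M.Sec U) :
    Forms.ofFun (n • f) = n • Forms.ofFun f := map_zsmul _ _ _

/-- The sign between the left and the right module structure of `1`-forms cancels the sign of the
commutation relation. `FormAct` speaks of homogeneous functions only, hence the decomposition of
`f`. -/
theorem ofForm1_formMul {η : ZMod 2} {α : M.Form1 U} (hα : α ∈ M.formPar U η) (f : M.Sec U) :
    Forms.ofForm1 (formMul α f) = Forms.ofForm1 α * Forms.ofFun f := by
  refine (M.isSuperAlg U).induction (C := fun f => Forms.ofForm1 (formMul α f) =
    Forms.ofForm1 α * Forms.ofFun f) (fun φ f hf => ?_) (fun f g hf hg => ?_) f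
  · rw [SuperSym.ofGen_mul_ofFun hf hα, SuperSym.ofFun_mul_ofGen (y := sgn (φ * η) • formMul α f),
      map_zsmul, sgn_smul_self]
    exact ⟨φ, η, hf, hα, fun V X => by rw [Form1.zsmul_app]; rfl⟩
  · have : formMul α (f + g) = formMul α f + formMul α g := Form1.ext fun V X => by
      change _ = (formMul α f).app V X + (formMul α g).app V X
      rw [formMul_app, map_add, mul_add]; rfl
    rw [this, Forms.ofForm1_add, hf, hg, Forms.ofFun_add, mul_add]

/-- Dual to the expansion of vector fields: evaluate `α` on `X = ∑ X(x_a) ∂_a` over each smaller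
open set, where the restricted coordinates serve. -/
theorem Coords.form_eq (x : M.Coords p q U) (α : M.Form1 U) :
    α = ∑ a, formMul (M.dFun (x.x a)) (α.ev (x.ptl a)) := by
  refine Form1.ext fun V X => ?_
  rw [Form1.sum_app]
  conv_lhs => rw [(x.restrict V.2).eq_sum_T X, map_sum]
  refine Finset.sum_congr rfl fun a _ => ?_
  rw [α.app_smulT, formMul_app, dFun_app, Form1.ev, α.res_app ⟨U, le_rfl⟩ V V.2]
  rfl

/-- The basis `dx_a` of the `1`-forms. -/
def Coords.formFrame (x : M.Coords p q U) : SuperSym.Frame (M.par U) (M.formPar U) (M.FormAct U)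
    (fun a : Fin p ⊕ Fin q => idxPar a + 1) where
  alg := M.isSuperAlg U
  e a := M.dFun (x.x a)
  e_mem a := dFun_mem (x.x_par a)
  coef a := Form1.evL (x.ptl a)
  coef_mem a η α hα := by
    have := hα ⟨U, le_rfl⟩ _ (x.ptl a) (x.ptl_par a)
    rwa [show idxPar a + η + 1 = η + (idxPar a + 1) by ring] at this
  coef_act := by
    rintro f α β ⟨ε, η, hf, hα, hβ⟩ a
    have h := hα ⟨U, le_rfl⟩ _ (x.ptl a) (x.ptl_par a)
    refine (hβ ⟨U, le_rfl⟩ (x.ptl a)).trans ?_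
    rw [res_id, (M.isSuperAlg U).comm h hf, (M.isSuperAlg U).tw_apply hf, sgn_smul_smul,
      smul_mul_assoc]
    exact sgn_smul_congr (by generalize idxPar a = y; clear * -; decide +revert) _
  coef_e a b := (dFun_ev _ _).trans (x.ptl_x a b)
  ofGen_eq α := by
    conv_lhs => rw [x.form_eq α, map_sum]
    exact Finset.sum_congr rfl fun a _ => ofForm1_formMul (dFun_mem (x.x_par a)) _

/-- The basis `π ∂_a` of `Π T_M`. -/
def Coords.polyFrame (x : M.Coords p q U) : SuperSym.Frame (M.par U) (M.piPar U) (M.VecAct U)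
    (fun a : Fin p ⊕ Fin q => idxPar a + 1) where
  alg := M.isSuperAlg U
  e a := x.ptl a
  e_mem a := by
    change (x.ptl a).1 ∈ M.Der U (idxPar a + 1 + 1)
    rw [show idxPar a + 1 + 1 = idxPar a by generalize idxPar a = y; clear * -; decide +revert]
    exact x.ptl_par a
  -- The expansion `X = ∑ X(x_a) ∂_a` has its coefficients on the left. Moving them to the right of
  -- `π ∂_a`, which has parity `idxPar a + 1`, twists them.
  coef a := (M.isSuperAlg U).tw (idxPar a + 1) ∘ₗ evL (x.x a) ∘ₗ (M.T U).subtype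
  coef_mem a η X hX := by
    have := (M.isSuperAlg U).tw_mem (ε := idxPar a + 1)
      (ev_mem (F := X.1) (Submodule.mem_comap.1 hX).1 (x.x_par a))
    rwa [show idxPar a + (η + 1) = η + (idxPar a + 1) by ring] at this
  coef_act f X Y h a := by
    change (M.isSuperAlg U).tw _ (M.ev Y.1 _) = _ * (M.isSuperAlg U).tw _ (M.ev X.1 _)
    rw [h, ev_mul, ev_mulEnd, IsSuperAlg.tw_mul]
  coef_e a b := by
    change (M.isSuperAlg U).tw _ (M.ev (x.ptl b).1 _) = _
    rw [x.ptl_x]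
    split_ifs with h h' h'
    · exact IsSuperAlg.tw_one _ _
    · exact absurd h.symm h'
    · exact absurd h'.symm h
    · exact map_zero _
  ofGen_eq X := by
    conv_lhs => rw [x.eq_sum_T X, map_sum]
    refine Finset.sum_congr rfl fun a _ => ?_
    rw [← SuperSym.ofFun_mul_ofGen (vecAct_smulT _ _)]
    refine (SuperSym.ofGen_mul_tw (M.isSuperAlg U) ?_ _).symm
    change (x.ptl a).1 ∈ M.Der U (idxPar a + 1 + 1)
    rw [show idxPar a + 1 + 1 = idxPar a by generalize idxPar a = y; clear * -; decide +revert]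
    exact x.ptl_par a

theorem ofForm1_dFun (x : M.Coords p q U) (f : M.Sec U) : Forms.ofForm1 (M.dFun f) =
    ∑ a, x.dx a * Forms.ofFun (M.ev (x.ptl a).1 f) := by
  refine (x.formFrame.ofGen_eq (M.dFun f)).trans (Finset.sum_congr rfl fun a _ => ?_)
  exact congrArg (fun g => x.dx a * Forms.ofFun g) (dFun_ev _ _)

theorem dFun_mul {φ ψ : ZMod 2} {f g : M.Sec U} (hf : f ∈ M.par U φ) (hg : g ∈ M.par U ψ) :
    M.dFun (f * g) = formMul (M.dFun f) g + sgn (φ * ψ) • formMul (M.dFun g) f := by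
  refine Form1.ext fun V X => ?_
  change _ = (formMul (M.dFun f) g).app V X + (sgn (φ * ψ) • formMul (M.dFun g) f).app V X
  rw [Form1.zsmul_app, formMul_app, formMul_app, dFun_app, dFun_app, dFun_app, map_mul]
  obtain ⟨X, hX⟩ := X
  refine T_induction (C := fun X => M.ev X (M.res V.2 f * M.res V.2 g) =
    M.ev X (M.res V.2 f) * M.res V.2 g + sgn (φ * ψ) • (M.ev X (M.res V.2 g) * M.res V.2 f))
    (fun ξ X hX => ?_) (fun X Y hX hY => ?_) hX
  · have hf' := M.res_mem V.2 φ f hf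
    have hg' := M.res_mem V.2 ψ g hg
    rw [ev_apply_mul hX, (M.isSuperAlg _).tw_apply hf', smul_mul_assoc,
      (M.isSuperAlg _).comm hf' (ev_mem hX.1 hg'), sgn_smul_smul]
    congr 1
    exact sgn_smul_congr (by clear * -; decide +revert) _
  · simp only [ev_add, add_mul, hX, hY, smul_add]; abel

/-- The Leibniz rule for `f ↦ df` in the form that `Frame.exists_isDer` requires of the values on
functions. -/
theorem ofForm1_dFun_mul (f g : M.Sec U) : Forms.ofForm1 (M.dFun (f * g)) =
    Forms.ofForm1 (M.dFun f) * Forms.ofFun g +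
      Forms.ofFun ((M.isSuperAlg U).tw 1 f) * Forms.ofForm1 (M.dFun g) := by
  let L : M.Sec U →ₗ[k] M.Forms U := SuperSym.ofGen _ _ _ ∘ₗ dFunL U
  have hL : ∀ f, Forms.ofForm1 (M.dFun f) = L f := fun f => rfl
  simp only [hL]
  refine (M.isSuperAlg U).induction (C := fun f => L (f * g) = L f * Forms.ofFun g +
    Forms.ofFun ((M.isSuperAlg U).tw 1 f) * L g) (fun φ f hf => ?_)
    (fun f f' h h' => by simp only [add_mul, map_add, h, h']; abel) f
  refine (M.isSuperAlg U).induction (C := fun g => L (f * g) = L f * Forms.ofFun g +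
    Forms.ofFun ((M.isSuperAlg U).tw 1 f) * L g) (fun ψ g hg => ?_)
    (fun f f' h h' => by simp only [mul_add, map_add, h, h']; abel) g
  rw [← hL, dFun_mul hf hg, Forms.ofForm1_add, Forms.ofForm1_zsmul,
    ofForm1_formMul (dFun_mem hf), ofForm1_formMul (dFun_mem hg),
    SuperSym.ofGen_mul_ofFun hf (dFun_mem hg), (M.isSuperAlg U).tw_apply hf, Forms.ofFun_zsmul,
    smul_mul_assoc, sgn_smul_smul]
  congr 1
  exact sgn_smul_congr (by clear * -; decide +revert) _

end Superspace
end SuperGeom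
end

noncomputable section
set_option linter.unusedSectionVars false
set_option linter.unusedVariables false
namespace SuperGeom
namespace Superspace

variable {k : Type u} [Field k] [CharZero k] {M : Superspace k} {U : Opens M.X} {p q : ℕ}
  (x : M.Coords p q U)

theorem Poly.isSuperAlg (x : M.Coords p q U) :
    IsSuperAlg (SuperSym.par (M.par U) (M.piPar U) (M.VecAct U)) := x.polyFrame.isSuperAlg

theorem Poly.ofFun_mul (f g : M.Sec U) :
    Poly.ofFun (f * g) = Poly.ofFun f * Poly.ofFun g := SuperSym.ofFun_mul f g

/-- The subspaces of forms of given parity. -/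
abbrev formsPar (U : Opens M.X) : ZMod 2 → Submodule k (M.Forms U) :=
  SuperSym.par (M.par U) (M.formPar U) (M.FormAct U)

/-- The subspaces of polyfields of given parity. -/
abbrev polyPar (U : Opens M.X) : ZMod 2 → Submodule k (M.Poly U) :=
  SuperSym.par (M.par U) (M.piPar U) (M.VecAct U)

theorem Coords.dx_mem (a : Fin p ⊕ Fin q) : x.dx a ∈ formsPar U (idxPar a + 1) :=
  x.formFrame.gen_mem a

/-- The polyfield `π ∂_a`. -/
abbrev Coords.pd (a : Fin p ⊕ Fin q) : M.Poly U := Poly.pi (x.ptl a)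

/-! ### The exterior derivative -/

theorem IsExteriorDerivative.isDer {d : M.Forms U →ₗ[k] M.Forms U} (hd : M.IsExteriorDerivative d) :
    IsDer (formsPar U) 1 d := fun η s hs t => by
  rw [one_mul]; exact hd.d_mul η s t hs

theorem IsExteriorDerivative.d_dx {d : M.Forms U →ₗ[k] M.Forms U} (hd : M.IsExteriorDerivative d)
    (a : Fin p ⊕ Fin q) : d (x.dx a) = 0 := by
  rw [Coords.dx, ← hd.d_fun, hd.d_d]

theorem IsExteriorDerivative.eq (x : M.Coords p q U) {d d' : M.Forms U →ₗ[k] M.Forms U}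
    (hd : M.IsExteriorDerivative d) (hd' : M.IsExteriorDerivative d') : d = d' :=
  x.formFrame.isDer_ext hd.isDer hd'.isDer (fun f => (hd.d_fun f).trans (hd'.d_fun f).symm)
    fun a => (hd.d_dx x a).trans (hd'.d_dx x a).symm

theorem IsExteriorDerivative.isHomog (x : M.Coords p q U) {d : M.Forms U →ₗ[k] M.Forms U}
    (hd : M.IsExteriorDerivative d) : IsHomog (formsPar U) 1 d :=
  x.formFrame.isHomog_of_isDer hd.isDer
    (fun η f hf => (hd.d_fun f).symm ▸ SuperSym.ofGen_mem (dFun_mem hf))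
    fun a => (hd.d_dx x a).symm ▸ zero_mem _

theorem IsExteriorDerivative.d_sum {d : M.Forms U →ₗ[k] M.Forms U}
    (hd : IsDer (formsPar U) 1 d) (h : ∀ a, d (x.dx a) = 0) (f : Fin p ⊕ Fin q → M.Forms U) :
    d (∑ a, x.dx a * f a) = ∑ a, sgn (idxPar a + 1) • (x.dx a * d (f a)) := by
  rw [map_sum]
  refine Finset.sum_congr rfl fun a _ => ?_
  rw [hd _ _ (x.dx_mem a), h, zero_mul, zero_add, one_mul]

/-- `d` is the odd superderivation with `f ↦ df` and `dx_a ↦ 0`. Twice its square is its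
supercommutator with itself, hence a superderivation. On a function `f` the square is a double sum
of `dx_a dx_b ∂_b ∂_a f`, which is antisymmetric because the parity of `dx_a` is shifted against
that of `∂_a`. -/
theorem Coords.exists_d (x : M.Coords p q U) : ∃ d, M.IsExteriorDerivative (U := U) d := by
  obtain ⟨d, hd, h0, h1, -⟩ := x.formFrame.exists_isDer (ε := 1)
    (D₀ := SuperSym.ofGen _ _ _ ∘ₗ dFunL U) (v := fun _ => 0)
    (fun η f hf => SuperSym.ofGen_mem (dFun_mem hf)) (fun f g => ofForm1_dFun_mul f g)
    (fun a => zero_mem _)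
  have hh : IsHomog (formsPar U) 1 d := x.formFrame.isHomog_of_isDer hd
    (fun η f hf => (h0 f).symm ▸ SuperSym.ofGen_mem (dFun_mem hf)) fun a => (h1 a).symm ▸ zero_mem _
  refine ⟨d, h0, fun ε ω η hω => ?_, fun ω => ?_⟩
  · have := hd ε ω hω η
    rwa [one_mul] at this
  have hdd : d * d - sgn (1 * 1) • (d * d) = 0 := by
    refine x.formFrame.isDer_ext (hd.supercomm hd hh hh) (isDer_zero _) (fun f => ?_) (fun a => ?_)
    · have : d (d (Forms.ofFun f)) = 0 := by
        refine (congrArg d ((h0 f).trans (ofForm1_dFun x f))).trans ?_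
        rw [IsExteriorDerivative.d_sum x hd h1]
        have h2 : ∀ a, sgn (idxPar a + 1) • (x.dx a * d (Forms.ofFun (M.ev (x.ptl a).1 f))) =
            ∑ b, sgn (idxPar a + 1) • (x.dx a * x.dx b *
              Forms.ofFun (M.ev (x.ptl b).1 (M.ev (x.ptl a).1 f))) := fun a => by
          refine (congrArg (fun t => sgn (idxPar a + 1) • (x.dx a * t))
            ((h0 _).trans (ofForm1_dFun x _))).trans ?_
          rw [Finset.mul_sum, Finset.smul_sum]
          exact Finset.sum_congr rfl fun b _ => by rw [mul_assoc]
        rw [Finset.sum_congr rfl fun a _ => h2 a]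
        refine sum_sum_eq_zero_of_antisymm (k := k) _ fun a b => ?_
        rw [x.ptl_ptl b a, SuperSym.comm (M.isSuperAlg U) (x.dx_mem a) (x.dx_mem b),
          Forms.ofFun_zsmul, mul_smul_comm, smul_mul_assoc, sgn_smul_smul, sgn_smul_smul]
        refine sgn_smul_add_sgn_smul ?_ _
        generalize idxPar a = y; generalize idxPar b = z; clear * -; decide +revert
      simp only [LinearMap.sub_apply, LinearMap.smul_apply, Module.End.mul_apply,
        LinearMap.zero_apply]
      rw [this]; simp
    · simp only [LinearMap.sub_apply, LinearMap.smul_apply, Module.End.mul_apply,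
        LinearMap.zero_apply]
      rw [h1]; simp
  rw [mul_one, sgn_one, neg_smul, one_smul, sub_neg_eq_add, ← two_smul k] at hdd
  exact LinearMap.congr_fun ((smul_eq_zero.1 hdd).resolve_left two_ne_zero) ω

/-! ### The pairing -/

section pairing

variable {c : M.Forms U →ₐ[k] Module.End k (M.Poly U)}

theorem IsPairing.isDer (hc : M.IsPairing c) {ε : ZMod 2} {α : M.Form1 U}
    (hα : α ∈ M.formPar U ε) : IsDer (polyPar U) ε (c (Forms.ofForm1 α)) := fun η s hs t =>
  hc.form_mul ε η α s t hα hs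

theorem IsPairing.dx_pd (hc : M.IsPairing c) (a b : Fin p ⊕ Fin q) :
    c (x.dx a) (x.pd b) = if a = b then sgn (idxPar a + 1) • 1 else 0 := by
  have hb : x.ptl b ∈ M.piPar U (idxPar b + 1) := x.polyFrame.e_mem b
  rw [Coords.dx, Coords.pd, hc.form_pi _ _ _ _ (dFun_mem (x.x_par a)) hb,
    dFun_ev, x.ptl_x]
  by_cases h : a = b
  · subst h
    rw [if_pos rfl, if_pos rfl, Poly.ofFun, SuperSym.ofFun_one]
    exact sgn_smul_congr (by generalize idxPar a = y; clear * -; decide +revert) _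
  · rw [if_neg h, if_neg (Ne.symm h), Poly.ofFun, map_zero, smul_zero]

/-- By multiplicativity and the expansion of `1`-forms only the contractions with the `dx_a` matter,
and these are superderivations with known values on functions and on the `π ∂_b`. -/
theorem IsPairing.eq (x : M.Coords p q U) {c' : M.Forms U →ₐ[k] Module.End k (M.Poly U)}
    (hc : M.IsPairing c) (hc' : M.IsPairing c') : c = c' := by
  have h0 : ∀ f, c (Forms.ofFun f) = c' (Forms.ofFun f) := fun f => LinearMap.ext fun τ => by
    rw [hc.fun_apply, hc'.fun_apply]
  refine SuperSym.hom_ext h0 fun α => ?_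
  rw [x.formFrame.ofGen_eq, map_sum, map_sum]
  refine Finset.sum_congr rfl fun a _ => ?_
  rw [map_mul, map_mul]
  refine congrArg₂ _ ?_ (h0 _)
  refine x.polyFrame.isDer_ext (hc.isDer (x.formFrame.e_mem a)) (hc'.isDer (x.formFrame.e_mem a))
    (fun f => (hc.form_fun _ _).trans (hc'.form_fun _ _).symm)
    fun b => (hc.dx_pd x a b).trans (hc'.dx_pd x a b).symm

theorem IsPairing.isHomog (x : M.Coords p q U) (hc : M.IsPairing c) {ε : ZMod 2} {ω : M.Forms U}
    (hω : ω ∈ formsPar U ε) : IsHomog (polyPar U) ε (c ω) := by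
  induction hω with
  | ofFun ε f hf =>
    intro η s hs
    rw [hc.fun_apply, add_comm]
    exact SuperSym.mul_mem (SuperSym.ofFun_mem hf) hs
  | ofGen ε α hα =>
    refine x.polyFrame.isHomog_of_isDer (hc.isDer hα) (fun η f hf => ?_) fun a => ?_
    · rw [hc.form_fun]; exact zero_mem _
    · rw [hc.form_pi _ _ _ _ hα (x.polyFrame.e_mem a)]
      refine sgn_smul_mem _ _ (SuperSym.ofFun_mem ?_)
      have := hα ⟨U, le_rfl⟩ _ (x.ptl a) (x.ptl_par a)
      rwa [show idxPar a + ε + 1 = idxPar a + 1 + ε by ring] at this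
  | mul ε η s t hs ht ihs iht => rw [map_mul, add_comm]; exact ihs.mul iht
  | add ε s t hs ht ihs iht => 
    intro η u hu
    rw [map_add]; exact add_mem (ihs η u hu) (iht η u hu)

end pairing

/-- Contraction with the forms `dx_a`. -/
theorem Coords.exists_contraction : ∃ ι : Fin p ⊕ Fin q → Module.End k (M.Poly U), ∀ a,
    IsDer (polyPar U) (idxPar a + 1) (ι a) ∧ (∀ f, ι a (Poly.ofFun f) = 0) ∧
    ∀ b, ι a (x.pd b) = if a = b then sgn (idxPar a + 1) • 1 else 0 := by
  refine Classical.skolem (p := fun a (D : Module.End k (M.Poly U)) =>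
    IsDer (polyPar U) (idxPar a + 1) D ∧ (∀ f, D (Poly.ofFun f) = 0) ∧
    ∀ b, D (x.pd b) = if a = b then sgn (idxPar a + 1) • 1 else 0).1 fun a => ?_
  obtain ⟨D, hD, h0, h1, -⟩ := x.polyFrame.exists_isDer (ε := idxPar a + 1) (D₀ := 0)
    (v := fun b => if a = b then sgn (idxPar a + 1) • 1 else 0) (fun η f hf => zero_mem _)
    (fun f g => by simp) (fun b => by
      split_ifs with h
      · subst h
        rw [CharTwo.add_self_eq_zero]
        exact sgn_smul_mem _ _ x.polyFrame.isSuperAlg.one_mem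
      · exact zero_mem _)
  exact ⟨D, hD, h0, h1⟩

/-- Contraction with `∑ dx_a α_a` has to be the sum of the operators "multiply by `α_a`, then apply
`ι_a`". To extend this to products of forms, contractions with `1`-forms must supercommute: the
supercommutator is a superderivation that kills functions, and it kills the `π ∂_b` because one
contraction already turns them into functions. -/
theorem Coords.exists_pairing (x : M.Coords p q U) : ∃ c, M.IsPairing (U := U) c := by
  obtain ⟨ι, hι⟩ := x.exists_contraction
  have hA := M.isSuperAlg U
  have hP := Poly.isSuperAlg x
  let m : M.Sec U →ₗ[k] Module.End k (M.Poly U) := LinearMap.mul k _ ∘ₗ SuperSym.ofFun _ _ _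
  have hm : ∀ f τ, m f τ = Poly.ofFun f * τ := fun f τ => rfl
  let e : M.Form1 U →ₗ[k] Module.End k (M.Poly U) :=
    ∑ a, LinearMap.mulLeft k (ι a) ∘ₗ m ∘ₗ x.formFrame.coef a
  have he : ∀ α, e α = ∑ a, ι a * m (x.formFrame.coef a α) := fun α => by simp [e]
  have htw : ∀ a f τ, ι a (Poly.ofFun (hA.tw (idxPar a + 1) f) * τ) = Poly.ofFun f * ι a τ := by
    intro a f τ
    rw [(hι a).1.apply_mul hP, (hι a).2.1, zero_mul, zero_add]
    exact congrArg (· * _) ((x.polyFrame.tw_ofFun _ _).trans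
      (congrArg (SuperSym.ofFun _ _ _) (hA.tw_self _ _)))
  have hh : ∀ a, IsHomog (polyPar U) (idxPar a + 1) (ι a) := fun a =>
    x.polyFrame.isHomog_of_isDer (hι a).1 (fun η f _ => (hι a).2.1 f ▸ zero_mem _) fun b => by
      rw [show ι a (x.polyFrame.gen b) = _ from (hι a).2.2 b]
      split_ifs with h
      · subst h
        rw [CharTwo.add_self_eq_zero]
        exact sgn_smul_mem _ _ x.polyFrame.isSuperAlg.one_mem
      · exact zero_mem _
  have e_der : ∀ ε, ∀ α ∈ M.formPar U ε, IsDer (polyPar U) ε (e α) := fun ε α hα => by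
    rw [he]
    refine IsDer.sum _ fun a => ?_
    have := (hι a).1.mul_mulLeft hP (SuperSym.ofFun_mem (x.formFrame.coef_mem a ε α hα))
      ((hι a).2.1 _)
    rwa [show idxPar a + 1 + (ε + (idxPar a + 1)) = ε by
      generalize idxPar a = y; clear * -; decide +revert] at this
  have e_homog : ∀ ε, ∀ α ∈ M.formPar U ε, IsHomog (polyPar U) ε (e α) := fun ε α hα => by
    rw [he]
    refine IsHomog.sum _ fun a _ => ?_
    have := (hh a).mul (isHomog_mulLeft hP (SuperSym.ofFun_mem (x.formFrame.coef_mem a ε α hα)))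
    rwa [show ε + (idxPar a + 1) + (idxPar a + 1) = ε by
      generalize idxPar a = y; clear * -; decide +revert] at this
  have e_fun : ∀ α f, e α (Poly.ofFun f) = 0 := fun α f => by
    rw [he, LinearMap.sum_apply]
    refine Finset.sum_eq_zero fun a _ => ?_
    rw [Module.End.mul_apply, hm]
    rw [← SuperSym.ofFun_mul]
    exact (hι a).2.1 _
  have e_pd : ∀ α f b, e α (Poly.ofFun f * x.pd b) = Poly.ofFun (sgn (idxPar b + 1) •
      hA.tw (idxPar b + 1) (x.formFrame.coef b α * f)) := fun α f b => by
    rw [he, LinearMap.sum_apply, Finset.sum_eq_single b]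
    · rw [Module.End.mul_apply, hm, ← mul_assoc, ← SuperSym.ofFun_mul,
        ← hA.tw_self (idxPar b + 1) (x.formFrame.coef b α * f)]
      refine (htw b _ _).trans ?_
      rw [(hι b).2.2, if_pos rfl, mul_smul_comm, mul_one, hA.tw_self, Poly.ofFun, Poly.ofFun,
        map_zsmul]
    · intro a _ hab
      rw [Module.End.mul_apply, hm, ← mul_assoc, ← SuperSym.ofFun_mul,
        ← hA.tw_self (idxPar a + 1) (x.formFrame.coef a α * f)]
      refine (htw a _ _).trans ?_
      rw [(hι a).2.2, if_neg hab, mul_zero]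
    · simp
  let c : M.Forms U →ₐ[k] Module.End k (M.Poly U) := SuperSym.lift m e
    (LinearMap.ext fun τ => by rw [hm, Poly.ofFun, SuperSym.ofFun_one, one_mul]; rfl)
    (fun f g => LinearMap.ext fun τ => by
      rw [Module.End.mul_apply, hm, hm, hm, Poly.ofFun, Poly.ofFun, Poly.ofFun, SuperSym.ofFun_mul,
        mul_assoc])
    (fun f α β h => by
      refine LinearMap.ext fun τ => ?_
      rw [Module.End.mul_apply, he, he, hm, LinearMap.sum_apply, LinearMap.sum_apply,
        Finset.mul_sum]
      refine Finset.sum_congr rfl fun a _ => ?_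
      rw [Module.End.mul_apply, Module.End.mul_apply, hm, hm, x.formFrame.coef_act f α β h,
        Poly.ofFun_mul, mul_assoc]
      exact (htw a _ _).symm)
    (fun ε η f hf α hα => by
      refine LinearMap.ext fun τ => ?_
      rw [Module.End.mul_apply, LinearMap.smul_apply, Module.End.mul_apply, hm, hm,
        e_der η α hα _ _ (SuperSym.ofFun_mem hf), e_fun, zero_mul, zero_add, mul_comm η])
    (fun ε η α hα β hβ => by
      rw [← sub_eq_zero]
      refine x.polyFrame.isDer_ext (IsDer.supercomm (e_der ε α hα) (e_der η β hβ)
        (e_homog ε α hα) (e_homog η β hβ)) (isDer_zero _) (fun f => ?_) fun b => ?_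
      · simp only [LinearMap.sub_apply, LinearMap.smul_apply, Module.End.mul_apply,
          LinearMap.zero_apply]
        refine (congrArg₂ (fun s t => s - sgn (ε * η) • t) ((congrArg _ (e_fun _ f)).trans
          (map_zero _)) ((congrArg _ (e_fun _ f)).trans (map_zero _))).trans (by simp)
      · simp only [LinearMap.sub_apply, LinearMap.smul_apply, Module.End.mul_apply,
          LinearMap.zero_apply]
        have h1 : ∀ α β, e α (e β (x.pd b)) = 0 := fun α β => by
          have := e_pd β 1 b
          rw [Poly.ofFun, SuperSym.ofFun_one, one_mul] at this
          rw [this, e_fun]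
        refine (congrArg₂ (fun s t => s - sgn (ε * η) • t) (h1 α β) (h1 β α)).trans (by simp))
  have c0 : ∀ f, c (Forms.ofFun f) = m f := fun f => SuperSym.lift_ofFun f
  have c1 : ∀ α, c (Forms.ofForm1 α) = e α := fun α => SuperSym.lift_ofGen α
  refine ⟨c, fun f τ => by rw [c0, hm], fun α f => by rw [c1, e_fun], ?_, ?_⟩
  · intro ε η α X hα hX
    rw [c1]
    conv_lhs => rw [Poly.pi, x.eq_sum_T X, map_sum]
    have hα' : α.ev X = ∑ a, M.ev X.1 (x.x a) * x.formFrame.coef a α := by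
      conv_lhs => rw [x.eq_sum_T X, Form1.ev, map_sum]
      exact Finset.sum_congr rfl fun a _ => α.app_smulT _ _ _
    rw [hα', map_sum, Poly.ofFun, map_sum, Finset.smul_sum]
    refine Finset.sum_congr rfl fun a _ => ?_
    rw [← SuperSym.ofFun_mul_ofGen (vecAct_smulT _ _)]
    refine (e_pd _ _ _).trans ?_
    have hX' := ev_mem (F := X.1) (Submodule.mem_comap.1 hX).1 (x.x_par a)
    have hα' := x.formFrame.coef_mem a ε α hα
    rw [hA.tw_apply (hA.mul_mem hα' hX'), hA.comm hα' hX', sgn_smul_smul, sgn_smul_smul,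
      Poly.ofFun, map_zsmul]
    exact sgn_smul_congr (by generalize idxPar a = y; clear * -; decide +revert) _
  · intro ε η α σ τ hα hσ
    rw [c1]
    exact e_der ε α hα η σ hσ τ

end Superspace
end SuperGeom
end

noncomputable section
set_option linter.unusedSectionVars false
set_option linter.unusedVariables false
namespace SuperGeom
namespace Superspace

variable {k : Type u} [Field k] [CharZero k] {M : Superspace k} {U : Opens M.X} {p q : ℕ}
  (x : M.Coords p q U)

/-! ### Lie derivatives -/

theorem Coords.ptl_fun_mul {S : Type*} [Ring S] [Algebra k S] (i : M.Sec U →ₗ[k] S)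
    (hi : ∀ f g, i (f * g) = i f * i g) (a : Fin p ⊕ Fin q) (f g : M.Sec U) :
    i (M.ev (x.ptl a).1 (f * g)) = i (M.ev (x.ptl a).1 f) * i g +
      i ((M.isSuperAlg U).tw (idxPar a) f) * i (M.ev (x.ptl a).1 g) := by
  rw [ev_apply_mul (x.ptl_par a), map_add, hi, hi]

/-- The action of a vector field on functions. -/
def vecL (X : M.T U) : M.Sec U →ₗ[k] M.Sec U := X.1.app ⟨U, le_rfl⟩

/-- The superderivation that is `∂_a` on functions and kills the `dx_b`. Its supercommutator with
`d` vanishes on functions because the `∂_a` supercommute, and on the `dx_b` because both operators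
kill them. -/
theorem Coords.exists_lieΩ {d : M.Forms U →ₗ[k] M.Forms U} (hd : M.IsExteriorDerivative d)
    (a : Fin p ⊕ Fin q) : ∃ L, M.IsLieForms d (x.ptl a) (idxPar a) L := by
  obtain ⟨L, hL, h0, h1, -⟩ := x.formFrame.exists_isDer (ε := idxPar a)
    (D₀ := SuperSym.ofFun _ _ _ ∘ₗ vecL (x.ptl a)) (v := fun _ => 0)
    (fun η f hf => SuperSym.ofFun_mem (x.ptl_mem a hf))
    (fun f g => x.ptl_fun_mul (SuperSym.ofFun _ _ _) SuperSym.ofFun_mul a f g)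
    (fun a => zero_mem _)
  have hh : IsHomog (formsPar U) (idxPar a) L := x.formFrame.isHomog_of_isDer hL
    (fun η f hf => (h0 f).symm ▸ SuperSym.ofFun_mem (x.ptl_mem a hf))
    fun a => (h1 a).symm ▸ zero_mem _
  have h0' : ∀ f, L (Forms.ofFun f) = Forms.ofFun (M.ev (x.ptl a).1 f) := h0
  have h1' : ∀ b, L (x.dx b) = 0 := h1
  refine ⟨L, h0, fun ε ω η hω => hL ε ω hω η, fun ω => ?_⟩
  have key : L * d - sgn (idxPar a * 1) • (d * L) = 0 := by
    refine x.formFrame.isDer_ext (hL.supercomm hd.isDer hh (hd.isHomog x)) (isDer_zero _)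
      (fun f => ?_) fun b => ?_
    · change L (d (Forms.ofFun f)) - sgn (idxPar a * 1) • d (L (Forms.ofFun f)) = 0
      rw [h0', hd.d_fun, hd.d_fun, ofForm1_dFun x, ofForm1_dFun x, map_sum, Finset.smul_sum,
        sub_eq_zero]
      refine Finset.sum_congr rfl fun b _ => ?_
      rw [hL _ _ (x.dx_mem b), h1', zero_mul, zero_add, h0', x.ptl_ptl a b, Forms.ofFun_zsmul,
        mul_smul_comm, sgn_smul_smul]
      exact sgn_smul_congr (by
        generalize idxPar a = y; generalize idxPar b = z; clear * -; decide +revert) _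
    · change L (d (x.dx b)) - sgn (idxPar a * 1) • d (L (x.dx b)) = 0
      rw [hd.d_dx, h1', map_zero, map_zero, smul_zero, sub_zero]
  have := LinearMap.congr_fun key ω
  rw [mul_one] at this
  exact sub_eq_zero.1 this

/-- Up to sign, `L dx_b` is the differential of the constant `∂_a x_b`. -/
theorem IsLieForms.dx {d : M.Forms U →ₗ[k] M.Forms U} (hd : M.IsExteriorDerivative d)
    {a : Fin p ⊕ Fin q} {L : Module.End k (M.Forms U)}
    (hL : M.IsLieForms d (x.ptl a) (idxPar a) L) (b : Fin p ⊕ Fin q) : L (x.dx b) = 0 := by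
  rw [Coords.dx, ← hd.d_fun, hL.lie_d, hL.lie_fun, x.ptl_x]
  have h1 : d (Forms.ofFun 1) = 0 := by
    rw [Forms.ofFun, SuperSym.ofFun_one, hd.isDer.apply_one x.formFrame.isSuperAlg]
  split_ifs
  · rw [h1, smul_zero]
  · rw [Forms.ofFun, map_zero, map_zero, smul_zero]

theorem IsLieForms.isDer {d : M.Forms U →ₗ[k] M.Forms U} {X : M.T U} {ξ : ZMod 2}
    {L : Module.End k (M.Forms U)} (hL : M.IsLieForms d X ξ L) : IsDer (formsPar U) ξ L :=
  fun ε ω hω η => hL.lie_mul ε ω η hω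

theorem IsLieForms.eq {d : M.Forms U →ₗ[k] M.Forms U} (hd : M.IsExteriorDerivative d)
    {a : Fin p ⊕ Fin q} {L L' : Module.End k (M.Forms U)}
    (hL : M.IsLieForms d (x.ptl a) (idxPar a) L) (hL' : M.IsLieForms d (x.ptl a) (idxPar a) L') :
    L = L' :=
  x.formFrame.isDer_ext hL.isDer hL'.isDer (fun f => (hL.lie_fun f).trans (hL'.lie_fun f).symm)
    fun b => (hL.dx x hd b).trans (hL'.dx x hd b).symm

theorem dx_contraction_isDer {c : M.Forms U →ₐ[k] Module.End k (M.Poly U)} (hc : M.IsPairing c)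
    (a : Fin p ⊕ Fin q) : IsDer (polyPar U) (idxPar a + 1) (c (x.dx a)) :=
  hc.isDer (x.formFrame.e_mem a)

theorem dx_contraction_deg {c : M.Forms U →ₐ[k] Module.End k (M.Poly U)} (hc : M.IsPairing c)
    (a : Fin p ⊕ Fin q) (n : ℕ) (τ : M.Poly U) (hτ : τ ∈ M.polyDeg U (n + 1)) :
    c (x.dx a) τ ∈ M.polyDeg U n := by
  refine x.polyFrame.deg_pred_of_isDer (dx_contraction_isDer x hc a) (hc.form_fun _) (fun b => ?_)
    n τ hτ
  rw [show c (x.dx a) (x.polyFrame.gen b) = _ from hc.dx_pd x a b]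
  split_ifs
  · rw [← SuperSym.ofFun_one, ← map_zsmul]; exact SuperSym.Frame.ofFun_mem_deg _
  · exact zero_mem _

theorem dx_contraction_zero {c : M.Forms U →ₐ[k] Module.End k (M.Poly U)} (hc : M.IsPairing c)
    (a : Fin p ⊕ Fin q) (τ : M.Poly U) (hτ : τ ∈ M.polyDeg U 0) : c (x.dx a) τ = 0 := by
  rw [polyDeg, SuperSym.deg, pow_zero, mul_one] at hτ
  obtain ⟨f, rfl⟩ := hτ
  exact hc.form_fun _ _

/-- A polyfield of positive degree whose contractions with all `dx_a` vanish is zero. -/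
theorem eq_zero_of_contraction {c : M.Forms U →ₐ[k] Module.End k (M.Poly U)} (hc : M.IsPairing c)
    {n : ℕ} (hn : n ≠ 0) {τ : M.Poly U} (hτ : τ ∈ M.polyDeg U n) (h : ∀ a, c (x.dx a) τ = 0) :
    τ = 0 :=
  x.polyFrame.eq_zero_of_forall_eq_zero (c := fun a => sgn (idxPar a + 1))
    (dx_contraction_isDer x hc) (fun a f => hc.form_fun _ _) (hc.dx_pd x)
    (fun a => sgn_mul_sgn _) hn hτ h

/-- The superderivation that is `∂_a` on functions and kills the `π ∂_b`. -/
theorem Coords.exists_lieDer (a : Fin p ⊕ Fin q) : ∃ L : Module.End k (M.Poly U),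
    IsDer (polyPar U) (idxPar a) L ∧ (∀ f, L (Poly.ofFun f) = Poly.ofFun (M.ev (x.ptl a).1 f)) ∧
    ∀ b, L (x.pd b) = 0 := by
  obtain ⟨L, hL, h0, h1, -⟩ := x.polyFrame.exists_isDer (ε := idxPar a)
    (D₀ := SuperSym.ofFun _ _ _ ∘ₗ vecL (x.ptl a)) (v := fun _ => 0)
    (fun η f hf => SuperSym.ofFun_mem (x.ptl_mem a hf))
    (fun f g => x.ptl_fun_mul (SuperSym.ofFun _ _ _) SuperSym.ofFun_mul a f g)
    (fun a => zero_mem _)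
  exact ⟨L, hL, h0, h1⟩

section lieDer

variable {a : Fin p ⊕ Fin q} {L : Module.End k (M.Poly U)} (hL : IsDer (polyPar U) (idxPar a) L)
  (h0 : ∀ f, L (Poly.ofFun f) = Poly.ofFun (M.ev (x.ptl a).1 f)) (h1 : ∀ b, L (x.pd b) = 0)

include hL h0 h1

theorem Coords.lieDer_isHomog : IsHomog (polyPar U) (idxPar a) L :=
  x.polyFrame.isHomog_of_isDer hL
    (fun η f hf => (h0 f).symm ▸ SuperSym.ofFun_mem (x.ptl_mem a hf))
    fun b => (h1 b).symm ▸ zero_mem _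

theorem Coords.lieDer_deg (n : ℕ) (τ : M.Poly U) (hτ : τ ∈ M.polyDeg U n) :
    L τ ∈ M.polyDeg U n :=
  x.polyFrame.deg_of_isDer hL (fun f => (h0 f).symm ▸ SuperSym.Frame.ofFun_mem_deg _)
    (fun b => (h1 b).symm ▸ zero_mem _) n τ hτ

/-- The formula is multiplicative in `ω`. For functions it is the Leibniz rule. For `ω = dx_b` it
says that `L` supercommutes with a contraction, and the supercommutator is a superderivation killing
all generators. The outcome holds in every degree, also for functions, where `IsLiePoly` asks for
nothing. -/
theorem Coords.lieDer_pair {d : M.Forms U →ₗ[k] M.Forms U} (hd : M.IsExteriorDerivative d)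
    {c : M.Forms U →ₐ[k] Module.End k (M.Poly U)} (hc : M.IsPairing c)
    {LΩ : Module.End k (M.Forms U)} (hLΩ : M.IsLieForms d (x.ptl a) (idxPar a) LΩ)
    (ω : M.Forms U) :
    L * c ω = c (LΩ ω) + c (x.formFrame.isSuperAlg.tw (idxPar a) ω) * L := by
  have hP := Poly.isSuperAlg x
  refine x.formFrame.induction (C := fun ω =>
    L * c ω = c (LΩ ω) + c (x.formFrame.isSuperAlg.tw (idxPar a) ω) * L) (fun f => ?_)
    (fun b => ?_) (fun ω ω' h h' => ?_) (fun ω ω' h h' => ?_) ω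
  · refine LinearMap.ext fun τ => ?_
    rw [x.formFrame.tw_ofFun]
    change L (c (Forms.ofFun f) τ) = c (LΩ (Forms.ofFun f)) τ + c (Forms.ofFun _) (L τ)
    rw [hLΩ.lie_fun, hc.fun_apply, hc.fun_apply, hc.fun_apply, hL.apply_mul hP, h0]
    exact congrArg (fun s => Poly.ofFun (M.ev (x.ptl a).1 f) * τ + s * L τ)
      (x.polyFrame.tw_ofFun _ _)
  · have key : L * c (x.dx b) - sgn (idxPar a * (idxPar b + 1)) • (c (x.dx b) * L) = 0 := by
      refine x.polyFrame.isDer_ext (hL.supercomm (dx_contraction_isDer x hc b)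
        (x.lieDer_isHomog hL h0 h1) (hc.isHomog x (x.dx_mem b))) (isDer_zero _) (fun f => ?_)
        fun e => ?_
      · change L (c (x.dx b) (Poly.ofFun f)) - sgn (idxPar a * (idxPar b + 1)) • c (x.dx b) (L (Poly.ofFun f)) = 0
        rw [h0, Coords.dx, hc.form_fun, hc.form_fun, map_zero, smul_zero, sub_zero]
      · change L (c (x.dx b) (x.pd e)) - sgn (idxPar a * (idxPar b + 1)) • c (x.dx b) (L (x.pd e)) = 0
        rw [h1, map_zero, smul_zero, sub_zero, hc.dx_pd x]
        split_ifs
        · rw [map_zsmul, hL.apply_one hP, smul_zero]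
        · exact map_zero _
    rw [sub_eq_zero] at key
    rw [x.formFrame.isSuperAlg.tw_apply (x.formFrame.gen_mem b)]
    change L * c (x.dx b) = c (LΩ (x.dx b)) + _
    rw [key, hLΩ.dx x hd, map_zero, zero_add, map_zsmul, smul_mul_assoc]
    rfl
  · rw [map_mul, ← mul_assoc, h, add_mul, mul_assoc, h', hLΩ.isDer.apply_mul x.formFrame.isSuperAlg,
      IsSuperAlg.tw_mul, map_add, map_mul, map_mul, map_mul, mul_add, add_assoc, mul_assoc]
  · simp only [map_add, mul_add, add_mul, h, h']; abel

theorem Coords.lieDer_isLiePoly {d : M.Forms U →ₗ[k] M.Forms U} (hd : M.IsExteriorDerivative d)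
    {c : M.Forms U →ₐ[k] Module.End k (M.Poly U)} (hc : M.IsPairing c)
    {LΩ : Module.End k (M.Forms U)} (hLΩ : M.IsLieForms d (x.ptl a) (idxPar a) LΩ) :
    M.IsLiePoly c (x.ptl a) (idxPar a) LΩ L where
  lie_fun := h0
  lie_deg := x.lieDer_deg hL h0 h1
  lie_pair n ε ω τ _ _ hω := by
    have := LinearMap.congr_fun (x.lieDer_pair hL h0 h1 hd hc hLΩ ω) τ
    rw [x.formFrame.isSuperAlg.tw_apply hω, map_zsmul, mul_comm (idxPar a)] at this
    exact this

end lieDer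

/-- Induction on the degree. Applied to `ω = dx_a`, the axiom `lie_pair` expresses the contractions
of `L τ` through `L` on polyfields of smaller degree. As `L` preserves degrees, contractions detect
the difference in positive degree. -/
theorem IsLiePoly.eq (x : M.Coords p q U) {c : M.Forms U →ₐ[k] Module.End k (M.Poly U)} (hc : M.IsPairing c)
    {LΩ : Module.End k (M.Forms U)} {X : M.T U} {ξ : ZMod 2} {L L' : Module.End k (M.Poly U)}
    (hL : M.IsLiePoly c X ξ LΩ L) (hL' : M.IsLiePoly c X ξ LΩ L') : L = L' := by
  have key : ∀ n, ∀ τ ∈ M.polyDeg U n, L τ = L' τ := by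
    intro n
    induction n with
    | zero =>
      intro τ hτ
      rw [polyDeg, SuperSym.deg, pow_zero, mul_one] at hτ
      obtain ⟨f, rfl⟩ := hτ
      exact (hL.lie_fun f).trans (hL'.lie_fun f).symm
    | succ n ih =>
      intro τ hτ
      rw [← sub_eq_zero]
      refine eq_zero_of_contraction x hc n.succ_ne_zero
        (sub_mem (hL.lie_deg _ τ hτ) (hL'.lie_deg _ τ hτ)) fun a => ?_
      have h := hL.lie_pair 1 _ (x.dx a) τ one_pos (SuperSym.Frame.ofGen_mem_deg _) (x.dx_mem a)
      have h' := hL'.lie_pair 1 _ (x.dx a) τ one_pos (SuperSym.Frame.ofGen_mem_deg _) (x.dx_mem a)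
      rw [ih _ (dx_contraction_deg x hc a n τ hτ), h'] at h
      rw [map_sub, sub_eq_zero, ← sgn_smul_self ((idxPar a + 1) * ξ) (c (x.dx a) (L τ)),
        ← add_left_cancel h, sgn_smul_self]
  refine LinearMap.ext fun τ => ?_
  have hτ : τ ∈ ⨆ n, M.polyDeg U n := by
    rw [show ⨆ n, M.polyDeg U n = ⊤ from x.polyFrame.iSup_deg]; trivial
  refine Submodule.iSup_induction _ (motive := fun τ => L τ = L' τ) hτ key (by simp)
    fun s t hs ht => by rw [map_add, map_add, hs, ht]

instance Calculus.subsingleton : Subsingleton (M.Calculus x) := ⟨fun C C' => by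
  have hd : C.d = C'.d := C.is_d.eq x C'.is_d
  have hc : C.pair = C'.pair := C.is_pair.eq x C'.is_pair
  have hL : C.lieΩ = C'.lieΩ := funext fun a =>
    (C.is_lieΩ a).eq x C.is_d (hd ▸ C'.is_lieΩ a)
  have hl : C.lie = C'.lie := funext fun a =>
    (C.is_lie a).eq x C.is_pair (hL ▸ hc ▸ C'.is_lie a)
  exact Calculus.ext hd hc hL hl⟩

/-- Records besides existence that the Lie derivatives of polyfields are superderivations killing
the `π ∂_b`, which their axioms do not state. By uniqueness this holds for every calculus. -/
theorem Coords.exists_calculus : ∃ C : M.Calculus x, ∀ a, IsDer (polyPar U) (idxPar a) (C.lie a) ∧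
    ∀ b, C.lie a (x.pd b) = 0 := by
  obtain ⟨d, hd⟩ := x.exists_d
  obtain ⟨c, hc⟩ := x.exists_pairing
  choose LΩ hLΩ using x.exists_lieΩ hd
  choose L hL h0 h1 using x.exists_lieDer
  exact ⟨⟨d, c, LΩ, L, hd, hc, hLΩ, fun a => x.lieDer_isLiePoly (hL a) (h0 a) (h1 a) hd hc (hLΩ a)⟩,
    fun a => ⟨hL a, h1 a⟩⟩

/-- The calculus over a coordinate open set. -/
def Coords.calculus : M.Calculus x := x.exists_calculus.choose

theorem Calculus.eq_calculus {x : M.Coords p q U} (C : M.Calculus x) : C = x.calculus :=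
  Subsingleton.elim _ _

end Superspace
end SuperGeom
end

noncomputable section
set_option linter.unusedSectionVars false
set_option linter.unusedVariables false
namespace SuperGeom
namespace Superspace

variable {k : Type u} [Field k] [CharZero k] {M : Superspace k} {U : Opens M.X} {p q : ℕ}

namespace Calculus

variable {x : M.Coords p q U} (C : M.Calculus x)

/-! ### The operator `e` on polyfields -/

theorem lie_isDer (a : Fin p ⊕ Fin q) : IsDer (polyPar U) (idxPar a) (C.lie a) := by
  rw [C.eq_calculus]; exact (x.exists_calculus.choose_spec a).1

theorem lie_pd (a b : Fin p ⊕ Fin q) : C.lie a (x.pd b) = 0 := by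
  rw [C.eq_calculus]; exact (x.exists_calculus.choose_spec a).2 b

theorem lie_isHomog (a : Fin p ⊕ Fin q) : IsHomog (polyPar U) (idxPar a) (C.lie a) :=
  x.lieDer_isHomog (C.lie_isDer a) (C.is_lie a).lie_fun (C.lie_pd a)

theorem lie_mul_pair (a : Fin p ⊕ Fin q) (ω : M.Forms U) : C.lie a * C.pair ω =
    C.pair (C.lieΩ a ω) + C.pair (x.formFrame.isSuperAlg.tw (idxPar a) ω) * C.lie a :=
  x.lieDer_pair (C.lie_isDer a) (C.is_lie a).lie_fun (C.lie_pd a) C.is_d C.is_pair (C.is_lieΩ a) ω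

theorem lie_mul_lie (a b : Fin p ⊕ Fin q) :
    C.lie a * C.lie b = sgn (idxPar a * idxPar b) • (C.lie b * C.lie a) := by
  rw [← sub_eq_zero]
  refine x.polyFrame.isDer_ext ((C.lie_isDer a).supercomm (C.lie_isDer b) (C.lie_isHomog a)
    (C.lie_isHomog b)) (isDer_zero _) (fun f => ?_) fun c => ?_
  · change C.lie a (C.lie b (Poly.ofFun f)) -
      sgn (idxPar a * idxPar b) • C.lie b (C.lie a (Poly.ofFun f)) = 0
    rw [(C.is_lie b).lie_fun, (C.is_lie a).lie_fun, (C.is_lie a).lie_fun, (C.is_lie b).lie_fun,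
      x.ptl_ptl a b, Poly.ofFun, map_zsmul, sub_self]
  · change C.lie a (C.lie b (x.pd c)) - sgn (idxPar a * idxPar b) • C.lie b (C.lie a (x.pd c)) = 0
    rw [C.lie_pd, C.lie_pd, map_zero, map_zero, smul_zero, sub_zero]

theorem pair_comm {ε η : ZMod 2} {ω ω' : M.Forms U} (h : ω ∈ formsPar U ε)
    (h' : ω' ∈ formsPar U η) : C.pair ω * C.pair ω' = sgn (ε * η) • (C.pair ω' * C.pair ω) := by
  rw [← map_mul, SuperSym.comm (M.isSuperAlg U) h h', map_zsmul, map_mul]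

/-- `e` as a linear operator. -/
def eEnd : Module.End k (M.Poly U) := ∑ a, C.pair (x.dx a) * C.lie a

theorem eEnd_apply (τ : M.Poly U) : C.eEnd τ = C.e τ := by
  rw [eEnd, LinearMap.sum_apply]; rfl

theorem e_deg (n : ℕ) (τ : M.Poly U) (hτ : τ ∈ M.polyDeg U (n + 1)) : C.e τ ∈ M.polyDeg U n :=
  sum_mem fun a _ => dx_contraction_deg x C.is_pair a n _ ((C.is_lie a).lie_deg _ τ hτ)

theorem e_deg_zero (τ : M.Poly U) (hτ : τ ∈ M.polyDeg U 0) : C.e τ = 0 :=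
  Finset.sum_eq_zero fun a _ => dx_contraction_zero x C.is_pair a _ ((C.is_lie a).lie_deg _ τ hτ)

theorem e_pd (b : Fin p ⊕ Fin q) : C.e (x.pd b) = 0 :=
  Finset.sum_eq_zero fun a _ => by rw [C.lie_pd, map_zero]

theorem dx_pair_fun_mul (a : Fin p ⊕ Fin q) (f : M.Sec U) (τ : M.Poly U) :
    C.pair (x.dx a) (Poly.ofFun f * τ) =
      Poly.ofFun ((M.isSuperAlg U).tw (idxPar a + 1) f) * C.pair (x.dx a) τ := by
  rw [(dx_contraction_isDer x C.is_pair a).apply_mul x.polyFrame.isSuperAlg, Coords.dx,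
    C.is_pair.form_fun, zero_mul, zero_add]
  exact congrArg (· * _) (x.polyFrame.tw_ofFun _ _)

/-- `𝔢_x` is a first-order operator: it fails to be linear over functions by the contraction with
`df = ∑ dx_a ∂_a f`. In `\hat δ` this defect cancels against the commutators of the `∂_a` with `f`.
-/
theorem e_fun_mul (f : M.Sec U) (τ : M.Poly U) : C.e (Poly.ofFun f * τ) =
    Poly.ofFun ((M.isSuperAlg U).tw 1 f) * C.e τ + C.pair (Forms.ofForm1 (M.dFun f)) τ := by
  rw [ofForm1_dFun x, map_sum, LinearMap.sum_apply, e, e, Finset.mul_sum, ← Finset.sum_add_distrib]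
  refine Finset.sum_congr rfl fun a _ => ?_
  rw [(C.lie_isDer a).apply_mul x.polyFrame.isSuperAlg, (C.is_lie a).lie_fun, map_add,
    ← C.is_pair.fun_apply, add_comm, map_mul C.pair, Module.End.mul_apply]
  refine congrArg (· + _) ?_
  rw [show x.polyFrame.isSuperAlg.tw (idxPar a) (Poly.ofFun f) =
    Poly.ofFun ((M.isSuperAlg U).tw (idxPar a) f) from x.polyFrame.tw_ofFun _ _,
    C.dx_pair_fun_mul, IsSuperAlg.tw_tw,
    show idxPar a + 1 + idxPar a = 1 by generalize idxPar a = y; clear * -; decide +revert]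

/-- Moving the Lie derivatives past the contraction leaves a contraction with `∑ dx_a L_{∂_a}(df)`,
and this form is `-d(df) = 0`. -/
theorem e_mul_pair {φ : ZMod 2} {f : M.Sec U} (hf : f ∈ M.par U φ) :
    C.eEnd * C.pair (Forms.ofForm1 (M.dFun f)) =
      sgn (φ + 1) • (C.pair (Forms.ofForm1 (M.dFun f)) * C.eEnd) := by
  have hdf : Forms.ofForm1 (M.dFun f) ∈ formsPar U (φ + 1) := SuperSym.ofGen_mem (dFun_mem hf)
  have h1 : ∑ a, x.dx a * C.lieΩ a (Forms.ofForm1 (M.dFun f)) = 0 := by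
    have h2 := C.is_d.d_d (Forms.ofFun f)
    rw [C.is_d.d_fun, ofForm1_dFun x, IsExteriorDerivative.d_sum x C.is_d.isDer (C.is_d.d_dx x)]
      at h2
    rw [← neg_eq_zero, ← Finset.sum_neg_distrib, ← h2]
    refine Finset.sum_congr rfl fun a _ => ?_
    rw [← C.is_d.d_fun, (C.is_lieΩ a).lie_d, (C.is_lieΩ a).lie_fun, mul_smul_comm, ← neg_smul]
    congr 1
    generalize idxPar a = y; clear * -; decide +revert
  have h3 : C.eEnd * C.pair (Forms.ofForm1 (M.dFun f)) =
      C.pair (∑ a, x.dx a * C.lieΩ a (Forms.ofForm1 (M.dFun f))) +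
      sgn (φ + 1) • (C.pair (Forms.ofForm1 (M.dFun f)) * C.eEnd) := by
    rw [eEnd, Finset.sum_mul, map_sum, Finset.mul_sum, Finset.smul_sum, ← Finset.sum_add_distrib]
    refine Finset.sum_congr rfl fun a _ => ?_
    rw [mul_assoc, C.lie_mul_pair, mul_add, map_mul, x.formFrame.isSuperAlg.tw_apply hdf, map_zsmul,
      smul_mul_assoc, mul_smul_comm, ← mul_assoc (C.pair (x.dx a)), C.pair_comm (x.dx_mem a) hdf,
      smul_mul_assoc, sgn_smul_smul, mul_assoc]
    congr 1
    exact sgn_smul_congr (by generalize idxPar a = y; clear * -; decide +revert) _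
  rw [h3, h1, map_zero, zero_add]

theorem e_mul_dx (a : Fin p ⊕ Fin q) :
    C.eEnd * C.pair (x.dx a) = sgn (idxPar a + 1) • (C.pair (x.dx a) * C.eEnd) :=
  C.e_mul_pair (x.x_par a)

/-- The Lie derivatives kill the `dx_b` and so pass the contractions up to sign. In the resulting
double sum the contractions and the Lie derivatives supercommute with parities that differ by one,
which makes it antisymmetric. -/
theorem e_mul_e : C.eEnd * C.eEnd = 0 := by
  have : C.eEnd * C.eEnd = ∑ a, ∑ b, sgn (idxPar a * (idxPar b + 1)) •
      (C.pair (x.dx a) * C.pair (x.dx b) * (C.lie a * C.lie b)) := by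
    rw [eEnd, Finset.sum_mul]
    refine Finset.sum_congr rfl fun a _ => ?_
    rw [Finset.mul_sum]
    refine Finset.sum_congr rfl fun b _ => ?_
    have h := C.lie_mul_pair a (x.dx b)
    rw [(C.is_lieΩ a).dx x C.is_d, map_zero, zero_add,
      x.formFrame.isSuperAlg.tw_apply (x.dx_mem b), map_zsmul, smul_mul_assoc] at h
    rw [mul_assoc, ← mul_assoc (C.lie a), h, smul_mul_assoc, mul_smul_comm, mul_assoc, mul_assoc]
  rw [this]
  refine sum_sum_eq_zero_of_antisymm (k := k) _ fun a b => ?_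
  rw [C.pair_comm (x.dx_mem a) (x.dx_mem b), C.lie_mul_lie a b, smul_mul_smul_comm, ← sgn_add,
    sgn_smul_smul]
  refine sgn_smul_add_sgn_smul ?_ _
  generalize idxPar a = y; generalize idxPar b = z; clear * -; decide +revert

end Calculus

/-! ### Change of coordinates -/

section change

variable {x y : M.Coords p q U} (C : M.Calculus x) (C' : M.Calculus y)

theorem Calculus.d_eq : C.d = C'.d := C.is_d.eq x C'.is_d
theorem Calculus.pair_eq : C.pair = C'.pair := C.is_pair.eq x C'.is_pair

variable (x y) in
/-- The Jacobian `∂y_b / ∂x_a`. -/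
def jac (a b : Fin p ⊕ Fin q) : M.Sec U := M.ev (x.ptl a).1 (y.x b)

theorem jac_mem (a b : Fin p ⊕ Fin q) : jac x y a b ∈ M.par U (idxPar b + idxPar a) :=
  x.ptl_mem a (y.x_par b)

variable (x y) in
/-- The coefficients of the difference of the operators `e` of two coordinate systems. -/
def jacDiv (a : Fin p ⊕ Fin q) : M.Sec U :=
  ∑ b, sgn ((idxPar a + idxPar b) * (idxPar a + 1)) • M.ev (y.ptl b).1 (jac x y a b)

theorem jacDiv_mem (a : Fin p ⊕ Fin q) : jacDiv x y a ∈ M.par U (idxPar a) := by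
  refine sum_mem fun b _ => sgn_smul_mem _ _ ?_
  have := y.ptl_mem b (jac_mem (x := x) (y := y) a b)
  rwa [show idxPar b + idxPar a + idxPar b = idxPar a by
    generalize idxPar a = y; generalize idxPar b = z; clear * -; decide +revert] at this

theorem ptl_eq_sum_jac (a : Fin p ⊕ Fin q) : x.ptl a = ∑ b, smulT (jac x y a b) (y.ptl b) :=
  y.eq_sum_T (x.ptl a)

theorem pd_eq_sum_jac (a : Fin p ⊕ Fin q) :
    x.pd a = ∑ b, Poly.ofFun (jac x y a b) * y.pd b := by
  conv_lhs => rw [Coords.pd, ptl_eq_sum_jac (y := y) a, Poly.pi, map_sum]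
  exact Finset.sum_congr rfl fun b _ => (SuperSym.ofFun_mul_ofGen (vecAct_smulT _ _)).symm

theorem dx_eq_sum_jac (b : Fin p ⊕ Fin q) : y.dx b = ∑ a, x.dx a * Forms.ofFun (jac x y a b) :=
  ofForm1_dFun x (y.x b)

/-- Expand `π ∂/∂x_c` in the fields `π ∂/∂y_b`, which the operator of the coordinates `y` kills.
Only the contraction with the differential of the Jacobian survives. -/
theorem Calculus.e_pd_change (c : Fin p ⊕ Fin q) :
    C'.e (x.pd c) = sgn (idxPar c + 1) • Poly.ofFun (jacDiv x y c) := by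
  rw [pd_eq_sum_jac (y := y), ← C'.eEnd_apply, map_sum, jacDiv, Poly.ofFun, map_sum,
    Finset.smul_sum]
  refine Finset.sum_congr rfl fun b _ => ?_
  have hb : y.ptl b ∈ M.piPar U (idxPar b + 1) := y.polyFrame.e_mem b
  rw [C'.eEnd_apply, C'.e_fun_mul, C'.e_pd, mul_zero, zero_add,
    C'.is_pair.form_pi _ _ _ _ (dFun_mem (jac_mem c b)) hb, dFun_ev, map_zsmul, sgn_smul_smul]
  exact sgn_smul_congr (by
    generalize idxPar c = y; generalize idxPar b = z; clear * -; decide +revert) _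

/-- The difference of the operators `e` of two coordinate systems. -/
def Calculus.eDiff : Module.End k (M.Poly U) :=
  C'.eEnd - C.eEnd - ∑ a, LinearMap.mulLeft k (Poly.ofFun (jacDiv x y a)) * C.pair (x.dx a)

theorem Calculus.eDiff_apply (τ : M.Poly U) : C.eDiff C' τ =
    C'.e τ - C.e τ - ∑ a, Poly.ofFun (jacDiv x y a) * C.pair (x.dx a) τ := by
  simp only [eDiff, LinearMap.sub_apply, LinearMap.sum_apply, eEnd_apply, Module.End.mul_apply,
    LinearMap.mulLeft_apply]

theorem Calculus.eDiff_mul_dx (c : Fin p ⊕ Fin q) : C.eDiff C' * C.pair (x.dx c) =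
    sgn (idxPar c + 1) • (C.pair (x.dx c) * C.eDiff C') := by
  have h := C'.e_mul_pair (x.x_par c)
  rw [← C.pair_eq C'] at h
  rw [eDiff, sub_mul, sub_mul, C.e_mul_dx, Finset.sum_mul, mul_sub, mul_sub, smul_sub, smul_sub,
    Finset.mul_sum, Finset.smul_sum]
  refine congrArg₂ _ (congrArg₂ _ h rfl) (Finset.sum_congr rfl fun a _ => ?_)
  have h2 : C.pair (x.dx c) * LinearMap.mulLeft k (Poly.ofFun (jacDiv x y a)) =
      sgn ((idxPar c + 1) * idxPar a) • (LinearMap.mulLeft k (Poly.ofFun (jacDiv x y a)) *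
        C.pair (x.dx c)) := LinearMap.ext fun τ => by
    change C.pair (x.dx c) (Poly.ofFun _ * τ) =
      sgn ((idxPar c + 1) * idxPar a) • (Poly.ofFun _ * C.pair (x.dx c) τ)
    rw [C.dx_pair_fun_mul, (M.isSuperAlg U).tw_apply (jacDiv_mem a), Poly.ofFun, map_zsmul,
      smul_mul_assoc]
  rw [← mul_assoc, h2, mul_assoc, C.pair_comm (x.dx_mem a) (x.dx_mem c), mul_smul_comm,
    smul_mul_assoc, sgn_smul_smul, mul_assoc]
  exact sgn_smul_congr (by
    generalize idxPar c = y; generalize idxPar a = z; clear * -; decide +revert) _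

theorem Calculus.eDiff_fun_mul (f : M.Sec U) (τ : M.Poly U) : C.eDiff C' (Poly.ofFun f * τ) =
    Poly.ofFun ((M.isSuperAlg U).tw 1 f) * C.eDiff C' τ := by
  rw [eDiff_apply, eDiff_apply, C.e_fun_mul, C'.e_fun_mul, ← C.pair_eq C', add_sub_add_right_eq_sub,
    mul_sub, mul_sub, Finset.mul_sum]
  congr 1
  refine Finset.sum_congr rfl fun a _ => ?_
  rw [C.dx_pair_fun_mul, ← mul_assoc, ← mul_assoc, ← Poly.ofFun_mul, ← Poly.ofFun_mul,
    (M.isSuperAlg U).mul_eq_tw_mul (jacDiv_mem a), IsSuperAlg.tw_tw,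
    show idxPar a + (idxPar a + 1) = 1 by generalize idxPar a = y; clear * -; decide +revert]

/-- The difference is linear over functions up to sign and supercommutes with the contractions by
`dx_c`. It vanishes on functions for reasons of degree and on the `π ∂_c` by the choice of `jacDiv`,
hence in degree `1`. In higher degree the contractions of its values vanish by induction, and so do
the values. -/
theorem Calculus.eDiff_eq_zero : C.eDiff C' = 0 := by
  have h0 : ∀ τ ∈ M.polyDeg U 0, C.eDiff C' τ = 0 := fun τ hτ => by
    rw [eDiff_apply, C.e_deg_zero τ hτ, C'.e_deg_zero τ hτ, sub_zero, zero_sub, neg_eq_zero]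
    exact Finset.sum_eq_zero fun a _ => by
      rw [dx_contraction_zero x C.is_pair a τ hτ, mul_zero]
  have hpd : ∀ c, C.eDiff C' (x.pd c) = 0 := fun c => by
    rw [eDiff_apply, C.e_pd, C'.e_pd_change, sub_zero, Finset.sum_eq_single c]
    · rw [C.is_pair.dx_pd, if_pos rfl, mul_smul_comm, mul_one, sub_self]
    · intro a _ hac
      rw [C.is_pair.dx_pd, if_neg hac, mul_zero]
    · simp
  have h1 : ∀ n, ∀ τ ∈ M.polyDeg U n, n = 1 → C.eDiff C' τ = 0 := by
    refine x.polyFrame.deg_induction (C := fun n τ => n = 1 → C.eDiff C' τ = 0) (by simp)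
      (fun n _ => map_zero _) (fun n s a hs _ hn => ?_)
      (fun n s t hs ht hn => by rw [map_add, hs hn, ht hn, add_zero])
    obtain rfl : n = 0 := by omega
    rw [SuperSym.deg, pow_zero, mul_one] at hs
    obtain ⟨f, rfl⟩ := hs
    rw [← (M.isSuperAlg U).tw_self (idxPar a + 1) f]
    rw [show _ = Poly.ofFun ((M.isSuperAlg U).tw (idxPar a + 1) f) * x.pd a from
      x.polyFrame.gen_mul_tw a _, C.eDiff_fun_mul, hpd, mul_zero]
  have key : ∀ n, ∀ τ ∈ M.polyDeg U n, C.eDiff C' τ = 0 := by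
    intro n
    induction n with
    | zero => exact h0
    | succ n ih =>
      intro τ hτ
      -- On polyfields of degree `1` the values are functions, which contractions do not detect;
      -- this case is `h1`.
      rcases Nat.eq_zero_or_pos n with rfl | hn
      · exact h1 1 τ hτ rfl
      · refine eq_zero_of_contraction x C.is_pair hn.ne' (n := n) ?_ fun c => ?_
        · rw [eDiff_apply]
          refine sub_mem (sub_mem (C'.e_deg n τ hτ) (C.e_deg n τ hτ)) (sum_mem fun a _ => ?_)
          have := x.polyFrame.mul_mem_deg (SuperSym.Frame.ofFun_mem_deg (jacDiv x y a))
            (dx_contraction_deg x C.is_pair a n τ hτ)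
          rwa [zero_add] at this
        · have := LinearMap.congr_fun (C.eDiff_mul_dx C' c) τ
          rw [Module.End.mul_apply, ih _ (dx_contraction_deg x C.is_pair c n τ hτ)] at this
          exact (sgn_smul_self _ _).symm.trans ((congrArg _ this.symm).trans (smul_zero _))
  refine LinearMap.ext fun τ => ?_
  have hτ : τ ∈ ⨆ n, M.polyDeg U n := by
    rw [show ⨆ n, M.polyDeg U n = ⊤ from x.polyFrame.iSup_deg]; trivial
  refine Submodule.iSup_induction _ (motive := fun τ => C.eDiff C' τ = 0) hτ key (by simp)
    fun s t hs ht => by rw [map_add, hs, ht, add_zero]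

/-- The dependence of `𝔢_x` on the coordinates: contractions with divergences of the rows of the
Jacobian as coefficients. `hatDelta_change` shows that the other part of `\hat δ` compensates for
it. -/
theorem Calculus.e_change (τ : M.Poly U) :
    C'.e τ = C.e τ + ∑ a, Poly.ofFun (jacDiv x y a) * C.pair (x.dx a) τ := by
  have := LinearMap.congr_fun (C.eDiff_eq_zero C') τ
  rw [eDiff_apply, LinearMap.zero_apply, sub_sub, sub_eq_zero] at this
  exact this

end change

/-! ### Restriction of the calculus -/

section restriction

variable {x : M.Coords p q U} (C : M.Calculus x) {V : Opens M.X} (h : V ≤ U)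
  (C' : M.Calculus (x.restrict h))

theorem resForms_mem (ε : ZMod 2) (ω : M.Forms U) (hω : ω ∈ formsPar U ε) :
    M.resForms h ω ∈ formsPar V ε := SuperSym.map_mem_par _ _ _ _ _ ε ω hω

theorem resPoly_mem (ε : ZMod 2) (τ : M.Poly U) (hτ : τ ∈ polyPar U ε) :
    M.resPoly h τ ∈ polyPar V ε := SuperSym.map_mem_par _ _ _ _ _ ε τ hτ

theorem resForm_dFun (f : M.Sec U) : M.resForm h (M.dFun f) = M.dFun (M.res h f) :=
  Form1.ext fun W X => by rw [dFun_app, res_res]; rfl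

theorem resForms_dx (a : Fin p ⊕ Fin q) : M.resForms h (x.dx a) = (x.restrict h).dx a := by
  rw [Coords.dx, resForms_ofForm1, resForm_dFun]; rfl

theorem resPoly_pd (a : Fin p ⊕ Fin q) : M.resPoly h (x.pd a) = (x.restrict h).pd a :=
  M.resPoly_pi h _

theorem Calculus.resForms_d (ω : M.Forms U) : M.resForms h (C.d ω) = C'.d (M.resForms h ω) := by
  refine x.formFrame.intertwine (x.restrict h).formFrame.isSuperAlg (M.resForms h)
    (resForms_mem h) C.is_d.isDer C'.is_d.isDer (fun f => ?_) (fun a => ?_) ω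
  · rw [show C.d (SuperSym.ofFun _ _ _ f) = _ from C.is_d.d_fun f, resForms_ofForm1,
      resForms_ofFun, C'.is_d.d_fun, resForm_dFun]
  · rw [show C.d (x.formFrame.gen a) = _ from C.is_d.d_dx x a, map_zero,
      show M.resForms h (x.formFrame.gen a) = _ from resForms_dx h a, C'.is_d.d_dx]

theorem Calculus.resPoly_pair (ω : M.Forms U) (τ : M.Poly U) :
    M.resPoly h (C.pair ω τ) = C'.pair (M.resForms h ω) (M.resPoly h τ) := by
  revert τ
  refine x.formFrame.induction (C := fun ω => ∀ τ, M.resPoly h (C.pair ω τ) =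
    C'.pair (M.resForms h ω) (M.resPoly h τ)) (fun f τ => ?_) (fun a τ => ?_)
    (fun ω ω' hω hω' τ => ?_) (fun ω ω' hω hω' τ => ?_) ω
  · rw [resForms_ofFun, C'.is_pair.fun_apply, C.is_pair.fun_apply, map_mul, resPoly_ofFun]
  · have hdx := resForms_dx (x := x) h a
    rw [show M.resForms h (x.formFrame.gen a) = _ from hdx]
    refine x.polyFrame.intertwine (x.restrict h).polyFrame.isSuperAlg (M.resPoly h)
      (resPoly_mem h) (dx_contraction_isDer x C.is_pair a)
      (dx_contraction_isDer _ C'.is_pair a) (fun f => ?_) (fun b => ?_) τ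
    · rw [resPoly_ofFun]
      exact (congrArg _ (C.is_pair.form_fun _ f)).trans ((map_zero _).trans
        (C'.is_pair.form_fun _ _).symm)
    · rw [show M.resPoly h (x.polyFrame.gen b) = _ from resPoly_pd h b, C'.is_pair.dx_pd,
        show C.pair (x.dx a) (x.polyFrame.gen b) = _ from C.is_pair.dx_pd x a b]
      split_ifs
      · rw [map_zsmul, map_one]
      · exact map_zero _
  · rw [map_mul, map_mul, map_mul, Module.End.mul_apply, Module.End.mul_apply, hω, hω']
  · rw [map_add, map_add, map_add, LinearMap.add_apply, LinearMap.add_apply, map_add, hω, hω']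

theorem Calculus.resPoly_lie (a : Fin p ⊕ Fin q) (τ : M.Poly U) :
    M.resPoly h (C.lie a τ) = C'.lie a (M.resPoly h τ) := by
  refine x.polyFrame.intertwine (x.restrict h).polyFrame.isSuperAlg (M.resPoly h)
    (resPoly_mem h) (C.lie_isDer a) (C'.lie_isDer a) (fun f => ?_) (fun b => ?_) τ
  · rw [show C.lie a (SuperSym.ofFun _ _ _ f) = _ from (C.is_lie a).lie_fun f, resPoly_ofFun,
      resPoly_ofFun, (C'.is_lie a).lie_fun, res_ev]
    rfl
  · rw [show C.lie a (x.polyFrame.gen b) = _ from C.lie_pd a b, map_zero,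
      show M.resPoly h (x.polyFrame.gen b) = _ from resPoly_pd h b, C'.lie_pd]

theorem Calculus.resPoly_e (τ : M.Poly U) : M.resPoly h (C.e τ) = C'.e (M.resPoly h τ) := by
  rw [e, e, map_sum]
  refine Finset.sum_congr rfl fun a _ => ?_
  rw [C.resPoly_pair h C', C.resPoly_lie h C', resForms_dx]

end restriction

end Superspace
end SuperGeom
end

noncomputable section
set_option linter.unusedSectionVars false
set_option linter.unusedVariables false
namespace SuperGeom
namespace Superspace

variable {k : Type u} [Field k] {M : Superspace k} {U : Opens M.X} {p q : ℕ}

/-! ### The parity involution of differential operators -/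

/-- Conjugation by the parity involution of functions. -/
def twEnd (U : Opens M.X) : M.EndO U →ₐ[k] M.EndO U where
  toFun F := ⟨fun V => (M.isSuperAlg V.1).tw 1 ∘ₗ F.app V ∘ₗ (M.isSuperAlg V.1).tw 1,
    fun V W h f => by
      simp only [LinearMap.comp_apply]
      rw [res_tw, F.res_app V W h, res_tw]⟩
  map_one' := EndO.ext fun V f => (M.isSuperAlg V.1).tw_self 1 f
  map_mul' F G := EndO.ext fun V f => by
    change (M.isSuperAlg V.1).tw 1 (F.app V (G.app V ((M.isSuperAlg V.1).tw 1 f))) =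
      (M.isSuperAlg V.1).tw 1 (F.app V ((M.isSuperAlg V.1).tw 1
        ((M.isSuperAlg V.1).tw 1 (G.app V ((M.isSuperAlg V.1).tw 1 f)))))
    rw [IsSuperAlg.tw_self]
  map_zero' := EndO.ext fun V f => map_zero ((M.isSuperAlg V.1).tw 1)
  map_add' F G := EndO.ext fun V f => map_add ((M.isSuperAlg V.1).tw 1)
    (F.app V ((M.isSuperAlg V.1).tw 1 f)) (G.app V ((M.isSuperAlg V.1).tw 1 f))
  commutes' c := EndO.ext fun V f => by
    change (M.isSuperAlg V.1).tw 1 (c • (M.isSuperAlg V.1).tw 1 f) = c • f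
    rw [map_smul, IsSuperAlg.tw_self]

theorem twEnd_app (F : M.EndO U) (V : {V : Opens M.X // V ≤ U}) (f : M.Sec V) :
    (twEnd U F).app V f = (M.isSuperAlg V.1).tw 1 (F.app V ((M.isSuperAlg V.1).tw 1 f)) := rfl

theorem EndO.zsmul_app (n : ℤ) (F : M.EndO U) (V : {V : Opens M.X // V ≤ U}) (f : M.Sec V) :
    (n • F).app V f = n • F.app V f := by
  let L : M.EndO U →+ M.Sec V :=
    { toFun := fun F => F.app V f, map_zero' := rfl, map_add' := fun _ _ => rfl }
  exact map_zsmul L n F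

/-- Makes the sign `(-1)^{|F|}` in `\hat δ` a linear operator that is defined for all `F`. -/
theorem twEnd_apply {φ : ZMod 2} {F : M.EndO U} (hF : M.EndPar U φ F) :
    twEnd U F = sgn φ • F := by
  refine EndO.ext fun V f => ?_
  rw [twEnd_app, EndO.zsmul_app]
  refine (M.isSuperAlg V.1).induction (C := fun f => (M.isSuperAlg V.1).tw 1 (F.app V
    ((M.isSuperAlg V.1).tw 1 f)) = sgn φ • F.app V f) (fun η f hf => ?_) (fun f g hf hg => ?_) f
  · rw [(M.isSuperAlg V.1).tw_apply hf, map_zsmul, map_zsmul,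
      (M.isSuperAlg V.1).tw_apply (hF V η f hf), sgn_smul_smul]
    exact sgn_smul_congr (by clear * -; decide +revert) _
  · rw [map_add, map_add, map_add, map_add, smul_add, hf, hg]

/-- On homogeneous `f`, the component of `F f` of the wrong parity gets the opposite sign from the
involution, so twice this component is zero. -/
theorem endPar_of_twEnd [CharZero k] {φ : ZMod 2} {F : M.EndO U} (hF : twEnd U F = sgn φ • F) :
    M.EndPar U φ F := by
  intro V η f hf
  have hA := M.isSuperAlg V.1
  have h1 : hA.tw 1 (F.app V f) = sgn (η + φ) • F.app V f := by
    have := congrArg (fun G : M.EndO U => G.app V (hA.tw 1 f)) hF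
    rw [twEnd_app, IsSuperAlg.tw_self, EndO.zsmul_app, hA.tw_apply hf, one_mul, map_zsmul,
      sgn_smul_smul] at this
    rw [this]
    exact sgn_smul_congr (by clear * -; decide +revert) _
  obtain ⟨g, hg, g', hg', h⟩ := Submodule.mem_sup.1
    (show F.app V f ∈ M.par V.1 (η + φ) ⊔ M.par V.1 (η + φ + 1) by
      have := (M.isCompl V.1).sup_eq_top
      rcases zmod2_cases (η + φ) with h | h <;> rw [h]
      · rw [zero_add, this]; trivial
      · rw [show (1 : ZMod 2) + 1 = 0 from rfl, sup_comm, this]; trivial)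
  rw [← h] at h1 ⊢
  rw [map_add, hA.tw_apply hg, hA.tw_apply hg', one_mul, one_mul, smul_add, add_right_inj,
    sgn_add, sgn_one, mul_neg_one, neg_smul, eq_comm] at h1
  have h2 : sgn (η + φ) • g' = 0 := by
    have h3 : (2 : k) • (sgn (η + φ) • g') = 0 := by rw [two_smul]; nth_rw 1 [h1]; simp
    exact (smul_eq_zero.1 h3).resolve_left two_ne_zero
  have h3 : g' = 0 := by rw [← sgn_smul_self (η + φ) g', h2, smul_zero]
  rwa [h3, add_zero]

theorem twEnd_mulEnd (f : M.Sec U) :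
    twEnd U (M.mulEnd U f) = M.mulEnd U ((M.isSuperAlg U).tw 1 f) := by
  refine EndO.ext fun V g => ?_
  rw [twEnd_app, mulEnd_app, mulEnd_app, IsSuperAlg.tw_mul, IsSuperAlg.tw_self, res_tw]

theorem twEnd_mem_D {F : M.EndO U} (hF : F ∈ M.D U) : twEnd U F ∈ M.D U := by
  have : M.D U ≤ (M.D U).comap (twEnd U) := by
    refine Algebra.adjoin_le ?_
    rintro _ (⟨f, rfl⟩ | hX)
    · exact Algebra.subset_adjoin (Or.inl ⟨(M.isSuperAlg U).tw 1 f, (twEnd_mulEnd f).symm⟩)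
    · refine Algebra.subset_adjoin (Or.inr ?_)
      exact T_induction (C := fun X => twEnd U X ∈ M.T U)
        (fun ε X hX => twEnd_apply hX.1 ▸ sgn_smul_mem _ _ (M.Der_le_T U ε hX))
        (fun X Y hX hY => by rw [map_add]; exact add_mem hX hY) hX
  exact this hF

/-- The parity involution of differential operators. -/
def twD (U : Opens M.X) : M.D U →ₐ[k] M.D U :=
  ((twEnd U).comp (M.D U).val).codRestrict (M.D U) fun F => twEnd_mem_D F.2

theorem twD_apply {φ : ZMod 2} {F : M.D U} (hF : M.EndPar U φ F.1) : twD U F = sgn φ • F :=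
  Subtype.ext ((twEnd_apply hF).trans (map_zsmul (M.D U).val _ F).symm)

theorem twD_funD (f : M.Sec U) : twD U (M.funD f) = M.funD ((M.isSuperAlg U).tw 1 f) :=
  Subtype.ext (twEnd_mulEnd f)

theorem twD_twD (F : M.D U) : twD U (twD U F) = F := Subtype.ext (EndO.ext fun V f => by
  change (M.isSuperAlg V.1).tw 1 ((M.isSuperAlg V.1).tw 1 (F.1.app V
    ((M.isSuperAlg V.1).tw 1 ((M.isSuperAlg V.1).tw 1 f)))) = F.1.app V f
  rw [IsSuperAlg.tw_self, IsSuperAlg.tw_self])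

theorem resD_twD {V : Opens M.X} (h : V ≤ U) (F : M.D U) :
    M.resD h (twD U F) = twD V (M.resD h F) := rfl

/-- Every differential operator is the sum of an even and an odd one. -/
theorem D_induction [CharZero k] {C : M.D U → Prop} (mem : ∀ φ F, M.EndPar U φ F.1 → C F)
    (add : ∀ F G, C F → C G → C (F + G)) (F : M.D U) : C F := by
  have h2 : (2 : k) ≠ 0 := two_ne_zero
  -- The even and odd parts `(F ± twD U F) / 2`. They are differential operators because conjugation
  -- by the parity involution preserves the generators of `M.D U` up to sums.
  have key : ∀ φ : ZMod 2, C ((2 : k)⁻¹ • (F + sgn φ • twD U F)) := fun φ => by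
    have h : twD U ((2 : k)⁻¹ • (F + sgn φ • twD U F)) =
        sgn φ • ((2 : k)⁻¹ • (F + sgn φ • twD U F)) := by
      rw [map_smul, map_add, map_zsmul, twD_twD, smul_comm (sgn φ) ((2 : k)⁻¹), smul_add (sgn φ),
        sgn_smul_self, add_comm]
    exact mem φ _ (endPar_of_twEnd ((congrArg (M.D U).val h).trans (map_zsmul (M.D U).val _ _)))
  have := add _ _ (key 0) (key 1)
  rwa [← smul_add, sgn_zero, sgn_one, one_smul, neg_one_smul, add_add_add_comm, add_neg_cancel,
    add_zero, ← two_smul k F, smul_smul, inv_mul_cancel₀ h2, one_smul] at this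

namespace Coords

variable (x : M.Coords p q U)

/-- A coordinate vector field as a differential operator. -/
abbrev pD (a : Fin p ⊕ Fin q) : M.D U := M.vecD (x.ptl a)

theorem pD_mul_funD (a : Fin p ⊕ Fin q) (f : M.Sec U) : x.pD a * M.funD f =
    M.funD (M.ev (x.ptl a).1 f) + M.funD ((M.isSuperAlg U).tw (idxPar a) f) * x.pD a := by
  refine Subtype.ext (EndO.ext fun V g => ?_)
  change (x.ptl a).1.app V (M.res V.2 f * g) = M.res V.2 (M.ev (x.ptl a).1 f) * g +
    M.res V.2 ((M.isSuperAlg U).tw (idxPar a) f) * (x.ptl a).1.app V g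
  have := IsDer.apply_mul ((x.ptl_par a).2 V) (M.isSuperAlg V.1) (M.res V.2 f) g
  rw [this, res_tw]
  congr 2
  exact ((x.ptl a).1.res_app ⟨U, le_rfl⟩ V V.2 f).symm

theorem pD_mul_pD (a b : Fin p ⊕ Fin q) :
    x.pD a * x.pD b = sgn (idxPar a * idxPar b) • (x.pD b * x.pD a) :=
  Subtype.ext ((x.ptl_mul_ptl a b).trans (map_zsmul (M.D U).val _ (x.pD b * x.pD a)).symm)

theorem twD_pD (a : Fin p ⊕ Fin q) : twD U (x.pD a) = sgn (idxPar a) • x.pD a :=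
  twD_apply (x.ptl_par a).1

theorem pD_eq_sum_jac (y : M.Coords p q U) (a : Fin p ⊕ Fin q) :
    x.pD a = ∑ b, M.funD (M.ev (x.ptl a).1 (y.x b)) * y.pD b := by
  refine Subtype.ext ?_
  rw [AddSubmonoidClass.coe_finsetSum]
  exact y.eq_sum_self (x.ptl a).2

theorem resD_pD {V : Opens M.X} (h : V ≤ U) (a : Fin p ⊕ Fin q) :
    M.resD h (x.pD a) = (x.restrict h).pD a := rfl

end Coords

/-! ### Tensors -/

/-- The quotient map to the tensor product over functions. -/
def virtMk (U : Opens M.X) : M.Forms U ⊗[k] (M.D U ⊗[k] M.Poly U) →ₗ[k] M.PreVirt U :=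
  (M.tensorRel U).mkQ

/-- `ω ⊗ F ⊗ τ` as a trilinear map. -/
def tmulL (U : Opens M.X) : M.Forms U →ₗ[k] M.D U →ₗ[k] M.Poly U →ₗ[k] M.PreVirt U :=
  TensorProduct.lcurry _ _ _ _ ∘ₗ TensorProduct.curry (virtMk U)

theorem tmulL_apply (ω : M.Forms U) (F : M.D U) (τ : M.Poly U) : tmulL U ω F τ = tmul ω F τ := rfl

section

variable (ω ω' : M.Forms U) (F F' : M.D U) (τ τ' : M.Poly U) (n : ℤ) {ι : Type*} (s : Finset ι)

theorem tmul_add_left : tmul (ω + ω') F τ = tmul ω F τ + tmul ω' F τ := by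
  simp only [← tmulL_apply, map_add, LinearMap.add_apply]
theorem tmul_add_mid : tmul ω (F + F') τ = tmul ω F τ + tmul ω F' τ := by
  simp only [← tmulL_apply, map_add, LinearMap.add_apply]
theorem tmul_add_right : tmul ω F (τ + τ') = tmul ω F τ + tmul ω F τ' := by
  simp only [← tmulL_apply, map_add]
theorem tmul_zero_left : tmul (0 : M.Forms U) F τ = 0 := by
  simp only [← tmulL_apply, map_zero, LinearMap.zero_apply]
theorem tmul_zero_right : tmul ω F (0 : M.Poly U) = 0 := by
  simp only [← tmulL_apply, map_zero]
theorem tmul_zsmul_left : tmul (n • ω) F τ = n • tmul ω F τ := by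
  simp only [← tmulL_apply, map_zsmul, LinearMap.smul_apply]
theorem tmul_zsmul_mid : tmul ω (n • F) τ = n • tmul ω F τ := by
  simp only [← tmulL_apply, map_zsmul, LinearMap.smul_apply]
theorem tmul_zsmul_right : tmul ω F (n • τ) = n • tmul ω F τ := by
  simp only [← tmulL_apply, map_zsmul]
theorem tmul_sum_left (f : ι → M.Forms U) :
    tmul (∑ i ∈ s, f i) F τ = ∑ i ∈ s, tmul (f i) F τ := by
  simp only [← tmulL_apply, map_sum, LinearMap.sum_apply]
theorem tmul_sum_mid (f : ι → M.D U) :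
    tmul ω (∑ i ∈ s, f i) τ = ∑ i ∈ s, tmul ω (f i) τ := by
  simp only [← tmulL_apply, map_sum, LinearMap.sum_apply]
theorem tmul_sum_right (f : ι → M.Poly U) :
    tmul ω F (∑ i ∈ s, f i) = ∑ i ∈ s, tmul ω F (f i) := by
  simp only [← tmulL_apply, map_sum]

theorem tmul_fun_left (f : M.Sec U) :
    tmul (ω * Forms.ofFun f) F τ = tmul ω (M.funD f * F) τ :=
  (Submodule.Quotient.eq _).2 (Submodule.subset_span (Or.inl ⟨ω, f, F, τ, rfl⟩))

theorem tmul_fun_right (f : M.Sec U) :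
    tmul ω (F * M.funD f) τ = tmul ω F (Poly.ofFun f * τ) :=
  (Submodule.Quotient.eq _).2 (Submodule.subset_span (Or.inr ⟨ω, f, F, τ, rfl⟩))

end

/-- Balanced linear maps descend to the tensor product over functions. -/
def liftVirt {N : Type u} [AddCommGroup N] [Module k N]
    (φ : M.Forms U ⊗[k] (M.D U ⊗[k] M.Poly U) →ₗ[k] N)
    (left : ∀ ω f F τ, φ ((ω * Forms.ofFun f) ⊗ₜ (F ⊗ₜ τ)) = φ (ω ⊗ₜ ((M.funD f * F) ⊗ₜ τ)))
    (right : ∀ ω f F τ, φ (ω ⊗ₜ ((F * M.funD f) ⊗ₜ τ)) = φ (ω ⊗ₜ (F ⊗ₜ (Poly.ofFun f * τ)))) :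
    M.PreVirt U →ₗ[k] N :=
  (M.tensorRel U).liftQ φ (by
    rw [tensorRel, Submodule.span_le]
    rintro _ (⟨ω, f, F, τ, rfl⟩ | ⟨ω, f, F, τ, rfl⟩)
    · exact LinearMap.mem_ker.2 ((map_sub φ _ _).trans (sub_eq_zero.2 (left ω f F τ)))
    · exact LinearMap.mem_ker.2 ((map_sub φ _ _).trans (sub_eq_zero.2 (right ω f F τ))))

end Superspace
end SuperGeom
end

/-! ### The operators on tensors over a coordinate open set -/

noncomputable section
set_option linter.unusedSectionVars false
set_option linter.unusedVariables false
namespace SuperGeom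

theorem SuperSym.Frame.tw_mem_deg {k : Type u} [Field k] [CharZero k] {A E : Type u} [Ring A]
    [Algebra k A] [AddCommGroup E] [Module k E] {pA : ZMod 2 → Submodule k A}
    {pE : ZMod 2 → Submodule k E} {act : A → E → E → Prop} {I : Type} [Fintype I] [DecidableEq I]
    {p : I → ZMod 2} (F : Frame pA pE act p) (ε : ZMod 2) (n : ℕ) (s : SuperSym k pA pE act)
    (hs : s ∈ deg pA pE act n) : F.isSuperAlg.tw ε s ∈ deg pA pE act n := by
  refine F.deg_induction (C := fun n s => F.isSuperAlg.tw ε s ∈ deg pA pE act n)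
    (fun f => F.tw_ofFun ε f ▸ ofFun_mem_deg _) (fun n => by simp)
    (fun n s a hs ih => ?_) (fun n s t hs ht => by rw [map_add]; exact add_mem hs ht) n s hs
  rw [IsSuperAlg.tw_mul, F.isSuperAlg.tw_apply (F.gen_mem a), add_comm n, smul_mul_assoc]
  exact sgn_smul_mem _ _ (F.mul_mem_deg (ofGen_mem_deg _) ih)

namespace Superspace

variable {k : Type u} [Field k] [CharZero k] {M : Superspace k} {U : Opens M.X} {p q : ℕ}

theorem zsmul_funD (n : ℤ) (f : M.Sec U) : M.funD (n • f) = n • M.funD f :=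
  Subtype.ext ((map_zsmul (M.mulEnd U) n f).trans (map_zsmul (M.D U).val n (M.funD f)).symm)

namespace Calculus

variable {x : M.Coords p q U} (C : M.Calculus x)

theorem d_mul (ω η : M.Forms U) :
    C.d (ω * η) = C.d ω * η + x.formFrame.isSuperAlg.tw 1 ω * C.d η :=
  C.is_d.isDer.apply_mul _ ω η

theorem tw_fun (ε : ZMod 2) (f : M.Sec U) : x.formFrame.isSuperAlg.tw ε (Forms.ofFun f) =
    Forms.ofFun ((M.isSuperAlg U).tw ε f) := x.formFrame.tw_ofFun _ _

theorem tw_d (ω : M.Forms U) : x.formFrame.isSuperAlg.tw 1 (C.d ω) =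
    -C.d (x.formFrame.isSuperAlg.tw 1 ω) := by
  refine x.formFrame.isSuperAlg.induction (C := fun ω => x.formFrame.isSuperAlg.tw 1 (C.d ω) =
    -C.d (x.formFrame.isSuperAlg.tw 1 ω)) (fun η f hf => ?_) (fun f g hf hg => ?_) ω
  · rw [x.formFrame.isSuperAlg.tw_apply hf,
      x.formFrame.isSuperAlg.tw_apply (C.is_d.isHomog x η f hf), map_zsmul, ← neg_smul]
    congr 1
    clear * -; decide +revert
  · rw [map_add, map_add, map_add, map_add, hf, hg, neg_add]

theorem tw_dx (a : Fin p ⊕ Fin q) : x.formFrame.isSuperAlg.tw 1 (x.dx a) =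
    sgn (idxPar a + 1) • x.dx a := by
  rw [x.formFrame.isSuperAlg.tw_apply (x.dx_mem a), one_mul]

theorem dx_mul_fun (a : Fin p ⊕ Fin q) (f : M.Sec U) : Forms.ofFun f * x.dx a =
    x.dx a * Forms.ofFun ((M.isSuperAlg U).tw (idxPar a + 1) f) := by
  have := x.formFrame.gen_mul_tw a f
  exact this.symm

/-! ### The operator `\hat d` on tensors -/

/-- `\hat d` on tensors over a coordinate open set. -/
def hatD : M.PreVirt U →ₗ[k] M.PreVirt U :=
  -- Since `dx_a` has parity `|x_a| + 1`, the term `(-1)^{|ω||x_a|} dx_a ω` equals `(-1)^{|ω|} ω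
  -- dx_a`. In this form it is linear in `ω`, and `dx_a` stands next to the tensor sign.
  liftVirt (virtMk U ∘ₗ (TensorProduct.map C.d LinearMap.id + ∑ a, TensorProduct.map
      (LinearMap.mulRight k (x.dx a) ∘ₗ x.formFrame.isSuperAlg.tw 1)
      (TensorProduct.map (LinearMap.mulLeft k (x.pD a)) LinearMap.id)))
    (fun ω f F τ => by
      simp only [LinearMap.comp_apply, LinearMap.add_apply, LinearMap.sum_apply,
        TensorProduct.map_tmul, map_add, map_sum, LinearMap.id_apply, LinearMap.mulRight_apply,
        LinearMap.mulLeft_apply]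
      change tmul (C.d (ω * Forms.ofFun f)) F τ + ∑ a, tmul (x.formFrame.isSuperAlg.tw 1
          (ω * Forms.ofFun f) * x.dx a) (x.pD a * F) τ =
        tmul (C.d ω) (M.funD f * F) τ + ∑ a, tmul (x.formFrame.isSuperAlg.tw 1 ω * x.dx a)
          (x.pD a * (M.funD f * F)) τ
      -- The term `±ω df = ∑ ±ω dx_a ∂_a f` of `d (ω f)` is matched by the term `∂_a f` of `∂_a ∘
      -- f`.
      rw [C.d_mul, tmul_add_left, tmul_fun_left, C.is_d.d_fun, ofForm1_dFun x, Finset.mul_sum,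
        tmul_sum_left, add_assoc, ← Finset.sum_add_distrib]
      congr 1
      refine Finset.sum_congr rfl fun a _ => ?_
      rw [← mul_assoc (x.pD a), x.pD_mul_funD, add_mul, tmul_add_mid, ← mul_assoc, tmul_fun_left,
        mul_assoc, IsSuperAlg.tw_mul, tw_fun (x := x),
        mul_assoc (x.formFrame.isSuperAlg.tw 1 ω) (Forms.ofFun _),
        dx_mul_fun (x := x) a,
        IsSuperAlg.tw_tw, ← mul_assoc,
        ← tmul_fun_left _ (x.pD a * F), show idxPar a + 1 + 1 = idxPar a by generalize idxPar a = y; clear * -; decide +revert])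
    (fun ω f F τ => by
      simp only [LinearMap.comp_apply, LinearMap.add_apply, LinearMap.sum_apply,
        TensorProduct.map_tmul, map_add, map_sum, LinearMap.id_apply, LinearMap.mulRight_apply,
        LinearMap.mulLeft_apply]
      change tmul (C.d ω) (F * M.funD f) τ + ∑ a, tmul (x.formFrame.isSuperAlg.tw 1 ω * x.dx a)
          (x.pD a * (F * M.funD f)) τ =
        tmul (C.d ω) F (Poly.ofFun f * τ) + ∑ a, tmul (x.formFrame.isSuperAlg.tw 1 ω * x.dx a)
          (x.pD a * F) (Poly.ofFun f * τ)
      simp only [← tmul_fun_right, mul_assoc])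

theorem hatD_tmul (ω : M.Forms U) (F : M.D U) (τ : M.Poly U) : C.hatD (tmul ω F τ) =
    tmul (C.d ω) F τ + ∑ a, tmul (x.formFrame.isSuperAlg.tw 1 ω * x.dx a) (x.pD a * F) τ := by
  refine Eq.trans (b := virtMk U _) rfl ?_
  simp only [LinearMap.add_apply, LinearMap.sum_apply,
    TensorProduct.map_tmul, map_add, map_sum, LinearMap.id_apply, LinearMap.mulRight_apply,
    LinearMap.mulLeft_apply, LinearMap.comp_apply]
  rfl

theorem hatD_eq_D₁ {ε : ZMod 2} {ω : M.Forms U} (hω : M.FormsPar U ε ω) (F : M.D U)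
    (τ : M.Poly U) : C.hatD (tmul ω F τ) = C.D₁ ε ω F τ := by
  rw [hatD_tmul, D₁]
  congr 1
  refine Finset.sum_congr rfl fun a _ => ?_
  rw [x.formFrame.isSuperAlg.tw_apply hω, smul_mul_assoc, SuperSym.comm (M.isSuperAlg U) hω (x.dx_mem a),
    sgn_smul_smul, tmul_zsmul_left]
  exact sgn_smul_congr (by generalize idxPar a = y; clear * -; decide +revert) _

/-- The terms with one `∂_a` cancel because `d` anticommutes with the sign of `ω` and kills `dx_a`.
The terms `ω dx_a dx_b ⊗ ∂_b ∂_a F` are antisymmetric, the parities of the `dx_a` and of the `∂_a`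
differing by one. -/
theorem hatD_hatD (t : M.PreVirt U) : C.hatD (C.hatD t) = 0 := by
  suffices C.hatD ∘ₗ C.hatD = 0 from LinearMap.congr_fun this t
  refine M.preVirt_ext fun ω F τ => ?_
  rw [LinearMap.comp_apply, LinearMap.zero_apply, hatD_tmul, map_add, map_sum, hatD_tmul,
    C.is_d.d_d, tmul_zero_left, zero_add]
  simp only [hatD_tmul]
  rw [Finset.sum_add_distrib, ← add_assoc, ← Finset.sum_add_distrib]
  convert zero_add (0 : M.PreVirt U)
  · refine Finset.sum_eq_zero fun a _ => ?_
    rw [C.d_mul, C.is_d.d_dx, mul_zero, add_zero, tw_d, neg_mul, ← tmul_add_left, neg_add_cancel,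
      tmul_zero_left]
  · refine sum_sum_eq_zero_of_antisymm (k := k) _ fun a b => ?_
    rw [IsSuperAlg.tw_mul, IsSuperAlg.tw_mul, IsSuperAlg.tw_self, tw_dx, tw_dx, mul_assoc, mul_assoc,
      ← mul_assoc (x.pD b), x.pD_mul_pD b a, ← mul_assoc (x.pD a), smul_mul_assoc, smul_mul_assoc,
      SuperSym.comm (M.isSuperAlg U) (x.dx_mem a) (x.dx_mem b), smul_mul_assoc, sgn_smul_smul,
      mul_smul_comm, mul_smul_comm]
    simp only [tmul_zsmul_left, tmul_zsmul_mid, sgn_smul_smul]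
    refine sgn_smul_add_sgn_smul ?_ _
    generalize idxPar a = y; generalize idxPar b = z; clear * -; decide +revert

/-- The chain rule: the Jacobian that expresses `dy_b` by the `dx_a` crosses the tensor sign and
expresses `∂/∂x_a` by the `∂/∂y_b`. -/
theorem hatD_change {y : M.Coords p q U} (C' : M.Calculus y) : C.hatD = C'.hatD := by
  refine M.preVirt_ext fun ω F τ => ?_
  rw [hatD_tmul, hatD_tmul, C.d_eq C']
  congr 1
  simp only [dx_eq_sum_jac (x := x) (y := y), Finset.mul_sum, tmul_sum_left]
  rw [Finset.sum_comm]
  refine Finset.sum_congr rfl fun a _ => ?_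
  rw [x.pD_eq_sum_jac y, Finset.sum_mul, tmul_sum_mid]
  refine Finset.sum_congr rfl fun b _ => ?_
  rw [← mul_assoc, tmul_fun_left, mul_assoc]; rfl

theorem resVirt_hatD {V : Opens M.X} (h : V ≤ U) (C' : M.Calculus (x.restrict h))
    (t : M.PreVirt U) : M.resVirt h (C.hatD t) = C'.hatD (M.resVirt h t) := by
  suffices M.resVirt h ∘ₗ C.hatD = C'.hatD ∘ₗ M.resVirt h from LinearMap.congr_fun this t
  refine M.preVirt_ext fun ω F τ => ?_
  rw [LinearMap.comp_apply, LinearMap.comp_apply, resVirt_tmul, hatD_tmul, hatD_tmul, map_add,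
    map_sum, resVirt_tmul, C.resForms_d h C']
  congr 1
  refine Finset.sum_congr rfl fun a _ => ?_
  rw [resVirt_tmul, map_mul, map_mul, resForms_dx, Coords.resD_pD]
  congr 2
  exact x.formFrame.isSuperAlg.map_tw (x.restrict h).formFrame.isSuperAlg
    (M.resForms h).toLinearMap (resForms_mem h) 1 ω

theorem d_mem_deg (n : ℕ) (ω : M.Forms U) (hω : ω ∈ M.formsDeg U n) :
    C.d ω ∈ M.formsDeg U (n + 1) :=
  x.formFrame.deg_succ_of_isDer C.is_d.isDer
    (fun f => (C.is_d.d_fun f).symm ▸ SuperSym.Frame.ofGen_mem_deg _)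
    (fun a => (C.is_d.d_dx x a).symm ▸ zero_mem _) n ω hω

theorem hatD_mem {i j : ℕ} {t : M.PreVirt U} (ht : t ∈ M.virtDeg U i j) :
    C.hatD t ∈ M.virtDeg U (i + 1) j := by
  have : M.virtDeg U i j ≤ (M.virtDeg U (i + 1) j).comap C.hatD := by
    refine Submodule.span_le.2 ?_
    rintro _ ⟨ω, hω, F, τ, hτ, rfl⟩
    change C.hatD (tmul ω F τ) ∈ M.virtDeg U (i + 1) j
    rw [hatD_tmul]
    refine add_mem (Submodule.subset_span ⟨_, ?_, _, _, hτ, rfl⟩)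
      (sum_mem fun a _ => Submodule.subset_span ⟨_, ?_, _, _, hτ, rfl⟩)
    · exact C.d_mem_deg i ω hω
    · exact x.formFrame.mul_mem_deg (x.formFrame.tw_mem_deg 1 i ω hω) (SuperSym.Frame.ofGen_mem_deg _)
  exact this ht

/-! ### The operator `\hat δ` on tensors -/

/-- `\hat δ` on tensors over a coordinate open set. -/
def hatDelta : M.PreVirt U →ₗ[k] M.PreVirt U :=
  -- The signs `(-1)^{|τ|}` of `\hat δ` and of `1 ⊗ δ` cancel. What remains is `(-1)^{|ω| + |F|}`,
  -- the twist of the first two factors.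
  liftVirt (virtMk U ∘ₗ (∑ a, TensorProduct.map (x.formFrame.isSuperAlg.tw 1)
      (TensorProduct.map (LinearMap.mulRight k (x.pD a) ∘ₗ (twD U).toLinearMap)
        (C.pair (x.dx a))) -
      TensorProduct.map (x.formFrame.isSuperAlg.tw 1)
        (TensorProduct.map (twD U).toLinearMap C.eEnd)))
    (fun ω f F τ => by
      simp only [LinearMap.comp_apply, LinearMap.sub_apply, LinearMap.sum_apply,
        TensorProduct.map_tmul, map_sub, map_sum, LinearMap.mulRight_apply,
        AlgHom.toLinearMap_apply]
      change ∑ a, tmul (x.formFrame.isSuperAlg.tw 1 (ω * Forms.ofFun f)) (twD U F * x.pD a)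
          (C.pair (x.dx a) τ) - tmul (x.formFrame.isSuperAlg.tw 1 (ω * Forms.ofFun f)) (twD U F)
          (C.eEnd τ) =
        ∑ a, tmul (x.formFrame.isSuperAlg.tw 1 ω) (twD U (M.funD f * F) * x.pD a)
          (C.pair (x.dx a) τ) - tmul (x.formFrame.isSuperAlg.tw 1 ω) (twD U (M.funD f * F))
          (C.eEnd τ)
      rw [IsSuperAlg.tw_mul, tw_fun (x := x)]
      simp only [map_mul, twD_funD, tmul_fun_left, mul_assoc])
    (fun ω f F τ => by
      simp only [LinearMap.comp_apply, LinearMap.sub_apply, LinearMap.sum_apply,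
        TensorProduct.map_tmul, map_sub, map_sum, LinearMap.mulRight_apply,
        AlgHom.toLinearMap_apply]
      change ∑ a, tmul (x.formFrame.isSuperAlg.tw 1 ω) (twD U (F * M.funD f) * x.pD a)
          (C.pair (x.dx a) τ) - tmul (x.formFrame.isSuperAlg.tw 1 ω) (twD U (F * M.funD f))
          (C.eEnd τ) =
        ∑ a, tmul (x.formFrame.isSuperAlg.tw 1 ω) (twD U F * x.pD a)
          (C.pair (x.dx a) (Poly.ofFun f * τ)) - tmul (x.formFrame.isSuperAlg.tw 1 ω) (twD U F)
          (C.eEnd (Poly.ofFun f * τ))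
      -- The defect of linearity of `𝔢_x`, contraction with `df`, cancels the terms `∂_a f` from
      -- moving `f` across `∂_a`.
      rw [C.eEnd_apply, C.eEnd_apply, C.e_fun_mul, tmul_add_right, ofForm1_dFun x, map_sum,
        LinearMap.sum_apply, tmul_sum_right, map_mul, twD_funD, tmul_fun_right, ← sub_sub,
        sub_right_comm, ← Finset.sum_sub_distrib]
      congr 1
      refine Finset.sum_congr rfl fun a _ => ?_
      rw [C.dx_pair_fun_mul, ← tmul_fun_right, mul_assoc (twD U F) (x.pD a), x.pD_mul_funD,
        IsSuperAlg.tw_tw, mul_add, tmul_add_mid, tmul_fun_right, map_mul, Module.End.mul_apply,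
        C.is_pair.fun_apply, C.dx_pair_fun_mul, mul_assoc,
        show idxPar a + (idxPar a + 1) = 1 by generalize idxPar a = y; clear * -; decide +revert,
        show M.ev (x.ptl a).1 ((M.isSuperAlg U).tw (idxPar a + 1) f) =
          (M.isSuperAlg U).tw (idxPar a + 1) (M.ev (x.ptl a).1 f) from ?_, add_sub_cancel_left]
      refine (M.isSuperAlg U).induction (C := fun f => M.ev (x.ptl a).1
        ((M.isSuperAlg U).tw (idxPar a + 1) f) =
          (M.isSuperAlg U).tw (idxPar a + 1) (M.ev (x.ptl a).1 f)) (fun η f hf => ?_)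
        (fun f g hf hg => ?_) f
      · rw [(M.isSuperAlg U).tw_apply hf, (M.isSuperAlg U).tw_apply (x.ptl_mem a hf)]
        refine (map_zsmul ((x.ptl a).1.app ⟨U, le_rfl⟩) _ _).trans (sgn_smul_congr ?_ _)
        generalize idxPar a = y; clear * -; decide +revert
      · rw [map_add]
        refine (map_add ((x.ptl a).1.app ⟨U, le_rfl⟩) _ _).trans ((congrArg₂ _ hf hg).trans ?_)
        rw [← map_add]; exact congrArg _ (map_add ((x.ptl a).1.app ⟨U, le_rfl⟩) _ _).symm)

theorem hatDelta_tmul (ω : M.Forms U) (F : M.D U) (τ : M.Poly U) : C.hatDelta (tmul ω F τ) =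
    ∑ a, tmul (x.formFrame.isSuperAlg.tw 1 ω) (twD U F * x.pD a) (C.pair (x.dx a) τ) -
      tmul (x.formFrame.isSuperAlg.tw 1 ω) (twD U F) (C.e τ) := by
  refine Eq.trans (b := virtMk U _) rfl ?_
  simp only [LinearMap.sub_apply, LinearMap.sum_apply, TensorProduct.map_tmul, map_sub, map_sum,
    LinearMap.mulRight_apply, LinearMap.comp_apply, C.eEnd_apply]
  rfl

theorem hatDelta_eq_δ₁ {ε φ t : ZMod 2} {ω : M.Forms U} {F : M.D U} {τ : M.Poly U}
    (hω : M.FormsPar U ε ω) (hF : M.EndPar U φ F.1) :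
    C.hatDelta (tmul ω F τ) = sgn (ε + φ + t) • C.δ₁ t ω F τ := by
  rw [hatDelta_tmul, δ₁, x.formFrame.isSuperAlg.tw_apply hω, twD_apply hF, one_mul, ← smul_sub,
    sgn_smul_smul, add_assoc, show t + t = 0 by clear * -; decide +revert, add_zero, smul_sub,
    Finset.smul_sum]
  simp only [smul_mul_assoc, tmul_zsmul_left, tmul_zsmul_mid, sgn_smul_smul, add_comm φ ε]

/-- Three cancellations: the terms `F ∂_a ∂_b` with two contractions are antisymmetric (`h1`), the
operator `𝔢_x` squares to zero, and the cross terms cancel because `𝔢_x` passes the contraction by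
`dx_a` with sign `|x_a| + 1` whereas the twist of `∂_a` gives `|x_a|`. -/
theorem hatDelta_hatDelta (t : M.PreVirt U) : C.hatDelta (C.hatDelta t) = 0 := by
  suffices C.hatDelta ∘ₗ C.hatDelta = 0 from LinearMap.congr_fun this t
  refine M.preVirt_ext fun ω F τ => ?_
  rw [LinearMap.comp_apply, LinearMap.zero_apply, hatDelta_tmul, map_sub, map_sum, hatDelta_tmul]
  simp only [hatDelta_tmul]
  rw [Finset.sum_sub_distrib, sub_sub]
  have h1 : ∑ a, ∑ b, tmul (x.formFrame.isSuperAlg.tw 1 (x.formFrame.isSuperAlg.tw 1 ω))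
      (twD U (twD U F * x.pD a) * x.pD b) (C.pair (x.dx b) (C.pair (x.dx a) τ)) = 0 := by
    refine sum_sum_eq_zero_of_antisymm (k := k) _ fun a b => ?_
    have h2 := LinearMap.congr_fun (C.pair_comm (x.dx_mem b) (x.dx_mem a)) τ
    rw [LinearMap.smul_apply, Module.End.mul_apply, Module.End.mul_apply] at h2
    rw [map_mul, map_mul, twD_twD, x.twD_pD, x.twD_pD, mul_assoc, mul_assoc, smul_mul_assoc,
      smul_mul_assoc, x.pD_mul_pD a b, h2]
    simp only [mul_smul_comm, tmul_zsmul_right, tmul_zsmul_mid, sgn_smul_smul]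
    refine sgn_smul_add_sgn_smul ?_ _
    generalize idxPar a = y; generalize idxPar b = z; clear * -; decide +revert
  rw [h1, zero_sub, neg_eq_zero, ← C.eEnd_apply (C.e τ), ← C.eEnd_apply τ,
    ← Module.End.mul_apply C.eEnd, C.e_mul_e, LinearMap.zero_apply, tmul_zero_right, sub_zero, ← Finset.sum_add_distrib]
  refine Finset.sum_eq_zero fun a _ => ?_
  have h2 := LinearMap.congr_fun (C.e_mul_dx a) τ
  rw [LinearMap.smul_apply, Module.End.mul_apply, Module.End.mul_apply] at h2
  rw [← C.eEnd_apply (C.pair _ _), h2, map_mul, x.twD_pD, mul_smul_comm, tmul_zsmul_mid,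
    tmul_zsmul_right, sgn_smul_smul]
  rw [← add_assoc, show idxPar a + idxPar a = 0 by generalize idxPar a = y; clear * -; decide +revert, zero_add,
    sgn_one, neg_one_smul, neg_add_cancel]

/-- One operator works on `ω` and on the left of `F`, the other on the right of `F` and on `τ`, so
apart from signs they commute. The minus sign comes from the twist of `ω` and `F` in `\hat δ`, which
`\hat d` anticommutes with. -/
theorem hatD_hatDelta (t : M.PreVirt U) : C.hatD (C.hatDelta t) + C.hatDelta (C.hatD t) = 0 := by
  suffices C.hatD ∘ₗ C.hatDelta + C.hatDelta ∘ₗ C.hatD = 0 from LinearMap.congr_fun this t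
  refine M.preVirt_ext fun ω F τ => ?_
  -- `G = ∂_a` and `G = 1` give the two parts of `\hat δ`.
  have key : ∀ (G : M.D U) (τ : M.Poly U),
      C.hatD (tmul (x.formFrame.isSuperAlg.tw 1 ω) (twD U F * G) τ) =
      -(tmul (x.formFrame.isSuperAlg.tw 1 (C.d ω)) (twD U F * G) τ +
        ∑ a, tmul (x.formFrame.isSuperAlg.tw 1 (x.formFrame.isSuperAlg.tw 1 ω * x.dx a))
          (twD U (x.pD a * F) * G) τ) := fun G τ => by
    rw [hatD_tmul, neg_add, IsSuperAlg.tw_self, ← Finset.sum_neg_distrib, tw_d, ← neg_one_zsmul,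
      ← neg_one_zsmul (C.d _), tmul_zsmul_left, smul_smul]
    congr 1
    · simp
    · refine Finset.sum_congr rfl fun a _ => ?_
      rw [IsSuperAlg.tw_mul, IsSuperAlg.tw_self, tw_dx, map_mul, x.twD_pD, mul_smul_comm, smul_mul_assoc,
        smul_mul_assoc, tmul_zsmul_left, tmul_zsmul_mid, sgn_smul_smul, mul_assoc, add_right_comm,
        show idxPar a + idxPar a = 0 by generalize idxPar a = y; clear * -; decide +revert, zero_add,
        sgn_one, neg_one_smul, neg_neg]
  have key1 := key 1
  simp only [mul_one] at key1
  rw [LinearMap.add_apply, LinearMap.comp_apply, LinearMap.comp_apply, LinearMap.zero_apply,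
    hatDelta_tmul, hatD_tmul, map_add, map_sub, map_sum, map_sum]
  simp only [key, key1, hatDelta_tmul, Finset.sum_neg_distrib, Finset.sum_add_distrib,
    Finset.sum_sub_distrib]
  rw [Finset.sum_comm]
  abel

/-- Write `∂/∂x_a` as the sum of `J_{ab} ∂/∂y_b`. To reach the polyfield, `J_{ab}` has to be moved
to the right of `∂/∂y_b`, which costs its derivative. These derivatives add up to `jacDiv`, the
amount by which `𝔢_x` changes. -/
theorem hatDelta_change {y : M.Coords p q U} (C' : M.Calculus y) : C.hatDelta = C'.hatDelta := by
  refine M.preVirt_ext fun ω F τ => ?_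
  rw [hatDelta_tmul, hatDelta_tmul, C.e_change C', tmul_add_right, ← C.pair_eq C',
    -- The sign operator depends on the parity subspaces only: the coordinates enter it through a
    -- proof.
    show y.formFrame.isSuperAlg.tw 1 ω = x.formFrame.isSuperAlg.tw 1 ω from rfl, ← sub_sub,
    sub_right_comm]
  congr 1
  rw [tmul_sum_right, eq_sub_iff_add_eq, ← Finset.sum_add_distrib]
  have h1 : ∀ a, tmul (x.formFrame.isSuperAlg.tw 1 ω) (twD U F * x.pD a) (C.pair (x.dx a) τ) +
      tmul (x.formFrame.isSuperAlg.tw 1 ω) (twD U F)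
        (Poly.ofFun (jacDiv x y a) * C.pair (x.dx a) τ) =
      ∑ b, tmul (x.formFrame.isSuperAlg.tw 1 ω) (twD U F * y.pD b)
        (C.pair (x.dx a) (Poly.ofFun (jac x y a b) * τ)) := fun a => by
    rw [x.pD_eq_sum_jac y, jacDiv, Poly.ofFun, map_sum, Finset.sum_mul, tmul_sum_right,
      Finset.mul_sum, tmul_sum_mid, ← Finset.sum_add_distrib]
    refine Finset.sum_congr rfl fun b _ => ?_
    -- The Jacobian moved across `∂/∂y_b`. The twist by `idxPar a + 1` is the one it acquires from
    -- the contraction with `dx_a`.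
    have h2 : y.pD b * M.funD ((M.isSuperAlg U).tw (idxPar a + 1) (jac x y a b)) =
        M.funD (M.ev (x.ptl a).1 (y.x b)) * y.pD b +
        M.funD (sgn ((idxPar a + idxPar b) * (idxPar a + 1)) •
          M.ev (y.ptl b).1 (jac x y a b)) := by
      rw [(M.isSuperAlg U).tw_apply (jac_mem a b), zsmul_funD, mul_smul_comm, y.pD_mul_funD,
        (M.isSuperAlg U).tw_apply (jac_mem a b), zsmul_funD, zsmul_funD, smul_mul_assoc, smul_add,
        sgn_smul_smul, add_comm, show M.ev (x.ptl a).1 (y.x b) = jac x y a b from rfl]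
      generalize idxPar a = y; generalize idxPar b = z
      refine congrArg₂ _ ?_ (sgn_smul_congr (by clear * -; decide +revert) _)
      rw [show (y + 1) * (z + y) + z * (z + y) = 0 by clear * -; decide +revert, sgn_zero, one_smul]
    rw [C.dx_pair_fun_mul]
    refine Eq.trans ?_ (tmul_fun_right _ _ _ _)
    rw [mul_assoc (twD U F) (y.pD b), h2, mul_add (twD U F), tmul_add_mid]
    exact congrArg _ (tmul_fun_right _ _ _ _).symm
  rw [Finset.sum_congr rfl fun a _ => h1 a, Finset.sum_comm]
  refine Finset.sum_congr rfl fun b _ => ?_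
  rw [dx_eq_sum_jac (x := x) b, map_sum, LinearMap.sum_apply, tmul_sum_right]
  refine Finset.sum_congr rfl fun a _ => ?_
  rw [map_mul C.pair, Module.End.mul_apply, C.is_pair.fun_apply]

theorem resVirt_hatDelta {V : Opens M.X} (h : V ≤ U) (C' : M.Calculus (x.restrict h))
    (t : M.PreVirt U) : M.resVirt h (C.hatDelta t) = C'.hatDelta (M.resVirt h t) := by
  suffices M.resVirt h ∘ₗ C.hatDelta = C'.hatDelta ∘ₗ M.resVirt h from LinearMap.congr_fun this t
  refine M.preVirt_ext fun ω F τ => ?_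
  have htw : M.resForms h (x.formFrame.isSuperAlg.tw 1 ω) =
      (x.restrict h).formFrame.isSuperAlg.tw 1 (M.resForms h ω) :=
    x.formFrame.isSuperAlg.map_tw (x.restrict h).formFrame.isSuperAlg
      (M.resForms h).toLinearMap (resForms_mem h) 1 ω
  rw [LinearMap.comp_apply, LinearMap.comp_apply, resVirt_tmul, hatDelta_tmul, hatDelta_tmul,
    map_sub, map_sum, resVirt_tmul, C.resPoly_e h C', htw, resD_twD]
  congr 1
  refine Finset.sum_congr rfl fun a _ => ?_
  rw [resVirt_tmul, map_mul, Coords.resD_pD, htw, resD_twD, C.resPoly_pair h C', resForms_dx]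

theorem hatDelta_mem {i j : ℕ} {t : M.PreVirt U} (ht : t ∈ M.virtDeg U i (j + 1)) :
    C.hatDelta t ∈ M.virtDeg U i j := by
  have : M.virtDeg U i (j + 1) ≤ (M.virtDeg U i j).comap C.hatDelta := by
    refine Submodule.span_le.2 ?_
    rintro _ ⟨ω, hω, F, τ, hτ, rfl⟩
    change C.hatDelta (tmul ω F τ) ∈ M.virtDeg U i j
    rw [hatDelta_tmul]
    exact sub_mem (sum_mem fun a _ => Submodule.subset_span ⟨_, x.formFrame.tw_mem_deg 1 i ω hω, _,
      _, dx_contraction_deg x C.is_pair a j τ hτ, rfl⟩)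
      (Submodule.subset_span ⟨_, x.formFrame.tw_mem_deg 1 i ω hω, _, _, C.e_deg j τ hτ, rfl⟩)
  exact this ht

theorem hatDelta_eq_zero {i : ℕ} {t : M.PreVirt U} (ht : t ∈ M.virtDeg U i 0) :
    C.hatDelta t = 0 := by
  have : M.virtDeg U i 0 ≤ LinearMap.ker C.hatDelta := by
    refine Submodule.span_le.2 ?_
    rintro _ ⟨ω, hω, F, τ, hτ, rfl⟩
    refine LinearMap.mem_ker.2 ?_
    rw [hatDelta_tmul, C.e_deg_zero τ hτ, tmul_zero_right, sub_zero]
    exact Finset.sum_eq_zero fun a _ => by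
      rw [dx_contraction_zero x C.is_pair a τ hτ, tmul_zero_right]
  exact this ht

end Calculus

end Superspace
end SuperGeom
end

noncomputable section
set_option linter.unusedSectionVars false
set_option linter.unusedVariables false
namespace SuperGeom
open Polynomial

namespace SuperSym

variable {k : Type u} [Field k] {A E : Type u} [Ring A] [Algebra k A] [AddCommGroup E] [Module k E]
  {pA : ZMod 2 → Submodule k A} {pE : ZMod 2 → Submodule k E} {act : A → E → E → Prop}

/-! ### The grading of the supersymmetric algebra -/

local notation "S" => SuperSym k pA pE act

/-- The monomial `s X ^ n`, as a linear function of `s`. -/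
def monoL (n : ℕ) : S →ₗ[k] S[X] := (Polynomial.monomial n : S →ₗ[S] S[X]).restrictScalars k

theorem monoL_mul (m n : ℕ) (s t : S) : monoL m s * monoL n t = monoL (m + n) (s * t) :=
  Polynomial.monomial_mul_monomial m n s t

/-- The algebra map that multiplies elements of degree `n` by `X ^ n`. -/
def grade : S →ₐ[k] S[X] :=
  lift (monoL 0 ∘ₗ ofFun pA pE act) (monoL 1 ∘ₗ ofGen pA pE act)
    (by rw [LinearMap.comp_apply, ofFun_one]; rfl)
    (fun f g => by simp only [LinearMap.comp_apply, monoL_mul, ofFun_mul])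
    (fun f x y h => by
      rw [LinearMap.comp_apply, LinearMap.comp_apply, LinearMap.comp_apply, monoL_mul,
        ofFun_mul_ofGen h])
    (fun ε η f hf x hx => by
      rw [LinearMap.comp_apply, LinearMap.comp_apply, monoL_mul, monoL_mul, ofGen_mul_ofFun hf hx,
        map_zsmul])
    (fun ε η x hx y hy => by
      rw [LinearMap.comp_apply, LinearMap.comp_apply, monoL_mul, monoL_mul, ofGen_mul_ofGen hx hy,
        map_zsmul])

theorem grade_of_mem {n : ℕ} {s : S} (hs : s ∈ deg pA pE act n) : grade s = monoL n s := by
  have hle : deg pA pE act n ≤ LinearMap.ker (grade.toLinearMap - monoL n) := by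
    have h0 : ∀ s ∈ LinearMap.range (ofFun pA pE act), grade s = monoL 0 s := by
      rintro _ ⟨f, rfl⟩; rw [grade, lift_ofFun]; rfl
    have h1 : ∀ n, ∀ s ∈ LinearMap.range (ofGen pA pE act) ^ n, grade s = monoL n s := by
      intro n
      induction n with
      | zero =>
        intro s hs
        rw [pow_zero, Submodule.mem_one] at hs
        obtain ⟨c, rfl⟩ := hs
        rw [AlgHom.commutes]; rfl
      | succ n ih =>
        intro s hs
        rw [pow_succ] at hs
        refine Submodule.mul_induction_on hs ?_ fun x y hx hy => by rw [map_add, map_add, hx, hy]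
        rintro s hs _ ⟨x, rfl⟩
        rw [map_mul, ih s hs, grade, lift_ofGen, LinearMap.comp_apply, monoL_mul]
    rw [deg, Submodule.mul_le]
    intro s hs t ht
    rw [LinearMap.mem_ker, LinearMap.sub_apply, AlgHom.toLinearMap_apply, map_mul, h0 s hs,
      h1 n t ht, monoL_mul, zero_add, sub_self]
  exact sub_eq_zero.1 (LinearMap.mem_ker.1 (hle hs))

/-- The projection to the homogeneous component of degree `n`. -/
def proj (n : ℕ) : S →ₗ[k] S :=
  ((Polynomial.lcoeff S n).restrictScalars k) ∘ₗ grade.toLinearMap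

theorem proj_apply (n : ℕ) (s : S) : proj n s = (grade s).coeff n := rfl

theorem proj_of_mem {m n : ℕ} {s : S} (hs : s ∈ deg pA pE act m) :
    proj n s = if m = n then s else 0 := by
  rw [proj_apply, grade_of_mem hs]
  exact Polynomial.coeff_monomial

theorem grade_ofFun (f : A) : grade (ofFun pA pE act f) = Polynomial.C (ofFun pA pE act f) :=
  lift_ofFun f

theorem proj_mul_ofFun (n : ℕ) (s : S) (f : A) :
    proj n (s * ofFun pA pE act f) = proj n s * ofFun pA pE act f := by
  rw [proj_apply, proj_apply, map_mul, grade_ofFun, Polynomial.coeff_mul_C]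

theorem proj_ofFun_mul (n : ℕ) (s : S) (f : A) :
    proj n (ofFun pA pE act f * s) = ofFun pA pE act f * proj n s := by
  rw [proj_apply, proj_apply, map_mul, grade_ofFun, Polynomial.coeff_C_mul]

end SuperSym

namespace Superspace

variable {k : Type u} [Field k] [CharZero k] {M : Superspace k} {U : Opens M.X} {p q : ℕ}

/-- The projection to the part of bidegree `(i, j)`. -/
def projVirt (U : Opens M.X) (i j : ℕ) : M.PreVirt U →ₗ[k] M.PreVirt U :=
  liftVirt (virtMk U ∘ₗ TensorProduct.map (SuperSym.proj i)
      (TensorProduct.map LinearMap.id (SuperSym.proj j)))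
    (fun ω f F τ => by
      simp only [LinearMap.comp_apply, TensorProduct.map_tmul, LinearMap.id_apply]
      change tmul (SuperSym.proj i (ω * Forms.ofFun f)) F (SuperSym.proj j τ) =
        tmul (SuperSym.proj i ω) (M.funD f * F) (SuperSym.proj j τ)
      rw [SuperSym.proj_mul_ofFun, tmul_fun_left])
    (fun ω f F τ => by
      simp only [LinearMap.comp_apply, TensorProduct.map_tmul, LinearMap.id_apply]
      change tmul (SuperSym.proj i ω) (F * M.funD f) (SuperSym.proj j τ) =
        tmul (SuperSym.proj i ω) F (SuperSym.proj j (Poly.ofFun f * τ))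
      rw [SuperSym.proj_ofFun_mul, tmul_fun_right])

theorem projVirt_tmul (i j : ℕ) (ω : M.Forms U) (F : M.D U) (τ : M.Poly U) :
    projVirt U i j (tmul ω F τ) = tmul (SuperSym.proj i ω) F (SuperSym.proj j τ) := rfl

theorem projVirt_of_mem {i j i' j' : ℕ} {t : M.PreVirt U} (ht : t ∈ M.virtDeg U i' j') :
    projVirt U i j t = if (i', j') = (i, j) then t else 0 := by
  have : M.virtDeg U i' j' ≤ LinearMap.ker
      (projVirt U i j - if (i', j') = (i, j) then LinearMap.id else 0) := by
    refine Submodule.span_le.2 ?_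
    rintro _ ⟨ω, hω, F, τ, hτ, rfl⟩
    refine LinearMap.mem_ker.2 ?_
    rw [LinearMap.sub_apply, projVirt_tmul, SuperSym.proj_of_mem hω, SuperSym.proj_of_mem hτ,
      sub_eq_zero]
    by_cases hi : i' = i <;> by_cases hj : j' = j <;>
      simp [hi, hj, tmul_zero_left, tmul_zero_right]
  have h := sub_eq_zero.1 ((LinearMap.sub_apply _ _ t).symm.trans (LinearMap.mem_ker.1 (this ht)))
  rw [h]
  split_ifs <;> rfl

theorem iSup_virtDeg (x : M.Coords p q U) : ⨆ ij : ℕ × ℕ, M.virtDeg U ij.1 ij.2 = ⊤ := by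
  rw [eq_top_iff]
  have key : ∀ (ω : M.Forms U) F (τ : M.Poly U),
      tmul ω F τ ∈ ⨆ ij : ℕ × ℕ, M.virtDeg U ij.1 ij.2 := by
    intro ω F τ
    have hω : ω ∈ ⨆ n, M.formsDeg U n := by
      rw [show ⨆ n, M.formsDeg U n = ⊤ from x.formFrame.iSup_deg]; trivial
    have hτ : τ ∈ ⨆ n, M.polyDeg U n := by
      rw [show ⨆ n, M.polyDeg U n = ⊤ from x.polyFrame.iSup_deg]; trivial
    refine Submodule.iSup_induction _ (motive := fun ω => tmul ω F τ ∈ _) hω (fun i ω hω => ?_)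
      (by rw [tmul_zero_left]; exact zero_mem _)
      fun s t hs ht => by rw [tmul_add_left]; exact add_mem hs ht
    refine Submodule.iSup_induction _ (motive := fun τ => tmul ω F τ ∈ _) hτ (fun j τ hτ => ?_)
      (by rw [tmul_zero_right]; exact zero_mem _)
      fun s t hs ht => by rw [tmul_add_right]; exact add_mem hs ht
    exact Submodule.mem_iSup_of_mem (i, j) (Submodule.subset_span ⟨ω, hω, F, τ, hτ, rfl⟩)
  have : (⨆ ij : ℕ × ℕ, M.virtDeg U ij.1 ij.2).mkQ = 0 :=
    M.preVirt_ext fun ω F τ => (Submodule.Quotient.mk_eq_zero _).2 (key ω F τ)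
  intro t _
  exact (Submodule.Quotient.mk_eq_zero _).1 (LinearMap.congr_fun this t)

/-- Independence comes from the projections, which exist because the relations of the supersymmetric
algebras and of the tensor product are homogeneous; spanning comes from the bases. -/
theorem isInternal_virtDeg (x : M.Coords p q U) :
    DirectSum.IsInternal fun ij : ℕ × ℕ => M.virtDeg U ij.1 ij.2 := by
  refine (DirectSum.isInternal_submodule_iff_iSupIndep_and_iSup_eq_top _).2
    ⟨fun ij => ?_, iSup_virtDeg x⟩
  rw [Submodule.disjoint_def]
  intro t ht ht'
  have h1 : projVirt U ij.1 ij.2 t = t := by rw [projVirt_of_mem ht, if_pos rfl]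
  have h2 : ⨆ j, ⨆ (_ : j ≠ ij), M.virtDeg U j.1 j.2 ≤ LinearMap.ker (projVirt U ij.1 ij.2) :=
    iSup_le fun j => iSup_le fun hj s hs => LinearMap.mem_ker.2 (by
      rw [projVirt_of_mem hs, if_neg hj])
  rw [← h1]
  exact LinearMap.mem_ker.1 (h2 ht')

end Superspace
end SuperGeom
end

noncomputable section
set_option linter.unusedSectionVars false
set_option linter.unusedVariables false
namespace SuperGeom

/-! ### Gluing of local operators -/

section gluing

variable {k : Type u} [Field k] {X : TopCat.{u}}

local notation "J" => Opens.grothendieckTopology X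

/-- The restriction maps of a presheaf of modules. -/
abbrev resP (P : X.Presheaf (ModuleCat.{u} k)) {U V : Opens X} (h : V ≤ U) :
    P.obj (op U) →ₗ[k] P.obj (op V) := (P.map (homOfLE h).op).hom

/-- The map from a presheaf to the associated sheaf. -/
abbrev sh (P : X.Presheaf (ModuleCat.{u} k)) (U : Opens X) : P.obj (op U) →ₗ[k]
    ((presheafToSheaf J (ModuleCat.{u} k)).obj P).obj.obj (op U) :=
  ((toSheafify J P).app (op U)).hom

theorem sh_res (P : X.Presheaf (ModuleCat.{u} k)) {U V : Opens X} (h : V ≤ U) (t : P.obj (op U)) :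
    resP ((presheafToSheaf J (ModuleCat.{u} k)).obj P).obj h (sh P U t) = sh P V (resP P h t) :=
  (LinearMap.congr_fun (congrArg ModuleCat.Hom.hom
    ((toSheafify J P).naturality (homOfLE h).op)) t).symm

theorem hom_res {P Q : X.Presheaf (ModuleCat.{u} k)} (φ : P ⟶ Q) {U V : Opens X} (h : V ≤ U)
    (t : P.obj (op U)) : resP Q h ((φ.app (op U)).hom t) = (φ.app (op V)).hom (resP P h t) :=
  (LinearMap.congr_fun (congrArg ModuleCat.Hom.hom (φ.naturality (homOfLE h).op)) t).symm

theorem presheafToSheaf_map_sh {P Q : X.Presheaf (ModuleCat.{u} k)} (φ : P ⟶ Q) (U : Opens X)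
    (t : P.obj (op U)) :
    (((presheafToSheaf J _).map φ).hom.app (op U)).hom (sh P U t) =
      sh Q U ((φ.app (op U)).hom t) :=
  (LinearMap.congr_fun (congrArg ModuleCat.Hom.hom (congrArg (fun α => α.app (op U))
    (toSheafify_naturality J φ))) t).symm

variable {B : Opens X → Prop} (hB : Opens.IsBasis (Set.range (Subtype.val : {V // B V} → Opens X)))

include hB in
/-- A natural family of linear maps over a basis, from a presheaf to a sheaf, extends to the
associated sheaf. -/
theorem exists_hom_of_basis (P : X.Presheaf (ModuleCat.{u} k)) (F : Sheaf J (ModuleCat.{u} k))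
    (g : ∀ V : {V // B V}, P.obj (op V.1) →ₗ[k] F.obj.obj (op V.1))
    (nat : ∀ (V W : {V // B V}) (h : W.1 ≤ V.1) (t : P.obj (op V.1)),
      resP F.obj h (g V t) = g W (resP P h t)) :
    ∃ φ : (presheafToSheaf J _).obj P ⟶ F,
      ∀ (V : {V // B V}) (t : P.obj (op V.1)), (φ.hom.app (op V.1)).hom (sh P V.1 t) = g V t := by
  let α : (inducedFunctor (Subtype.val : {V // B V} → Opens X)).op ⋙ P ⟶
      (inducedFunctor (Subtype.val : {V // B V} → Opens X)).op ⋙ F.1 :=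
    { app := fun V => ModuleCat.ofHom (g V.unop)
      naturality := fun V W f => ModuleCat.hom_ext (LinearMap.ext fun t =>
        (nat V.unop W.unop f.unop.hom.le t).symm) }
  -- A map of presheaves over a basis extends to all open sets because the target is a sheaf; for
  -- the same reason it then factors through the sheafification.
  let β : P ⟶ F.obj := TopCat.Sheaf.restrictHomEquivHom P F hB α
  refine ⟨⟨sheafifyLift _ β F.property⟩, fun V t => ?_⟩
  have h1 : β.app (op V.1) = ModuleCat.ofHom (g V) := TopCat.Sheaf.extend_hom_app P F hB α V
  have h2 := toSheafify_sheafifyLift J β F.property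
  have h3 := LinearMap.congr_fun (congrArg (fun γ : P ⟶ F.obj => (γ.app (op V.1)).hom) h2) t
  exact h3.trans (congrArg (fun γ => ModuleCat.Hom.hom γ t) h1)

include hB in
/-- Morphisms out of an associated sheaf agree if they agree on the presheaf over a basis. -/
theorem hom_ext_of_basis {P : X.Presheaf (ModuleCat.{u} k)} {F : Sheaf J (ModuleCat.{u} k)}
    {φ ψ : (presheafToSheaf J _).obj P ⟶ F}
    (h : ∀ (V : {V // B V}) (t : P.obj (op V.1)),
      (φ.hom.app (op V.1)).hom (sh P V.1 t) = (ψ.hom.app (op V.1)).hom (sh P V.1 t)) : φ = ψ := by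
  refine Sheaf.hom_ext (sheafify_hom_ext _ _ _ F.property ?_)
  refine TopCat.Sheaf.hom_ext P F hB fun V => ?_
  exact ModuleCat.hom_ext (LinearMap.ext fun t => h V t)

variable (T : Opens X → Type u) [∀ U, AddCommGroup (T U)] [∀ U, Module k (T U)]
  (r : ∀ {U V : Opens X}, V ≤ U → T U →ₗ[k] T V) (r_id : ∀ U, r (le_refl U) = LinearMap.id)
  (r_comp : ∀ {U V W : Opens X} (h : V ≤ U) (h' : W ≤ V), r (h'.trans h) = r h' ∘ₗ r h)

/-- The presheaf with given sections and restriction maps. -/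
def preOf : X.Presheaf (ModuleCat.{u} k) where
  obj U := ModuleCat.of k (T U.unop)
  map i := ModuleCat.ofHom (r i.unop.le)
  map_id U := by rw [← ModuleCat.ofHom_id, ← r_id]
  map_comp i j := by rw [← ModuleCat.ofHom_comp, ← r_comp]

variable {T} (A : ∀ U, Submodule k (T U))
  (hA : ∀ {U V : Opens X} (h : V ≤ U), ∀ t ∈ A U, r h t ∈ A V)

/-- The subpresheaf with given sections. -/
def preSub : X.Presheaf (ModuleCat.{u} k) where
  obj U := ModuleCat.of k (A U.unop)
  map f := ModuleCat.ofHom ((r f.unop.le).restrict (hA f.unop.le))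
  map_id U := ModuleCat.hom_ext (LinearMap.ext fun t =>
    Subtype.ext (LinearMap.congr_fun (r_id U.unop) t.1))
  map_comp f g := ModuleCat.hom_ext (LinearMap.ext fun t =>
    Subtype.ext (LinearMap.congr_fun (r_comp f.unop.le g.unop.le) t.1))

/-- The inclusion of a subpresheaf. -/
def preSubι : preSub r r_id r_comp A hA ⟶ preOf T r r_id r_comp where
  app U := ModuleCat.ofHom (A U.unop).subtype
  naturality _ _ _ := rfl

variable {A}

include hB in
-- Phrased for `preOf`, which becomes `M.preVirt` by unfolding once `T` and `r` are `M.PreVirt` and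
-- `M.resVirt`.
theorem exists_endo_of_basis (g : ∀ V : {V // B V}, T V.1 →ₗ[k] T V.1)
    (nat : ∀ (V W : {V // B V}) (h : W.1 ≤ V.1) (t : T V.1), r h (g V t) = g W (r h t)) :
    ∃ φ : (presheafToSheaf J _).obj (preOf T r r_id r_comp) ⟶
        (presheafToSheaf J _).obj (preOf T r r_id r_comp),
      ∀ (V : {V // B V}) (t : T V.1), (φ.hom.app (op V.1)).hom (sh (preOf T r r_id r_comp) V.1 t) =
        sh (preOf T r r_id r_comp) V.1 (g V t) :=
  exists_hom_of_basis hB (preOf T r r_id r_comp) _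
    (fun V => sh (preOf T r r_id r_comp) V.1 ∘ₗ g V) fun V W h t =>
      (sh_res (preOf T r r_id r_comp) h (g V t)).trans (congrArg _ (nat V W h t))

include hB in
/-- A local operator that maps one subpresheaf to another induces a map of the associated
sheaves. -/
theorem exists_factor_of_basis {A' : ∀ U, Submodule k (T U)}
    (hA' : ∀ {U V : Opens X} (h : V ≤ U), ∀ t ∈ A' U, r h t ∈ A' V)
    {g : ∀ V : {V // B V}, T V.1 →ₗ[k] T V.1}
    (nat : ∀ (V W : {V // B V}) (h : W.1 ≤ V.1) (t : T V.1), r h (g V t) = g W (r h t))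
    {φ : (presheafToSheaf J _).obj (preOf T r r_id r_comp) ⟶
        (presheafToSheaf J _).obj (preOf T r r_id r_comp)}
    (hφ : ∀ (V : {V // B V}) (t : T V.1),
      (φ.hom.app (op V.1)).hom (sh (preOf T r r_id r_comp) V.1 t) =
        sh (preOf T r r_id r_comp) V.1 (g V t))
    (hg : ∀ (V : {V // B V}), ∀ t ∈ A V.1, g V t ∈ A' V.1) :
    ∃ ψ : (presheafToSheaf J _).obj (preSub r r_id r_comp A hA) ⟶
        (presheafToSheaf J _).obj (preSub r r_id r_comp A' hA'),
      (presheafToSheaf J _).map (preSubι r r_id r_comp A hA) ≫ φ =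
        ψ ≫ (presheafToSheaf J _).map (preSubι r r_id r_comp A' hA') := by
  obtain ⟨ψ, hψ⟩ := exists_hom_of_basis hB (preSub r r_id r_comp A hA)
    ((presheafToSheaf J _).obj (preSub r r_id r_comp A' hA'))
    (fun V => sh (preSub r r_id r_comp A' hA') V.1 ∘ₗ (g V).restrict (hg V))
    (fun V W h t => (sh_res (preSub r r_id r_comp A' hA') h _).trans
      (congrArg (sh (preSub r r_id r_comp A' hA') W.1) (Subtype.ext (nat V W h t.1))))
  refine ⟨ψ, hom_ext_of_basis hB fun V t => ?_⟩
  refine (congrArg (φ.hom.app (op V.1)).hom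
    (presheafToSheaf_map_sh (preSubι r r_id r_comp A hA) V.1 t)).trans ?_
  refine (hφ V t.1).trans ?_
  refine Eq.trans ?_ (congrArg ((((presheafToSheaf J _).map
    (preSubι r r_id r_comp A' hA')).hom.app (op V.1)).hom) (hψ V t)).symm
  exact (presheafToSheaf_map_sh (preSubι r r_id r_comp A' hA') V.1
    ((g V).restrict (hg V) t)).symm

include hB in
theorem factor_eq_zero_of_basis {g : ∀ V : {V // B V}, T V.1 →ₗ[k] T V.1}
    {φ : (presheafToSheaf J _).obj (preOf T r r_id r_comp) ⟶
        (presheafToSheaf J _).obj (preOf T r r_id r_comp)}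
    (hφ : ∀ (V : {V // B V}) (t : T V.1),
      (φ.hom.app (op V.1)).hom (sh (preOf T r r_id r_comp) V.1 t) =
        sh (preOf T r r_id r_comp) V.1 (g V t))
    (hg : ∀ (V : {V // B V}), ∀ t ∈ A V.1, g V t = 0) :
    (presheafToSheaf J _).map (preSubι r r_id r_comp A hA) ≫ φ = 0 := by
  refine hom_ext_of_basis hB fun V t => ?_
  refine (congrArg (φ.hom.app (op V.1)).hom
    (presheafToSheaf_map_sh (preSubι r r_id r_comp A hA) V.1 t)).trans ?_
  refine (hφ V t.1).trans ?_
  rw [hg V t.1 t.2]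
  exact map_zero _

include hB in
/-- If sections over a basis decompose as direct sums, then so does the associated sheaf. -/
theorem directSum_of_basis {ι : Type} [DecidableEq ι] (A : ι → ∀ U, Submodule k (T U))
    (hA : ∀ (i : ι) {U V : Opens X} (h : V ≤ U), ∀ t ∈ A i U, r h t ∈ A i V)
    (hint : ∀ V : {V // B V}, DirectSum.IsInternal fun i => A i V.1) :
    Nonempty (Limits.IsColimit (Limits.Cofan.mk
      ((presheafToSheaf J _).obj (preOf T r r_id r_comp)) fun i =>
        (presheafToSheaf J _).map (preSubι r r_id r_comp (A i) (hA i)))) := by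
  have hsup : ∀ V : {V // B V}, ⨆ i, A i V.1 = ⊤ := fun V => (hint V).submodule_iSup_eq_top
  -- The universal property of the direct sum: over a basic open set the given maps combine through
  -- the decomposition of the sections, and naturality is checked on the summands.
  have key : ∀ (G : Sheaf J (ModuleCat.{u} k))
      (f : ∀ i, (presheafToSheaf J _).obj (preSub r r_id r_comp (A i) (hA i)) ⟶ G),
      ∃ φ : (presheafToSheaf J _).obj (preOf T r r_id r_comp) ⟶ G,
        ∀ i, (presheafToSheaf J _).map (preSubι r r_id r_comp (A i) (hA i)) ≫ φ = f i := by
    intro G f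
    let gi : ∀ (V : {V // B V}) (i : ι), A i V.1 →ₗ[k] G.obj.obj (op V.1) := fun V i =>
      ((f i).hom.app (op V.1)).hom ∘ₗ sh (preSub r r_id r_comp (A i) (hA i)) V.1
    let eV : ∀ V : {V // B V}, (DirectSum ι fun i => A i V.1) ≃ₗ[k] T V.1 := fun V =>
      LinearEquiv.ofBijective (DirectSum.coeLinearMap fun i => A i V.1) (hint V)
    let g : ∀ V : {V // B V}, T V.1 →ₗ[k] G.obj.obj (op V.1) := fun V =>
      DirectSum.toModule k ι _ (gi V) ∘ₗ (eV V).symm.toLinearMap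
    have hg : ∀ V i (t : A i V.1), g V t.1 = gi V i t := by
      intro V i t
      have : (eV V).symm t.1 = DirectSum.lof k ι (fun i => A i V.1) i t := by
        rw [LinearEquiv.symm_apply_eq]
        exact (DirectSum.coeLinearMap_lof (fun i => A i V.1) i t).symm
      change DirectSum.toModule k ι _ (gi V) ((eV V).symm t.1) = _
      rw [this, DirectSum.toModule_lof]
    obtain ⟨φ, hφ⟩ := exists_hom_of_basis hB (preOf T r r_id r_comp) G g (by
      intro V W h t
      change resP G.obj h (g V t) = g W (r h t)
      have ht : (t : T V.1) ∈ ⨆ i, A i V.1 := by rw [hsup]; trivial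
      refine Submodule.iSup_induction _ (motive := fun t => resP G.obj h (g V t) = g W (r h t)) ht
        (fun i t ht => ?_) (by simp only [map_zero])
        (fun s t hs ht => by simp only [map_add]; rw [hs, ht])
      refine (congrArg _ (hg V i ⟨t, ht⟩)).trans ?_
      refine Eq.trans ?_ (hg W i ⟨_, hA i h t ht⟩).symm
      refine (hom_res (f i).hom h _).trans (congrArg _ ?_)
      exact sh_res (preSub r r_id r_comp (A i) (hA i)) h _)
    refine ⟨φ, fun i => hom_ext_of_basis hB fun V t => ?_⟩
    refine (congrArg ((φ.hom.app (op V.1)).hom)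
      (presheafToSheaf_map_sh (preSubι r r_id r_comp (A i) (hA i)) V.1 t)).trans ?_
    exact (hφ V t.1).trans (hg V i t)
  refine ⟨Limits.Cofan.IsColimit.mk _ (fun s => (key s.pt s.inj).choose)
    (fun s => (key s.pt s.inj).choose_spec) fun s m hm => ?_⟩
  refine hom_ext_of_basis hB fun V t => ?_
  have ht : (t : T V.1) ∈ ⨆ i, A i V.1 := by rw [hsup]; trivial
  refine Submodule.iSup_induction _ (motive := fun t =>
    (m.hom.app (op V.1)).hom (sh (preOf T r r_id r_comp) V.1 t) =
      ((key s.pt s.inj).choose.hom.app (op V.1)).hom (sh (preOf T r r_id r_comp) V.1 t)) ht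
    (fun i t ht => ?_) ?_ (fun s' t hs ht => ?_)
  · have h1 := presheafToSheaf_map_sh (preSubι r r_id r_comp (A i) (hA i)) V.1 ⟨t, ht⟩
    have h2 := (hm i).trans ((key s.pt s.inj).choose_spec i).symm
    refine (congrArg _ h1.symm).trans (Eq.trans ?_ (congrArg _ h1))
    exact congrArg (fun γ : (presheafToSheaf J _).obj (preSub r r_id r_comp (A i) (hA i)) ⟶ s.pt =>
      (γ.hom.app (op V.1)).hom
      (sh (preSub r r_id r_comp (A i) (hA i)) V.1 ⟨t, ht⟩)) h2
  · exact (map_zero ((m.hom.app (op V.1)).hom ∘ₗ sh (preOf T r r_id r_comp) V.1)).trans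
      (map_zero (((key s.pt s.inj).choose.hom.app (op V.1)).hom ∘ₗ
        sh (preOf T r r_id r_comp) V.1)).symm
  · refine (map_add ((m.hom.app (op V.1)).hom ∘ₗ sh (preOf T r r_id r_comp) V.1) s' t).trans ?_
    refine (congrArg₂ (· + ·) hs ht).trans ?_
    exact (map_add (((key s.pt s.inj).choose.hom.app (op V.1)).hom ∘ₗ
        sh (preOf T r r_id r_comp) V.1) s' t).symm

end gluing

end SuperGeom
end

noncomputable section
set_option linter.unusedSectionVars false
set_option linter.unusedVariables false
namespace SuperGeom
namespace Superspace

variable {k : Type u} [Field k] [CharZero k] {M : Superspace k} {p q : ℕ}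

/-! ### The double complex -/

variable (M p q) in
/-- `M` is covered by coordinate open sets. -/
def HasCoords : Prop := ∀ m : M.X, ∃ U, m ∈ U ∧ Nonempty (M.Coords p q U)

variable (M p q) in
/-- The coordinate open sets. -/
abbrev CoordOpen : Type u := {V : Opens M.X // Nonempty (M.Coords p q V)}

/-- Coordinates restrict to every smaller open set. -/
theorem HasCoords.isBasis (hM : M.HasCoords p q) :
    Opens.IsBasis (Set.range (Subtype.val : M.CoordOpen p q → Opens M.X)) := by
  rw [Opens.isBasis_iff_nbhd]
  intro U m hm
  obtain ⟨V, hV, ⟨x⟩⟩ := hM m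
  exact ⟨U ⊓ V, ⟨⟨U ⊓ V, ⟨x.restrict inf_le_right⟩⟩, rfl⟩, ⟨hm, hV⟩, inf_le_left⟩

/-- Local operators on tensors, as operators on sections of the sheaf of virtual superforms. -/
theorem HasCoords.exists_virt (hM : M.HasCoords p q)
    (g : ∀ V : M.CoordOpen p q, M.PreVirt V.1 →ₗ[k] M.PreVirt V.1)
    (nat : ∀ (V W : M.CoordOpen p q) (h : W.1 ≤ V.1) (t : M.PreVirt V.1),
      M.resVirt h (g V t) = g W (M.resVirt h t)) :
    ∃ φ : M.Virt ⟶ M.Virt, ∀ (V : M.CoordOpen p q) (t : M.PreVirt V.1),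
      onSec φ V.1 (M.toVirt V.1 t) = M.toVirt V.1 (g V t) :=
  exists_endo_of_basis hM.isBasis M.resVirt M.resVirt_id M.resVirt_comp g nat

theorem HasCoords.virt_ext (hM : M.HasCoords p q) {φ ψ : M.Virt ⟶ M.Virt}
    (h : ∀ (V : M.CoordOpen p q) (t : M.PreVirt V.1),
      onSec φ V.1 (M.toVirt V.1 t) = onSec ψ V.1 (M.toVirt V.1 t)) : φ = ψ :=
  hom_ext_of_basis hM.isBasis h

/-- A local operator of bidegree `(i, j) → (i', j')` induces a map of the graded parts. -/
theorem HasCoords.exists_virtDeg (hM : M.HasCoords p q) {φ : M.Virt ⟶ M.Virt}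
    {g : ∀ V : M.CoordOpen p q, M.PreVirt V.1 →ₗ[k] M.PreVirt V.1}
    (nat : ∀ (V W : M.CoordOpen p q) (h : W.1 ≤ V.1) (t : M.PreVirt V.1),
      M.resVirt h (g V t) = g W (M.resVirt h t))
    (hφ : ∀ (V : M.CoordOpen p q) (t : M.PreVirt V.1),
      onSec φ V.1 (M.toVirt V.1 t) = M.toVirt V.1 (g V t))
    {i j i' j' : ℕ} (hg : ∀ (V : M.CoordOpen p q), ∀ t ∈ M.virtDeg V.1 i j,
      g V t ∈ M.virtDeg V.1 i' j') :
    ∃ ψ : M.VirtDeg i j ⟶ M.VirtDeg i' j', M.VirtDegι i j ≫ φ = ψ ≫ M.VirtDegι i' j' :=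
  exists_factor_of_basis hM.isBasis M.resVirt M.resVirt_id M.resVirt_comp
    (fun h => M.resVirt_mem_virtDeg h i j) (fun h => M.resVirt_mem_virtDeg h i' j') nat hφ hg

theorem HasCoords.virtDeg_comp_eq_zero (hM : M.HasCoords p q) {φ : M.Virt ⟶ M.Virt}
    {g : ∀ V : M.CoordOpen p q, M.PreVirt V.1 →ₗ[k] M.PreVirt V.1}
    (nat : ∀ (V W : M.CoordOpen p q) (h : W.1 ≤ V.1) (t : M.PreVirt V.1),
      M.resVirt h (g V t) = g W (M.resVirt h t))
    (hφ : ∀ (V : M.CoordOpen p q) (t : M.PreVirt V.1),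
      onSec φ V.1 (M.toVirt V.1 t) = M.toVirt V.1 (g V t))
    {i j : ℕ} (hg : ∀ (V : M.CoordOpen p q), ∀ t ∈ M.virtDeg V.1 i j, g V t = 0) :
    M.VirtDegι i j ≫ φ = 0 :=
  factor_eq_zero_of_basis hM.isBasis M.resVirt M.resVirt_id M.resVirt_comp
    (fun h => M.resVirt_mem_virtDeg h i j) hφ hg

/-- The sheaf of virtual superforms is the direct sum of its graded parts. -/
theorem HasCoords.directSum (hM : M.HasCoords p q) : Nonempty (Limits.IsColimit
    (Limits.Cofan.mk M.Virt fun ij : ℕ × ℕ => M.VirtDegι ij.1 ij.2)) := by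
  have h := directSum_of_basis hM.isBasis M.resVirt M.resVirt_id M.resVirt_comp
    (fun (ij : ℕ × ℕ) U => M.virtDeg U ij.1 ij.2) (fun ij _ _ h => M.resVirt_mem_virtDeg h ij.1 ij.2)
    fun V => isInternal_virtDeg V.2.some
  unfold Virt VirtDegι VirtDeg preVirt preVirtDegι preVirtDeg
  exact h

/-- The existence and uniqueness of the double complex of virtual superforms, on a space with local
coordinates. -/
theorem HasCoords.exists_doubleComplex (hM : M.HasCoords p q) :
    ∃ d' δ' : M.Virt ⟶ M.Virt,
      (∀ φ, M.IsHatD p q φ ↔ φ = d') ∧ (∀ φ, M.IsHatDelta p q φ ↔ φ = δ') ∧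
      M.IsDoubleComplex d' δ' ∧ (d' + δ') ≫ (d' + δ') = 0 := by
  let c : ∀ V : M.CoordOpen p q, M.Calculus V.2.some := fun V => V.2.some.calculus
  -- The system chosen on `W` need not be the restriction of the one chosen on `V`; independence of
  -- the coordinates bridges the gap.
  have natD : ∀ (V W : M.CoordOpen p q) (h : W.1 ≤ V.1) (t : M.PreVirt V.1),
      M.resVirt h ((c V).hatD t) = (c W).hatD (M.resVirt h t) := fun V W h t => by
    rw [(c V).resVirt_hatD h (V.2.some.restrict h).calculus, Calculus.hatD_change _ (c W)]
  have natδ : ∀ (V W : M.CoordOpen p q) (h : W.1 ≤ V.1) (t : M.PreVirt V.1),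
      M.resVirt h ((c V).hatDelta t) = (c W).hatDelta (M.resVirt h t) := fun V W h t => by
    rw [(c V).resVirt_hatDelta h (V.2.some.restrict h).calculus, Calculus.hatDelta_change _ (c W)]
  obtain ⟨d', hd'⟩ := hM.exists_virt (fun V => (c V).hatD) natD
  obtain ⟨δ', hδ'⟩ := hM.exists_virt (fun V => (c V).hatDelta) natδ
  have onSec_comp : ∀ (φ ψ : M.Virt ⟶ M.Virt) (U : Opens M.X) (s),
      onSec (φ ≫ ψ) U s = onSec ψ U (onSec φ U s) := fun _ _ _ _ => rfl
  have hdd : d' ≫ d' = 0 := hM.virt_ext fun V t => by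
    rw [onSec_comp, hd', hd', Calculus.hatD_hatD, map_zero]; rfl
  have hδδ : δ' ≫ δ' = 0 := hM.virt_ext fun V t => by
    rw [onSec_comp, hδ', hδ', Calculus.hatDelta_hatDelta, map_zero]; rfl
  have hanti : δ' ≫ d' + d' ≫ δ' = 0 := hM.virt_ext fun V t => by
    change onSec (δ' ≫ d') V.1 (M.toVirt V.1 t) + onSec (d' ≫ δ') V.1 (M.toVirt V.1 t) = 0
    rw [onSec_comp, onSec_comp, hd', hδ', hd', hδ', ← map_add, Calculus.hatD_hatDelta, map_zero]
  refine ⟨d', δ', fun φ => ⟨fun hφ => hM.virt_ext fun V t => ?_, ?_⟩,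
    fun φ => ⟨fun hφ => hM.virt_ext fun V t => ?_, ?_⟩, ⟨hM.directSum, fun i j => ?_,
    fun i j => ?_, fun i => ?_, hdd, hδδ, hanti⟩, ?_⟩
  -- The formula prescribes the values on tensors with homogeneous `ω`; these span. For `\hat δ`
  -- below, all three factors are decomposed.
  · rw [hd']
    refine LinearMap.congr_fun (M.preVirt_ext (φ := onSec φ V.1 ∘ₗ M.toVirt V.1)
      (ψ := M.toVirt V.1 ∘ₗ (c V).hatD) fun ω F τ => ?_) t
    refine V.2.some.formFrame.isSuperAlg.induction (C := fun ω =>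
      (onSec φ V.1 ∘ₗ M.toVirt V.1) (tmul ω F τ) = (M.toVirt V.1 ∘ₗ (c V).hatD) (tmul ω F τ))
      (fun ε ω hω => ?_) (fun f g hf hg => by rw [tmul_add_left, map_add, map_add, hf, hg]) ω
    rw [LinearMap.comp_apply, LinearMap.comp_apply, hφ V.1 _ (c V) ε ω F τ hω,
      (c V).hatD_eq_D₁ hω]
  · rintro rfl U x C ε ω F τ hω
    rw [hd' ⟨U, ⟨x⟩⟩, ← C.hatD_eq_D₁ hω, C.hatD_change (c ⟨U, ⟨x⟩⟩)]
  · rw [hδ']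
    refine LinearMap.congr_fun (M.preVirt_ext (φ := onSec φ V.1 ∘ₗ M.toVirt V.1)
      (ψ := M.toVirt V.1 ∘ₗ (c V).hatDelta) fun ω F τ => ?_) t
    refine V.2.some.formFrame.isSuperAlg.induction (C := fun ω =>
      (onSec φ V.1 ∘ₗ M.toVirt V.1) (tmul ω F τ) = (M.toVirt V.1 ∘ₗ (c V).hatDelta) (tmul ω F τ))
      (fun ε ω hω => ?_) (fun f g hf hg => by rw [tmul_add_left, map_add, map_add, hf, hg]) ω
    refine D_induction (C := fun F =>
      (onSec φ V.1 ∘ₗ M.toVirt V.1) (tmul ω F τ) = (M.toVirt V.1 ∘ₗ (c V).hatDelta) (tmul ω F τ))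
      (fun η F hF => ?_) (fun f g hf hg => by rw [tmul_add_mid, map_add, map_add, hf, hg]) F
    refine V.2.some.polyFrame.isSuperAlg.induction (C := fun τ =>
      (onSec φ V.1 ∘ₗ M.toVirt V.1) (tmul ω F τ) = (M.toVirt V.1 ∘ₗ (c V).hatDelta) (tmul ω F τ))
      (fun t τ hτ => ?_) (fun f g hf hg => by rw [tmul_add_right, map_add, map_add, hf, hg]) τ
    rw [LinearMap.comp_apply, LinearMap.comp_apply, hφ V.1 _ (c V) ε η t ω F τ hω hF hτ,
      (c V).hatDelta_eq_δ₁ hω hF (t := t), map_zsmul]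
  · rintro rfl U x C ε η t ω F τ hω hF hτ
    rw [hδ' ⟨U, ⟨x⟩⟩, ← map_zsmul, ← C.hatDelta_eq_δ₁ hω hF (t := t),
      C.hatDelta_change (c ⟨U, ⟨x⟩⟩)]
  · exact hM.exists_virtDeg natD hd' fun V t ht => (c V).hatD_mem ht
  · exact hM.exists_virtDeg natδ hδ' fun V t ht => (c V).hatDelta_mem ht
  · exact hM.virtDeg_comp_eq_zero natδ hδ' fun V t ht => (c V).hatDelta_eq_zero ht
  · rw [Preadditive.add_comp, Preadditive.comp_add, Preadditive.comp_add, hdd, hδδ, zero_add,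
      add_zero, add_comm]
    exact hanti

end Superspace
end SuperGeom
end

noncomputable section
set_option linter.unusedSectionVars false
set_option linter.unusedVariables false
namespace SuperGeom

/-! ### Algebras of the form `B ⊗ Λ(θ_1, …, θ_q)` -/

/-- The ordered product `θ^I`. -/
def thetaProd {A : Type*} [Ring A] {q : ℕ} (θ : Fin q → A) (I : Finset (Fin q)) : A :=
  ((I.sort (· ≤ ·)).map θ).prod

theorem map_thetaProd {A A' : Type*} [Ring A] [Ring A'] {q : ℕ} (φ : A →+* A') (θ : Fin q → A)
    (I : Finset (Fin q)) : φ (thetaProd θ I) = thetaProd (fun i => φ (θ i)) I := by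
  rw [thetaProd, thetaProd, map_list_prod, List.map_map]; rfl

@[simp] theorem thetaProd_empty {A : Type*} [Ring A] {q : ℕ} (θ : Fin q → A) :
    thetaProd θ ∅ = 1 := by simp [thetaProd]

section thetaProd

variable {A : Type*} [Ring A] {q : ℕ} {θ : Fin q → A} (h : ∀ i j, θ i * θ j = -(θ j * θ i))
  (h0 : ∀ i, θ i * θ i = 0)

include h in
theorem prod_perm {l l' : List (Fin q)} (hl : l.Perm l') :
    ∃ n : ℤ, (l.map θ).prod = n • (l'.map θ).prod := by
  induction hl with
  | nil => exact ⟨1, by simp⟩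
  | cons a _ ih =>
    obtain ⟨n, hn⟩ := ih
    exact ⟨n, by rw [List.map_cons, List.prod_cons, hn, mul_smul_comm]; rfl⟩
  | swap a b l =>
    refine ⟨-1, ?_⟩
    simp only [List.map_cons, List.prod_cons, ← mul_assoc]
    rw [h b a]; simp
  | trans _ _ ih ih' =>
    obtain ⟨n, hn⟩ := ih
    obtain ⟨m, hm⟩ := ih'
    exact ⟨n * m, by rw [hn, hm, smul_smul]⟩

include h h0 in
-- A repeated index gives zero, as `θ i` squares to zero; otherwise sorting costs a sign. Only the
-- span of the `θ^I` matters, so the integer is left unspecified.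
theorem theta_mul_thetaProd (i : Fin q) (I : Finset (Fin q)) :
    ∃ (n : ℤ) (I' : Finset (Fin q)), θ i * thetaProd θ I = n • thetaProd θ I' := by
  have hcons : θ i * thetaProd θ I = ((i :: I.sort (· ≤ ·)).map θ).prod := by
    rw [List.map_cons, List.prod_cons]; rfl
  by_cases hi : i ∈ I
  · refine ⟨0, ∅, ?_⟩
    obtain ⟨n, hn⟩ := prod_perm h (List.perm_cons_erase ((Finset.mem_sort (· ≤ ·)).2 hi))
    rw [thetaProd, hn, List.map_cons, List.prod_cons, mul_smul_comm, ← mul_assoc, h0]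
    simp
  · have hp : (i :: I.sort (· ≤ ·)).Perm ((insert i I).sort (· ≤ ·)) := by
      refine List.perm_of_nodup_nodup_toFinset_eq ?_ (Finset.sort_nodup _ _) ?_
      · exact List.nodup_cons.2 ⟨by simpa using hi, Finset.sort_nodup _ _⟩
      · ext; simp
    obtain ⟨n, hn⟩ := prod_perm h hp
    exact ⟨n, insert i I, hcons.trans hn⟩

end thetaProd

/-- The algebra `A` is `B ⊗ Λ(θ_1, …, θ_q)`, with `B` even and the `θ_i` odd. -/
structure IsSplit {k : Type u} [Field k] {A : Type u} [Ring A] [Algebra k A]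
    (pA : ZMod 2 → Submodule k A) (B : Subalgebra k A) {q : ℕ} (θ : Fin q → A) : Prop where
  alg : IsSuperAlg pA
  even : ∀ b ∈ B, b ∈ pA 0
  odd : ∀ i, θ i ∈ pA 1
  bijective : Function.Bijective fun f : Finset (Fin q) → B => ∑ I, (f I : A) * thetaProd θ I

namespace IsSplit

variable {k : Type u} [Field k] {A : Type u} [Ring A] [Algebra k A]
  {pA : ZMod 2 → Submodule k A} {B : Subalgebra k A} {q : ℕ} {θ : Fin q → A}
  (h : IsSplit pA B θ)

theorem induction (h : IsSplit pA B θ) {C : A → Prop} (base : ∀ b ∈ B, C b) (gen : ∀ i, C (θ i))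
    (mul : ∀ s t, C s → C t → C (s * t)) (add : ∀ s t, C s → C t → C (s + t)) (s : A) : C s := by
  obtain ⟨f, rfl⟩ := h.bijective.2 s
  refine Finset.sum_induction _ C add (base 0 B.zero_mem) fun I _ => mul _ _ (base _ (f I).2) ?_
  rw [thetaProd]
  induction I.sort (· ≤ ·) with
  | nil => exact base 1 B.one_mem
  | cons a l ih => rw [List.map_cons, List.prod_cons]; exact mul _ _ (gen a) ih

theorem isDer_ext (h : IsSplit pA B θ) {ε : ZMod 2} {D D' : Module.End k A} (hD : IsDer pA ε D)
    (hD' : IsDer pA ε D') (h₀ : ∀ b ∈ B, D b = D' b) (h₁ : ∀ i, D (θ i) = D' (θ i)) : D = D' := by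
  refine LinearMap.ext (h.induction h₀ h₁ (fun s t hs ht => ?_) fun s t hs ht => ?_)
  · rw [hD.apply_mul h.alg, hD'.apply_mul h.alg, hs, ht]
  · rw [map_add, map_add, hs, ht]

/-- The components of an element of `B ⊗ Λ(θ_1, …, θ_q)`. -/
def coef (h : IsSplit pA B θ) : A ≃ₗ[k] (Finset (Fin q) → B) :=
  (LinearEquiv.ofBijective
    { toFun := fun f : Finset (Fin q) → B => ∑ I, (f I : A) * thetaProd θ I
      map_add' := fun f g => by simp [add_mul, Finset.sum_add_distrib]
      map_smul' := fun c f => by simp [Finset.smul_sum] } h.bijective).symm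

theorem sum_coef (s : A) : ∑ I, (h.coef s I : A) * thetaProd θ I = s :=
  h.coef.symm_apply_apply s

theorem coef_sum (f : Finset (Fin q) → B) : h.coef (∑ I, (f I : A) * thetaProd θ I) = f :=
  h.coef.apply_symm_apply f

theorem coef_mul (s : A) (b : B) (I : Finset (Fin q)) : h.coef (b * s) I = b * h.coef s I := by
  have : (b : A) * s = ∑ I, ((b * h.coef s I : B) : A) * thetaProd θ I := by
    conv_lhs => rw [← h.sum_coef s]
    rw [Finset.mul_sum]
    exact Finset.sum_congr rfl fun I _ => (mul_assoc _ _ _).symm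
  rw [this, h.coef_sum (fun I => b * h.coef s I)]

/-! #### The free supersymmetric algebra over `B` with odd generators -/

variable (k B q) in
/-- All elements of `B` are even. -/
def pB (ε : ZMod 2) : Submodule k B := if ε = 0 then ⊤ else ⊥

variable (k B q) in
/-- All elements of `B ^ q` are odd. -/
def pE (ε : ZMod 2) : Submodule k (Fin q → B) := if ε = 0 then ⊥ else ⊤

variable (B q) in
/-- The module structure of `B ^ q`. -/
def actE (b : B) (x y : Fin q → B) : Prop := y = fun i => b * x i

theorem commute (h : IsSplit pA B θ) {b : A} (hb : b ∈ B) (s : A) : b * s = s * b := by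
  rw [h.alg.mul_eq_tw_mul (h.even b hb), h.alg.tw_zero]

theorem isSuperAlg_pB (h : IsSplit pA B θ) : IsSuperAlg (pB k B) where
  isCompl := by simpa [pB] using isCompl_top_bot
  one_mem := by simp [pB]
  mul_mem := by
    intro ε η f g hf hg
    rcases zmod2_cases ε with rfl | rfl <;> rcases zmod2_cases η with rfl | rfl <;>
      simp_all [pB]
  comm := by
    intro ε η f g hf hg
    rcases zmod2_cases ε with rfl | rfl <;> rcases zmod2_cases η with rfl | rfl <;>
      simp_all [pB]
    exact Subtype.ext (h.commute f.2 g)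

/-- The frame of the free module with odd generators. -/
def frame (h : IsSplit pA B θ) : SuperSym.Frame (pB k B) (pE k B q) (actE B q)
    (fun _ : Fin q => (1 : ZMod 2)) where
  alg := h.isSuperAlg_pB
  e i := Pi.single i 1
  e_mem i := by simp [pE]
  coef i := LinearMap.proj i
  coef_mem i η x hx := by
    rcases zmod2_cases η with rfl | rfl
    · have : x = 0 := by simpa [pE] using hx
      simp [this]
    · rw [show (1 : ZMod 2) + 1 = 0 from rfl]; simp [pB]
  coef_act f x y hxy i := by
    have hf : f ∈ pB k B 0 := by simp [pB]
    rw [h.isSuperAlg_pB.tw_apply hf, mul_zero, sgn_zero, one_smul]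
    exact congrFun hxy i
  coef_e i j := by simp [Pi.single_apply]
  ofGen_eq x := by
    have hx : x = ∑ i, fun j => x i * (Pi.single i 1 : Fin q → B) j := by
      ext j; simp [Pi.single_apply]
    conv_lhs => rw [hx, map_sum]
    refine Finset.sum_congr rfl fun i _ => ?_
    rw [← SuperSym.ofFun_mul_ofGen (f := x i) (x := Pi.single i 1) rfl,
      SuperSym.ofGen_mul_ofFun (ε := 0) (η := 1) (by simp [pB]) (by simp [pE])]
    simp

/-- The comparison map from the free supersymmetric algebra. -/
def compare (h : IsSplit pA B θ) : SuperSym k (pB k B) (pE k B q) (actE B q) →ₐ[k] A :=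
  SuperSym.lift B.val.toLinearMap
    (∑ i, LinearMap.mulRight k (θ i) ∘ₗ B.val.toLinearMap ∘ₗ LinearMap.proj i)
    (map_one B.val) (fun f g => (map_mul B.val f g).symm)
    (fun f x y hxy => by
      rw [hxy]
      simp [Finset.mul_sum, mul_assoc])
    (fun ε η f hf x hx => by
      rcases zmod2_cases ε with rfl | rfl
      · simpa using (h.commute f.2 _).symm
      · have : f = 0 := by simpa [pB] using hf
        simp [this])
    (fun ε η x hx y hy => by
      rcases zmod2_cases ε with rfl | rfl
      · have : x = 0 := by simpa [pE] using hx
        simp [this]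
      rcases zmod2_cases η with rfl | rfl
      · have : y = 0 := by simpa [pE] using hy
        simp [this]
      have hm : ∀ x : Fin q → B, (∑ i, LinearMap.mulRight k (θ i) ∘ₗ B.val.toLinearMap ∘ₗ
          LinearMap.proj i) x ∈ pA 1 := fun x => by
        rw [LinearMap.sum_apply]
        refine sum_mem fun i _ => ?_
        have := h.alg.mul_mem (h.even _ (x i).2) (h.odd i)
        rwa [zero_add] at this
      exact h.alg.comm (hm x) (hm y))

theorem compare_ofFun (b : B) : h.compare (SuperSym.ofFun _ _ _ b) = b := SuperSym.lift_ofFun b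

theorem compare_gen (i : Fin q) : h.compare (h.frame.gen i) = θ i := by
  refine (SuperSym.lift_ofGen _).trans ?_
  rw [LinearMap.sum_apply, Finset.sum_eq_single i]
  · simp [frame]
  · intro j _ hj; simp [frame, hj]
  · simp

theorem compare_mem {ε : ZMod 2} {s} (hs : s ∈ SuperSym.par (pB k B) (pE k B q) (actE B q) ε) :
    h.compare s ∈ pA ε := by
  induction hs with
  | ofFun ε f hf =>
    rw [compare_ofFun]
    rcases zmod2_cases ε with rfl | rfl
    · exact h.even _ f.2
    · have : f = 0 := by simpa [pB] using hf
      rw [this]; exact zero_mem _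
  | ofGen ε x hx =>
    rcases zmod2_cases ε with rfl | rfl
    · have : x = 0 := by simpa [pE] using hx
      rw [this, map_zero, map_zero]; exact zero_mem _
    · rw [h.frame.ofGen_eq, map_sum]
      refine sum_mem fun i _ => ?_
      rw [map_mul, compare_ofFun, show h.compare (SuperSym.ofGen _ _ _ (h.frame.e i)) = θ i from
        h.compare_gen i]
      have := h.alg.mul_mem (h.odd i) (h.even _ (h.frame.coef i x).2)
      rwa [add_zero] at this
  | mul ε η s t _ _ hs ht => rw [map_mul]; exact h.alg.mul_mem hs ht
  | add ε s t _ _ hs ht => rw [map_add]; exact add_mem hs ht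

/-- Every element of the free supersymmetric algebra is a combination of the `θ^I`. -/
theorem exists_sum [CharZero k] (s : SuperSym k (pB k B) (pE k B q) (actE B q)) :
    ∃ f : Finset (Fin q) → B, s = ∑ I, SuperSym.ofFun _ _ _ (f I) * thetaProd h.frame.gen I := by
  -- The span of the `f θ^I`. It contains `1` and is stable under left multiplication by generators,
  -- hence is everything.
  let P : Submodule k (SuperSym k (pB k B) (pE k B q) (actE B q)) :=
    ⨆ I, LinearMap.range (LinearMap.mulRight k (thetaProd h.frame.gen I) ∘ₗ
      SuperSym.ofFun (pB k B) (pE k B q) (actE B q))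
  have hP : ∀ I (b : B), SuperSym.ofFun _ _ _ b * thetaProd h.frame.gen I ∈ P := fun I b =>
    Submodule.mem_iSup_of_mem I ⟨b, rfl⟩
  have hsq : ∀ i, h.frame.gen i * h.frame.gen i = 0 := fun i =>
    h.frame.isSuperAlg.odd_mul_self (h.frame.gen_mem i)
  have hanti : ∀ i j, h.frame.gen i * h.frame.gen j = -(h.frame.gen j * h.frame.gen i) :=
    fun i j => (SuperSym.comm h.isSuperAlg_pB (h.frame.gen_mem i) (h.frame.gen_mem j)).trans
      (by simp)
  have key : ∀ s, ∀ t ∈ P, s * t ∈ P := by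
    refine h.frame.induction (fun b t ht => ?_) (fun i t ht => ?_)
      (fun s s' hs hs' t ht => by rw [mul_assoc]; exact hs _ (hs' _ ht))
      (fun s s' hs hs' t ht => by rw [add_mul]; exact add_mem (hs t ht) (hs' t ht))
    · refine Submodule.iSup_induction _ (motive := fun t => _ * t ∈ P) ht ?_
        (by rw [mul_zero]; exact zero_mem _)
        (fun t t' ht ht' => by rw [mul_add]; exact add_mem ht ht')
      rintro I _ ⟨b', rfl⟩
      rw [LinearMap.comp_apply, LinearMap.mulRight_apply, ← mul_assoc, ← SuperSym.ofFun_mul]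
      exact hP _ _
    · refine Submodule.iSup_induction _ (motive := fun t => _ * t ∈ P) ht ?_
        (by rw [mul_zero]; exact zero_mem _)
        (fun t t' ht ht' => by rw [mul_add]; exact add_mem ht ht')
      rintro I _ ⟨b', rfl⟩
      obtain ⟨n, I', hn⟩ := theta_mul_thetaProd hanti hsq i I
      have hb : h.frame.gen i * SuperSym.ofFun (pB k B) (pE k B q) (actE B q) b' =
          SuperSym.ofFun _ _ _ b' * h.frame.gen i := by
        refine (SuperSym.ofGen_mul_ofFun (ε := 0) (η := 1) (by simp [pB]) (h.frame.e_mem i)).trans ?_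
        simp
      rw [LinearMap.comp_apply, LinearMap.mulRight_apply, ← mul_assoc, hb, mul_assoc, hn,
        mul_smul_comm]
      exact zsmul_mem (hP _ _) _
  have h1 : (1 : SuperSym k (pB k B) (pE k B q) (actE B q)) ∈ P := by
    have := hP ∅ 1
    rwa [SuperSym.ofFun_one, thetaProd_empty, mul_one] at this
  have hs := key s 1 h1
  rw [mul_one, Submodule.mem_iSup_iff_exists_finsupp] at hs
  obtain ⟨f, hf, rfl⟩ := hs
  choose g hg using hf
  refine ⟨g, ?_⟩
  rw [Finsupp.sum_fintype _ _ (fun _ => rfl)]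
  exact Finset.sum_congr rfl fun I _ => (hg I).symm

/-- Both algebras consist of combinations of the `θ^I` over `B`. Uniqueness of the components in `A`
gives injectivity, their existence surjectivity. -/
theorem compare_bijective [CharZero k] : Function.Bijective h.compare := by
  have hθ : ∀ I, h.compare (thetaProd h.frame.gen I) = thetaProd θ I := fun I => by
    refine (map_thetaProd h.compare.toRingHom _ I).trans (congrArg (thetaProd · I) ?_)
    exact funext h.compare_gen
  have hsum : ∀ f : Finset (Fin q) → B, h.compare (∑ I, SuperSym.ofFun _ _ _ (f I) *
      thetaProd h.frame.gen I) = ∑ I, (f I : A) * thetaProd θ I := fun f => by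
    rw [map_sum]
    exact Finset.sum_congr rfl fun I _ => by rw [map_mul, compare_ofFun, hθ]
  refine ⟨(injective_iff_map_eq_zero _).2 fun s hs => ?_, fun a => ?_⟩
  · obtain ⟨f, rfl⟩ := h.exists_sum s
    rw [hsum] at hs
    have : f = 0 := h.bijective.1 (hs.trans (by simp))
    simp [this]
  · obtain ⟨f, rfl⟩ := h.bijective.2 a
    exact ⟨_, hsum f⟩

/-- The superderivations of `B ⊗ Λ(θ_1, …, θ_q)` with given values on `B` and on the `θ_i`. -/
theorem exists_isDer [CharZero k] (h : IsSplit pA B θ) {ε : ZMod 2} {D₀ : B →ₗ[k] A} {v : Fin q → A}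
    (hD : ∀ b, D₀ b ∈ pA ε) (hDm : ∀ b b', D₀ (b * b') = D₀ b * b' + b * D₀ b')
    (hv : ∀ i, v i ∈ pA (1 + ε)) :
    ∃ D : Module.End k A, IsHomog pA ε D ∧ IsDer pA ε D ∧ (∀ b : B, D b = D₀ b) ∧
      ∀ i, D (θ i) = v i := by
  let Φ := AlgEquiv.ofBijective h.compare h.compare_bijective
  have hΦ : ∀ s, Φ s = h.compare s := fun s => rfl
  -- Parity passes back along the isomorphism: the component of the wrong parity has an image that
  -- is both even and odd, hence zero.
  have hmem : ∀ {η : ZMod 2} {a : A}, a ∈ pA η → Φ.symm a ∈ SuperSym.par _ _ _ η := by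
    intro η a ha
    have hS := h.frame.isSuperAlg
    have : Φ.symm a ∈ SuperSym.par (pB k B) (pE k B q) (actE B q) η ⊔
        SuperSym.par (pB k B) (pE k B q) (actE B q) (η + 1) := by
      have h2 := hS.isCompl.sup_eq_top
      rcases zmod2_cases η with rfl | rfl
      · rw [zero_add, h2]; trivial
      · rw [show (1 : ZMod 2) + 1 = 0 from rfl, sup_comm, h2]; trivial
    obtain ⟨s, hs, t, ht, hst⟩ := Submodule.mem_sup.1 this
    have h3 : h.compare t = 0 := by
      refine h.alg.eq_zero_of_mem_mem (ε := η) ?_ (h.compare_mem ht)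
      have : h.compare t = a - h.compare s := by
        rw [eq_sub_iff_add_eq, add_comm, ← map_add, hst, ← hΦ, AlgEquiv.apply_symm_apply]
      rw [this]
      exact sub_mem ha (h.compare_mem hs)
    rw [← hst, (injective_iff_map_eq_zero _).1 h.compare_bijective.1 t h3, add_zero]
    exact hs
  have hfun : ∀ b : B, Φ.symm (b : A) = SuperSym.ofFun _ _ _ b := fun b => by
    rw [AlgEquiv.symm_apply_eq, hΦ, compare_ofFun]
  have hgen : ∀ i, Φ.symm (θ i) = h.frame.gen i := fun i => by
    rw [AlgEquiv.symm_apply_eq, hΦ, compare_gen]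
  have htw : ∀ b : B, h.frame.alg.tw ε b = b := fun b => by
    rw [h.frame.alg.tw_apply (η := 0) (by simp [pB]), mul_zero, sgn_zero, one_smul]
  obtain ⟨D, hDer, hD0, hDg, -⟩ := h.frame.exists_isDer (ε := ε)
    (D₀ := Φ.symm.toLinearMap ∘ₗ D₀) (v := fun i => Φ.symm (v i))
    (fun η f hf => by
      rcases zmod2_cases η with rfl | rfl
      · rw [zero_add]; exact hmem (hD f)
      · have : f = 0 := by simpa [pB] using hf
        rw [this, map_zero]; exact zero_mem _)
    (fun f g => by
      rw [htw, ← hfun, ← hfun, LinearMap.comp_apply, hDm, LinearMap.comp_apply,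
        LinearMap.comp_apply]
      simp)
    (fun i => hmem (hv i))
  have hH : IsHomog _ ε D := h.frame.isHomog_of_isDer hDer
    (fun η f hf => by
      rw [hD0]
      rcases zmod2_cases η with rfl | rfl
      · rw [zero_add]; exact hmem (hD f)
      · have : f = 0 := by simpa [pB] using hf
        rw [this, map_zero]; exact zero_mem _)
    (fun i => by rw [hDg]; exact hmem (hv i))
  refine ⟨Φ.toLinearMap ∘ₗ D ∘ₗ Φ.symm.toLinearMap, fun η s hs => ?_, fun η s hs t => ?_,
    fun b => ?_, fun i => ?_⟩
  · exact h.compare_mem (hH η _ (hmem hs))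
  · change Φ (D (Φ.symm (s * t))) = Φ (D (Φ.symm s)) * t + sgn (ε * η) • (s * Φ (D (Φ.symm t)))
    rw [map_mul, hDer η _ (hmem hs), map_add, map_mul, map_zsmul, map_mul,
      AlgEquiv.apply_symm_apply, AlgEquiv.apply_symm_apply]
  · change Φ (D (Φ.symm b)) = D₀ b
    rw [hfun, hD0]
    exact Φ.apply_symm_apply _
  · change Φ (D (Φ.symm (θ i))) = v i
    rw [hgen, hDg, AlgEquiv.apply_symm_apply]

end IsSplit

end SuperGeom
end

/-! ### From a splitting to coordinate vector fields -/

noncomputable section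
set_option linter.unusedSectionVars false
set_option linter.unusedVariables false
namespace SuperGeom
namespace Superspace

variable {k : Type u} [Field k]

/-- A splitting of `O_M` over `U` as `B ⊗ Λ(θ_1, …, θ_q)`, with coordinates `x_i` and coordinate
derivations `∂_i` on the sheaf `B` of even functions; `B` has no derivation that kills the `x_i`. -/
structure Splitting (M : Superspace k) (p q : ℕ) (U : Opens M.X) where
  B : ∀ V : Opens M.X, V ≤ U → Subalgebra k (M.Sec V)
  res_mem : ∀ (V W : Opens M.X) (hV : V ≤ U) (h : W ≤ V), ∀ b ∈ B V hV, M.res h b ∈ B W (h.trans hV)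
  θ : Fin q → M.Sec U
  isSplit : ∀ V hV, IsSplit (M.par V) (B V hV) fun i => M.res hV (θ i)
  x : Fin p → M.Sec U
  x_mem : ∀ i, x i ∈ B U le_rfl
  ptl : Fin p → ∀ V hV, B V hV →ₗ[k] B V hV
  ptl_mul : ∀ i V hV b c, ptl i V hV (b * c) = ptl i V hV b * c + b * ptl i V hV c
  ptl_res : ∀ i V W hV (h : W ≤ V) (b : B V hV),
    M.res h (ptl i V hV b) = ptl i W (h.trans hV) ⟨M.res h b, res_mem V W hV h b b.2⟩
  ptl_x : ∀ i j, (ptl i U le_rfl ⟨x j, x_mem j⟩ : M.Sec U) = if i = j then 1 else 0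
  eq_zero : ∀ V hV (D : ∀ W (h : W ≤ V), B W (h.trans hV) →ₗ[k] B W (h.trans hV)),
    (∀ W h b c, D W h (b * c) = D W h b * c + b * D W h c) →
    (∀ W W' h (h' : W' ≤ W) (b : B W (h.trans hV)),
      M.res h' (D W h b) = D W' (h'.trans h) ⟨M.res h' b, res_mem W W' (h.trans hV) h' b b.2⟩) →
    (∀ i, D V le_rfl ⟨M.res hV (x i), res_mem U V le_rfl hV _ (x_mem i)⟩ = 0) →
    D V le_rfl = 0

namespace Splitting

variable {M : Superspace k} {p q : ℕ} {U : Opens M.X} (S : M.Splitting p q U)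

/-- Over each open set the derivation exists by freeness. Compatibility with restriction can be
tested on `B` and on the `θ_i`, where the values are prescribed compatibly. -/
theorem exists_der [CharZero k] {ε : ZMod 2} {D₀ : ∀ V hV, S.B V hV →ₗ[k] M.Sec V} {v : Fin q → M.Sec U}
    (mem : ∀ V hV b, D₀ V hV b ∈ M.par V ε)
    (mul : ∀ V hV b c, D₀ V hV (b * c) = D₀ V hV b * c + b * D₀ V hV c)
    (nat : ∀ V W hV (h : W ≤ V) (b : S.B V hV),
      M.res h (D₀ V hV b) = D₀ W (h.trans hV) ⟨M.res h b, S.res_mem V W hV h b b.2⟩)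
    (hv : ∀ i, v i ∈ M.par U (1 + ε)) :
    ∃ X ∈ M.Der U ε, (∀ V hV (b : S.B V hV), X.app ⟨V, hV⟩ b = D₀ V hV b) ∧
      ∀ i, M.ev X (S.θ i) = v i := by
  have ex : ∀ V : {V : Opens M.X // V ≤ U}, _ := fun V =>
    (S.isSplit V.1 V.2).exists_isDer (mem V.1 V.2) (mul V.1 V.2) fun i => M.res_mem V.2 _ _ (hv i)
  choose D hom der hb hθ using ex
  have hres : ∀ (V W : {V : Opens M.X // V ≤ U}) (h : W.1 ≤ V.1) (f : M.Sec V),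
      M.res h (D V f) = D W (M.res h f) := by
    intro V W h
    refine (S.isSplit V.1 V.2).induction (fun b hbV => ?_) (fun i => ?_) (fun s t hs ht => ?_)
      fun s t hs ht => ?_
    · rw [hb V ⟨b, hbV⟩, nat V.1 W.1 V.2 h ⟨b, hbV⟩]
      exact (hb W ⟨M.res h b, _⟩).symm
    · rw [hθ V, res_res, res_res, hθ W]
    · rw [(der V).apply_mul (M.isSuperAlg V.1), map_mul, (der W).apply_mul (M.isSuperAlg W.1), map_add, map_mul, map_mul,
        hs, ht, res_tw]
    · rw [map_add, map_add, hs, ht, map_add, map_add]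
  refine ⟨⟨D, hres⟩, ⟨hom, der⟩, fun V hV b => hb ⟨V, hV⟩ b, fun i => ?_⟩
  have := hθ ⟨U, le_rfl⟩ i
  rwa [res_id, res_id] at this

theorem res_coef {V W : Opens M.X} (hV : V ≤ U) (h : W ≤ V) (s : M.Sec V) (I : Finset (Fin q)) :
    M.res h ((S.isSplit V hV).coef s I) = (S.isSplit W (h.trans hV)).coef (M.res h s) I := by
  have key : M.res h s = ∑ I, ((⟨M.res h ((S.isSplit V hV).coef s I),
      S.res_mem V W hV h _ ((S.isSplit V hV).coef s I).2⟩ : S.B W (h.trans hV)) : M.Sec W) *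
        thetaProd (fun i => M.res (h.trans hV) (S.θ i)) I := by
    conv_lhs => rw [← (S.isSplit V hV).sum_coef s, map_sum]
    refine Finset.sum_congr rfl fun I _ => ?_
    rw [map_mul]
    refine congrArg _ ((map_thetaProd (M.res h).toRingHom _ I).trans (congrArg (thetaProd · I) ?_))
    exact funext fun i => M.res_res hV h _
  rw [key, (S.isSplit W (h.trans hV)).coef_sum
    (fun I => ⟨M.res h ((S.isSplit V hV).coef s I), S.res_mem V W hV h _ ((S.isSplit V hV).coef s I).2⟩)]

/-- Even functions commute with everything, so that each `θ^I`-component of `Y` on the sheaf `B` is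
an ordinary derivation. It kills the coordinates, hence vanishes; then `Y` vanishes on `B` and on
the `θ_i`. -/
theorem der_eq_zero {V : Opens M.X} (hV : V ≤ U) {ε : ZMod 2} {Y : M.EndO V} (hY : Y ∈ M.Der V ε)
    (hx : ∀ i, M.ev Y (M.res hV (S.x i)) = 0) (hθ : ∀ i, M.ev Y (M.res hV (S.θ i)) = 0) : Y = 0 := by
  refine EndO.ext fun W f => LinearMap.congr_fun (g := (0 : Module.End k (M.Sec W.1))) ?_ f
  obtain ⟨W, hW⟩ := W
  refine (S.isSplit W (hW.trans hV)).isDer_ext (hY.2 ⟨W, hW⟩) (isDer_zero ε) (fun b hb => ?_) fun i => ?_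
  · apply (S.isSplit W (hW.trans hV)).coef.injective
    rw [LinearMap.zero_apply, map_zero]
    funext I
    let D : ∀ W' (h : W' ≤ W), S.B W' (h.trans (hW.trans hV)) →ₗ[k] S.B W' (h.trans (hW.trans hV)) :=
      fun W' h => LinearMap.proj I ∘ₗ (S.isSplit W' (h.trans (hW.trans hV))).coef.toLinearMap ∘ₗ
        Y.app ⟨W', h.trans hW⟩ ∘ₗ (S.B W' (h.trans (hW.trans hV))).val.toLinearMap
    have hD : ∀ W' h b, D W' h b =
      (S.isSplit W' (h.trans (hW.trans hV))).coef (Y.app ⟨W', h.trans hW⟩ b) I := fun _ _ _ => rfl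
    have h0 := S.eq_zero W (hW.trans hV) D (fun W' h b c => ?_) (fun W' W'' h h' b => ?_) fun i => ?_
    · exact LinearMap.congr_fun h0 ⟨b, hb⟩
    · have hs := S.isSplit W' (h.trans (hW.trans hV))
      rw [hD W' h, hD W' h, hD W' h, Subalgebra.coe_mul, IsDer.apply_mul (hY.2 ⟨W', h.trans hW⟩) hs.alg, map_add,
        hs.alg.tw_apply (hs.even _ b.2), mul_zero, sgn_zero, one_smul, Pi.add_apply,
        hs.coef_mul, ← hs.commute c.2, hs.coef_mul]
      exact congrArg (· + _) (Subtype.ext (hs.commute c.2 _))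
    · rw [hD W' h, hD W'' (h'.trans h), res_coef, Y.res_app ⟨W', _⟩ ⟨W'', h'.trans (h.trans hW)⟩ h']
    · rw [hD W le_rfl]
      have h1 : Y.app ⟨W, hW⟩ (M.res (hW.trans hV) (S.x i)) = 0 := by
        rw [← M.res_res hV hW]
        refine (Y.res_app ⟨V, le_rfl⟩ ⟨W, hW⟩ hW (M.res hV (S.x i))).symm.trans ?_
        refine (congrArg (M.res hW) (hx i)).trans (map_zero _)
      refine (congrFun (congrArg (S.isSplit W (hW.trans hV)).coef h1) I).trans ?_
      rw [map_zero]; rfl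
  · rw [LinearMap.zero_apply, ← M.res_res hV hW]
    refine (Y.res_app ⟨V, le_rfl⟩ ⟨W, hW⟩ hW (M.res hV (S.θ i))).symm.trans ?_
    exact (congrArg (M.res hW) (hθ i)).trans (map_zero _)

/-- The coordinate vector fields on a split superspace. -/
theorem exists_ptl [CharZero k] (a : Fin p ⊕ Fin q) : ∃ X ∈ M.Der U (idxPar a), ∀ b,
    M.ev X (Sum.elim S.x S.θ b) = if a = b then 1 else 0 := by
  rcases a with i | j
  · obtain ⟨X, hX, h1, h2⟩ := S.exists_der (ε := 0)
      (D₀ := fun V hV => (S.B V hV).val.toLinearMap ∘ₗ S.ptl i V hV) (v := 0)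
      (fun V hV b => (S.isSplit V hV).even _ (S.ptl i V hV b).2)
      (fun V hV b c => by simp [S.ptl_mul])
      (fun V W hV h b => S.ptl_res i V W hV h b) (fun _ => zero_mem _)
    refine ⟨X, hX, ?_⟩
    rintro (i' | j')
    · refine (h1 U le_rfl ⟨S.x i', S.x_mem i'⟩).trans ((S.ptl_x i i').trans ?_)
      simp [Sum.inl.injEq]
    · simpa using h2 j'
  · obtain ⟨X, hX, h1, h2⟩ := S.exists_der (ε := 1) (D₀ := fun V hV => 0)
      (v := fun j' => if j = j' then 1 else 0)
      (fun V hV b => zero_mem _) (fun V hV b c => by simp)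
      (fun V W hV h b => by simp) (fun j' => by
        split_ifs
        · exact M.one_mem U
        · exact zero_mem _)
    refine ⟨X, hX, ?_⟩
    rintro (i' | j')
    · refine (h1 U le_rfl ⟨S.x i', S.x_mem i'⟩).trans ?_
      simp
    · refine (h2 j').trans ?_
      simp [Sum.inr.injEq]

theorem coord_mem (a : Fin p ⊕ Fin q) : Sum.elim S.x S.θ a ∈ M.par U (idxPar a) := by
  rcases a with i | j
  · exact (S.isSplit U le_rfl).even _ (S.x_mem i)
  · have := (S.isSplit U le_rfl).odd j
    rwa [res_id] at this

/-- The local coordinates defined by a splitting. -/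
def coords [CharZero k] : M.Coords p q U where
  x := Sum.elim S.x S.θ
  x_par := S.coord_mem
  ptl a := ⟨(S.exists_ptl a).choose, M.Der_le_T U _ (S.exists_ptl a).choose_spec.1⟩
  ptl_par a := (S.exists_ptl a).choose_spec.1
  ptl_x a := (S.exists_ptl a).choose_spec.2
  eq_sum V hV X := by
    refine T_induction (C := fun X => X = ∑ a, M.mulEnd V (M.ev X (M.res hV (Sum.elim S.x S.θ a))) *
      M.resEnd hV (S.exists_ptl a).choose) (fun ε X hX => ?_) (fun X Y hX hY => ?_) X.2
    -- The difference between `X` and its expansion is homogeneous and kills all coordinates.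
    · have hsum : X - ∑ a, M.mulEnd V (M.ev X (M.res hV (Sum.elim S.x S.θ a))) *
          M.resEnd hV (S.exists_ptl a).choose ∈ M.Der V ε := by
        refine sub_mem hX (sum_mem fun a _ => ?_)
        have := mulEnd_mul_mem_Der (ev_mem hX.1 (M.res_mem hV _ _ (S.coord_mem a)))
          (M.resEnd_mem_Der hV _ _ (S.exists_ptl a).choose_spec.1)
        rwa [show idxPar a + ε + idxPar a = ε by generalize idxPar a = y; clear * -; decide +revert] at this
      have hzero : ∀ b, M.ev (X - ∑ a, M.mulEnd V (M.ev X (M.res hV (Sum.elim S.x S.θ a))) *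
          M.resEnd hV (S.exists_ptl a).choose) (M.res hV (Sum.elim S.x S.θ b)) = 0 := fun b => by
        rw [← evL_apply, map_sub, map_sum, Finset.sum_eq_single b]
        · rw [evL_apply, evL_apply, ev_mul, ev_mulEnd, ← res_ev, (S.exists_ptl b).choose_spec.2 b,
            if_pos rfl, map_one, mul_one, sub_self]
        · intro a _ hab
          rw [evL_apply, ev_mul, ev_mulEnd, ← res_ev, (S.exists_ptl a).choose_spec.2 b, if_neg hab,
            map_zero, mul_zero]
        · simp
      exact sub_eq_zero.1 (S.der_eq_zero hV hsum (fun i => hzero (Sum.inl i)) fun j => hzero (Sum.inr j))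
    · conv_lhs => rw [hX, hY]
      rw [← Finset.sum_add_distrib]
      exact Finset.sum_congr rfl fun a _ => by rw [ev_add, map_add, add_mul]

end Splitting
end Superspace
end SuperGeom
end

/-! ### From coordinates on a local model to a splitting over a chart -/

noncomputable section
set_option linter.unusedSectionVars false
set_option linter.unusedVariables false
namespace SuperGeom

variable {k : Type u} [Field k]

namespace LocalModel

/-- Restriction of functions on a local model. -/
def res (Y : LocalModel k) {W W' : Opens Y.Y} (h : W' ≤ W) : Y.B.obj (op W) →+* Y.B.obj (op W') :=
  (Y.B.map (homOfLE h).op).hom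

theorem res_id (Y : LocalModel k) {W : Opens Y.Y} (g : Y.B.obj (op W)) : Y.res le_rfl g = g := by
  have : (homOfLE (le_refl W)).op = 𝟙 (op W) := rfl
  rw [res, this, Y.B.map_id]; rfl

theorem res_res (Y : LocalModel k) {W W' W'' : Opens Y.Y} (h : W' ≤ W) (h' : W'' ≤ W')
    (g : Y.B.obj (op W)) : Y.res h' (Y.res h g) = Y.res (h'.trans h) g := by
  have : (homOfLE (h'.trans h)).op = (homOfLE h).op ≫ (homOfLE h').op := rfl
  rw [res, res, res, this, Y.B.map_comp]; rfl

/-- The constant functions. -/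
def const (Y : LocalModel k) (W : Opens Y.Y) : k →+* Y.B.obj (op W) :=
  (Y.res (le_top : W ≤ ⊤)).comp Y.scalars

theorem res_const (Y : LocalModel k) {W W' : Opens Y.Y} (h : W' ≤ W) (c : k) :
    Y.res h (Y.const W c) = Y.const W' c := Y.res_res _ _ _

/-- Coordinates `x_i` on an open subset of a local model, with the coordinate derivations `∂_i`;
a derivation over `k` that kills the `x_i` vanishes. -/
structure Coords (Y : LocalModel k) (p : ℕ) (W₀ : Opens Y.Y) where
  x : Fin p → Y.B.obj (op W₀)
  ptl : Fin p → ∀ W, W ≤ W₀ → (Y.B.obj (op W) →+ Y.B.obj (op W))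
  ptl_mul : ∀ i W hW f g, ptl i W hW (f * g) = ptl i W hW f * g + f * ptl i W hW g
  ptl_const : ∀ i W hW c, ptl i W hW (Y.const W c) = 0
  ptl_res : ∀ i W W' hW (h : W' ≤ W) f, Y.res h (ptl i W hW f) = ptl i W' (h.trans hW) (Y.res h f)
  ptl_x : ∀ i j, ptl i W₀ le_rfl (x j) = if i = j then 1 else 0
  eq_zero : ∀ W (hW : W ≤ W₀) (D : ∀ W', W' ≤ W → (Y.B.obj (op W') →+ Y.B.obj (op W'))),
    (∀ W' h f g, D W' h (f * g) = D W' h f * g + f * D W' h g) →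
    (∀ W' h c, D W' h (Y.const W' c) = 0) →
    (∀ W' W'' h (h' : W'' ≤ W') f, Y.res h' (D W' h f) = D W'' (h'.trans h) (Y.res h' f)) →
    (∀ i, D W le_rfl (Y.res hW (x i)) = 0) → D W le_rfl = 0

end LocalModel

namespace Superspace

variable {M : Superspace k}

theorem res_bijective {U V : Opens M.X} (h : V = U) : Function.Bijective (M.res h.le) := by
  subst h
  have : (M.res (le_refl V) : M.Sec V → M.Sec V) = id := funext fun f => M.res_id f
  rw [this]; exact Function.bijective_id

namespace Chart

variable {Y : LocalModel k} {q : ℕ} {U : Opens M.X} (c : M.Chart Y q U)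

/-- The open subset of the model that corresponds to `V ⊆ U`. -/
def img (V : Opens M.X) : Opens Y.Y :=
  ⟨c.φ '' (Subtype.val ⁻¹' (V : Set M.X)),
    c.isOpenEmbedding.isOpenMap _ (V.isOpen.preimage continuous_subtype_val)⟩

theorem img_mono {V W : Opens M.X} (h : W ≤ V) : c.img W ≤ c.img V :=
  Set.image_mono (Set.preimage_mono h)

theorem img_subset_range (V : Opens M.X) : (c.img V : Set Y.Y) ⊆ Set.range c.φ :=
  Set.image_subset_range _ _

theorem preOpen_img {V : Opens M.X} (h : V ≤ U) : preOpen U c.φ (c.img V) = V := by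
  apply le_antisymm
  · rintro _ ⟨m, ⟨m', hm', e⟩, rfl⟩
    rw [← c.isOpenEmbedding.injective e]
    exact hm'
  · exact fun m hm => ⟨⟨m, h hm⟩, ⟨⟨m, h hm⟩, hm, rfl⟩, rfl⟩

theorem img_preOpen {W : Opens Y.Y} (h : (W : Set Y.Y) ⊆ Set.range c.φ) :
    c.img (preOpen U c.φ W) = W := by
  apply le_antisymm
  · rintro _ ⟨m, ⟨m', hm', e⟩, rfl⟩
    rw [← Subtype.ext e]
    exact hm'
  · intro y hy
    obtain ⟨m, rfl⟩ := h hy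
    exact ⟨m, ⟨m, hy, rfl⟩, rfl⟩

theorem img_le {V : Opens M.X} {W : Opens Y.Y} (h : V ≤ preOpen U c.φ W) : c.img V ≤ W := by
  rintro _ ⟨m, hm, rfl⟩
  obtain ⟨m', hm', e⟩ := h hm
  rw [← Subtype.ext e]
  exact hm'

/-- The inclusion of the functions on the model. -/
def sec {V : Opens M.X} (hV : V ≤ U) {W : Opens Y.Y} (hW : W = c.img V) :
    Y.B.obj (op W) →+* M.Sec V :=
  ((M.res (by rw [hW, c.preOpen_img hV])).toRingHom).comp (c.s W)

theorem sec_apply {V : Opens M.X} (hV : V ≤ U) {W : Opens Y.Y} (hW : W = c.img V) (g : Y.B.obj (op W)) :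
    c.sec hV hW g = M.res (by rw [hW, c.preOpen_img hV]) (c.s W g) := rfl

/-- Open sets of the model enter through equations `W = c.img V`, because an open set of the model
is the image of its preimage by a proof and not by definition. -/
theorem res_sec {V V' : Opens M.X} (hV : V ≤ U) (h : V' ≤ V) {W W' : Opens Y.Y} (hW : W = c.img V)
    (hW' : W' = c.img V') (hWW' : W' ≤ W) (g : Y.B.obj (op W)) :
    M.res h (c.sec hV hW g) = c.sec (h.trans hV) hW' (Y.res hWW' g) := by
  rw [sec_apply, sec_apply, LocalModel.res, ← c.s_res W W' hWW' g, res_res, res_res]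

theorem sec_const {V : Opens M.X} (hV : V ≤ U) {W : Opens Y.Y} (hW : W = c.img V) (a : k) :
    c.sec hV hW (Y.const W a) = algebraMap k _ a := by
  rw [sec_apply]
  refine (congrArg _ (c.s_scalars W a)).trans (AlgHom.commutes _ _)

theorem sec_mem {V : Opens M.X} (hV : V ≤ U) {W : Opens Y.Y} (hW : W = c.img V) (g : Y.B.obj (op W)) :
    c.sec hV hW g ∈ M.par V 0 := M.res_mem _ _ _ (c.s_even W g)

theorem sec_bijective {V : Opens M.X} (hV : V ≤ U) {W : Opens Y.Y} (hW : W = c.img V) :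
    Function.Bijective fun f : Finset (Fin q) → Y.B.obj (op W) =>
      ∑ I, c.sec hV hW (f I) * thetaProd (fun i => M.res hV (c.θ i)) I := by
  have hW' : V = preOpen U c.φ W := by rw [hW, c.preOpen_img hV]
  have := (res_bijective (M := M) hW').comp (c.bijective W (by rw [hW]; exact c.img_subset_range V))
  refine (congrArg Function.Bijective (funext fun f => ?_)).mp this
  refine (map_sum _ _ _).trans (Finset.sum_congr rfl fun I _ => ?_)
  rw [map_mul]
  refine congrArg (_ * ·) ((map_thetaProd (M.res hW'.le).toRingHom _ I).trans (congrArg (thetaProd · I) ?_))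
  exact funext fun i => M.res_res _ _ _

theorem sec_injective {V : Opens M.X} (hV : V ≤ U) {W : Opens Y.Y} (hW : W = c.img V) :
    Function.Injective (c.sec hV hW) := fun f g hfg => by
  have := (c.sec_bijective hV hW).1 (a₁ := fun I => if I = ∅ then f else 0)
    (a₂ := fun I => if I = ∅ then g else 0) (Finset.sum_congr rfl fun I _ => by
      dsimp only
      split_ifs
      · rw [hfg]
      · rfl)
  simpa using congrFun this ∅

/-- The even functions on `V` that come from the model. -/
def base {V : Opens M.X} (hV : V ≤ U) : Subalgebra k (M.Sec V) where
  toSubsemiring := (c.sec hV rfl).rangeS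
  algebraMap_mem' a := ⟨_, c.sec_const hV rfl a⟩

/-- Functions from the model are functions on the model. -/
def baseEquiv {V : Opens M.X} (hV : V ≤ U) {W : Opens Y.Y} (hW : W = c.img V) :
    Y.B.obj (op W) ≃+* c.base hV :=
  RingEquiv.ofBijective
    ({ toFun := fun g => ⟨c.sec hV hW g, by subst hW; exact ⟨g, rfl⟩⟩
       map_one' := Subtype.ext (map_one _)
       map_mul' := fun _ _ => Subtype.ext (map_mul _ _ _)
       map_zero' := Subtype.ext (map_zero _)
       map_add' := fun _ _ => Subtype.ext (map_add _ _ _) } : _ →+* _)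
    ⟨fun f g h => c.sec_injective hV hW (congrArg Subtype.val h), by
      subst hW
      rintro ⟨_, g, rfl⟩
      exact ⟨g, rfl⟩⟩

theorem res_base_mem {V V' : Opens M.X} (hV : V ≤ U) (h : V' ≤ V) (b : M.Sec V) (hb : b ∈ c.base hV) :
    M.res h b ∈ c.base (h.trans hV) := by
  obtain ⟨g, rfl⟩ := hb
  exact ⟨_, (c.res_sec hV h rfl rfl (c.img_mono h) g).symm⟩

theorem baseEquiv_const {V : Opens M.X} (hV : V ≤ U) {W : Opens Y.Y} (hW : W = c.img V) (a : k) :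
    c.baseEquiv hV hW (Y.const W a) = algebraMap k _ a := Subtype.ext (c.sec_const hV hW a)

theorem baseEquiv_res {V V' : Opens M.X} (hV : V ≤ U) (h : V' ≤ V) {W W' : Opens Y.Y} (hW : W = c.img V)
    (hW' : W' = c.img V') (hWW' : W' ≤ W) (g : Y.B.obj (op W)) :
    c.baseEquiv (h.trans hV) hW' (Y.res hWW' g) =
      ⟨M.res h (c.baseEquiv hV hW g), c.res_base_mem hV h _ (c.baseEquiv hV hW g).2⟩ :=
  Subtype.ext (c.res_sec hV h hW hW' hWW' g).symm

theorem symm_res {V V' : Opens M.X} (hV : V ≤ U) (h : V' ≤ V) {W W' : Opens Y.Y} (hW : W = c.img V)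
    (hW' : W' = c.img V') (hWW' : W' ≤ W) (b : c.base hV) :
    (c.baseEquiv (h.trans hV) hW').symm ⟨M.res h b, c.res_base_mem hV h _ b.2⟩ =
      Y.res hWW' ((c.baseEquiv hV hW).symm b) := by
  rw [RingEquiv.symm_apply_eq, c.baseEquiv_res hV h hW hW' hWW']
  simp

theorem isSplit {V : Opens M.X} (hV : V ≤ U) :
    IsSplit (M.par V) (c.base hV) fun i => M.res hV (c.θ i) where
  alg := M.isSuperAlg V
  even := by
    rintro _ ⟨g, rfl⟩
    exact c.sec_mem hV rfl g
  odd i := M.res_mem _ _ _ (c.θ_odd i)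
  bijective := by
    have := (c.sec_bijective hV rfl).comp
      (Equiv.piCongrRight fun _ : Finset (Fin q) => (c.baseEquiv hV rfl).symm.toEquiv).bijective
    refine (congrArg Function.Bijective (funext fun f => Finset.sum_congr rfl fun I _ => ?_)).mp this
    refine congrArg (· * _) ?_
    exact congrArg Subtype.val ((c.baseEquiv hV rfl).apply_symm_apply (f I))

/-- A derivation on the model over `k`, as a derivation on even functions. -/
def liftDer {V : Opens M.X} (hV : V ≤ U) (D : Y.B.obj (op (c.img V)) →+ Y.B.obj (op (c.img V)))
    (mul : ∀ f g, D (f * g) = D f * g + f * D g) (const : ∀ a, D (Y.const _ a) = 0) :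
    c.base hV →ₗ[k] c.base hV where
  toFun b := c.baseEquiv hV rfl (D ((c.baseEquiv hV rfl).symm b))
  map_add' b b' := by rw [map_add, map_add, map_add]
  map_smul' a b := by
    rw [Algebra.smul_def, map_mul, mul, ← c.baseEquiv_const hV rfl, RingEquiv.symm_apply_apply, const,
      zero_mul, zero_add, map_mul, c.baseEquiv_const, ← Algebra.smul_def]; rfl

theorem liftDer_apply {V : Opens M.X} (hV : V ≤ U) (D : Y.B.obj (op (c.img V)) →+ Y.B.obj (op (c.img V)))
    (mul : ∀ f g, D (f * g) = D f * g + f * D g) (const : ∀ a, D (Y.const _ a) = 0) (b : c.base hV) :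
    c.liftDer hV D mul const b = c.baseEquiv hV rfl (D ((c.baseEquiv hV rfl).symm b)) := rfl

variable {p : ℕ} {W₀ : Opens Y.Y} (C : Y.Coords p W₀)

/-- Coordinates on the model split the superspace over a chart. -/
def splitting : M.Splitting p q (preOpen U c.φ W₀) where
  B V hV := c.base (hV.trans (preOpen_le _ _ _))
  res_mem V W hV h b hb := c.res_base_mem _ h b hb
  θ i := M.res (preOpen_le _ _ _) (c.θ i)
  isSplit V hV := by
    simp only [res_res]
    exact c.isSplit _
  x i := c.baseEquiv (preOpen_le _ _ _) rfl (Y.res (c.img_le le_rfl) (C.x i))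
  x_mem i := Subtype.property _
  ptl i V hV := c.liftDer _ (C.ptl i _ (c.img_le hV)) (C.ptl_mul i _ _) (C.ptl_const i _ _)
  ptl_mul i V hV b b' := by
    rw [liftDer_apply, map_mul, C.ptl_mul, map_add, map_mul, map_mul, RingEquiv.apply_symm_apply,
      RingEquiv.apply_symm_apply]; rfl
  ptl_res i V W hV h b := by
    rw [liftDer_apply, liftDer_apply, c.symm_res _ h rfl rfl (c.img_mono h), ← C.ptl_res,
      c.baseEquiv_res _ h rfl rfl]
  ptl_x i j := by
    rw [liftDer_apply, Subtype.coe_eta, RingEquiv.symm_apply_apply, ← C.ptl_res i W₀ _ le_rfl, C.ptl_x]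
    split_ifs <;> simp
  eq_zero V hV D mul nat hx := by
    have hVU := hV.trans (preOpen_le U c.φ W₀)
    have hr : ∀ W', W' ≤ c.img V → W' = c.img (preOpen U c.φ W') := fun W' h =>
      (c.img_preOpen (Set.Subset.trans h (c.img_subset_range V))).symm
    have hl : ∀ W', W' ≤ c.img V → preOpen U c.φ W' ≤ V := fun W' h =>
      (preOpen_mono U c.φ h).trans (c.preOpen_img hVU).le
    -- The derivations transported to the model: an open set `W'` of the model takes the derivation
    -- over the corresponding open subset of `V`.
    let D' : ∀ W', W' ≤ c.img V → (Y.B.obj (op W') →+ Y.B.obj (op W')) := fun W' h =>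
      AddMonoidHom.mk' (fun f => (c.baseEquiv (preOpen_le U c.φ W') (hr W' h)).symm
        (D _ (hl W' h) (c.baseEquiv (preOpen_le U c.φ W') (hr W' h) f)))
        (fun f g => by rw [map_add, map_add, map_add])
    have hD' : ∀ W' h f, D' W' h f = (c.baseEquiv (preOpen_le U c.φ W') (hr W' h)).symm
      (D _ (hl W' h) (c.baseEquiv (preOpen_le U c.φ W') (hr W' h) f)) := fun _ _ _ => rfl
    have h0 := C.eq_zero (c.img V) (c.img_le hV) D' (fun W' h f g => ?_) (fun W' h a => ?_)
      (fun W' W'' h h' f => ?_) fun i => ?_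
    -- The transported derivation lives over `preOpen U c.φ (c.img V)`. This is equal to `V`, and
    -- restriction along the equality is bijective.
    · refine LinearMap.ext fun b => Subtype.ext
        ((res_bijective (M := M) (c.preOpen_img hVU)).1 ?_)
      rw [LinearMap.zero_apply, ZeroMemClass.coe_zero, map_zero, nat V _ le_rfl]
      have h1 := DFunLike.congr_fun h0 ((c.baseEquiv hVU rfl).symm b)
      rw [hD' _ le_rfl, AddMonoidHom.zero_apply, map_eq_zero_iff _ (RingEquiv.injective _)] at h1
      refine (congrArg Subtype.val (congrArg (D _ _) ?_)).trans (congrArg Subtype.val h1)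
      have h2 := c.baseEquiv_res hVU (c.preOpen_img hVU).le rfl
        (hr _ le_rfl) le_rfl ((c.baseEquiv hVU rfl).symm b)
      rw [Y.res_id, RingEquiv.apply_symm_apply] at h2
      exact h2.symm
    · rw [hD' W' h, map_mul, mul, map_add, map_mul, map_mul, RingEquiv.symm_apply_apply,
        RingEquiv.symm_apply_apply, ← hD' W' h, ← hD' W' h]
    -- A derivation kills `1`, and `D` is linear over `k`, so constants are killed. The derivations
    -- on the model are only additive, which is why this is a condition there.
    · have h1 := mul (preOpen U c.φ W') (hl W' h) 1 1
      rw [one_mul, one_mul, mul_one, left_eq_add] at h1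
      rw [hD' W' h, c.baseEquiv_const, Algebra.algebraMap_eq_smul_one, map_smul, h1, smul_zero, map_zero]
    · rw [hD' W' h, hD' W'' (h'.trans h), c.baseEquiv_res (preOpen_le U c.φ W') (preOpen_mono U c.φ h') (hr W' h)
        (hr W'' (h'.trans h)) h', ← c.symm_res (preOpen_le U c.φ W') (preOpen_mono U c.φ h') (hr W' h)
        (hr W'' (h'.trans h)) h']
      exact congrArg _ (Subtype.ext (nat _ _ (hl W' h) (preOpen_mono U c.φ h') _))
    · rw [hD' _ le_rfl, map_eq_zero_iff _ (RingEquiv.injective _)]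
      have h1 := nat V _ le_rfl (hl _ le_rfl)
        ⟨_, c.res_base_mem (preOpen_le _ _ _) hV _ (c.baseEquiv (preOpen_le U c.φ W₀) rfl
          (Y.res (c.img_le le_rfl) (C.x i))).2⟩
      rw [hx i, ZeroMemClass.coe_zero, map_zero] at h1
      refine Subtype.ext (Eq.trans (congrArg Subtype.val (congrArg (D _ _) ?_)) h1.symm)
      refine Subtype.ext ?_
      have h2 := c.baseEquiv_res (preOpen_le U c.φ W₀) ((hl _ le_rfl).trans hV) rfl (hr _ le_rfl)
        (c.img_mono hV) (Y.res (c.img_le le_rfl) (C.x i))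
      rw [Y.res_res] at h2
      exact (congrArg Subtype.val h2).trans (M.res_res _ _ _).symm

end Chart

/-- A superspace with charts in local models with coordinates has local coordinates. -/
theorem HasCoords.of_charts [CharZero k] {p q : ℕ} (h : ∀ m : M.X, ∃ (Y : LocalModel k) (U : Opens M.X)
    (_ : m ∈ U), Nonempty (M.Chart Y q U) ∧ ∀ y : Y.Y, ∃ W, y ∈ W ∧ Nonempty (Y.Coords p W)) :
    M.HasCoords p q := fun m => by
  obtain ⟨Y, U, hm, ⟨c⟩, hY⟩ := h m
  obtain ⟨W, hW, ⟨C⟩⟩ := hY (c.φ ⟨m, hm⟩)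
  exact ⟨preOpen U c.φ W, ⟨⟨m, hm⟩, hW, rfl⟩, ⟨(c.splitting C).coords⟩⟩

end Superspace
end SuperGeom
end

noncomputable section
set_option linter.unusedSectionVars false
set_option linter.unusedVariables false
namespace SuperGeom

/-! ### The Hadamard lemma -/

section Hadamard

open Metric MeasureTheory intervalIntegral Set
open scoped Topology ContDiff

variable {𝕜 : Type u} [RCLike 𝕜] {E : Type u} [NormedAddCommGroup E] [NormedSpace 𝕜 E]

theorem segment_mem_ball {c z : E} {r t : ℝ} (hz : z ∈ ball c r) (ht : t ∈ Icc (0 : ℝ) 1) :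
    c + (t : 𝕜) • (z - c) ∈ ball c r := by
  rw [mem_ball_iff_norm] at hz ⊢
  rw [add_sub_cancel_left, norm_smul, RCLike.norm_ofReal, abs_of_nonneg ht.1]
  exact (mul_le_of_le_one_left (norm_nonneg _) ht.2).trans_lt hz

variable {F : Type u} [NormedAddCommGroup F] [NormedSpace 𝕜 F]

theorem continuousOn_segment {h : E → F} {c z : E} {r : ℝ} (hh : ContinuousOn h (ball c r))
    (hz : z ∈ ball c r) {φ : ℝ → 𝕜} (hφ : Continuous φ) :
    ContinuousOn (fun t : ℝ => φ t • h (c + (t : 𝕜) • (z - c))) (Icc 0 1) :=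
  hφ.continuousOn.smul (hh.comp (Continuous.continuousOn (by fun_prop)) fun t ht => segment_mem_ball hz ht)

variable [NormedSpace ℝ F]

/-- Differentiation under the integral sign, dominated on a slightly smaller ball by compactness.
The inner factor `t` goes into the weight, so that the derivative is an integral of the same form.
-/
theorem hasFDerivAt_segmentIntegral [ProperSpace E] [SMulCommClass 𝕜 ℝ F] {h : E → F} {c z : E} {r : ℝ}
    (hh : ContDiffOn 𝕜 ∞ h (ball c r)) (hz : z ∈ ball c r) {φ : ℝ → 𝕜} (hφ : Continuous φ) :
    HasFDerivAt (fun z => ∫ t in (0 : ℝ)..1, φ t • h (c + (t : 𝕜) • (z - c)))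
      (∫ t in (0 : ℝ)..1, (φ t * t) • fderiv 𝕜 h (c + (t : 𝕜) • (z - c))) z := by
  have hφ' : Continuous fun t : ℝ => φ t * (t : 𝕜) := by fun_prop
  have hd : ContinuousOn (fderiv 𝕜 h) (ball c r) := hh.continuousOn_fderiv_of_isOpen isOpen_ball (by simp)
  have hu : Set.uIoc (0 : ℝ) 1 ⊆ Icc 0 1 := by rw [uIoc_of_le zero_le_one]; exact Ioc_subset_Icc_self
  obtain ⟨R, hzR, hRr⟩ := exists_between (mem_ball.1 hz)
  have hsub : ∀ z' ∈ ball c R, z' ∈ ball c r := fun z' h' => ball_subset_ball hRr.le h'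
  obtain ⟨C₁, hC₁⟩ := (isCompact_closedBall c R).exists_bound_of_continuousOn
    (hd.mono (closedBall_subset_ball hRr))
  obtain ⟨C₂, hC₂⟩ := (isCompact_Icc (a := (0 : ℝ)) (b := 1)).exists_bound_of_continuousOn hφ'.continuousOn
  refine hasFDerivAt_integral_of_dominated_of_fderiv_le (s := ball c R) (bound := fun _ => C₂ * C₁)
    (F' := fun z t => (φ t * t) • fderiv 𝕜 h (c + (t : 𝕜) • (z - c)))
    (isOpen_ball.mem_nhds hzR) ?_ ?_ ?_ ?_ ?_ ?_
  · filter_upwards [isOpen_ball.mem_nhds hz] with z' hz'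
    exact ((continuousOn_segment hh.continuousOn hz' hφ).mono hu).aestronglyMeasurable measurableSet_uIoc
  · exact ContinuousOn.intervalIntegrable_of_Icc zero_le_one (continuousOn_segment hh.continuousOn hz hφ)
  · exact ((continuousOn_segment hd hz hφ').mono hu).aestronglyMeasurable measurableSet_uIoc
  · refine Filter.Eventually.of_forall fun t ht z' hz' => ?_
    rw [norm_smul]
    exact mul_le_mul (hC₂ t (hu ht)) (hC₁ _ (ball_subset_closedBall (segment_mem_ball hz' (hu ht))))
      (norm_nonneg _) ((norm_nonneg _).trans (hC₂ t (hu ht)))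
  · exact intervalIntegrable_const
  · refine Filter.Eventually.of_forall fun t ht z' hz' => ?_
    have h1 : HasFDerivAt h (fderiv 𝕜 h (c + (t : 𝕜) • (z' - c))) (c + (t : 𝕜) • (z' - c)) :=
      ((hh.differentiableOn (by simp)).differentiableAt
        (isOpen_ball.mem_nhds (segment_mem_ball (hsub z' hz') (hu ht)))).hasFDerivAt
    have h2 : HasFDerivAt (fun z : E => c + (t : 𝕜) • (z - c)) ((t : 𝕜) • ContinuousLinearMap.id 𝕜 E) z' :=
      (((hasFDerivAt_id z').sub_const c).const_smul (t : 𝕜)).const_add c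
    have h3 := (h1.comp z' h2).const_smul (φ t)
    refine h3.congr_fderiv ?_
    ext v
    simp [mul_smul]

/-- Induction on `n`: the derivative is the integral for `fderiv 𝕜 h` with weight `φ t * t`. Hence
the target space, `h` and `φ` all vary in the induction. -/
theorem contDiffOn_segmentIntegral [ProperSpace E] {c : E} {r : ℝ} (n : ℕ) :
    ∀ {F : Type u} [NormedAddCommGroup F] [NormedSpace 𝕜 F] [NormedSpace ℝ F] [SMulCommClass 𝕜 ℝ F]
      {h : E → F} (_ : ContDiffOn 𝕜 ∞ h (ball c r)) {φ : ℝ → 𝕜} (_ : Continuous φ),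
      ContDiffOn 𝕜 n (fun z => ∫ t in (0 : ℝ)..1, φ t • h (c + (t : 𝕜) • (z - c))) (ball c r) := by
  induction n with
  | zero =>
    intro F _ _ _ _ h hh φ hφ
    exact contDiffOn_zero.2 fun z hz =>
      (hasFDerivAt_segmentIntegral hh hz hφ).continuousAt.continuousWithinAt
  | succ n ih =>
    intro F _ _ _ _ h hh φ hφ
    have := (contDiffOn_succ_iff_fderiv_of_isOpen (n := n) (𝕜 := 𝕜)
      (f := fun z => ∫ t in (0 : ℝ)..1, φ t • h (c + (t : 𝕜) • (z - c))) (isOpen_ball (x := c) (ε := r))).2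
    refine this ⟨fun z hz => (hasFDerivAt_segmentIntegral hh hz hφ).differentiableAt.differentiableWithinAt,
      fun h => by simp at h, ?_⟩
    refine (ih (hh.fderiv_of_isOpen isOpen_ball (by simp)) (φ := fun t => φ t * t) (by fun_prop)).congr
      fun z hz => ?_
    exact (hasFDerivAt_segmentIntegral hh hz hφ).fderiv

/-- The Hadamard lemma: a smooth function `f` on a ball with centre `c` satisfies
`f z = f c + G z (z - c)` with `G` smooth. -/
theorem exists_hadamard [ProperSpace E] {c : E} {r : ℝ} {f : E → 𝕜} (hf : ContDiffOn 𝕜 ∞ f (ball c r)) :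
    ∃ G : E → E →L[𝕜] 𝕜, ContDiffOn 𝕜 ∞ G (ball c r) ∧ ∀ z ∈ ball c r, f z = f c + G z (z - c) := by
  -- The mean of the derivative along the segment from `c` to `z`. The identity is the fundamental
  -- theorem of calculus in the real parameter `t`, also for `𝕜 = ℂ`.
  refine ⟨fun z => ∫ t in (0 : ℝ)..1, (1 : 𝕜) • fderiv 𝕜 f (c + (t : 𝕜) • (z - c)), ?_, fun z hz => ?_⟩
  · exact contDiffOn_infty.2 fun n => contDiffOn_segmentIntegral n
      (hf.fderiv_of_isOpen isOpen_ball (by simp)) continuous_const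
  · have hd : ContinuousOn (fderiv 𝕜 f) (ball c r) := hf.continuousOn_fderiv_of_isOpen isOpen_ball (by simp)
    have hint : IntervalIntegrable (fun t : ℝ => (1 : 𝕜) • fderiv 𝕜 f (c + (t : 𝕜) • (z - c))) volume 0 1 :=
      ContinuousOn.intervalIntegrable_of_Icc zero_le_one (continuousOn_segment hd hz continuous_const)
    have hder : ∀ t ∈ uIcc (0 : ℝ) 1, HasDerivAt (fun t : ℝ => f (c + (t : 𝕜) • (z - c)))
        (((1 : 𝕜) • fderiv 𝕜 f (c + (t : 𝕜) • (z - c))) (z - c)) t := fun t ht => by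
      rw [uIcc_of_le zero_le_one] at ht
      have h1 : HasFDerivAt f (fderiv 𝕜 f (c + (t : 𝕜) • (z - c))) (c + (t : 𝕜) • (z - c)) :=
        ((hf.differentiableOn (by simp)).differentiableAt
          (isOpen_ball.mem_nhds (segment_mem_ball hz ht))).hasFDerivAt
      have h2 : HasDerivAt (fun s : 𝕜 => c + s • (z - c)) ((1 : 𝕜) • (z - c)) (t : 𝕜) :=
        ((hasDerivAt_id _).smul_const _).const_add c
      have h3 := (h1.comp_hasDerivAt (t : 𝕜) h2).hasFDerivAt.restrictScalars ℝ
      have h4 := h3.comp_hasDerivAt t (RCLike.ofRealCLM (K := 𝕜)).hasDerivAt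
      refine h4.congr_deriv ?_
      simp
    have h5 := integral_eq_sub_of_hasDerivAt hder
      (ContinuousOn.intervalIntegrable_of_Icc zero_le_one
        ((continuousOn_segment hd hz continuous_const).clm_apply continuousOn_const))
    rw [ContinuousLinearMap.intervalIntegral_apply hint, h5]
    simp

end Hadamard

end SuperGeom
end

noncomputable section
set_option linter.unusedSectionVars false
set_option linter.unusedVariables false
namespace SuperGeom

/-! ### Coordinates on affine space -/

namespace SmoothModel

open scoped Topology ContDiff

variable {𝕜 : Type u} [RCLike 𝕜] {p : ℕ}

/-- Open subsets of the model, as open subsets of affine space. -/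
def toOpens (W : Opens (smoothModel 𝕜 p).Y) : Opens (EuclideanSpace 𝕜 (Fin p)) := W

/-- Smooth functions over `W`. -/
abbrev Fn (W : Opens (smoothModel 𝕜 p).Y) : Type u := (smoothModel 𝕜 p).B.obj (op W)

/-- The underlying smooth map. -/
def toMap {W : Opens (smoothModel 𝕜 p).Y} (f : Fn W) :
    ContMDiffMap 𝓘(𝕜, EuclideanSpace 𝕜 (Fin p)) 𝓘(𝕜, 𝕜) (toOpens W) 𝕜 ((⊤ : ℕ∞) : WithTop ℕ∞) := f

/-- Extension of a smooth function by zero. -/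
def ext {W : Opens (smoothModel 𝕜 p).Y} (f : Fn W) (y : EuclideanSpace 𝕜 (Fin p)) : 𝕜 :=
  open Classical in if h : y ∈ toOpens W then toMap f ⟨y, h⟩ else 0

variable {W W' : Opens (smoothModel 𝕜 p).Y}

theorem ext_of_mem (f : Fn W) {y : EuclideanSpace 𝕜 (Fin p)} (h : y ∈ toOpens W) : ext f y = toMap f ⟨y, h⟩ :=
  dif_pos h

theorem ext_injective {f g : Fn W} (h : ∀ y ∈ toOpens W, ext f y = ext g y) : f = g := by
  refine ContMDiffMap.ext (f := toMap f) (g := toMap g) fun y => ?_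
  have := h y y.2
  rwa [ext_of_mem f y.2, ext_of_mem g y.2] at this

theorem ext_add (f g : Fn W) : ext (f + g) = ext f + ext g := by
  funext y
  by_cases h : y ∈ toOpens W
  · rw [Pi.add_apply, ext_of_mem _ h, ext_of_mem _ h, ext_of_mem _ h]; rfl
  · simp [ext, h]

theorem ext_zero (y : EuclideanSpace 𝕜 (Fin p)) : ext (0 : Fn W) y = 0 := by
  have := congrFun (ext_add (0 : Fn W) 0) y
  rwa [add_zero, Pi.add_apply, left_eq_add] at this

theorem ext_sum {ι : Type*} (s : Finset ι) (f : ι → Fn W) (y : EuclideanSpace 𝕜 (Fin p)) :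
    ext (∑ i ∈ s, f i) y = ∑ i ∈ s, ext (f i) y :=
  map_sum (AddMonoidHom.mk' (fun f : Fn W => ext f y) fun f g => congrFun (ext_add f g) y) _ _

theorem ext_mul (f g : Fn W) : ext (f * g) = ext f * ext g := by
  funext y
  by_cases h : y ∈ toOpens W
  · rw [Pi.mul_apply, ext_of_mem _ h, ext_of_mem _ h, ext_of_mem _ h]; rfl
  · simp [ext, h]

theorem ext_const (c : 𝕜) {y : EuclideanSpace 𝕜 (Fin p)} (h : y ∈ toOpens W) :
    ext (W := W) ((smoothModel 𝕜 p).const W c) y = c := by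
  rw [ext_of_mem _ h]; rfl

theorem ext_res (h : W' ≤ W) (f : Fn W) {y : EuclideanSpace 𝕜 (Fin p)} (hy : y ∈ toOpens W') :
    ext (W := W') ((smoothModel 𝕜 p).res h f) y = ext f y := by
  rw [ext_of_mem _ hy, ext_of_mem _ (h hy)]; rfl

theorem contDiffOn_ext (f : Fn W) : ContDiffOn 𝕜 ∞ (ext f) (toOpens W) := by
  intro y hy
  refine ContDiffAt.contDiffWithinAt ?_
  rw [← contMDiffAt_iff_contDiffAt]
  refine (contMDiffAt_subtype_iff (x := (⟨y, hy⟩ : toOpens W))).1 ?_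
  have : (fun x : toOpens W => ext f x) = toMap f := funext fun x => ext_of_mem f x.2
  rw [this]
  exact (toMap f).contMDiff.contMDiffAt

/-- The section defined by a smooth function. -/
def ofFun (F : EuclideanSpace 𝕜 (Fin p) → 𝕜) (hF : ContDiffOn 𝕜 ∞ F (toOpens W)) : Fn W :=
  (⟨fun y => F y, fun y => contMDiffAt_subtype_iff.2
    (contMDiffAt_iff_contDiffAt.2 (hF.contDiffAt ((toOpens W).isOpen.mem_nhds y.2)))⟩ :
    ContMDiffMap 𝓘(𝕜, EuclideanSpace 𝕜 (Fin p)) 𝓘(𝕜, 𝕜) (toOpens W) 𝕜 ((⊤ : ℕ∞) : WithTop ℕ∞))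

theorem ext_ofFun {F : EuclideanSpace 𝕜 (Fin p) → 𝕜} (hF : ContDiffOn 𝕜 ∞ F (toOpens W))
    {y : EuclideanSpace 𝕜 (Fin p)} (hy : y ∈ toOpens W) : ext (ofFun F hF) y = F y := by
  rw [ext_of_mem _ hy]; rfl

theorem differentiableAt_ext (f : Fn W) {y : EuclideanSpace 𝕜 (Fin p)} (hy : y ∈ toOpens W) :
    DifferentiableAt 𝕜 (ext f) y :=
  ((contDiffOn_ext f).differentiableOn (by simp)).differentiableAt ((toOpens W).isOpen.mem_nhds hy)

/-- The standard basis vectors. -/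
def basisVec (i : Fin p) : EuclideanSpace 𝕜 (Fin p) := EuclideanSpace.single i 1

/-- The partial derivatives of a smooth function. -/
def pderiv (i : Fin p) (f : Fn W) : Fn W := ofFun (fun y => fderiv 𝕜 (ext f) y (basisVec i))
    (((contDiffOn_ext f).fderiv_of_isOpen (toOpens W).isOpen (by simp)).clm_apply contDiffOn_const)

theorem ext_pderiv (i : Fin p) (f : Fn W) {y : EuclideanSpace 𝕜 (Fin p)} (hy : y ∈ toOpens W) :
    ext (pderiv i f) y = fderiv 𝕜 (ext f) y (basisVec i) := ext_ofFun _ hy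

/-- The coordinate functions. -/
def coord (i : Fin p) : Fn (⊤ : Opens (smoothModel 𝕜 p).Y) :=
  ofFun (fun y => y i) (by fun_prop)

theorem ext_coord (i : Fin p) (y : EuclideanSpace 𝕜 (Fin p)) : ext (coord i) y = y i :=
  ext_ofFun _ trivial

/-- By Hadamard's lemma `f = f(y) + ∑ (x_i - y_i) g_i` on a ball around `y`. A derivation that kills
constants and coordinates leaves `∑ (x_i - y_i) D g_i`, which vanishes at `y`. Compatibility with
restriction allows the passage to the ball. -/
theorem eq_zero (D : ∀ W', W' ≤ W → (Fn W' →+ Fn W'))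
    (mul : ∀ W' h f g, D W' h (f * g) = D W' h f * g + f * D W' h g)
    (const : ∀ W' h c, D W' h ((smoothModel 𝕜 p).const W' c) = 0)
    (nat : ∀ W' W'' h (h' : W'' ≤ W') f,
      (smoothModel 𝕜 p).res h' (D W' h f) = D W'' (h'.trans h) ((smoothModel 𝕜 p).res h' f))
    (hx : ∀ i, D W le_rfl ((smoothModel 𝕜 p).res le_top (coord i)) = 0) : D W le_rfl = 0 := by
  refine AddMonoidHom.ext fun f => ext_injective fun y hy => ?_
  obtain ⟨r, hr, hrW⟩ := Metric.isOpen_iff.1 (toOpens W).isOpen y hy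
  obtain ⟨G, hG, hfG⟩ := exists_hadamard ((contDiffOn_ext f).mono hrW)
  let B : Opens (smoothModel 𝕜 p).Y := (⟨Metric.ball y r, Metric.isOpen_ball⟩ :
    Opens (EuclideanSpace 𝕜 (Fin p)))
  have hB : B ≤ W := hrW
  have hyB : y ∈ toOpens B := Metric.mem_ball_self hr
  let g : Fin p → Fn B := fun i => ofFun (fun z => G z (basisVec i)) (hG.clm_apply contDiffOn_const)
  let v : Fin p → Fn B := fun i =>
    (smoothModel 𝕜 p).res le_top (coord i) - (smoothModel 𝕜 p).const B (y i)
  have hv : ∀ i z, z ∈ toOpens B → ext (v i) z = z i - y i := fun i z hz => by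
    have h1 := congrFun (ext_add (v i) ((smoothModel 𝕜 p).const B (y i))) z
    rw [sub_add_cancel, Pi.add_apply, ext_const _ hz, ext_res _ _ hz, ext_coord] at h1
    rw [h1, add_sub_cancel_right]
  have hD : ∀ i, D B hB (v i) = 0 := fun i => by
    rw [map_sub, const, sub_zero, ← (smoothModel 𝕜 p).res_res le_top hB, ← nat W B le_rfl hB, hx, map_zero]
  have key : (smoothModel 𝕜 p).res hB f =
      (smoothModel 𝕜 p).const B (ext f y) + ∑ i, v i * g i := ext_injective fun z hz => by
    rw [ext_res hB f hz, hfG z hz, ext_add, Pi.add_apply, ext_const _ hz, ext_sum]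
    congr 1
    have hsum : z - y = ∑ i, (z i - y i) • (basisVec i : EuclideanSpace 𝕜 (Fin p)) := by
      have := (EuclideanSpace.basisFun (Fin p) 𝕜).sum_repr (z - y)
      rw [← this]
      simp [basisVec]
    conv_lhs => rw [hsum, map_sum]
    refine Finset.sum_congr rfl fun i _ => ?_
    rw [ext_mul, Pi.mul_apply, hv i z hz, show ext (g i) z = G z (basisVec i) from ext_ofFun _ hz, map_smul, smul_eq_mul]
  have h1 : ext ((smoothModel 𝕜 p).res hB (D W le_rfl f)) y = 0 := by
    rw [nat W B le_rfl hB, key, map_add, const, zero_add, map_sum, ext_sum]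
    refine Finset.sum_eq_zero fun i _ => ?_
    rw [mul, hD, zero_mul, zero_add, ext_mul, Pi.mul_apply, hv i y hyB, sub_self, zero_mul]
  rw [ext_res hB _ hyB] at h1
  rw [h1, AddMonoidHom.zero_apply, ext_zero]

/-- The standard coordinates on affine space. -/
def coords : (smoothModel 𝕜 p).Coords p ⊤ where
  x := coord
  ptl i W _ := AddMonoidHom.mk' (pderiv i) fun f g => ext_injective fun y hy => by
    rw [ext_add, Pi.add_apply, ext_pderiv i _ hy, ext_pderiv i _ hy, ext_pderiv i _ hy, ext_add,
      fderiv_add (differentiableAt_ext f hy) (differentiableAt_ext g hy)]; rfl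
  ptl_mul i W hW f g := ext_injective fun y hy => by
    refine (ext_pderiv i _ hy).trans ?_
    rw [ext_mul f g, fderiv_mul (differentiableAt_ext f hy) (differentiableAt_ext g hy), ext_add,
      Pi.add_apply, ext_mul, ext_mul, Pi.mul_apply, Pi.mul_apply, AddMonoidHom.mk'_apply,
      ext_pderiv i _ hy, ext_pderiv i _ hy]
    simp
    ring
  ptl_const i W hW c := ext_injective fun y hy => by
    have : ext ((smoothModel 𝕜 p).const W c) =ᶠ[𝓝 y] fun _ => c :=
      Filter.eventually_of_mem ((toOpens W).isOpen.mem_nhds hy) fun z hz => ext_const c hz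
    refine (ext_pderiv i _ hy).trans ?_
    rw [this.fderiv_eq, ext_zero]
    simp
  ptl_res i W W' hW h f := ext_injective fun y hy => by
    have : ext ((smoothModel 𝕜 p).res h f) =ᶠ[𝓝 y] ext f :=
      Filter.eventually_of_mem ((toOpens W').isOpen.mem_nhds hy) fun z hz => ext_res h f hz
    refine (ext_res h _ hy).trans ((ext_pderiv i f (h hy)).trans ?_)
    refine Eq.trans ?_ (ext_pderiv i _ hy).symm
    rw [this.fderiv_eq]
  ptl_x i j := ext_injective fun y hy => by
    refine (ext_pderiv i _ hy).trans ?_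
    have : ext (coord j) = (EuclideanSpace.proj j : EuclideanSpace 𝕜 (Fin p) →L[𝕜] 𝕜) :=
      funext fun z => ext_coord j z
    rw [this, ContinuousLinearMap.fderiv]
    split_ifs with h
    · subst h
      refine Eq.trans ?_ (ext_of_mem _ hy).symm
      simp [basisVec]; rfl
    · rw [ext_zero]
      simp [basisVec, Ne.symm h]
  eq_zero W hW D mul const nat hx := eq_zero D mul const nat hx

end SmoothModel
end SuperGeom
end

/-! ### Derivations of standard smooth algebras and their extension to fractions -/

noncomputable section
set_option linter.unusedSectionVars false
set_option linter.unusedVariables false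
namespace SuperGeom

/-- A standard smooth algebra of relative dimension `p` has coordinates `x_i` with dual derivations,
and derivations are determined by their values on the `x_i`. -/
theorem exists_coords_of_isStandardSmooth {R A : Type u} [CommRing R] [CommRing A] [Algebra R A] {p : ℕ}
    (h : Algebra.IsStandardSmoothOfRelativeDimension p R A) :
    ∃ (x : Fin p → A) (D : Fin p → Derivation R A A), (∀ i j, D i (x j) = if i = j then 1 else 0) ∧
      ∀ (B : Type u) [CommRing B] (r : A →+* B) (E : A →+ B), (∀ f g, E (f * g) = E f * r g + r f * E g) →
        (∀ a, E (algebraMap R A a) = 0) → (∀ i, E (x i) = 0) → E = 0 := by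
  obtain ⟨ι, σ, _, _, P, hP⟩ := h.out
  -- The image of `P.map` consists of one variable for each relation; the number of variables
  -- outside it is the dimension of the presentation.
  have hcard : Nat.card ((Set.range P.map)ᶜ : Set ι) = p := by
    have : Fintype ι := Fintype.ofFinite ι
    have : Fintype σ := Fintype.ofFinite σ
    classical
    rw [← hP, Algebra.Presentation.dimension, Nat.card_eq_fintype_card, Fintype.card_compl_set,
      Nat.card_eq_fintype_card, Nat.card_eq_fintype_card, Set.card_range_of_injective P.map_inj]
  -- The coordinates are the remaining variables. Their differentials are a basis of the Kähler
  -- differentials, and the dual basis gives the derivations.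
  let e := Finite.equivFinOfCardEq hcard
  let b := P.basisKaehler.reindex e
  have hb : ∀ i, b i = KaehlerDifferential.D R A (P.val (e.symm i)) := fun i => by
    rw [Module.Basis.reindex_apply, P.basisKaehler_apply]
  refine ⟨fun i => P.val (e.symm i), fun i => (b.coord i).compDer (KaehlerDifferential.D R A),
    fun i j => ?_, fun B _ r E mul const hE => ?_⟩
  · have : (b.coord i).compDer (KaehlerDifferential.D R A) (P.val (e.symm j)) = b.coord i (b j) := by
      rw [hb]; rfl
    rw [this, Module.Basis.coord_apply, Module.Basis.repr_self, Finsupp.single_apply]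
    simp only [eq_comm]
  · let _ : Algebra A B := r.toAlgebra
    let _ : Algebra R B := (r.comp (algebraMap R A)).toAlgebra
    have : IsScalarTower R A B := IsScalarTower.of_algebraMap_eq' rfl
    let D' : Derivation R A B := Derivation.mk'
      { toFun := E, map_add' := map_add E, map_smul' := fun a g => by
          rw [Algebra.smul_def, mul, const, zero_mul, zero_add, RingHom.id_apply, Algebra.smul_def]; rfl }
      fun g h => by
        refine (mul g h).trans ?_
        rw [add_comm, mul_comm (E g)]; rfl
    have h0 : D'.liftKaehlerDifferential = 0 := b.ext fun i => by
      rw [hb, Derivation.liftKaehlerDifferential_comp_D, LinearMap.zero_apply]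
      exact hE i
    refine AddMonoidHom.ext fun a => ?_
    change D' a = 0
    rw [← Derivation.liftKaehlerDifferential_comp_D, h0]; rfl

namespace LocalModel

variable {k : Type u} [Field k] (Y : LocalModel k) (hY : Y.B.IsSheaf)

include hY in
theorem eq_of_locally_eq {W : Opens Y.Y} {f g : Y.B.obj (op W)}
    (h : ∀ y ∈ W, ∃ (O : Opens Y.Y) (hO : O ≤ W), y ∈ O ∧ Y.res hO f = Y.res hO g) : f = g := by
  choose O hO hy he using h
  exact TopCat.Sheaf.eq_of_locally_eq' ⟨Y.B, hY⟩ (fun y : W => O y.1 y.2) W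
    (fun y => homOfLE (hO y.1 y.2)) (fun y hyW => Opens.mem_iSup.2 ⟨⟨y, hyW⟩, hy y hyW⟩) f g
    fun y => he y.1 y.2

include hY in
theorem exists_glue {W : Opens Y.Y} {P : ∀ O : Opens Y.Y, O ≤ W → Y.B.obj (op O) → Prop}
    (res : ∀ O O' hO (h : O' ≤ O) f, P O hO f → P O' (h.trans hO) (Y.res h f))
    (uniq : ∀ O hO f g, P O hO f → P O hO g → f = g)
    (ex : ∀ y ∈ W, ∃ (O : Opens Y.Y) (hO : O ≤ W) (f : _), y ∈ O ∧ P O hO f) :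
    ∃ f : Y.B.obj (op W), ∀ y ∈ W, ∃ (O : Opens Y.Y) (hO : O ≤ W), y ∈ O ∧ P O hO (Y.res hO f) := by
  choose O hO f hy hf using ex
  obtain ⟨s, hs, -⟩ := TopCat.Sheaf.existsUnique_gluing' ⟨Y.B, hY⟩ (fun y : W => O y.1 y.2) W
    (fun y => homOfLE (hO y.1 y.2)) (fun y hyW => Opens.mem_iSup.2 ⟨⟨y, hyW⟩, hy y hyW⟩)
    (fun y => f y.1 y.2) fun y y' => uniq _ (inf_le_left.trans (hO y.1 y.2)) _ _
      (res _ _ _ inf_le_left _ (hf y.1 y.2)) (res _ _ _ inf_le_right _ (hf y'.1 y'.2))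
  exact ⟨s, fun y hyW => ⟨O y hyW, hO y hyW, hy y hyW, by
    have := hs ⟨y, hyW⟩
    exact (congrArg (P _ _) this).mpr (hf y hyW)⟩⟩

/-- Locally on `V`, functions are fractions of functions on `V`, and a function on `V` that vanishes
near a point is killed by a function that is invertible near the point. -/
structure IsFractional (V : Opens Y.Y) : Prop where
  exists_frac : ∀ W (hW : W ≤ V) (g : Y.B.obj (op W)), ∀ y ∈ W, ∃ (O : Opens Y.Y) (hO : O ≤ W), y ∈ O ∧
    ∃ e b : Y.B.obj (op V), IsUnit (Y.res (hO.trans hW) e) ∧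
      Y.res (hO.trans hW) e * Y.res hO g = Y.res (hO.trans hW) b
  exists_mul_eq_zero : ∀ W (hW : W ≤ V) (a : Y.B.obj (op V)), Y.res hW a = 0 → ∀ y ∈ W,
    ∃ (O : Opens Y.Y) (hO : O ≤ W), y ∈ O ∧ ∃ e : Y.B.obj (op V),
      IsUnit (Y.res (hO.trans hW) e) ∧ e * a = 0

variable {Y} {V : Opens Y.Y}

/-- `g = b / e`, and `h` is the derivative of `g` by the quotient rule. -/
structure IsQuotDeriv (D : Y.B.obj (op V) →+ Y.B.obj (op V)) {O : Opens Y.Y} (hO : O ≤ V)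
    (g h : Y.B.obj (op O)) (e b : Y.B.obj (op V)) : Prop where
  isUnit : IsUnit (Y.res hO e)
  mul_eq : Y.res hO e * g = Y.res hO b
  deriv_eq : Y.res hO (D e) * g + Y.res hO e * h = Y.res hO (D b)

/-- `h` is, locally, the derivative of `g` by the quotient rule. -/
def IsDeriv (D : Y.B.obj (op V) →+ Y.B.obj (op V)) {W : Opens Y.Y} (hW : W ≤ V)
    (g h : Y.B.obj (op W)) : Prop :=
  ∀ y ∈ W, ∃ (O : Opens Y.Y) (hO : O ≤ W), y ∈ O ∧ ∃ e b : Y.B.obj (op V),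
    IsQuotDeriv D (hO.trans hW) (Y.res hO g) (Y.res hO h) e b

section

variable (hV : Y.IsFractional V) {D : Y.B.obj (op V) →+ Y.B.obj (op V)}

theorem IsQuotDeriv.res {O O' : Opens Y.Y} {hO : O ≤ V} {g h : Y.B.obj (op O)} {e b : Y.B.obj (op V)}
    (H : IsQuotDeriv D hO g h e b) (hO' : O' ≤ O) :
    IsQuotDeriv D (hO'.trans hO) (Y.res hO' g) (Y.res hO' h) e b where
  isUnit := by simpa only [Y.res_res] using H.isUnit.map (Y.res hO')
  mul_eq := by simpa only [map_mul, Y.res_res] using congrArg (Y.res hO') H.mul_eq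
  deriv_eq := by simpa only [map_mul, map_add, Y.res_res] using congrArg (Y.res hO') H.deriv_eq

theorem IsDeriv.res {W W' : Opens Y.Y} {hW : W ≤ V} {g h : Y.B.obj (op W)}
    (H : IsDeriv D hW g h) (hW' : W' ≤ W) :
    IsDeriv D (hW'.trans hW) (Y.res hW' g) (Y.res hW' h) := fun y hy => by
  obtain ⟨O, hO, hyO, e, b, h1⟩ := H y (hW' hy)
  refine ⟨O ⊓ W', inf_le_right, ⟨hyO, hy⟩, e, b, ?_⟩
  have := h1.res (inf_le_left : O ⊓ W' ≤ O)
  rw [Y.res_res, Y.res_res] at this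
  rwa [Y.res_res, Y.res_res]

/-- Two quotient presentations near a point exist over a common open set. -/
theorem IsDeriv.exists_common {W : Opens Y.Y} {hW : W ≤ V} {g h g' h' : Y.B.obj (op W)}
    (H : IsDeriv D hW g h) (H' : IsDeriv D hW g' h') {y : Y.Y} (hy : y ∈ W) :
    ∃ (O : Opens Y.Y) (hO : O ≤ W), y ∈ O ∧ ∃ e b e' b' : Y.B.obj (op V),
      IsQuotDeriv D (hO.trans hW) (Y.res hO g) (Y.res hO h) e b ∧
      IsQuotDeriv D (hO.trans hW) (Y.res hO g') (Y.res hO h') e' b' := by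
  obtain ⟨O, hO, hyO, e, b, h1⟩ := H y hy
  obtain ⟨O', hO', hyO', e', b', h1'⟩ := H' y hy
  refine ⟨O ⊓ O', inf_le_left.trans hO, ⟨hyO, hyO'⟩, e, b, e', b', ?_, ?_⟩
  · have := h1.res (inf_le_left : O ⊓ O' ≤ O)
    rwa [Y.res_res, Y.res_res] at this
  · have := h1'.res (inf_le_right : O ⊓ O' ≤ O')
    rwa [Y.res_res, Y.res_res] at this

variable (mul : ∀ f g, D (f * g) = D f * g + f * D g)

include hY hV mul in
-- Where `e a = 0` with `e` locally invertible, the Leibniz rule gives `D e · a + e · D a = 0`, and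
-- the first term restricts to zero.
theorem res_eq_zero {W : Opens Y.Y} (hW : W ≤ V) (a : Y.B.obj (op V)) (ha : Y.res hW a = 0) :
    Y.res hW (D a) = 0 := by
  refine Y.eq_of_locally_eq hY fun y hy => ?_
  obtain ⟨O, hO, hyO, e, he, hea⟩ := hV.exists_mul_eq_zero W hW a ha y hy
  refine ⟨O, hO, hyO, ?_⟩
  have h1 := congrArg (fun f => Y.res (hO.trans hW) (D f)) hea
  simp only [mul, map_add, map_mul, map_zero] at h1
  have h2 : Y.res (hO.trans hW) a = 0 := by rw [← Y.res_res hW hO, ha, map_zero]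
  rw [h2, mul_zero, zero_add] at h1
  rw [Y.res_res, map_zero]
  exact (he.mul_right_eq_zero).1 h1

include hY hV mul in
-- If `e g = b` and `e' g = b'`, then `e b' - e' b` restricts to zero, and so does its derivative,
-- which is `e e' (h' - h)`.
theorem IsDeriv.unique {W : Opens Y.Y} {hW : W ≤ V} {g h h' : Y.B.obj (op W)} (H : IsDeriv D hW g h)
    (H' : IsDeriv D hW g h') : h = h' := by
  refine Y.eq_of_locally_eq hY fun y hy => ?_
  obtain ⟨O, hO, hyO, e, b, e', b', h1, h1'⟩ := H.exists_common H' hy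
  refine ⟨O, hO, hyO, ?_⟩
  have h3 := res_eq_zero hY hV mul (hO.trans hW) (e * b' - e' * b)
    (by rw [map_sub, map_mul, map_mul, ← h1.mul_eq, ← h1'.mul_eq]; ring)
  rw [map_sub, mul, mul, map_sub, map_add, map_add, map_mul, map_mul, map_mul, map_mul, ← h1.mul_eq,
    ← h1'.mul_eq, ← h1.deriv_eq, ← h1'.deriv_eq] at h3
  refine (h1.isUnit.mul h1'.isUnit).mul_left_cancel ?_
  linear_combination -h3

include mul in
theorem IsDeriv.add {W : Opens Y.Y} {hW : W ≤ V} {g h g' h' : Y.B.obj (op W)} (H : IsDeriv D hW g h)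
    (H' : IsDeriv D hW g' h') : IsDeriv D hW (g + g') (h + h') := fun y hy => by
  obtain ⟨O, hO, hyO, e, b, e', b', h1, h1'⟩ := H.exists_common H' hy
  refine ⟨O, hO, hyO, e * e', b * e' + b' * e, ?_, ?_, ?_⟩
  · rw [map_mul]; exact h1.isUnit.mul h1'.isUnit
  · simp only [map_add, map_mul, ← h1.mul_eq, ← h1'.mul_eq]; ring
  · simp only [mul, map_add, map_mul, ← h1.mul_eq, ← h1'.mul_eq, ← h1.deriv_eq, ← h1'.deriv_eq]; ring

include mul in
theorem IsDeriv.product {W : Opens Y.Y} {hW : W ≤ V} {g h g' h' : Y.B.obj (op W)} (H : IsDeriv D hW g h)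
    (H' : IsDeriv D hW g' h') : IsDeriv D hW (g * g') (h * g' + g * h') := fun y hy => by
  obtain ⟨O, hO, hyO, e, b, e', b', h1, h1'⟩ := H.exists_common H' hy
  refine ⟨O, hO, hyO, e * e', b * b', ?_, ?_, ?_⟩
  · rw [map_mul]; exact h1.isUnit.mul h1'.isUnit
  · simp only [map_mul, ← h1.mul_eq, ← h1'.mul_eq]; ring
  · simp only [mul, map_add, map_mul, ← h1.mul_eq, ← h1'.mul_eq, ← h1.deriv_eq, ← h1'.deriv_eq]; ring

include mul in
theorem isDeriv_res {W : Opens Y.Y} (hW : W ≤ V) (a : Y.B.obj (op V)) :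
    IsDeriv D hW (Y.res hW a) (Y.res hW (D a)) := fun y hy => by
  have h1 : D 1 = 0 := by
    have := mul 1 1
    rwa [one_mul, one_mul, mul_one, left_eq_add] at this
  exact ⟨W, le_rfl, hy, 1, a, by rw [map_one]; exact isUnit_one, by rw [Y.res_id, map_one, one_mul],
    by rw [Y.res_id, Y.res_id, h1, map_zero, map_one, one_mul, zero_mul, zero_add]⟩

include hY hV mul in
-- Locally `g = b / e`, and the quotient rule gives `e⁻¹ (D b - D e · g)`. By uniqueness the local
-- solutions agree on overlaps and glue.
theorem exists_isDeriv {W : Opens Y.Y} (hW : W ≤ V) (g : Y.B.obj (op W)) : ∃ h, IsDeriv D hW g h := by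
  obtain ⟨h, hh⟩ := Y.exists_glue hY (P := fun O hO h => IsDeriv D (hO.trans hW) (Y.res hO g) h)
    (fun O O' hO hO' h H => by
      have := H.res hO'
      rwa [Y.res_res] at this)
    (fun O hO f f' H H' => H.unique hY hV mul H') fun y hy => by
      obtain ⟨O, hO, hyO, e, b, he, heb⟩ := hV.exists_frac W hW g y hy
      obtain ⟨u, hu⟩ := he
      refine ⟨O, hO, ↑u⁻¹ * (Y.res (hO.trans hW) (D b) - Y.res (hO.trans hW) (D e) * Y.res hO g), hyO,
        fun y' hy' => ⟨O, le_rfl, hy', e, b, ⟨u, hu⟩, by rw [Y.res_id, heb], ?_⟩⟩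
      rw [Y.res_id, Y.res_id, ← hu, Units.mul_inv_cancel_left, add_sub_cancel]
  refine ⟨h, fun y hy => ?_⟩
  obtain ⟨O, hO, hyO, H⟩ := hh y hy
  obtain ⟨O', hO', hyO', e, b, H'⟩ := H y hyO
  rw [Y.res_res, Y.res_res] at H'
  exact ⟨O', hO'.trans hO, hyO', e, b, H'⟩

include hY hV mul in
/-- Derivations of the functions on `V` extend to all open subsets of `V`. -/
theorem exists_extend : ∃ D' : ∀ W, W ≤ V → (Y.B.obj (op W) →+ Y.B.obj (op W)),
    (∀ W hW f g, D' W hW (f * g) = D' W hW f * g + f * D' W hW g) ∧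
    (∀ W W' hW (h : W' ≤ W) f, Y.res h (D' W hW f) = D' W' (h.trans hW) (Y.res h f)) ∧
    ∀ W hW a, D' W hW (Y.res hW a) = Y.res hW (D a) := by
  choose D' hD' using fun W (hW : W ≤ V) g => exists_isDeriv hY hV mul hW g
  exact ⟨fun W hW => AddMonoidHom.mk' (D' W hW) fun f g =>
      (hD' W hW _).unique hY hV mul ((hD' W hW f).add mul (hD' W hW g)),
    fun W hW f g => (hD' W hW _).unique hY hV mul ((hD' W hW f).product mul (hD' W hW g)),
    fun W W' hW h f => ((hD' W hW f).res h).unique hY hV mul (hD' W' (h.trans hW) _),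
    fun W hW a => (hD' W hW _).unique hY hV mul (isDeriv_res mul hW a)⟩

end

include hY in
/-- Coordinates on the functions on `V` are coordinates on `V`. -/
theorem nonempty_coords (hV : Y.IsFractional V) {p : ℕ} (x : Fin p → Y.B.obj (op V))
    (D : Fin p → (Y.B.obj (op V) →+ Y.B.obj (op V)))
    (mul : ∀ i f g, D i (f * g) = D i f * g + f * D i g) (const : ∀ i c, D i (Y.const V c) = 0)
    (hx : ∀ i j, D i (x j) = if i = j then 1 else 0)
    (eq_zero : ∀ (O : Opens Y.Y) (hO : O ≤ V) (D' : Y.B.obj (op V) →+ Y.B.obj (op O)),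
      (∀ f g, D' (f * g) = D' f * Y.res hO g + Y.res hO f * D' g) → (∀ c, D' (Y.const V c) = 0) →
      (∀ i, D' (x i) = 0) → D' = 0) : Nonempty (Y.Coords p V) := by
  choose D' hmul hres hD' using fun i => exists_extend hY hV (mul i)
  refine ⟨⟨x, D', hmul, fun i W hW c => ?_, hres, fun i j => ?_, fun W hW E Emul Econst Eres Ex => ?_⟩⟩
  · rw [← Y.res_const hW, hD', const, map_zero]
  · have := hD' i V le_rfl (x j)
    rwa [Y.res_id, Y.res_id, hx] at this
  -- A derivation that kills the `x_i` kills the restrictions of functions on `V`; for a fraction `e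
  -- g = b` it follows that `e · E g = 0` with `e` a unit.
  · have h0 : ∀ (O : Opens Y.Y) (hO : O ≤ W) a, E O hO (Y.res (hO.trans hW) a) = 0 := fun O hO =>
      DFunLike.congr_fun (eq_zero O (hO.trans hW)
        ((E O hO).comp ((Y.res (hO.trans hW) : _ →+* _) : _ →+ _))
        (fun f g => by simp [Emul]) (fun c => by
          refine (congrArg (E O hO) (Y.res_const (hO.trans hW) c)).trans (Econst O hO c))
        fun i => by
          have := Eres W O le_rfl hO (Y.res hW (x i))
          rw [Ex, map_zero, Y.res_res] at this
          exact this.symm)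
    refine AddMonoidHom.ext fun g => Y.eq_of_locally_eq hY fun y hy => ?_
    obtain ⟨O, hO, hyO, e, b, he, heb⟩ := hV.exists_frac W hW g y hy
    refine ⟨O, hO, hyO, ?_⟩
    have h1 := h0 O hO b
    rw [← heb, Emul, h0 O hO, zero_mul, zero_add, he.mul_right_eq_zero] at h1
    rw [Eres W O le_rfl hO, h1, AddMonoidHom.zero_apply, map_zero]

end LocalModel

end SuperGeom
end

noncomputable section
set_option linter.unusedSectionVars false
set_option linter.unusedVariables false
namespace SuperGeom

/-! ### Coordinates on smooth schemes -/

namespace SchemeModel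

open AlgebraicGeometry

section

variable {S : Scheme.{u}} {V : S.Opens} (hV : IsAffineOpen V)

include hV in
-- Basic open sets are a basis of an affine open set, and the functions on one of them are a
-- localization. This also gives the annihilating denominator in `exists_mul_eq_zero`.
theorem exists_frac {W : S.Opens} (hW : W ≤ V) (g : Γ(S, W)) {y : S} (hy : y ∈ W) :
    ∃ (O : S.Opens) (hO : O ≤ W), y ∈ O ∧ ∃ e b : Γ(S, V),
      IsUnit ((S.presheaf.map (homOfLE (hO.trans hW)).op).hom e) ∧
        (S.presheaf.map (homOfLE (hO.trans hW)).op).hom e * (S.presheaf.map (homOfLE hO).op).hom g =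
          (S.presheaf.map (homOfLE (hO.trans hW)).op).hom b := by
  obtain ⟨c, hc, hyc⟩ := hV.exists_basicOpen_le ⟨y, hy⟩ (hW hy)
  have := hV.isLocalization_basicOpen c
  obtain ⟨⟨b, e⟩, h⟩ := IsLocalization.surj (Submonoid.powers c) ((S.presheaf.map (homOfLE hc).op).hom g)
  refine ⟨_, hc, hyc, e, b, IsLocalization.map_units Γ(S, S.basicOpen c) e, ?_⟩
  rw [mul_comm]
  exact h

include hV in
theorem exists_mul_eq_zero {W : S.Opens} (hW : W ≤ V) (a : Γ(S, V))
    (ha : (S.presheaf.map (homOfLE hW).op).hom a = 0) {y : S} (hy : y ∈ W) :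
    ∃ (O : S.Opens) (hO : O ≤ W), y ∈ O ∧ ∃ e : Γ(S, V),
      IsUnit ((S.presheaf.map (homOfLE (hO.trans hW)).op).hom e) ∧ e * a = 0 := by
  obtain ⟨c, hc, hyc⟩ := hV.exists_basicOpen_le ⟨y, hy⟩ (hW hy)
  have := hV.isLocalization_basicOpen c
  have h0 : algebraMap Γ(S, V) Γ(S, S.basicOpen c) a = 0 := by
    have h1 := congrArg (S.presheaf.map (homOfLE hc).op).hom ha
    rw [map_zero, ← CommRingCat.comp_apply, ← S.presheaf.map_comp] at h1
    exact h1
  obtain ⟨e, he⟩ := (IsLocalization.map_eq_zero_iff (Submonoid.powers c) Γ(S, S.basicOpen c) a).1 h0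
  exact ⟨_, hc, hyc, e, IsLocalization.map_units Γ(S, S.basicOpen c) e, he⟩

end

variable {k : Type u} [Field k] {S : Scheme.{u}} (f : S ⟶ Spec (.of k))

theorem isFractional {V : S.Opens} (hV : IsAffineOpen V) : (schemeModel f).IsFractional V where
  exists_frac W hW g y hy := exists_frac hV (W := W) hW g hy
  exists_mul_eq_zero W hW a ha y hy := exists_mul_eq_zero hV (W := W) hW a ha hy

theorem const_eq {V : S.Opens} (e : V ≤ f ⁻¹ᵁ ⊤) (c : k) : (schemeModel f).const V c =
    (f.appLE ⊤ V e).hom ((Scheme.ΓSpecIso (.of k)).inv.hom c) := by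
  rfl

theorem exists_coords {p : ℕ} (hf : SmoothOfRelativeDimension p f) (y : S) :
    ∃ V : S.Opens, y ∈ V ∧ Nonempty ((schemeModel f).Coords p V) := by
  obtain ⟨U, hU, V, hV, hy, e, hs⟩ := hf.exists_isStandardSmoothOfRelativeDimension y
  -- The spectrum of a field is a point, so the affine open set in the base is everything and the
  -- algebra is standard smooth over `k` itself.
  have hUtop : U = ⊤ := by
    refine top_unique fun z _ => ?_
    have : Subsingleton (Spec (.of k) : Scheme) := inferInstanceAs (Subsingleton (PrimeSpectrum k))
    rw [Subsingleton.elim z (f y)]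
    exact e hy
  subst hUtop
  refine ⟨V, hy, ?_⟩
  let _ := (f.appLE ⊤ V e).hom.toAlgebra
  obtain ⟨x, D, hx, huniq⟩ := exists_coords_of_isStandardSmooth (R := Γ(Spec (.of k), ⊤)) (A := Γ(S, V)) hs
  have hconst : ∀ c : k, (schemeModel f).const V c =
      algebraMap Γ(Spec (.of k), ⊤) Γ(S, V) ((Scheme.ΓSpecIso (.of k)).inv.hom c) := const_eq f e
  have hleib : ∀ i (g h : Γ(S, V)), D i (g * h) = D i g * h + g * D i h := fun i g h => by
    rw [(D i).leibniz, smul_eq_mul, smul_eq_mul, add_comm, mul_comm h]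
  refine LocalModel.nonempty_coords (Y := schemeModel f) S.sheaf.property (isFractional f hV) x
    (fun i => (D i : Γ(S, V) →ₗ[Γ(Spec (.of k), ⊤)] Γ(S, V)).toAddMonoidHom) (fun i g h => ?_) (fun i c => ?_) (fun i j => hx i j) ?_
  · exact hleib i g h
  · exact (congrArg (D i) (hconst c)).trans ((D i).map_algebraMap _)
  · intro O hO D' mul const hD'x
    refine huniq _ ((schemeModel f).res hO) D' mul (fun a => ?_) hD'x
    obtain ⟨c, rfl⟩ := (Scheme.ΓSpecIso (.of k)).symm.commRingCatIsoToRingEquiv.surjective a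
    exact (congrArg D' (hconst c).symm).trans (const c)

end SchemeModel

/-- The local models have local coordinates. -/
theorem Geometry.IsModel.exists_coords {G : Geometry.{u}} {p : ℕ} {Y : LocalModel G.K} (h : G.IsModel p Y)
    (y : Y.Y) : ∃ W, y ∈ W ∧ Nonempty (Y.Coords p W) := by
  cases G with
  | analytic 𝕜 inst =>
    obtain rfl : Y = smoothModel 𝕜 p := h
    exact ⟨⊤, trivial, ⟨@SmoothModel.coords 𝕜 inst p⟩⟩
  | algebraic k _ _ =>
    obtain ⟨S, f, hf, rfl⟩ := h
    exact SchemeModel.exists_coords f hf y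

theorem Geometry.charZero (G : Geometry.{u}) : CharZero G.K := by
  cases G with
  | analytic 𝕜 _ => exact inferInstanceAs (CharZero 𝕜)
  | algebraic k _ h => exact h

theorem Superspace.IsSupermanifold.hasCoords {G : Geometry.{u}} {p q : ℕ} {M : Superspace G.K}
    (hM : M.IsSupermanifold G p q) : M.HasCoords p q := by
  have := G.charZero
  refine Superspace.HasCoords.of_charts fun m => ?_
  obtain ⟨Y, U, hY, hm, c⟩ := hM m
  exact ⟨Y, U, hm, c, hY.exists_coords⟩

end SuperGeom
end

theorem mainTheorem7 (G : SuperGeom.Geometry.{u}) (p q : ℕ) (M : SuperGeom.Superspace G.K)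
    (hM : M.IsSupermanifold G p q) :
    (∀ (U : Opens M.X) (x : M.Coords p q U), Nonempty (Unique (M.Calculus x))) ∧
    ∃ d' δ' : M.Virt ⟶ M.Virt,
      (∀ φ, M.IsHatD p q φ ↔ φ = d') ∧ (∀ φ, M.IsHatDelta p q φ ↔ φ = δ') ∧
      M.IsDoubleComplex d' δ' ∧ (d' + δ') ≫ (d' + δ') = 0 := by
  have := G.charZero
  exact ⟨fun U x => ⟨⟨⟨x.calculus⟩, fun C => C.eq_calculus⟩⟩, hM.hasCoords.exists_doubleComplex⟩
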